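/- Let $m>0$, let $\Omega_+\subset\mathbb{R}^3$ be a bounded open set with $C^2$-boundary $\Sigma:=\partial\Omega_+$ (for instance a bounded $C^2$-domain), let $\Omega_-:=\mathbb{R}^3\setminus\overline{\Omega_+}$, and let $\nu$ be the unit normal field on $\Sigma$ pointing out of $\Omega_+$. Let $$\alpha_j=\begin{pmatrix}0&\sigma_j\\ \sigma_j&0\end{pmatrix}\ (j=1,2,3),\qquad \beta=\begin{pmatrix}I_2&0\\0&-I_2\end{pmatrix}$$ be the Dirac matrices, where $\sigma_1,\sigma_2,\sigma_3$ are the Pauli matrices, and write $\alpha\cdot x=\sum_j x_j\alpha_j$. For $f\in L^2(\mathbb{R}^3;\mathbb{C}^4)$ put $f_\pm:=f\upharpoonright\Omega_\pm$. The space $L^2(\Sigma;\mathbb{C}^4)$ is taken with respect to the surface (two-dimensional Hausdorff) measure $\sigma$, and $H^{1/2}(\Sigma;\mathbb{C}^4)$ is the space of all $g\in L^2(\Sigma;\mathbb{C}^4)$ with $\int_\Sigma\int_\Sigma |g(x)-g(y)|^2|x-y|^{-3}\,d\sigma(y)\,d\sigma(x)<\infty$. Define the following operators in $L^2(\mathbb{R}^3;\mathbb{C}^4)$,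 with derivatives in the sense of distributions: - the free Dirac operator $A_0f:=-i\alpha\cdot\nabla f+m\beta f$, $\operatorname{dom}A_0:=H^1(\mathbb{R}^3;\mathbb{C}^4)$; - $S:=A_0\upharpoonright H^1_0(\mathbb{R}^3\setminus\Sigma;\mathbb{C}^4)$, where $H^1_0$ is the closure of $C_c^\infty$ in the $H^1$-norm; - $T_{\max}f:=(-i\alpha\cdot\nabla+m\beta)f_+\oplus(-i\alpha\cdot\nabla+m\beta)f_-$, where $\operatorname{dom}T_{\max}$ consists of all $f\in L^2(\mathbb{R}^3;\mathbb{C}^4)$ with $(-i\alpha\cdot\nabla+m\beta)f_\pm\in L^2(\Omega_\pm;\mathbb{C}^4)$; - $T:=T_{\max}\upharpoonright H^1(\mathbb{R}^3\setminus\Sigma;\mathbb{C}^4)$, where $H^1(\mathbb{R}^3\setminus\Sigma;\mathbb{C}^4)=H^1(\Omega_+;\mathbb{C}^4)\oplus H^1(\Omega_-;\mathbb{C}^4)$. For $f\in H^1(\mathbb{R}^3\setminus\Sigma;\mathbb{C}^4)$ let $f_\pm|_\Sigma\in L^2(\Sigma;\mathbb{C}^4)$ be the traces of $f_\pm$, that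 is, the limits in $L^2(\Sigma;\mathbb{C}^4)$ of $\varphi_n|_\Sigma$ for $\varphi_n\in C_c^\infty(\mathbb{R}^3;\mathbb{C}^4)$ with $\varphi_n\upharpoonright\Omega_\pm\to f_\pm$ in $H^1(\Omega_\pm;\mathbb{C}^4)$, and let $$\Gamma_0f:=i\,\alpha\cdot\nu\,(f_+|_\Sigma-f_-|_\Sigma),\qquad \Gamma_1f:=\tfrac12(f_+|_\Sigma+f_-|_\Sigma).$$ Then the traces are well defined, $\operatorname{dom}T=H^1(\mathbb{R}^3\setminus\Sigma;\mathbb{C}^4)$, and $\{L^2(\Sigma;\mathbb{C}^4),\Gamma_0,\Gamma_1\}$ is a quasi boundary triple for $T_{\max}=S^*=\overline{T}$; that is, $S$ is densely defined, closed and symmetric, $T$ is closable, $T_{\max}=S^*=\overline{T}$, the maps $\Gamma_0,\Gamma_1:\operatorname{dom}T\to L^2(\Sigma;\mathbb{C}^4)$ are linear, and 1. $(Tf,g)_{\mathbb{R}^3}-(f,Tg)_{\mathbb{R}^3}=(\Gamma_1f,\Gamma_0g)_\Sigma-(\Gamma_0f,\Gamma_1g)_\Sigma$ for all $f,g\in\operatorname{dom}T$;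 2. the range of $(\Gamma_0,\Gamma_1)^\top$ is dense in $L^2(\Sigma;\mathbb{C}^4)\times L^2(\Sigma;\mathbb{C}^4)$; 3. $T\upharpoonright\ker\Gamma_0$ is self-adjoint in $L^2(\mathbb{R}^3;\mathbb{C}^4)$. Moreover $\operatorname{ran}(\Gamma_0,\Gamma_1)^\top=H^{1/2}(\Sigma;\mathbb{C}^4)\times H^{1/2}(\Sigma;\mathbb{C}^4)$ and $T\upharpoonright\ker\Gamma_0=A_0$. -/

import Mathlib

open MeasureTheory Filter Topology Set
open scoped ENNReal ContDiff LinearPMap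

noncomputable section

namespace DiracShell

/-! ### Abstract quasi boundary triples -/

section Abstract

variable {H G : Type*} [NormedAddCommGroup H] [InnerProductSpace ℂ H] [CompleteSpace H]
  [NormedAddCommGroup G] [InnerProductSpace ℂ G] [CompleteSpace G]

/-- The kernel of a partially defined linear map, as a subspace of the ambient space. -/
def pker (Γ : H →ₗ.[ℂ] G) : Submodule ℂ H :=
  (LinearMap.ker Γ.toFun).map Γ.domain.subtype

/-- `{G, Γ₀, Γ₁}` is a quasi boundary triple for `S*`, where `S` is a densely defined closed
symmetric operator and `T` is the operator with `closure T = S*` on whose domain the boundary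
mappings are defined. -/
structure IsQuasiBoundaryTriple (S T : H →ₗ.[ℂ] H) (Γ₀ Γ₁ : H →ₗ.[ℂ] G) : Prop where
  dense_domain : Dense (S.domain : Set H)
  isClosed : S.IsClosed
  symmetric : S.IsFormalAdjoint S
  closable : T.IsClosable
  closure_eq : T.closure = S†
  domain_zero : Γ₀.domain = T.domain
  domain_one : Γ₁.domain = T.domain
  green : ∀ (f g : T.domain) (f₀ g₀ : Γ₀.domain) (f₁ g₁ : Γ₁.domain),
    (f₀ : H) = f → (f₁ : H) = f → (g₀ : H) = g → (g₁ : H) = g →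
    inner ℂ (T f) (g : H) - inner ℂ (f : H) (T g) =
      inner ℂ (Γ₁ f₁) (Γ₀ g₀) - inner ℂ (Γ₀ f₀) (Γ₁ g₁)
  dense_range : Dense {p : G × G | ∃ f : H, (f, p.1) ∈ Γ₀.graph ∧ (f, p.2) ∈ Γ₁.graph}
  selfAdjoint : IsSelfAdjoint (T.domRestrict (pker Γ₀))

end Abstract

/-! ### Dirac matrices -/

/-- The Euclidean space `ℝ³`. -/
abbrev E3 : Type := EuclideanSpace ℝ (Fin 3)

/-- The spinor space `ℂ⁴`. -/
abbrev C4 : Type := EuclideanSpace ℂ (Fin 4)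

/-- The Pauli matrices `σ₁, σ₂, σ₃`, indexed by `0, 1, 2`. -/
def pauli : Fin 3 → Matrix (Fin 2) (Fin 2) ℂ :=
  ![!![0, 1; 1, 0], !![0, -Complex.I; Complex.I, 0], !![1, 0; 0, -1]]

/-- A `4 × 4` matrix composed of four `2 × 2` blocks. -/
def ofBlocks (A B C D : Matrix (Fin 2) (Fin 2) ℂ) : Matrix (Fin 4) (Fin 4) ℂ :=
  (Matrix.fromBlocks A B C D).submatrix (finSumFinEquiv (m := 2) (n := 2)).symm
    (finSumFinEquiv (m := 2) (n := 2)).symm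

/-- The Dirac matrices `α₁, α₂, α₃`. -/
def alpha (j : Fin 3) : Matrix (Fin 4) (Fin 4) ℂ := ofBlocks 0 (pauli j) (pauli j) 0

/-- The Dirac matrix `β`. -/
def beta : Matrix (Fin 4) (Fin 4) ℂ := ofBlocks 1 0 0 (-1)

/-- `α · x = ∑ⱼ xⱼ αⱼ`. -/
def alphaDot (x : E3) : Matrix (Fin 4) (Fin 4) ℂ := ∑ j, (x j : ℂ) • alpha j

/-- The action of a `4 × 4` matrix on spinors. -/
def act (A : Matrix (Fin 4) (Fin 4) ℂ) : C4 →L[ℂ] C4 :=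
  Matrix.toEuclideanCLM (n := Fin 4) (𝕜 := ℂ) A

/-! ### Domains with `C²` boundary, surface measure, outer normal -/

/-- `Ω` is a bounded open set with `C²` boundary: near every boundary point and after a rotation
or reflection of the coordinates, `Ω` is the region strictly below the graph of a `C²` function. -/
structure IsBoundedC2 (Ω : Set E3) : Prop where
  isOpen : IsOpen Ω
  isBounded : Bornology.IsBounded Ω
  boundary : ∀ x ∈ frontier Ω, ∃ (r : ℝ) (e : E3 ≃ₗᵢ[ℝ] E3) (h : EuclideanSpace ℝ (Fin 2) → ℝ),
    0 < r ∧ ContDiff ℝ 2 h ∧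
      ∀ y ∈ Metric.ball x r, (y ∈ Ω ↔ e y 2 < h !₂[e y 0, e y 1])

/-- The exterior `Ω₋ = ℝ³ ∖ closure Ω₊`. -/
def exterior (Ω : Set E3) : Set E3 := (closure Ω)ᶜ

/-- The surface measure on `Σ = ∂Ω`: the two-dimensional Hausdorff measure, normalized as usual so
that it agrees with Lebesgue measure on planes. -/
def surf (Ω : Set E3) : Measure E3 :=
  (Measure.euclideanHausdorffMeasure 2 : Measure E3).restrict (frontier Ω)

/-- `n` is the outer unit normal of `Ω` at `x`: every direction that makes an obtuse angle with `n`
enters `Ω`, and every direction that makes an acute angle with `n` enters the exterior. -/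
def IsOuterUnitNormal (Ω : Set E3) (x n : E3) : Prop :=
  ‖n‖ = 1 ∧ ∀ v : E3,
    (inner ℝ v n < 0 → ∀ᶠ t : ℝ in 𝓝[>] 0, x + t • v ∈ Ω) ∧
    (0 < inner ℝ v n → ∀ᶠ t : ℝ in 𝓝[>] 0, x + t • v ∈ exterior Ω)

open Classical in
/-- The outer unit normal field `ν` of `Ω` on `∂Ω` (zero where there is no such normal). -/
def normal (Ω : Set E3) (x : E3) : E3 :=
  if h : ∃ n, IsOuterUnitNormal Ω x n then h.choose else 0

/-! ### Function spaces -/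

/-- `L²(ℝ³; ℂ⁴)`. -/
abbrev L2R : Type := Lp C4 2 (volume : Measure E3)

/-- `L²(Σ; ℂ⁴)`, where `Σ = ∂Ω`. -/
abbrev L2S (Ω : Set E3) : Type := Lp C4 2 (surf Ω)

/-- The membership `φ ∈ C_c^∞(U; F)`. -/
def IsTest {F : Type*} [NormedAddCommGroup F] [NormedSpace ℝ F] (U : Set E3) (φ : E3 → F) : Prop :=
  ContDiff ℝ ∞ φ ∧ HasCompactSupport φ ∧ tsupport φ ⊆ U

/-- The classical partial derivative `∂ⱼ φ`. -/
def pd {F : Type*} [NormedAddCommGroup F] [NormedSpace ℝ F] (j : Fin 3) (φ : E3 → F) (x : E3) : F :=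
  fderiv ℝ φ x (EuclideanSpace.single j 1)

/-- `∂ⱼ f = d` on `U` in the sense of distributions. -/
def IsWeakPD (U : Set E3) (j : Fin 3) (f d : E3 → C4) : Prop :=
  ∀ φ : E3 → ℝ, IsTest U φ → ∫ x in U, φ x • d x = -∫ x in U, pd j φ x • f x

/-- `(-i α·∇ + m β) f = g` on `U` in the sense of distributions. -/
def IsWeakDirac (m : ℝ) (U : Set E3) (f g : E3 → C4) : Prop :=
  ∀ φ : E3 → ℝ, IsTest U φ →
    ∫ x in U, φ x • g x =
      (∑ j, ∫ x in U, pd j φ x • (Complex.I • act (alpha j) (f x))) +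
        ∫ x in U, φ x • ((m : ℂ) • act beta (f x))

/-- Convergence `φₙ → f` in the norm of `H¹(U; ℂ⁴)` for a sequence of smooth functions; it contains
that `f` has weak first derivatives in `L²(U; ℂ⁴)`. -/
def H1Tendsto (U : Set E3) (φ : ℕ → E3 → C4) (f : E3 → C4) : Prop :=
  Tendsto (fun n => eLpNorm (φ n - f) 2 (volume.restrict U)) atTop (𝓝 0) ∧
  ∀ j, ∃ d, MemLp d 2 (volume.restrict U) ∧ IsWeakPD U j f d ∧
    Tendsto (fun n => eLpNorm (pd j (φ n) - d) 2 (volume.restrict U)) atTop (𝓝 0)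

/-- `g` is the trace on `Σ = ∂Ω` of `f|_U ∈ H¹(U; ℂ⁴)`, where `U` is one of the two sides of `Σ`:
the trace map is the continuous extension to `H¹(U; ℂ⁴)` of the restriction map `φ ↦ φ|_Σ` on
`C^∞(closure U; ℂ⁴)`, the space of restrictions to `U` of functions in `C_c^∞(ℝ³; ℂ⁴)`. -/
def HasTrace (Ω U : Set E3) (f g : E3 → C4) : Prop :=
  ∃ φ : ℕ → E3 → C4, (∀ n, IsTest univ (φ n)) ∧ H1Tendsto U φ f ∧
    Tendsto (fun n => eLpNorm (φ n - g) 2 (surf Ω)) atTop (𝓝 0)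

/-! #### Linearity of these notions -/

section Linearity

variable {F : Type*} [NormedAddCommGroup F] [NormedSpace ℝ F]

lemma IsTest.zero (U : Set E3) : IsTest U (0 : E3 → F) :=
  ⟨contDiff_const, HasCompactSupport.zero, by simp [tsupport]⟩

lemma IsTest.add {U : Set E3} {φ ψ : E3 → F} (h : IsTest U φ) (k : IsTest U ψ) :
    IsTest U (φ + ψ) :=
  ⟨h.1.add k.1, h.2.1.add k.2.1,
    (tsupport_add φ ψ).trans (union_subset h.2.2 k.2.2)⟩

lemma IsTest.smul {U : Set E3} {φ : E3 → C4} (c : ℂ) (h : IsTest U φ) : IsTest U (c • φ) :=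
  ⟨h.1.const_smul c, h.2.1.comp_left (g := fun z => c • z) (smul_zero c),
    (closure_mono (Function.support_const_smul_subset c φ)).trans h.2.2⟩

lemma IsTest.differentiable {U : Set E3} {φ : E3 → F} (h : IsTest U φ) : Differentiable ℝ φ :=
  h.1.differentiable (by simp)

lemma IsTest.continuous_pd {U : Set E3} {φ : E3 → F} (h : IsTest U φ) (j : Fin 3) :
    Continuous (pd j φ) :=
  (h.1.continuous_fderiv (by simp)).clm_apply continuous_const

lemma pd_add {U : Set E3} {φ ψ : E3 → F} (h : IsTest U φ) (k : IsTest U ψ) (j : Fin 3) :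
    pd j (φ + ψ) = pd j φ + pd j ψ := by
  ext1 x
  simp [pd, fderiv_add (h.differentiable x) (k.differentiable x)]

lemma pd_smul {U : Set E3} {φ : E3 → C4} (c : ℂ) (h : IsTest U φ) (j : Fin 3) :
    pd j (c • φ) = c • pd j φ := by
  ext1 x
  simp [pd, fderiv_const_smul (h.differentiable x) c]

lemma pd_zero (j : Fin 3) : pd j (0 : E3 → F) = 0 := by
  ext1 x
  simp [pd]

lemma integrable_smul {U : Set E3} {φ : E3 → ℝ} {f : E3 → C4} (hφ : Continuous φ)
    (hc : HasCompactSupport φ) (hf : MemLp f 2 (volume.restrict U)) :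
    IntegrableOn (fun x => φ x • f x) U :=
  (hf.locallyIntegrable (by norm_num)).integrable_smul_left_of_hasCompactSupport hφ hc

lemma IsTest.integrable {U : Set E3} {φ : E3 → ℝ} {f : E3 → C4} (h : IsTest U φ)
    (hf : MemLp f 2 (volume.restrict U)) : IntegrableOn (fun x => φ x • f x) U :=
  integrable_smul h.1.continuous h.2.1 hf

lemma IsTest.integrable_pd {U : Set E3} {φ : E3 → ℝ} {f : E3 → C4} (h : IsTest U φ) (j : Fin 3)
    (hf : MemLp f 2 (volume.restrict U)) : IntegrableOn (fun x => pd j φ x • f x) U :=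
  integrable_smul (h.continuous_pd j) (h.2.1.fderiv_apply ℝ (EuclideanSpace.single j 1)) hf

lemma memLp_act {U : Set E3} {f : E3 → C4} (A : Matrix (Fin 4) (Fin 4) ℂ) (c : ℂ)
    (hf : MemLp f 2 (volume.restrict U)) :
    MemLp (fun x => c • act A (f x)) 2 (volume.restrict U) :=
  ((act A).comp_memLp' hf).const_smul c

lemma L2R.memLp (f : L2R) (U : Set E3) : MemLp f 2 (volume.restrict U) := (Lp.memLp f).restrict U

lemma IsWeakPD.congr {U : Set E3} {j : Fin 3} {f f' d : E3 → C4} (h : IsWeakPD U j f d)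
    (hf : f =ᵐ[volume] f') : IsWeakPD U j f' d := by
  intro φ hφ
  rw [h φ hφ]
  congr 1
  refine integral_congr_ae ?_
  filter_upwards [ae_restrict_of_ae hf] with x hx
  rw [hx]

lemma IsWeakPD.zero (U : Set E3) (j : Fin 3) : IsWeakPD U j 0 0 := by
  intro φ _
  simp

lemma IsWeakPD.add {U : Set E3} {j : Fin 3} {f f' d d' : E3 → C4}
    (hf : MemLp f 2 (volume.restrict U)) (hf' : MemLp f' 2 (volume.restrict U))
    (hd : MemLp d 2 (volume.restrict U)) (hd' : MemLp d' 2 (volume.restrict U))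
    (h : IsWeakPD U j f d) (h' : IsWeakPD U j f' d') : IsWeakPD U j (f + f') (d + d') := by
  intro φ hφ
  simp only [Pi.add_apply, smul_add]
  rw [integral_add (hφ.integrable hd) (hφ.integrable hd'),
    integral_add (hφ.integrable_pd j hf) (hφ.integrable_pd j hf'), h φ hφ, h' φ hφ, neg_add]

lemma IsWeakPD.smul {U : Set E3} {j : Fin 3} {f d : E3 → C4} (c : ℂ) (h : IsWeakPD U j f d) :
    IsWeakPD U j (c • f) (c • d) := by
  intro φ hφ
  simp only [Pi.smul_apply, smul_comm _ c]
  rw [integral_smul, integral_smul, h φ hφ, smul_neg]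

lemma IsWeakDirac.congr {m : ℝ} {U : Set E3} {f f' g g' : E3 → C4} (h : IsWeakDirac m U f g)
    (hf : f =ᵐ[volume] f') (hg : g =ᵐ[volume] g') : IsWeakDirac m U f' g' := by
  intro φ hφ
  have h1 : ∫ x in U, φ x • g' x = ∫ x in U, φ x • g x := by
    refine integral_congr_ae ?_
    filter_upwards [ae_restrict_of_ae hg] with x hx
    rw [hx]
  have h2 : ∀ j, ∫ x in U, pd j φ x • (Complex.I • act (alpha j) (f' x)) =
      ∫ x in U, pd j φ x • (Complex.I • act (alpha j) (f x)) := by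
    intro j
    refine integral_congr_ae ?_
    filter_upwards [ae_restrict_of_ae hf] with x hx
    rw [hx]
  have h3 : ∫ x in U, φ x • ((m : ℂ) • act beta (f' x)) =
      ∫ x in U, φ x • ((m : ℂ) • act beta (f x)) := by
    refine integral_congr_ae ?_
    filter_upwards [ae_restrict_of_ae hf] with x hx
    rw [hx]
  rw [h1, h3]
  simp only [h2]
  exact h φ hφ

lemma IsWeakDirac.zero (m : ℝ) (U : Set E3) : IsWeakDirac m U 0 0 := by
  intro φ _
  simp

lemma IsWeakDirac.add {m : ℝ} {U : Set E3} {f f' g g' : E3 → C4}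
    (hf : MemLp f 2 (volume.restrict U)) (hf' : MemLp f' 2 (volume.restrict U))
    (hg : MemLp g 2 (volume.restrict U)) (hg' : MemLp g' 2 (volume.restrict U))
    (h : IsWeakDirac m U f g) (h' : IsWeakDirac m U f' g') :
    IsWeakDirac m U (f + f') (g + g') := by
  intro φ hφ
  simp only [Pi.add_apply, smul_add, map_add]
  rw [integral_add (hφ.integrable hg) (hφ.integrable hg'),
    integral_add (hφ.integrable (memLp_act beta m hf)) (hφ.integrable (memLp_act beta m hf')),
    h φ hφ, h' φ hφ]
  have : ∀ j, ∫ x in U, (pd j φ x • (Complex.I • act (alpha j) (f x)) +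
      pd j φ x • (Complex.I • act (alpha j) (f' x))) =
      (∫ x in U, pd j φ x • (Complex.I • act (alpha j) (f x))) +
        ∫ x in U, pd j φ x • (Complex.I • act (alpha j) (f' x)) := fun j =>
    integral_add (hφ.integrable_pd j (memLp_act _ _ hf)) (hφ.integrable_pd j (memLp_act _ _ hf'))
  simp only [this, Finset.sum_add_distrib]
  abel

lemma IsWeakDirac.smul {m : ℝ} {U : Set E3} {f g : E3 → C4} (c : ℂ) (h : IsWeakDirac m U f g) :
    IsWeakDirac m U (c • f) (c • g) := by
  intro φ hφ
  simp only [Pi.smul_apply, map_smul, smul_comm _ c]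
  simp only [integral_smul]
  rw [h φ hφ, smul_add, Finset.smul_sum]

lemma tendsto_eLpNorm_add {μ : Measure E3} {u v : ℕ → E3 → C4} {f g : E3 → C4}
    (hu : ∀ n, Continuous (u n)) (hv : ∀ n, Continuous (v n))
    (hf : AEStronglyMeasurable f μ) (hg : AEStronglyMeasurable g μ)
    (h : Tendsto (fun n => eLpNorm (u n - f) 2 μ) atTop (𝓝 0))
    (k : Tendsto (fun n => eLpNorm (v n - g) 2 μ) atTop (𝓝 0)) :
    Tendsto (fun n => eLpNorm (u n + v n - (f + g)) 2 μ) atTop (𝓝 0) := by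
  have hk := h.add k
  rw [add_zero] at hk
  refine tendsto_of_tendsto_of_tendsto_of_le_of_le tendsto_const_nhds hk (fun _ => zero_le) ?_
  intro n
  have e : u n + v n - (f + g) = (u n - f) + (v n - g) := by abel
  simp only [e]
  exact eLpNorm_add_le ((hu n).aestronglyMeasurable.sub hf) ((hv n).aestronglyMeasurable.sub hg)
    (by norm_num)

lemma tendsto_eLpNorm_smul {μ : Measure E3} {u : ℕ → E3 → C4} {f : E3 → C4} (c : ℂ)
    (h : Tendsto (fun n => eLpNorm (u n - f) 2 μ) atTop (𝓝 0)) :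
    Tendsto (fun n => eLpNorm (c • u n - c • f) 2 μ) atTop (𝓝 0) := by
  have hk := ENNReal.Tendsto.const_mul (a := ‖c‖ₑ) h (Or.inr (by simp))
  rw [mul_zero] at hk
  simpa only [← smul_sub, eLpNorm_const_smul] using hk

lemma tendsto_eLpNorm_congr {μ : Measure E3} {u : ℕ → E3 → C4} {f g : E3 → C4} (hfg : f =ᵐ[μ] g)
    (h : Tendsto (fun n => eLpNorm (u n - f) 2 μ) atTop (𝓝 0)) :
    Tendsto (fun n => eLpNorm (u n - g) 2 μ) atTop (𝓝 0) := by
  refine h.congr fun n => eLpNorm_congr_ae ?_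
  filter_upwards [hfg] with x hx
  simp [hx]

lemma H1Tendsto.congr {U : Set E3} {φ : ℕ → E3 → C4} {f f' : E3 → C4} (h : H1Tendsto U φ f)
    (hf : f =ᵐ[volume] f') : H1Tendsto U φ f' := by
  refine ⟨tendsto_eLpNorm_congr (ae_restrict_of_ae hf) h.1, fun j => ?_⟩
  obtain ⟨d, hd, hw, ht⟩ := h.2 j
  exact ⟨d, hd, hw.congr hf, ht⟩

lemma H1Tendsto.zero (U : Set E3) : H1Tendsto U (fun _ => 0) 0 := by
  refine ⟨by simp, fun j => ⟨0, MemLp.zero, IsWeakPD.zero U j, ?_⟩⟩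
  simp [pd_zero]

lemma H1Tendsto.add {U V : Set E3} {φ ψ : ℕ → E3 → C4} {f f' : E3 → C4}
    (hφ : ∀ n, IsTest V (φ n)) (hψ : ∀ n, IsTest V (ψ n))
    (hf : MemLp f 2 (volume.restrict U)) (hf' : MemLp f' 2 (volume.restrict U))
    (h : H1Tendsto U φ f) (h' : H1Tendsto U ψ f') :
    H1Tendsto U (fun n => φ n + ψ n) (f + f') := by
  refine ⟨tendsto_eLpNorm_add (fun n => (hφ n).1.continuous) (fun n => (hψ n).1.continuous)
    hf.1 hf'.1 h.1 h'.1, fun j => ?_⟩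
  obtain ⟨d, hd, hw, ht⟩ := h.2 j
  obtain ⟨d', hd', hw', ht'⟩ := h'.2 j
  refine ⟨d + d', hd.add hd', hw.add hf hf' hd hd' hw', ?_⟩
  simp only [fun n => pd_add (hφ n) (hψ n) j]
  exact tendsto_eLpNorm_add (fun n => (hφ n).continuous_pd j) (fun n => (hψ n).continuous_pd j)
    hd.1 hd'.1 ht ht'

lemma H1Tendsto.smul {U V : Set E3} {φ : ℕ → E3 → C4} {f : E3 → C4} (c : ℂ)
    (hφ : ∀ n, IsTest V (φ n)) (h : H1Tendsto U φ f) :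
    H1Tendsto U (fun n => c • φ n) (c • f) := by
  refine ⟨tendsto_eLpNorm_smul c h.1, fun j => ?_⟩
  obtain ⟨d, hd, hw, ht⟩ := h.2 j
  refine ⟨c • d, hd.const_smul c, hw.smul c, ?_⟩
  simp only [fun n => pd_smul c (hφ n) j]
  exact tendsto_eLpNorm_smul c ht

lemma HasTrace.zero (Ω U : Set E3) : HasTrace Ω U (0 : L2R) (0 : L2S Ω) :=
  ⟨fun _ => 0, fun _ => IsTest.zero _,
    (H1Tendsto.zero U).congr (Lp.coeFn_zero C4 2 volume).symm,
    tendsto_eLpNorm_congr (Lp.coeFn_zero C4 2 (surf Ω)).symm (by simp)⟩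

lemma HasTrace.add {Ω U : Set E3} {f f' : L2R} {g g' : L2S Ω} (h : HasTrace Ω U f g)
    (h' : HasTrace Ω U f' g') :
    HasTrace Ω U (f + f' : L2R) (g + g' : L2S Ω) := by
  obtain ⟨φ, hφ, h1, h2⟩ := h
  obtain ⟨φ', hφ', h1', h2'⟩ := h'
  refine ⟨fun n => φ n + φ' n, fun n => (hφ n).add (hφ' n),
    (H1Tendsto.add hφ hφ' (f.memLp U) (f'.memLp U) h1 h1').congr (Lp.coeFn_add f f').symm, ?_⟩
  exact tendsto_eLpNorm_congr (Lp.coeFn_add g g').symm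
    (tendsto_eLpNorm_add (fun n => (hφ n).1.continuous) (fun n => (hφ' n).1.continuous)
      (Lp.aestronglyMeasurable g) (Lp.aestronglyMeasurable g') h2 h2')

lemma HasTrace.smul {Ω U : Set E3} {f : L2R} {g : L2S Ω} (c : ℂ) (h : HasTrace Ω U f g) :
    HasTrace Ω U (c • f : L2R) (c • g : L2S Ω) := by
  obtain ⟨φ, hφ, h1, h2⟩ := h
  exact ⟨fun n => c • φ n, fun n => (hφ n).smul c,
    (h1.smul c hφ).congr (Lp.coeFn_smul c f).symm,
    tendsto_eLpNorm_congr (Lp.coeFn_smul c g).symm (tendsto_eLpNorm_smul c h2)⟩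

end Linearity

/-! #### Sobolev spaces -/

/-- The functions `f ∈ L²(ℝ³; ℂ⁴)` with `f|_U ∈ H¹(U; ℂ⁴)`. -/
def H1 (U : Set E3) : Submodule ℂ L2R where
  carrier := {f | ∀ j, ∃ d, MemLp d 2 (volume.restrict U) ∧ IsWeakPD U j f d}
  zero_mem' j := ⟨0, MemLp.zero, (IsWeakPD.zero U j).congr (Lp.coeFn_zero C4 2 volume).symm⟩
  add_mem' {f g} hf hg j := by
    obtain ⟨d, hd, hw⟩ := hf j
    obtain ⟨d', hd', hw'⟩ := hg j
    exact ⟨d + d', hd.add hd',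
      (hw.add (f.memLp U) (g.memLp U) hd hd' hw').congr (Lp.coeFn_add f g).symm⟩
  smul_mem' c f hf j := by
    obtain ⟨d, hd, hw⟩ := hf j
    exact ⟨c • d, hd.const_smul c, (hw.smul c).congr (Lp.coeFn_smul c f).symm⟩

/-- `H¹(ℝ³ ∖ Σ; ℂ⁴) = H¹(Ω₊; ℂ⁴) ⊕ H¹(Ω₋; ℂ⁴)`, where `Σ = ∂Ω` and `Ω₊ = Ω`. -/
def H1off (Ω : Set E3) : Submodule ℂ L2R := H1 Ω ⊓ H1 (exterior Ω)

/-- `H¹₀(U; ℂ⁴)`: the closure of `C_c^∞(U; ℂ⁴)` in the `H¹`-norm (functions in `H¹₀(U; ℂ⁴)` are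
extended by zero to `ℝ³`). -/
def H10 (U : Set E3) : Submodule ℂ L2R where
  carrier := {f | ∃ φ : ℕ → E3 → C4, (∀ n, IsTest U (φ n)) ∧ H1Tendsto univ φ f}
  zero_mem' := ⟨fun _ => 0, fun _ => IsTest.zero _,
    (H1Tendsto.zero univ).congr (Lp.coeFn_zero C4 2 volume).symm⟩
  add_mem' {f g} hf hg := by
    obtain ⟨φ, hφ, h1⟩ := hf
    obtain ⟨φ', hφ', h1'⟩ := hg
    exact ⟨fun n => φ n + φ' n, fun n => (hφ n).add (hφ' n),
      (H1Tendsto.add hφ hφ' (f.memLp univ) (g.memLp univ) h1 h1').congr (Lp.coeFn_add f g).symm⟩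
  smul_mem' c f hf := by
    obtain ⟨φ, hφ, h1⟩ := hf
    exact ⟨fun n => c • φ n, fun n => (hφ n).smul c,
      (h1.smul c hφ).congr (Lp.coeFn_smul c f).symm⟩

/-- `H^{1/2}(Σ; ℂ⁴)`, where `Σ = ∂Ω`, with the Sobolev–Slobodeckij seminorm (`Σ` has dimension two,
so the exponent is `2 + 2 · 1/2 = 3`). -/
def H12 (Ω : Set E3) : Set (L2S Ω) :=
  {g | ∫⁻ x, ∫⁻ y, ‖g x - g y‖ₑ ^ 2 / edist x y ^ 3 ∂(surf Ω) ∂(surf Ω) < ⊤}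

/-! ### The Dirac operators -/

/-- The pairs `(f, g)` in `L²(ℝ³; ℂ⁴)` with `(-i α·∇ + m β) f = g` on `U` in the sense of
distributions. -/
def diracRel (m : ℝ) (U : Set E3) : Submodule ℂ (L2R × L2R) where
  carrier := {p | IsWeakDirac m U p.1 p.2}
  zero_mem' := (IsWeakDirac.zero m U).congr (Lp.coeFn_zero C4 2 volume).symm
    (Lp.coeFn_zero C4 2 volume).symm
  add_mem' {p q} hp hq :=
    (IsWeakDirac.add (p.1.memLp U) (q.1.memLp U) (p.2.memLp U) (q.2.memLp U) hp hq).congr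
      (Lp.coeFn_add p.1 q.1).symm (Lp.coeFn_add p.2 q.2).symm
  smul_mem' c p hp := (IsWeakDirac.smul c hp).congr (Lp.coeFn_smul c p.1).symm
    (Lp.coeFn_smul c p.2).symm

/-- The free Dirac operator `A₀ f = -i ∑ⱼ αⱼ ∂ⱼ f + m β f` with `dom A₀ = H¹(ℝ³; ℂ⁴)`. -/
def freeDirac (m : ℝ) : L2R →ₗ.[ℂ] L2R := (diracRel m univ).toLinearPMap.domRestrict (H1 univ)

/-- `S = A₀ ↾ H¹₀(ℝ³ ∖ Σ; ℂ⁴)`. -/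
def minDirac (m : ℝ) (Ω : Set E3) : L2R →ₗ.[ℂ] L2R := (freeDirac m).domRestrict (H10 (frontier Ω)ᶜ)

/-- The maximal Dirac operator
`T_max f = (-i α·∇ + m β) f₊ ⊕ (-i α·∇ + m β) f₋`, defined on all `f ∈ L²(ℝ³; ℂ⁴)` for which
the right-hand side, in the sense of distributions on `Ω₊` and `Ω₋`, is in `L²`. -/
def maxDirac (m : ℝ) (Ω : Set E3) : L2R →ₗ.[ℂ] L2R :=
  (diracRel m Ω ⊓ diracRel m (exterior Ω)).toLinearPMap

/-- `T = T_max ↾ H¹(ℝ³ ∖ Σ; ℂ⁴)`. -/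
def diracT (m : ℝ) (Ω : Set E3) : L2R →ₗ.[ℂ] L2R := (maxDirac m Ω).domRestrict (H1off Ω)

/-! ### The boundary mappings -/

/-- `Γ₀ f = i α·ν (f₊|_Σ - f₋|_Σ)`, given by its graph. -/
def Gamma0 (Ω : Set E3) : L2R →ₗ.[ℂ] L2S Ω :=
  Submodule.toLinearPMap
  { carrier := {p : L2R × L2S Ω | ∃ gp gm : L2S Ω,
      HasTrace Ω Ω p.1 gp ∧ HasTrace Ω (exterior Ω) p.1 gm ∧
        ∀ᵐ x ∂(surf Ω), p.2 x = Complex.I • act (alphaDot (normal Ω x)) (gp x - gm x)}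
    zero_mem' := by
      refine ⟨0, 0, HasTrace.zero _ _, HasTrace.zero _ _, ?_⟩
      filter_upwards [Lp.coeFn_zero C4 2 (surf Ω)] with x hx
      rw [sub_self, map_zero, smul_zero]
      exact hx
    add_mem' := by
      rintro p q ⟨gp, gm, h1, h2, h3⟩ ⟨gp', gm', h1', h2', h3'⟩
      refine ⟨gp + gp', gm + gm', h1.add h1', h2.add h2', ?_⟩
      filter_upwards [h3, h3', Lp.coeFn_add p.2 q.2, Lp.coeFn_add gp gp',
        Lp.coeFn_add gm gm'] with x a a' b c d
      simp only [Prod.snd_add, b, c, d, Pi.add_apply, a, a', add_sub_add_comm, map_add, smul_add]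
    smul_mem' := by
      rintro z p ⟨gp, gm, h1, h2, h3⟩
      refine ⟨z • gp, z • gm, h1.smul z, h2.smul z, ?_⟩
      filter_upwards [h3, Lp.coeFn_smul z p.2, Lp.coeFn_smul z gp,
        Lp.coeFn_smul z gm] with x a b c d
      simp only [Prod.smul_snd, b, c, d, Pi.smul_apply, a, ← smul_sub, map_smul]
      rw [smul_comm] }

/-- `Γ₁ f = (f₊|_Σ + f₋|_Σ) / 2`, given by its graph. -/
def Gamma1 (Ω : Set E3) : L2R →ₗ.[ℂ] L2S Ω :=
  Submodule.toLinearPMap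
  { carrier := {p : L2R × L2S Ω | ∃ gp gm : L2S Ω,
      HasTrace Ω Ω p.1 gp ∧ HasTrace Ω (exterior Ω) p.1 gm ∧ p.2 = (1 / 2 : ℂ) • (gp + gm)}
    zero_mem' := ⟨0, 0, HasTrace.zero _ _, HasTrace.zero _ _, by simp⟩
    add_mem' := by
      rintro p q ⟨gp, gm, h1, h2, h3⟩ ⟨gp', gm', h1', h2', h3'⟩
      refine ⟨gp + gp', gm + gm', h1.add h1', h2.add h2', ?_⟩
      rw [Prod.snd_add, h3, h3', ← smul_add, add_add_add_comm]
    smul_mem' := by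
      rintro z p ⟨gp, gm, h1, h2, h3⟩
      refine ⟨z • gp, z • gm, h1.smul z, h2.smul z, ?_⟩
      rw [Prod.smul_snd, h3, ← smul_add, smul_comm] }

end DiracShell

end

open DiracShell

open MeasureTheory Filter Topology Set
open scoped ENNReal ContDiff LinearPMap

noncomputable section

namespace DiracShell

open scoped Convolution

set_option linter.unusedSectionVars false

/-! ### Square integrals and mollification -/

section Mollify

/-! The boundary is handled one side at a time. The class `IsC2` (open, compact C² boundary) is
closed under passing to the exterior and contains ℝ³ itself, so each one-sided result holds on Ω₊,
on Ω₋ with the opposite normal, and on ℝ³ without any boundary term. Four facts carry the proof.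

Density: a weak L² solution of a first order system with constant coefficients is a limit, in the
graph norm and up to the boundary, of restrictions of test functions on ℝ³ (`exists_test_approx`).
With the gradient as system this is density in H¹(U) (`exists_h1Err_le`); with the Dirac system it
is density in the maximal domain (`exists_dirac_approx`).

Traces: flattening the boundary reduces the trace inequality to the half space (`exists_trace_le`).
Conversely, averaging boundary data at scale equal to the height gives an extension whose energy is
bounded by the Slobodeckij seminorm (`exists_avg_energy_le`). Hence H^{1/2}(Σ) is exactly the space
of traces from either side (`mem_H12_iff_left`, `mem_H12_iff_right`).

Green's identity: the area formula for graphs (`Chart.comap_gr`) gives the Gauss–Green formula, and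
since the Dirac matrices are Hermitian this yields `dirac_green` with boundary form i⟨φ, α·ν ψ⟩.

Energy identity: on ℝ³ the square of the Dirac operator is -Δ + m², so for test functions the graph
norm controls the H¹ norm (`integral_norm_dirac_sq`). Thus every weak L² solution on ℝ³ is in H¹,
and the graph of S is the graph closure of the Dirac operator on test functions supported off Σ.

The operator statements follow. S* = T_max because Green's identity against functions vanishing on Σ
has no boundary term, while test functions on each side already force the weak equation. T has
closure T_max by density on the two sides separately. A₀ is self-adjoint because it is the maximal
operator on ℝ³. The abstract Green identity rewrites the difference of the two boundary forms by
means and jumps. Since (α·ν)² = 1 and ν is C¹, multiplication by α·ν is a bijection of H^{1/2}(Σ),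
so mean and jump can be prescribed independently. Finally Γ₀f = 0 says that the traces agree; then
the boundary terms from the two sides cancel and the weak equation holds across Σ. -/

lemma lintegral_mul_sq_le {α : Type*} [MeasurableSpace α] {μ : Measure α} {f g : α → ℝ≥0∞}
    (hf : AEMeasurable f μ) (hg : AEMeasurable g μ) :
    (∫⁻ a, f a * g a ∂μ) ^ 2 ≤ (∫⁻ a, f a ^ 2 ∂μ) * ∫⁻ a, g a ^ 2 ∂μ := by
  have h := ENNReal.lintegral_mul_le_Lp_mul_Lq μ Real.HolderConjugate.two_two hf hg
  simp only [Pi.mul_apply, ENNReal.rpow_two] at h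
  calc _ ≤ ((∫⁻ a, f a ^ 2 ∂μ) ^ (1 / 2 : ℝ) * (∫⁻ a, g a ^ 2 ∂μ) ^ (1 / 2 : ℝ)) ^ 2 := by gcongr
    _ = _ := by
      rw [mul_pow, ← ENNReal.rpow_two, ← ENNReal.rpow_two, ← ENNReal.rpow_mul, ← ENNReal.rpow_mul]
      norm_num

/-- Cauchy–Schwarz for the measure with density `w`, from the splitting w = w^{1/2} w^{1/2}. With a
kernel of mass one it is Jensen's inequality; with a singular weight it gives the Hardy type bound
of the trace inequality. -/
lemma lintegral_weight_mul_sq_le {α : Type*} [MeasurableSpace α] {μ : Measure α} {w h : α → ℝ≥0∞}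
    (hw : AEMeasurable w μ) (hh : AEMeasurable h μ) :
    (∫⁻ a, w a * h a ∂μ) ^ 2 ≤ (∫⁻ a, w a ∂μ) * ∫⁻ a, w a * h a ^ 2 ∂μ := by
  have e : ∀ a, w a ^ (1 / 2 : ℝ) * w a ^ (1 / 2 : ℝ) = w a := fun a => by
    rw [← ENNReal.rpow_add_of_nonneg _ _ (by norm_num) (by norm_num)]
    norm_num
  have := lintegral_mul_sq_le (hw.pow_const (1 / 2 : ℝ)) ((hw.pow_const (1 / 2 : ℝ)).mul hh)
  simp only [Pi.mul_apply, ← mul_assoc, e, mul_pow, pow_two (w _ ^ (1 / 2 : ℝ))] at this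
  exact this

lemma eLpNorm_two_sq {α E : Type*} [MeasurableSpace α] [NormedAddCommGroup E] (μ : Measure α)
    (f : α → E) : eLpNorm f 2 μ ^ 2 = ∫⁻ x, ‖f x‖ₑ ^ 2 ∂μ := by
  have := eLpNorm_nnreal_pow_eq_lintegral (μ := μ) (f := f) (p := 2) (by norm_num)
  simpa using this

lemma eLpNorm_two_le {α E : Type*} [MeasurableSpace α] [NormedAddCommGroup E] {μ : Measure α}
    {f : α → E} {c : ℝ≥0∞} (h : ∫⁻ x, ‖f x‖ₑ ^ 2 ∂μ ≤ c ^ 2) : eLpNorm f 2 μ ≤ c := by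
  rw [← eLpNorm_two_sq] at h
  exact (ENNReal.pow_le_pow_left_iff two_ne_zero).1 h

/-- For a kernel of mass one the first factor is 1, and Tonelli then turns the pointwise bound into
a mean square bound. All averaging operators below are estimated in this way. -/
lemma enorm_integral_smul_sq_le {α E : Type*} [MeasurableSpace α] [NormedAddCommGroup E]
    [NormedSpace ℝ E] {μ : Measure α} {κ : α → ℝ} {F : α → E} (hκ : AEStronglyMeasurable κ μ)
    (hF : AEStronglyMeasurable F μ) :
    ‖∫ a, κ a • F a ∂μ‖ₑ ^ 2 ≤ (∫⁻ a, ‖κ a‖ₑ ∂μ) * ∫⁻ a, ‖κ a‖ₑ * ‖F a‖ₑ ^ 2 ∂μ := by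
  refine le_trans ?_ (lintegral_weight_mul_sq_le hκ.enorm hF.enorm)
  gcongr
  refine (enorm_integral_le_lintegral_enorm _).trans (le_of_eq ?_)
  simp only [enorm_smul]

/-! ### Mollification in `L²` with kernels of small support. -/

variable {V : Type*} [NormedAddCommGroup V] [NormedSpace ℝ V] [FiniteDimensional ℝ V]
  [MeasurableSpace V] [BorelSpace V] {μ : Measure V} [μ.IsAddHaarMeasure]
  {F : Type*} [NormedAddCommGroup F]

/-- Translations act continuously on `L²`. -/
lemma tendsto_eLpNorm_translate {f : V → F} (hf : MemLp f 2 μ) :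
    Tendsto (fun v => eLpNorm (fun x => f (x - v) - f x) 2 μ) (𝓝 0) (𝓝 0) := by
  -- Translation is composition with a measure preserving map that depends continuously on `v` in
  -- the compact-open topology; such compositions act continuously on `L²`.
  let g : V → C(V, V) := fun v => ⟨fun x => x - v, by fun_prop⟩
  have hg : Continuous g := ContinuousMap.continuous_of_continuous_uncurry _ (by
    simp only [Function.uncurry_def, g, ContinuousMap.coe_mk]; fun_prop)
  have hgm : ∀ v, MeasurePreserving (g v) μ μ := fun v => measurePreserving_sub_right μ v
  have h := (continuous_const (y := hf.toLp f)).compMeasurePreservingLp hg hgm (by norm_num)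
  have h0 := (h.tendsto 0)
  rw [Lp.tendsto_Lp_iff_tendsto_eLpNorm'] at h0
  refine h0.congr fun v => eLpNorm_congr_ae ?_
  have h1 := Lp.coeFn_compMeasurePreserving (hf.toLp f) (hgm v)
  have h2 := Lp.coeFn_compMeasurePreserving (hf.toLp f) (hgm 0)
  have h3 := (hgm v).quasiMeasurePreserving.ae_eq_comp hf.coeFn_toLp
  have h4 := (hgm 0).quasiMeasurePreserving.ae_eq_comp hf.coeFn_toLp
  filter_upwards [h1, h2, h3, h4] with x a b c d
  rw [Pi.sub_apply, a, b, c, d]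
  simp [g]

/-- A smooth nonnegative kernel of integral one that is supported in the ball of radius `η`. -/
structure IsKernel (μ : Measure V) (κ : V → ℝ) (η : ℝ) : Prop where
  contDiff : ContDiff ℝ ∞ κ
  hasCompactSupport : HasCompactSupport κ
  nonneg : ∀ x, 0 ≤ κ x
  integral : ∫ x, κ x ∂μ = 1
  support : Function.support κ ⊆ Metric.ball 0 η

/-- The bump may be centred away from the origin. Off-centre kernels are what push points
transversally to the boundary in `Atlas.exists_kernel`. -/
lemma _root_.ContDiffBump.isKernel {c : V} (b : ContDiffBump c) {η : ℝ} (h : ‖c‖ + b.rOut ≤ η) :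
    IsKernel μ (b.normed μ) η where
  contDiff := b.contDiff_normed
  hasCompactSupport := b.hasCompactSupport_normed
  nonneg := b.nonneg_normed
  integral := b.integral_normed
  support := by
    rw [b.support_normed_eq]
    refine Metric.ball_subset_ball' ?_
    rw [dist_zero_right]
    linarith

lemma IsKernel.lintegral {κ : V → ℝ} {η : ℝ} (h : IsKernel μ κ η) : ∫⁻ x, ‖κ x‖ₑ ∂μ = 1 := by
  have hi : Integrable κ μ := h.contDiff.continuous.integrable_of_hasCompactSupport
    h.hasCompactSupport
  have := ofReal_integral_eq_lintegral_ofReal hi (ae_of_all _ h.nonneg)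
  rw [h.integral, ENNReal.ofReal_one] at this
  rw [this]
  exact lintegral_congr fun x => Real.enorm_of_nonneg (h.nonneg x)

lemma IsKernel.mono {κ : V → ℝ} {η η' : ℝ} (h : IsKernel μ κ η) (hη : η ≤ η') :
    IsKernel μ κ η' :=
  { h with support := h.support.trans (Metric.ball_subset_ball hη) }

/-- A kernel average is bounded in mean square by the worst kernel-supported value. -/
lemma IsKernel.lintegral_average_le {κ : V → ℝ} {η : ℝ} (h : IsKernel μ κ η) {c : ℝ≥0∞}
    {G : V → ℝ≥0∞} (hc : ∀ v, ‖v‖ < η → G v ≤ c) : ∫⁻ v, ‖κ v‖ₑ * G v ∂μ ≤ c := by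
  calc ∫⁻ v, ‖κ v‖ₑ * G v ∂μ ≤ ∫⁻ v, ‖κ v‖ₑ * c ∂μ := by
        refine lintegral_mono fun v => ?_
        by_cases hv : κ v = 0
        · simp [hv]
        · have : v ∈ Metric.ball (0 : V) η := h.support hv
          gcongr
          exact hc v (by simpa using this)
    _ = c := by
      rw [lintegral_mul_const _ h.contDiff.continuous.enorm.measurable, h.lintegral, one_mul]

variable [NormedSpace ℝ F] [CompleteSpace F]

lemma IsKernel.convolution_sub {κ : V → ℝ} {η : ℝ} (h : IsKernel μ κ η) {f : V → F}
    (hf : LocallyIntegrable f μ) (x : V) :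
    (κ ⋆[ContinuousLinearMap.lsmul ℝ ℝ, μ] f) x - f x = ∫ v, κ v • (f (x - v) - f x) ∂μ := by
  have hi : Integrable κ μ := h.contDiff.continuous.integrable_of_hasCompactSupport
    h.hasCompactSupport
  have he := (h.hasCompactSupport.convolutionExists_left (ContinuousLinearMap.lsmul ℝ ℝ)
    h.contDiff.continuous hf x).integrable
  simp only [ContinuousLinearMap.lsmul_apply] at he
  simp only [smul_sub]
  rw [integral_sub he (hi.smul_const _), integral_smul_const, h.integral, one_smul]
  rfl

/-- Mollification converges in `L²`, uniformly over the kernels with small support. -/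
lemma exists_mollify_radius {f : V → F} (hf : MemLp f 2 μ) {ε : ℝ≥0∞} (hε : ε ≠ 0) :
    ∃ η > 0, ∀ κ : V → ℝ, IsKernel μ κ η →
      eLpNorm ((κ ⋆[ContinuousLinearMap.lsmul ℝ ℝ, μ] f) - f) 2 μ ≤ ε := by
  -- The radius is fixed by `f` and `ε` before the kernel is chosen, so the kernel can afterwards be
  -- adapted to the geometry, or shared by several functions.
  have ht := (tendsto_eLpNorm_translate hf).eventually (ge_mem_nhds (pos_iff_ne_zero.2 hε))
  obtain ⟨η, hη, hb⟩ := Metric.eventually_nhds_iff.1 ht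
  refine ⟨η, hη, fun κ hκ => eLpNorm_two_le ?_⟩
  have hloc : LocallyIntegrable f μ := hf.locallyIntegrable (by norm_num)
  have hm : AEStronglyMeasurable (fun p : V × V => f (p.1 - p.2) - f p.1) (μ.prod μ) :=
    (hf.1.comp_quasiMeasurePreserving (quasiMeasurePreserving_sub_of_right_invariant μ μ)).sub
      hf.1.comp_fst
  have hκc : Continuous κ := hκ.contDiff.continuous
  -- Jensen in the kernel variable, then Tonelli: the inner integral becomes the squared `L²`
  -- modulus of continuity, which is at most `ε ^ 2` for shifts shorter than `η`.
  calc ∫⁻ x, ‖((κ ⋆[ContinuousLinearMap.lsmul ℝ ℝ, μ] f) - f) x‖ₑ ^ 2 ∂μ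
      ≤ ∫⁻ x, ∫⁻ v, ‖κ v‖ₑ * ‖f (x - v) - f x‖ₑ ^ 2 ∂μ ∂μ := by
        refine lintegral_mono_ae ?_
        filter_upwards [hm.prodMk_left] with x hx
        rw [Pi.sub_apply, hκ.convolution_sub hloc]
        refine (enorm_integral_smul_sq_le hκc.aestronglyMeasurable hx).trans ?_
        rw [hκ.lintegral, one_mul]
    _ = ∫⁻ v, ‖κ v‖ₑ * ∫⁻ x, ‖f (x - v) - f x‖ₑ ^ 2 ∂μ ∂μ := by
        rw [lintegral_lintegral_swap]
        · refine lintegral_congr fun v => ?_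
          rw [lintegral_const_mul' _ _ (by simp)]
        · exact (hκc.enorm.measurable.comp measurable_snd).aemeasurable.mul (hm.enorm.pow_const 2)
    _ ≤ ε ^ 2 := by
        refine hκ.lintegral_average_le fun v hv => ?_
        rw [← eLpNorm_two_sq (f := fun x => f (x - v) - f x)]
        gcongr
        exact hb (by simpa using hv)

end Mollify

/-! ### Graph coordinates -/

section Geometry

/-- The plane `ℝ²` of graph parameters. -/
abbrev E2 : Type := EuclideanSpace ℝ (Fin 2)

/-- The identification `ℝ² × ℝ ≃ ℝ³`. -/
def join : (E2 × ℝ) ≃L[ℝ] E3 :=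
  LinearEquiv.toContinuousLinearEquiv
    { toFun := fun p => !₂[p.1 0, p.1 1, p.2]
      invFun := fun z => (!₂[z 0, z 1], z 2)
      map_add' := fun p q => by ext i; fin_cases i <;> simp
      map_smul' := fun a p => by ext i; fin_cases i <;> simp
      left_inv := fun p => by ext i <;> [(fin_cases i <;> simp); simp]
      right_inv := fun z => by ext i; fin_cases i <;> simp }

lemma join_apply (p : E2 × ℝ) : join p = !₂[p.1 0, p.1 1, p.2] := rfl

lemma join_symm_apply (z : E3) : join.symm z = (!₂[z 0, z 1], z 2) := rfl

lemma norm_join_sq (p : E2 × ℝ) : ‖join p‖ ^ 2 = ‖p.1‖ ^ 2 + p.2 ^ 2 := by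
  simp [join_apply, EuclideanSpace.norm_sq_eq, Fin.sum_univ_three]

lemma inner_join (p q : E2 × ℝ) : inner ℝ (join p) (join q) = inner ℝ p.1 q.1 + p.2 * q.2 := by
  simp [join_apply, PiLp.inner_apply, Fin.sum_univ_three, mul_comm]

lemma norm_join_symm_fst_le (z : E3) : ‖(join.symm z).1‖ ≤ ‖z‖ := by
  have h := norm_join_sq (join.symm z)
  rw [ContinuousLinearEquiv.apply_symm_apply] at h
  exact le_of_sq_le_sq (by nlinarith [sq_nonneg (join.symm z).2]) (norm_nonneg z)

lemma abs_join_symm_snd_le (z : E3) : |(join.symm z).2| ≤ ‖z‖ := by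
  have h := norm_join_sq (join.symm z)
  rw [ContinuousLinearEquiv.apply_symm_apply] at h
  refine le_of_sq_le_sq ?_ (norm_nonneg z)
  rw [sq_abs]
  nlinarith [sq_nonneg ‖(join.symm z).1‖]

lemma norm_join_le (p : E2 × ℝ) : ‖join p‖ ≤ ‖p.1‖ + |p.2| := by
  refine le_of_sq_le_sq ?_ (by positivity)
  rw [norm_join_sq, ← sq_abs p.2]
  nlinarith [norm_nonneg p.1, abs_nonneg p.2, mul_nonneg (norm_nonneg p.1) (abs_nonneg p.2)]

lemma measurePreserving_join : MeasurePreserving join volume volume := by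
  have h1 := (volume_preserving_piFinSuccAbove (fun _ : Fin 3 => ℝ) 2).symm
  have h2 : MeasurePreserving (Prod.swap : (Fin 2 → ℝ) × ℝ → ℝ × (Fin 2 → ℝ)) volume volume :=
    Measure.measurePreserving_swap
  have h3 : MeasurePreserving (Prod.map (WithLp.ofLp : E2 → Fin 2 → ℝ) (id : ℝ → ℝ))
      (volume.prod volume) (volume.prod volume) :=
    (PiLp.volume_preserving_ofLp (Fin 2)).prod (MeasurePreserving.id volume)
  have h4 := (PiLp.volume_preserving_toLp (Fin 3)).comp (h1.comp (h2.comp h3))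
  have e : ⇑join = WithLp.toLp 2 ∘ ⇑(MeasurableEquiv.piFinSuccAbove (fun _ : Fin 3 => ℝ) 2).symm ∘
      Prod.swap ∘ Prod.map WithLp.ofLp id := by
    funext p
    ext i
    fin_cases i <;> rfl
  rw [e]
  exact h4

/-- `U` is open with compact `C²` boundary, and lies locally on one side of its boundary. -/
structure IsC2 (U : Set E3) : Prop where
  isOpen : IsOpen U
  isCompact_frontier : IsCompact (frontier U)
  boundary : ∀ x ∈ frontier U, ∃ (r : ℝ) (e : E3 ≃ₗᵢ[ℝ] E3) (h : E2 → ℝ),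
    0 < r ∧ ContDiff ℝ 2 h ∧ ∀ y ∈ Metric.ball x r, (y ∈ U ↔ e y 2 < h !₂[e y 0, e y 1])

lemma IsBoundedC2.isC2 {Ω : Set E3} (h : IsBoundedC2 Ω) : IsC2 Ω where
  isOpen := h.isOpen
  isCompact_frontier := Metric.isCompact_of_isClosed_isBounded isClosed_frontier
    (h.isBounded.closure.subset frontier_subset_closure)
  boundary := h.boundary

/-- With empty boundary the one-sided results specialize to ℝ³, where no boundary term appears; this
is how the free operator is treated. -/
lemma isC2_univ : IsC2 univ where
  isOpen := isOpen_univ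
  isCompact_frontier := by simp
  boundary := by simp

/-- Graph coordinates for `U` near a boundary point; the graph function has compact support. -/
structure Chart (U : Set E3) where
  /-- the centre -/
  x : E3
  /-- the radius -/
  r : ℝ
  /-- the rotation of coordinates -/
  e : E3 ≃ₗᵢ[ℝ] E3
  /-- the graph function -/
  h : E2 → ℝ
  r_pos : 0 < r
  contDiff : ContDiff ℝ 2 h
  hasCompactSupport : HasCompactSupport h
  mem_iff' : ∀ y ∈ Metric.ball x r, (y ∈ U ↔ e y 2 < h !₂[e y 0, e y 1])

/-- Multiplying the graph function by a bump equal to one on the shadow of the ball changes nothing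
inside the ball, because projection does not increase distances. Compact support makes the graph
function globally Lipschitz, so the flattening map is global and no domains need to be tracked. -/
lemma IsC2.exists_chart {U : Set E3} (hU : IsC2 U) {x : E3} (hx : x ∈ frontier U) :
    ∃ c : Chart U, c.x = x := by
  obtain ⟨r, e, h, hr, hh, hm⟩ := hU.boundary x hx
  let b : ContDiffBump ((join.symm (e x)).1) := ⟨r, r + 1, hr, by linarith⟩
  refine ⟨⟨x, r, e, fun z => b z * h z, hr, b.contDiff.mul hh, b.hasCompactSupport.mul_right, ?_⟩,
    rfl⟩
  intro y hy
  have : b !₂[e y 0, e y 1] = 1 := by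
    apply b.one_of_mem_closedBall
    have h1 := norm_join_symm_fst_le (e y - e x)
    rw [← map_sub e, e.norm_map, ← dist_eq_norm, map_sub, map_sub, Prod.fst_sub,
      ← dist_eq_norm] at h1
    exact Metric.mem_closedBall.2 (h1.trans (Metric.mem_ball.1 hy).le)
  simp only [this, one_mul]
  exact hm y hy

namespace Chart

variable {U : Set E3} (c : Chart U)

/-- The flattening coordinates: the graph parameter and the height below the graph. -/
def proj (y : E3) : E2 × ℝ :=
  ((join.symm (c.e y)).1, c.h (join.symm (c.e y)).1 - (join.symm (c.e y)).2)

/-- The inverse of the flattening coordinates. -/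
def lift (p : E2 × ℝ) : E3 := c.e.symm (join (p.1, c.h p.1 - p.2))

/-- The parametrization of the graph. -/
def gr (z : E2) : E3 := c.lift (z, 0)

/-- The direction out of `U` along the vertical axis of the chart. -/
def up : E3 := c.e.symm (join (0, 1))

lemma norm_up : ‖c.up‖ = 1 := by
  rw [up, LinearIsometryEquiv.norm_map]
  rw [← pow_left_inj₀ (norm_nonneg _) zero_le_one two_ne_zero, norm_join_sq]
  simp

@[simp] lemma proj_lift (p : E2 × ℝ) : c.proj (c.lift p) = p := by
  simp [proj, lift]

@[simp] lemma lift_proj (y : E3) : c.lift (c.proj y) = y := by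
  simp [proj, lift]

lemma contDiff_proj : ContDiff ℝ 2 c.proj := by
  have h1 : ContDiff ℝ 2 (fun y => join.symm (c.e y)) :=
    join.symm.contDiff.comp c.e.contDiff
  exact h1.fst.prodMk ((c.contDiff.comp h1.fst).sub h1.snd)

lemma contDiff_lift : ContDiff ℝ 2 c.lift :=
  c.e.symm.contDiff.comp (join.contDiff.comp
    (contDiff_fst.prodMk ((c.contDiff.comp contDiff_fst).sub contDiff_snd)))

/-- The flattening coordinates as a homeomorphism. -/
def homeo : E2 × ℝ ≃ₜ E3 where
  toFun := c.lift
  invFun := c.proj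
  left_inv := c.proj_lift
  right_inv := c.lift_proj
  continuous_toFun := c.contDiff_lift.continuous
  continuous_invFun := c.contDiff_proj.continuous

lemma measurableEmbedding_lift : MeasurableEmbedding c.lift := c.homeo.measurableEmbedding

/-- On each vertical line the map is t ↦ h(x) - t, an isometry, so flattening is a measure
preserving skew product. Volume integrals carry no Jacobian; only the surface measure has a density.
-/
lemma measurePreserving_lift : MeasurePreserving c.lift volume volume := by
  have h1 : MeasurePreserving (fun p : E2 × ℝ => (id p.1, c.h p.1 - p.2)) (volume.prod volume)
      (volume.prod volume) :=
    (MeasurePreserving.id volume).skew_product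
      (g := fun x t => c.h x - t)
      (((c.contDiff.continuous.comp continuous_fst).sub continuous_snd).measurable)
      (ae_of_all _ fun x => (Measure.measurePreserving_sub_left volume (c.h x)).map_eq)
  exact c.e.symm.measurePreserving.comp (measurePreserving_join.comp h1)

lemma proj_add_up (y : E3) (s : ℝ) : c.proj (y + s • c.up) = ((c.proj y).1, (c.proj y).2 - s) := by
  simp only [proj, up, map_add, map_smul, LinearIsometryEquiv.apply_symm_apply,
    ContinuousLinearEquiv.symm_apply_apply]
  simp
  ring

variable {c} in
lemma mem_iff {y : E3} (hy : y ∈ Metric.ball c.x c.r) : y ∈ U ↔ 0 < (c.proj y).2 := by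
  rw [c.mem_iff' y hy, proj, sub_pos]
  rfl

lemma tendsto_add_up (y : E3) : Tendsto (fun s : ℝ => y + s • c.up) (𝓝 0) (𝓝 y) := by
  have : Continuous (fun s : ℝ => y + s • c.up) := by fun_prop
  simpa using this.tendsto 0

variable {c} in
lemma mem_closure_iff {y : E3} (hy : y ∈ Metric.ball c.x c.r) :
    y ∈ closure U ↔ 0 ≤ (c.proj y).2 := by
  constructor
  · intro h
    by_contra! hlt
    have h1 : ∀ᶠ z in 𝓝 y, (c.proj z).2 < 0 :=
      (c.contDiff_proj.continuous.snd.continuousAt).eventually (gt_mem_nhds hlt)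
    have h2 := Metric.isOpen_ball.mem_nhds hy
    obtain ⟨z, ⟨hz1, hz2⟩, hz3⟩ := mem_closure_iff_nhds.1 h _ (inter_mem h1 h2)
    have := (mem_iff hz2).1 hz3
    have hz1 : (c.proj z).2 < 0 := hz1
    linarith
  · intro h
    -- Moving along `up` by a negative amount increases the height below the graph, so these points
    -- lie in `U` and approach `y`.
    have h1 : Tendsto (fun s : ℝ => y + s • c.up) (𝓝[<] 0) (𝓝 y) :=
      (c.tendsto_add_up y).mono_left nhdsWithin_le_nhds
    refine mem_closure_of_tendsto h1 ?_
    filter_upwards [h1.eventually (Metric.isOpen_ball.mem_nhds hy), self_mem_nhdsWithin] with s hs hs0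
    rw [mem_iff hs, proj_add_up]
    have : s < 0 := hs0
    simp only
    linarith

variable {c} in
lemma mem_exterior_iff {y : E3} (hy : y ∈ Metric.ball c.x c.r) :
    y ∈ exterior U ↔ (c.proj y).2 < 0 := by
  rw [exterior, mem_compl_iff, mem_closure_iff hy, not_le]

variable {c} in
lemma mem_frontier_iff (hU : IsOpen U) {y : E3} (hy : y ∈ Metric.ball c.x c.r) :
    y ∈ frontier U ↔ (c.proj y).2 = 0 := by
  rw [hU.frontier_eq, Set.mem_sdiff, mem_closure_iff hy, mem_iff hy]
  exact ⟨fun h => le_antisymm (not_lt.1 h.2) h.1, fun h => ⟨h.ge, h.le.not_gt⟩⟩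

/-- The reflection of the last coordinate. -/
def _root_.DiracShell.flip3 : E3 ≃ₗᵢ[ℝ] E3 :=
  LinearIsometryEquiv.piLpCongrRight 2 fun i : Fin 3 =>
    if i = 2 then LinearIsometryEquiv.neg ℝ else LinearIsometryEquiv.refl ℝ ℝ

lemma _root_.DiracShell.flip3_apply (y : E3) : flip3 y = !₂[y 0, y 1, -y 2] := by
  ext i
  fin_cases i <;> simp [flip3]

/-- The same coordinates, seen from the other side of the boundary. -/
def ext : Chart (exterior U) where
  x := c.x
  r := c.r
  e := c.e.trans flip3
  h := -c.h
  r_pos := c.r_pos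
  contDiff := c.contDiff.neg
  hasCompactSupport := c.hasCompactSupport.neg
  mem_iff' := fun y hy => by
    rw [mem_exterior_iff hy, proj, sub_neg]
    simp [flip3_apply, join_symm_apply]

end Chart

/-- For a general open set the exterior can have a smaller boundary. Here `U` lies on one side of a
graph, so the same chart turned upside down shows that every boundary point is a boundary point of
the exterior. -/
lemma IsC2.frontier_exterior {U : Set E3} (hU : IsC2 U) : frontier (exterior U) = frontier U := by
  have ho : IsOpen (exterior U) := isClosed_closure.isOpen_compl
  apply Subset.antisymm
  · rw [exterior, frontier_compl]
    exact frontier_closure_subset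
  · intro y hy
    obtain ⟨c, rfl⟩ := hU.exists_chart hy
    have hb := Metric.mem_ball_self (x := c.x) c.r_pos
    have h0 := (Chart.mem_frontier_iff hU.isOpen hb).1 hy
    refine (Chart.mem_frontier_iff (c := c.ext) ho hb).2 ?_
    have : (c.ext.proj c.x).2 = -(c.proj c.x).2 := by
      simp [Chart.proj, Chart.ext, flip3_apply, join_symm_apply]
      ring
    rw [this, h0, neg_zero]

/-- This closure property lets every one-sided theorem be applied on both sides of Σ. -/
lemma IsC2.exterior {U : Set E3} (hU : IsC2 U) : IsC2 (exterior U) where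
  isOpen := isClosed_closure.isOpen_compl
  isCompact_frontier := hU.frontier_exterior ▸ hU.isCompact_frontier
  boundary := fun x hx => by
    rw [hU.frontier_exterior] at hx
    obtain ⟨c, rfl⟩ := hU.exists_chart hx
    exact ⟨c.ext.r, c.ext.e, c.ext.h, c.ext.r_pos, c.ext.contDiff, c.ext.mem_iff'⟩

/-- A finite cover of the boundary by charts, with a smooth partition of unity. -/
structure Atlas (U : Set E3) where
  /-- the index set -/
  ι : Type
  fintype : Fintype ι
  /-- the charts -/
  c : ι → Chart U
  /-- the partition of unity -/
  χ : Option ι → E3 → ℝ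
  contDiff : ∀ i, ContDiff ℝ ∞ (χ i)
  sum_eq : ∀ y, ∑ i, χ i y = 1
  tsupport_none : tsupport (χ none) ⊆ (frontier U)ᶜ
  tsupport_some : ∀ i, tsupport (χ (some i)) ⊆ Metric.ball (c i).x ((c i).r / 2)

attribute [instance] Atlas.fintype

-- The partition functions are supported in balls of half the chart radius. The margin keeps
-- slightly displaced points inside the chart, and keeps the Slobodeckij kernel bounded between the
-- support and the outside of the chart.
open scoped Manifold in
lemma IsC2.nonempty_atlas {U : Set E3} (hU : IsC2 U) : Nonempty (Atlas U) := by
  choose c hc using fun x : frontier U => hU.exists_chart x.2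
  obtain ⟨t, hcov⟩ := hU.isCompact_frontier.elim_nhds_subcover'
    (fun x hx => Metric.ball (c ⟨x, hx⟩).x ((c ⟨x, hx⟩).r / 2)) (fun x hx => by
      rw [hc ⟨x, hx⟩]; exact Metric.ball_mem_nhds _ (half_pos (c ⟨x, hx⟩).r_pos))
  let W : Option t → Set E3 := fun i => i.elim (frontier U)ᶜ
    (fun x => Metric.ball (c x).x ((c x).r / 2))
  obtain ⟨f, hf⟩ := SmoothPartitionOfUnity.exists_isSubordinate 𝓘(ℝ, E3) isClosed_univ W
    (by
      rintro (_ | i)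
      · exact isClosed_frontier.isOpen_compl
      · exact Metric.isOpen_ball)
    (by
      intro y _
      by_cases hy : y ∈ frontier U
      · obtain ⟨x, hx, hyx⟩ := mem_iUnion₂.1 (hcov hy)
        exact mem_iUnion.2 ⟨some ⟨x, hx⟩, hyx⟩
      · exact mem_iUnion.2 ⟨none, hy⟩)
  refine ⟨⟨t, inferInstance, fun x => c x, fun i => f i, fun i => (f i).contMDiff.contDiff, ?_,
    hf none, fun i => hf (some i)⟩⟩
  intro y
  have := f.sum_eq_one (mem_univ y)
  rwa [finsum_eq_sum_of_fintype] at this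

/-- In flattening coordinates the boundary is the hyperplane of height zero, and the coordinates
preserve volume. -/
lemma volume_frontier {U : Set E3} (hU : IsC2 U) : volume (frontier U) = 0 := by
  refine hU.isCompact_frontier.measure_zero_of_nhdsWithin fun x hx => ?_
  obtain ⟨c, rfl⟩ := hU.exists_chart hx
  refine ⟨frontier U ∩ Metric.ball c.x c.r, inter_mem_nhdsWithin _
    (Metric.ball_mem_nhds _ c.r_pos), ?_⟩
  have h0 : volume (c.proj ⁻¹' (univ ×ˢ {0})) = 0 := by
    rw [← c.measurePreserving_lift.measure_preimage_emb c.measurableEmbedding_lift,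
      ← preimage_comp, show c.proj ∘ c.lift = id from funext c.proj_lift, preimage_id,
      Measure.volume_eq_prod, Measure.prod_prod]
    simp
  refine measure_mono_null ?_ h0
  rintro y ⟨hy, hb⟩
  exact ⟨mem_univ _, (Chart.mem_frontier_iff hU.isOpen hb).1 hy⟩

end Geometry

/-! ### Approximation of weak solutions of first order systems by smooth functions -/

section Density

namespace Chart

variable {U : Set E3} (c : Chart U)

lemma exists_lipschitz : ∃ L, LipschitzWith L c.h :=
  (c.contDiff.of_le one_le_two).lipschitzWith_of_hasCompactSupport c.hasCompactSupport one_ne_zero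

/-- A Lipschitz constant of the graph function. -/
def lip : NNReal := c.exists_lipschitz.choose

lemma lipschitz : LipschitzWith c.lip c.h := c.exists_lipschitz.choose_spec

lemma abs_proj_snd_sub_le (y z : E3) :
    |(c.proj y).2 - (c.proj z).2| ≤ (c.lip + 1) * ‖y - z‖ := by
  have h1 := c.lipschitz.dist_le_mul (join.symm (c.e y)).1 (join.symm (c.e z)).1
  have h2 := norm_join_symm_fst_le (c.e y - c.e z)
  have h3 := abs_join_symm_snd_le (c.e y - c.e z)
  rw [← map_sub c.e, c.e.norm_map, map_sub, map_sub] at h2 h3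
  rw [Real.dist_eq, dist_eq_norm] at h1
  rw [Prod.fst_sub] at h2
  rw [Prod.snd_sub] at h3
  have h4 : (c.lip : ℝ) * ‖(join.symm (c.e y)).1 - (join.symm (c.e z)).1‖ ≤ c.lip * ‖y - z‖ := by
    gcongr
  calc |(c.proj y).2 - (c.proj z).2|
      = |(c.h (join.symm (c.e y)).1 - c.h (join.symm (c.e z)).1) -
          ((join.symm (c.e y)).2 - (join.symm (c.e z)).2)| := by
        simp only [proj]; congr 1; ring
    _ ≤ _ := (abs_sub _ _).trans (by linarith)

end Chart

/-- Kernels that move points of `U` seen in the support of a member of the partition of unity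
inside `U`. -/
lemma Atlas.exists_kernel {U : Set E3} (hU : IsC2 U) (A : Atlas U) (i : Option A.ι) {η : ℝ}
    (hη : 0 < η) : ∃ κ : E3 → ℝ, IsKernel volume κ η ∧
      ∀ y ∈ U, ∀ x ∈ tsupport (A.χ i), y - x ∈ tsupport κ → x ∈ U := by
  rcases i with _ | i
  -- The support of the interior member is at positive distance `δ` from the compact boundary, so
  -- displacements shorter than `δ` cannot cross it.
  · obtain ⟨δ, hδ, hd⟩ := ((disjoint_compl_right (a := frontier U)).mono_right
      A.tsupport_none).exists_thickenings hU.isCompact_frontier (isClosed_tsupport _)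
    have hm : 0 < min η δ := lt_min hη hδ
    let b : ContDiffBump (0 : E3) := ⟨min η δ / 4, min η δ / 2, by linarith, by linarith⟩
    refine ⟨b.normed volume, b.isKernel ?_, fun y hy x hx hyx => ?_⟩
    · have := min_le_left η δ
      simp only [norm_zero, zero_add, b]
      linarith
    · rw [b.tsupport_normed_eq, Metric.mem_closedBall, dist_zero_right] at hyx
      by_contra hxU
      -- A segment is connected, so one joining a point of `U` to a point outside must meet the
      -- boundary.
      obtain ⟨z, hz, hzf⟩ : ∃ z ∈ segment ℝ x y, z ∈ frontier U := by
        by_contra! hne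
        have hcl : ∀ z ∈ segment ℝ x y, z ∉ U → z ∉ closure U := fun z hz hzU hzc =>
          hne z hz (hU.isOpen.frontier_eq ▸ ⟨hzc, hzU⟩)
        obtain ⟨z, -, hz1, hz2⟩ := (convex_segment (𝕜 := ℝ) x y).isPreconnected U (closure U)ᶜ
          hU.isOpen isClosed_closure.isOpen_compl
          (fun z hz => or_iff_not_imp_left.2 (hcl z hz)) ⟨y, right_mem_segment ℝ x y, hy⟩
          ⟨x, left_mem_segment ℝ x y, hcl x (left_mem_segment ℝ x y) hxU⟩
        exact hz2 (subset_closure hz1)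
      have hlt : dist z x < δ := by
        have h1 : dist z x ≤ dist y x := by
          have := (segment_subset_iff ℝ |>.2 fun a b ha hb hab => ?_ : segment ℝ x y ⊆
            Metric.closedBall x (dist y x)) hz
          · exact this
          · have : a • x + b • y - x = b • (y - x) := by
              rw [eq_sub_of_add_eq hab]; module
            rw [Metric.mem_closedBall, dist_eq_norm, this, norm_smul, dist_eq_norm,
              Real.norm_of_nonneg hb]
            exact mul_le_of_le_one_left (norm_nonneg _) (by linarith)
        rw [dist_eq_norm] at h1 ⊢
        have := min_le_right η δ
        rw [dist_eq_norm] at h1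
        have h2 : ‖y - x‖ ≤ min η δ / 2 := hyx
        linarith
      exact disjoint_left.1 hd (Metric.self_subset_thickening hδ _ hzf)
        (Metric.mem_thickening_iff.2 ⟨x, hx, hlt⟩)
  · let c := A.c i
    have hr := c.r_pos
    -- The kernel lives in a ball of radius `t` about `s • up`, so `x` is `y` shifted into `U` by
    -- `s` up to an error `t`. The height is Lipschitz with constant `lip + 1`, hence the height of
    -- `x` is at least that of `y` plus s - (lip + 1)t, which is positive for t = s / (lip + 2). The
    -- bounds on `s` keep `y` in the chart and the kernel in the ball of radius `η`.
    set s : ℝ := min η (c.r / 2) / 4 with hs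
    have hs0 : 0 < s := by have : 0 < min η (c.r / 2) := lt_min hη (by linarith)
                           linarith
    have hsη : 4 * s ≤ η := by have := min_le_left η (c.r / 2); linarith
    have hsr : 4 * s ≤ c.r / 2 := by have := min_le_right η (c.r / 2); linarith
    set t : ℝ := s / (c.lip + 2) with ht
    have hL : (0 : ℝ) ≤ c.lip := c.lip.2
    have ht0 : 0 < t := by positivity
    have hts : (c.lip + 2) * t = s := by rw [ht]; field_simp
    have hts' : t ≤ s := by nlinarith
    let b : ContDiffBump (s • c.up) := ⟨t / 2, t, by linarith, by linarith⟩
    have hn : ‖s • c.up‖ = s := by rw [norm_smul, c.norm_up, Real.norm_of_nonneg hs0.le, mul_one]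
    refine ⟨b.normed volume, b.isKernel ?_, fun y hy x hx hyx => ?_⟩
    · rw [hn]
      simp only [b]
      linarith
    · rw [b.tsupport_normed_eq, Metric.mem_closedBall, dist_eq_norm] at hyx
      have hyx : ‖y - x - s • c.up‖ ≤ t := hyx
      have hxb := A.tsupport_some i hx
      have hxy : ‖y - x‖ ≤ 2 * s := by
        have := norm_add_le (y - x - s • c.up) (s • c.up)
        rw [sub_add_cancel, hn] at this
        linarith
      rw [Metric.mem_ball, dist_eq_norm] at hxb
      have hxb : ‖x - c.x‖ < c.r / 2 := hxb
      have hyb : y ∈ Metric.ball c.x c.r := by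
        rw [Metric.mem_ball, dist_eq_norm]
        have := norm_add_le (y - x) (x - c.x)
        rw [sub_add_sub_cancel] at this
        linarith
      have hxb' : x ∈ Metric.ball c.x c.r := by
        rw [Metric.mem_ball, dist_eq_norm]; linarith
      rw [Chart.mem_iff hxb']
      have h1 := (Chart.mem_iff hyb).1 hy
      have h2 := c.abs_proj_snd_sub_le (y + (-s) • c.up) x
      rw [c.proj_add_up, neg_smul, ← sub_eq_add_neg] at h2
      have h3 : (c.lip + 1) * ‖y - x - s • c.up‖ ≤ (c.lip + 1) * t := by gcongr
      rw [sub_right_comm] at h3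
      have h4 := (abs_le.1 (h2.trans h3)).2
      simp only at h4
      nlinarith

/-- The interior member need not have compact support, but it is one minus the sum of the others,
which do. -/
lemma Atlas.exists_bound {U : Set E3} (A : Atlas U) :
    ∃ M : ℝ, ∀ i y, |A.χ i y| ≤ M ∧ ‖fderiv ℝ (A.χ i) y‖ ≤ M := by
  have hs : ∀ i, HasCompactSupport (A.χ (some i)) := fun i =>
    HasCompactSupport.of_support_subset_isCompact (isCompact_closedBall (A.c i).x ((A.c i).r / 2))
      ((subset_tsupport _).trans ((A.tsupport_some i).trans Metric.ball_subset_closedBall))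
  have h1 : ∀ i, ∃ M : ℝ, 0 ≤ M ∧ ∀ y, |A.χ (some i) y| ≤ M ∧ ‖fderiv ℝ (A.χ (some i)) y‖ ≤ M := by
    intro i
    obtain ⟨C1, hC1⟩ := (hs i).exists_bound_of_continuous (A.contDiff _).continuous
    obtain ⟨C2, hC2⟩ := ((hs i).fderiv ℝ).exists_bound_of_continuous
      ((A.contDiff (some i)).continuous_fderiv (by simp))
    exact ⟨max C1 C2, ((norm_nonneg _).trans (hC1 0)).trans (le_max_left _ _), fun y =>
      ⟨(hC1 y).trans (le_max_left _ _), (hC2 y).trans (le_max_right _ _)⟩⟩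
  choose M hM0 hM using h1
  have hnone : A.χ none = fun y => 1 - ∑ i, A.χ (some i) y := by
    funext y
    have := A.sum_eq y
    rw [Fintype.sum_option] at this
    linarith
  have hS : 0 ≤ ∑ i, M i := Finset.sum_nonneg fun i _ => hM0 i
  refine ⟨1 + ∑ i, M i, ?_⟩
  rintro (_ | i) y
  · constructor
    · rw [hnone]
      refine (abs_sub _ _).trans ?_
      rw [abs_one]
      gcongr
      exact (Finset.abs_sum_le_sum_abs _ _).trans (Finset.sum_le_sum fun i _ => (hM i y).1)
    · rw [hnone, fderiv_const_sub, norm_neg, fderiv_fun_sum fun i _ =>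
        ((A.contDiff (some i)).differentiable (by simp)) y]
      refine (norm_sum_le _ _).trans ((Finset.sum_le_sum fun i _ => (hM i y).2).trans (by linarith))
  · have := Finset.single_le_sum (fun i _ => hM0 i) (Finset.mem_univ i)
    exact ⟨(hM i y).1.trans (by linarith), (hM i y).2.trans (by linarith)⟩

/-! ### First order systems with constant coefficients. -/

variable {F : Type*} [NormedAddCommGroup F] [NormedSpace ℝ F] [CompleteSpace F]

/-- `∑ⱼ Aⱼ ∂ⱼ f + B f = g` on `U` in the sense of distributions. -/
def IsWeakOp (A : Fin 3 → C4 →L[ℝ] F) (B : C4 →L[ℝ] F) (U : Set E3) (f : E3 → C4) (g : E3 → F) :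
    Prop :=
  ∀ φ : E3 → ℝ, IsTest U φ →
    ∫ x in U, (φ x • g x + ∑ j, pd j φ x • A j (f x) - φ x • B (f x)) = 0

/-- The first order operator `∑ⱼ Aⱼ ∂ⱼ + B` on differentiable functions. -/
def opApply (A : Fin 3 → C4 →L[ℝ] F) (B : C4 →L[ℝ] F) (φ : E3 → C4) (x : E3) : F :=
  ∑ j, A j (pd j φ x) + B (φ x)

lemma pd_convolution {κ : E3 → ℝ} (hκ : ContDiff ℝ ∞ κ) (hc : HasCompactSupport κ) {f : E3 → C4}
    (hf : LocallyIntegrable f volume) (j : Fin 3) (y : E3) :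
    pd j (κ ⋆[ContinuousLinearMap.lsmul ℝ ℝ, volume] f) y = ∫ x, pd j κ (y - x) • f x := by
  rw [pd, (hc.hasFDerivAt_convolution_left (ContinuousLinearMap.lsmul ℝ ℝ) (hκ.of_le (by simp)) hf
    y).fderiv, convolution_eq_swap, ContinuousLinearMap.integral_apply]
  · simp [pd]
  · have h := ((hc.fderiv ℝ).convolutionExists_left
      ((ContinuousLinearMap.lsmul ℝ ℝ : ℝ →L[ℝ] C4 →L[ℝ] C4).precompL E3)
      (hκ.continuous_fderiv (by simp)) hf y)
    exact (convolutionExistsAt_iff_integrable_swap).1 h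

lemma pd_comp_sub {κ : E3 → ℝ} (hκ : ContDiff ℝ ∞ κ) (j : Fin 3) (y x : E3) :
    pd j (fun z => κ (y - z)) x = -pd j κ (y - x) := by
  have h1 : HasFDerivAt κ (fderiv ℝ κ (y - x)) (y - x) :=
    (hκ.differentiable (by simp) _).hasFDerivAt
  have h2 := h1.comp x ((hasFDerivAt_id (𝕜 := ℝ) x).const_sub y)
  have h3 : fderiv ℝ (fun z => κ (y - z)) x = (fderiv ℝ κ (y - x)).comp
    (-ContinuousLinearMap.id ℝ E3) := h2.fderiv
  simp [pd, h3]

lemma pd_mul {φ ψ : E3 → ℝ} {x : E3} (hφ : DifferentiableAt ℝ φ x) (hψ : DifferentiableAt ℝ ψ x)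
    (j : Fin 3) : pd j (fun y => φ y * ψ y) x = pd j φ x * ψ x + φ x * pd j ψ x := by
  rw [pd, fderiv_fun_mul hφ hψ]
  simp [pd]
  ring

/-- Mollification of a localized weak solution. -/
lemma opApply_convolution {A : Fin 3 → C4 →L[ℝ] F} {B : C4 →L[ℝ] F} {U : Set E3}
    (hU : MeasurableSet U) {f : E3 → C4} {g : E3 → F} (h : IsWeakOp A B U f g) {χ κ : E3 → ℝ}
    (hχ : ContDiff ℝ ∞ χ) (hκ : ContDiff ℝ ∞ κ) (hc : HasCompactSupport κ) {y : E3}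
    (hy : ∀ x ∈ tsupport χ, y - x ∈ tsupport κ → x ∈ U)
    (hf : LocallyIntegrable (U.indicator fun x => χ x • f x) volume)
    (hg : LocallyIntegrable (U.indicator fun x => χ x • g x + ∑ j, pd j χ x • A j (f x)) volume) :
    opApply A B (κ ⋆[ContinuousLinearMap.lsmul ℝ ℝ, volume] U.indicator fun x => χ x • f x) y =
      (κ ⋆[ContinuousLinearMap.lsmul ℝ ℝ, volume]
        U.indicator fun x => χ x • g x + ∑ j, pd j χ x • A j (f x)) y := by
  set f' : E3 → C4 := U.indicator fun x => χ x • f x with hf'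
  set g' : E3 → F := U.indicator fun x => χ x • g x + ∑ j, pd j χ x • A j (f x) with hg'
  -- The weak equation is tested with x ↦ κ(y - x)χ(x). The hypothesis `hy` puts the support of this
  -- product inside `U`, so the extension by zero across the boundary produces no boundary term.
  let ψ : E3 → ℝ := fun x => κ (y - x)
  have hsub : ContDiff ℝ ∞ (fun x : E3 => y - x) := contDiff_const.sub contDiff_id
  have hψ : ContDiff ℝ ∞ ψ := hκ.comp hsub
  have hψc : HasCompactSupport ψ := hc.comp_homeomorph (Homeomorph.subLeft y)
  have hψt : tsupport ψ ⊆ (fun x => y - x) ⁻¹' tsupport κ :=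
    closure_minimal (fun x hx => subset_tsupport κ hx)
      ((isClosed_tsupport κ).preimage hsub.continuous)
  have htest : IsTest U (fun x => ψ x * χ x) := by
    refine ⟨hψ.mul hχ, hψc.mul_right, fun x hx => hy x ?_ (hψt ?_)⟩
    · exact closure_mono (Function.support_mul_subset_right ψ χ) hx
    · exact closure_mono (Function.support_mul_subset_left ψ χ) hx
  have hw := h _ htest
  have key : ∀ x, U.indicator (fun x => (ψ x * χ x) • g x +
      ∑ j, pd j (fun x => ψ x * χ x) x • A j (f x) - (ψ x * χ x) • B (f x)) x =
      ψ x • g' x - (∑ j, A j (pd j κ (y - x) • f' x)) - B (ψ x • f' x) := by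
    intro x
    by_cases hx : x ∈ U
    · simp only [hf', hg', indicator_of_mem hx]
      have h1 : ∀ j, pd j (fun x => ψ x * χ x) x = -pd j κ (y - x) * χ x + ψ x * pd j χ x := by
        intro j
        rw [pd_mul (hψ.differentiable (by simp) x) (hχ.differentiable (by simp) x),
          pd_comp_sub hκ]
      simp only [h1, add_smul, neg_mul, neg_smul, map_smul, smul_add, Finset.sum_add_distrib,
        Finset.sum_neg_distrib, mul_smul, Finset.smul_sum]
      abel
    · simp [hf', hg', indicator_of_notMem hx]
  rw [← integral_indicator hU] at hw
  simp only [key] at hw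
  have i1 : Integrable fun x => ψ x • g' x :=
    hg.integrable_smul_left_of_hasCompactSupport hψ.continuous hψc
  have i2 : Integrable fun x => ψ x • f' x :=
    hf.integrable_smul_left_of_hasCompactSupport hψ.continuous hψc
  have i3 : ∀ j, Integrable fun x => pd j κ (y - x) • f' x := by
    intro j
    refine hf.integrable_smul_left_of_hasCompactSupport ?_ ?_
    · exact (((hκ.continuous_fderiv (by simp)).clm_apply continuous_const)).comp hsub.continuous
    · exact (hc.fderiv_apply ℝ (EuclideanSpace.single j 1)).comp_homeomorph (Homeomorph.subLeft y)
  have i4 : Integrable fun x => ∑ j, A j (pd j κ (y - x) • f' x) :=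
    integrable_finsetSum _ fun j _ => (A j).integrable_comp (i3 j)
  have i5 : Integrable fun x => ψ x • g' x - ∑ j, A j (pd j κ (y - x) • f' x) := i1.sub i4
  rw [integral_sub i5 (B.integrable_comp i2), integral_sub i1 i4,
    integral_finsetSum _ fun j _ => (A j).integrable_comp (i3 j)] at hw
  rw [opApply]
  simp only [pd_convolution hκ hc hf]
  rw [convolution_eq_swap, convolution_eq_swap]
  simp only [ContinuousLinearMap.lsmul_apply]
  simp only [(A _).integral_comp_comm (i3 _), B.integral_comp_comm i2] at hw
  rw [sub_sub, sub_eq_zero] at hw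
  exact hw.symm

lemma norm_pd_le {G : Type*} [NormedAddCommGroup G] [NormedSpace ℝ G] (j : Fin 3) (φ : E3 → G)
    (x : E3) : ‖pd j φ x‖ ≤ ‖fderiv ℝ φ x‖ := by
  refine ((fderiv ℝ φ x).le_opNorm _).trans (le_of_eq ?_)
  simp

lemma continuous_pd {G : Type*} [NormedAddCommGroup G] [NormedSpace ℝ G] (j : Fin 3) {φ : E3 → G}
    (h : ContDiff ℝ 1 φ) : Continuous (pd j φ) :=
  (h.continuous_fderiv one_ne_zero).clm_apply continuous_const

lemma continuous_opApply {A : Fin 3 → C4 →L[ℝ] F} {B : C4 →L[ℝ] F} {φ : E3 → C4}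
    (h : ContDiff ℝ 1 φ) : Continuous (opApply A B φ) :=
  (continuous_finsetSum _ fun j _ => (A j).continuous.comp (continuous_pd j h)).add
    (B.continuous.comp h.continuous)

lemma memLp_bdd_smul {G : Type*} [NormedAddCommGroup G] [NormedSpace ℝ G] {ν : Measure E3}
    {χ : E3 → ℝ} (hχ : Continuous χ) {M : ℝ} (hM : ∀ x, |χ x| ≤ M) {f : E3 → G}
    (hf : MemLp f 2 ν) : MemLp (fun x => χ x • f x) 2 ν := by
  refine hf.of_le_mul (c := M) (hχ.aestronglyMeasurable.smul hf.1) (ae_of_all _ fun x => ?_)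
  rw [norm_smul]
  gcongr
  exact hM x

/-- Weak solutions of first order systems with constant coefficients are approximated by smooth
functions up to the boundary. -/
lemma exists_smooth_approx {A : Fin 3 → C4 →L[ℝ] F} {B : C4 →L[ℝ] F} {U : Set E3} (hU : IsC2 U)
    {f : E3 → C4} {g : E3 → F} (h : IsWeakOp A B U f g) (hf : MemLp f 2 (volume.restrict U))
    (hg : MemLp g 2 (volume.restrict U)) {ε : ℝ≥0∞} (hε : ε ≠ 0) :
    ∃ φ : E3 → C4, ContDiff ℝ ∞ φ ∧ eLpNorm (φ - f) 2 (volume.restrict U) ≤ ε ∧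
      eLpNorm (opApply A B φ - g) 2 (volume.restrict U) ≤ ε := by
  obtain ⟨T⟩ := hU.nonempty_atlas
  obtain ⟨M, hM⟩ := T.exists_bound
  have hUm := hU.isOpen.measurableSet
  set N : ℝ≥0∞ := ((Fintype.card (Option T.ι) : ℕ) : ℝ≥0∞) with hN
  have hN0 : N ≠ 0 := by simp [hN]
  have hNt : N ≠ ⊤ := by simp [hN]
  have hε' : ε / N ≠ 0 := ENNReal.div_ne_zero.2 ⟨hε, hNt⟩
  -- Each localized piece solves the system with an additional commutator term on the right, and
  -- both sides are extended by zero.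
  let f' : Option T.ι → E3 → C4 := fun i => U.indicator fun x => T.χ i x • f x
  let g' : Option T.ι → E3 → F := fun i =>
    U.indicator fun x => T.χ i x • g x + ∑ j, pd j (T.χ i) x • A j (f x)
  have hf' : ∀ i, MemLp (f' i) 2 volume := fun i =>
    (memLp_indicator_iff_restrict hUm).2
      (memLp_bdd_smul (T.contDiff i).continuous (fun x => (hM i x).1) hf)
  have hg' : ∀ i, MemLp (g' i) 2 volume := fun i => by
    refine (memLp_indicator_iff_restrict hUm).2
      ((memLp_bdd_smul (T.contDiff i).continuous (fun x => (hM i x).1) hg).add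
        (memLp_finsetSum _ fun j _ => ?_))
    exact memLp_bdd_smul (continuous_pd j ((T.contDiff i).of_le (by simp)))
      (fun x => (norm_pd_le j _ x).trans (hM i x).2) ((A j).comp_memLp' hf)
  -- The mollification radius is uniform over kernels, so one kernel, shifted into `U` if necessary,
  -- serves `f' i` and `g' i` simultaneously.
  have key : ∀ i, ∃ κ : E3 → ℝ, ContDiff ℝ ∞ κ ∧ HasCompactSupport κ ∧
      (∀ y ∈ U, ∀ x ∈ tsupport (T.χ i), y - x ∈ tsupport κ → x ∈ U) ∧
      eLpNorm ((κ ⋆[ContinuousLinearMap.lsmul ℝ ℝ, volume] f' i) - f' i) 2 volume ≤ ε / N ∧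
      eLpNorm ((κ ⋆[ContinuousLinearMap.lsmul ℝ ℝ, volume] g' i) - g' i) 2 volume ≤ ε / N := by
    intro i
    obtain ⟨η₁, h₁, k₁⟩ := exists_mollify_radius (hf' i) hε'
    obtain ⟨η₂, h₂, k₂⟩ := exists_mollify_radius (hg' i) hε'
    obtain ⟨κ, hκ, hs⟩ := T.exists_kernel hU i (lt_min h₁ h₂)
    exact ⟨κ, hκ.contDiff, hκ.hasCompactSupport, hs, k₁ κ (hκ.mono (min_le_left _ _)),
      k₂ κ (hκ.mono (min_le_right _ _))⟩
  choose κ hκ hκc hκs e1 e2 using key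
  have hfl : ∀ i, LocallyIntegrable (f' i) volume := fun i => (hf' i).locallyIntegrable (by norm_num)
  have hgl : ∀ i, LocallyIntegrable (g' i) volume := fun i => (hg' i).locallyIntegrable (by norm_num)
  let φ : Option T.ι → E3 → C4 := fun i => κ i ⋆[ContinuousLinearMap.lsmul ℝ ℝ, volume] f' i
  let γ : Option T.ι → E3 → F := fun i => κ i ⋆[ContinuousLinearMap.lsmul ℝ ℝ, volume] g' i
  have hφ : ∀ i, ContDiff ℝ ∞ (φ i) := fun i =>
    (hκc i).contDiff_convolution_left _ (hκ i) (hfl i)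
  have hγ : ∀ i, ContDiff ℝ ∞ (γ i) := fun i =>
    (hκc i).contDiff_convolution_left _ (hκ i) (hgl i)
  have hsum : ∀ a : Option T.ι → ℝ≥0∞, (∀ i, a i ≤ ε / N) → ∑ i, a i ≤ ε := by
    intro a ha
    refine (Finset.sum_le_sum fun i _ => ha i).trans ?_
    rw [Finset.sum_const, Finset.card_univ, nsmul_eq_mul]
    exact ENNReal.mul_div_le
  refine ⟨fun x => ∑ i, φ i x, ContDiff.sum fun i _ => hφ i, ?_, ?_⟩
  · have e : ((fun x => ∑ i, φ i x) - f) =ᵐ[volume.restrict U] ∑ i, (φ i - f' i) := by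
      filter_upwards [ae_restrict_mem hUm] with x hx
      simp only [Pi.sub_apply, Finset.sum_apply, f', indicator_of_mem hx, Finset.sum_sub_distrib,
        ← Finset.sum_smul, T.sum_eq, one_smul]
    rw [eLpNorm_congr_ae e]
    refine (eLpNorm_sum_le (fun i _ => ?_) (by norm_num)).trans (hsum _ fun i =>
      (eLpNorm_mono_measure _ Measure.restrict_le_self).trans (e1 i))
    exact (hφ i).continuous.aestronglyMeasurable.sub (hf' i).1.restrict
  -- The partition functions add up to a constant, so the commutator terms cancel after summation.
  · have hder : ∀ x, ∑ i, fderiv ℝ (T.χ i) x = 0 := by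
      intro x
      rw [← fderiv_fun_sum fun i _ => (T.contDiff i).differentiable (by simp) x]
      simp only [T.sum_eq]
      simp
    have hder' : ∀ j x, ∑ i, pd j (T.χ i) x = 0 := by
      intro j x
      have := DFunLike.congr_fun (hder x) (EuclideanSpace.single j 1)
      simpa [pd] using this
    have e : (opApply A B (fun x => ∑ i, φ i x) - g) =ᵐ[volume.restrict U] ∑ i, (γ i - g' i) := by
      filter_upwards [ae_restrict_mem hUm] with x hx
      have h1 : opApply A B (fun x => ∑ i, φ i x) x = ∑ i, opApply A B (φ i) x := by
        simp only [opApply, pd]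
        rw [fderiv_fun_sum fun i _ => (hφ i).differentiable (by simp) x]
        simp only [sum_apply, map_sum, Finset.sum_add_distrib]
        rw [Finset.sum_comm]
      have h2 : ∀ i, opApply A B (φ i) x = γ i x := fun i =>
        opApply_convolution hUm h (T.contDiff i) (hκ i) (hκc i) (hκs i x hx) (hfl i) (hgl i)
      have h3 : ∑ i, g' i x = g x := by
        simp only [g', indicator_of_mem hx, Finset.sum_add_distrib, ← Finset.sum_smul, T.sum_eq,
          one_smul]
        rw [Finset.sum_comm]
        simp only [← Finset.sum_smul, hder', zero_smul, Finset.sum_const_zero, add_zero]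
      simp only [Pi.sub_apply, Finset.sum_apply, Finset.sum_sub_distrib, h1, h2, h3]
    rw [eLpNorm_congr_ae e]
    refine (eLpNorm_sum_le (fun i _ => ?_) (by norm_num)).trans (hsum _ fun i =>
      (eLpNorm_mono_measure _ Measure.restrict_le_self).trans (e2 i))
    exact (hγ i).continuous.aestronglyMeasurable.sub (hg' i).1.restrict

/-- Dilated cut-off functions. -/
lemma exists_cutoff : ∃ (θ : ℕ → E3 → ℝ) (C : ℝ), (∀ n, ContDiff ℝ ∞ (θ n)) ∧
    (∀ n, HasCompactSupport (θ n)) ∧ (∀ n x, |θ n x| ≤ 1) ∧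
    (∀ (n : ℕ) x, ‖x‖ ≤ n → θ n x = 1) ∧ ∀ (n : ℕ) x, ‖fderiv ℝ (θ n) x‖ ≤ C / (n + 1) := by
  let b : ContDiffBump (0 : E3) := ⟨1, 2, by norm_num, by norm_num⟩
  obtain ⟨C, hC⟩ := (b.hasCompactSupport.fderiv ℝ).exists_bound_of_continuous
      ((b.contDiff (n := ⊤)).continuous_fderiv (by simp))
  refine ⟨fun n x => b (((n : ℝ) + 1)⁻¹ • x), C, fun n => ?_, fun n => ?_, fun n x => ?_,
    fun n x hx => ?_, fun n x => ?_⟩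
  · exact b.contDiff.comp (contDiff_const_smul _)
  · exact b.hasCompactSupport.comp_homeomorph (Homeomorph.smulOfNeZero ((n : ℝ) + 1)⁻¹ (by positivity))
  · rw [abs_of_nonneg b.nonneg]
    exact b.le_one
  · apply b.one_of_mem_closedBall
    rw [mem_closedBall_zero_iff, norm_smul, norm_inv, Real.norm_of_nonneg (by positivity)]
    rw [inv_mul_le_iff₀ (by positivity)]
    simp only [b]
    linarith
  · have h1 : HasFDerivAt b (fderiv ℝ b (((n : ℝ) + 1)⁻¹ • x)) (((n : ℝ) + 1)⁻¹ • x) :=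
      ((b.contDiff (n := ⊤)).differentiable (by simp) _).hasFDerivAt
    have h2 := h1.comp x ((hasFDerivAt_id (𝕜 := ℝ) x).const_smul ((n : ℝ) + 1)⁻¹)
    have h3 : fderiv ℝ (fun x => b (((n : ℝ) + 1)⁻¹ • x)) x = _ := h2.fderiv
    rw [h3, ContinuousLinearMap.comp_smul, ContinuousLinearMap.comp_id, norm_smul, norm_inv,
      Real.norm_of_nonneg (by positivity), div_eq_inv_mul]
    gcongr
    exact hC _

lemma tendsto_eLpNorm_cutoff {G : Type*} [NormedAddCommGroup G] [NormedSpace ℝ G] {ν : Measure E3}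
    {θ : ℕ → E3 → ℝ} (hθ : ∀ n, Continuous (θ n)) (h1 : ∀ n x, |θ n x| ≤ 1)
    (h2 : ∀ (n : ℕ) x, ‖x‖ ≤ n → θ n x = 1) {w : E3 → G} (hw : MemLp w 2 ν) :
    Tendsto (fun n => eLpNorm (fun x => θ n x • w x - w x) 2 ν) atTop (𝓝 0) := by
  have h0 : Tendsto (fun n => ∫⁻ x, ‖θ n x • w x - w x‖ₑ ^ 2 ∂ν) atTop (𝓝 (∫⁻ _, 0 ∂ν)) := by
    refine tendsto_lintegral_of_dominated_convergence' (fun x => (2 * ‖w x‖ₑ) ^ 2) (fun n => ?_)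
      (fun n => ae_of_all _ fun x => ?_) ?_ (ae_of_all _ fun x => ?_)
    · exact (((hθ n).aestronglyMeasurable.smul hw.1).sub hw.1).enorm.pow_const 2
    · refine pow_le_pow_left' (enorm_sub_le.trans ?_) 2
      rw [two_mul, enorm_smul]
      gcongr
      have : ‖θ n x‖ₑ ≤ 1 := by
        rw [← ofReal_norm, ← ENNReal.ofReal_one]
        exact ENNReal.ofReal_le_ofReal (h1 n x)
      exact mul_le_of_le_one_left' this
    · simp only [mul_pow]
      rw [lintegral_const_mul' _ _ (by simp), ← eLpNorm_two_sq]
      exact ENNReal.mul_ne_top (by simp) (ENNReal.pow_ne_top hw.eLpNorm_ne_top)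
    · refine tendsto_const_nhds.congr' ?_
      obtain ⟨N, hN⟩ := exists_nat_ge ‖x‖
      filter_upwards [eventually_ge_atTop N] with n hn
      rw [h2 n x (hN.trans (by exact_mod_cast hn))]
      simp
  simp only [lintegral_zero, ← eLpNorm_two_sq] at h0
  have := (ENNReal.continuous_rpow_const (y := 1 / 2)).tendsto 0 |>.comp h0
  simp only [Function.comp_def, ← ENNReal.rpow_two, ← ENNReal.rpow_mul] at this
  simpa using this

lemma pd_smul_fun {G : Type*} [NormedAddCommGroup G] [NormedSpace ℝ G] {θ : E3 → ℝ} {φ : E3 → G}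
    {x : E3} (hθ : DifferentiableAt ℝ θ x) (hφ : DifferentiableAt ℝ φ x) (j : Fin 3) :
    pd j (fun y => θ y • φ y) x = θ x • pd j φ x + pd j θ x • φ x := by
  rw [pd, fderiv_fun_smul hθ hφ]
  simp [pd]

/-- Weak solutions of first order systems with constant coefficients are approximated by test
functions on `ℝ³`. -/
theorem exists_test_approx {A : Fin 3 → C4 →L[ℝ] F} {B : C4 →L[ℝ] F} {U : Set E3} (hU : IsC2 U)
    {f : E3 → C4} {g : E3 → F} (h : IsWeakOp A B U f g) (hf : MemLp f 2 (volume.restrict U))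
    (hg : MemLp g 2 (volume.restrict U)) {ε : ℝ≥0∞} (hε : ε ≠ 0) :
    ∃ φ : E3 → C4, IsTest univ φ ∧ eLpNorm (φ - f) 2 (volume.restrict U) ≤ ε ∧
      eLpNorm (opApply A B φ - g) 2 (volume.restrict U) ≤ ε := by
  -- A finite error is needed to conclude that the smooth approximation and its image under the
  -- operator are in `L²(U)`.
  wlog hεt : ε ≠ ⊤ generalizing ε
  · obtain ⟨φ, h1, h2, h3⟩ := this one_ne_zero ENNReal.one_ne_top
    rw [ne_eq, not_not] at hεt
    exact ⟨φ, h1, hεt ▸ le_top, hεt ▸ le_top⟩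
  have hε2 : ε / 2 ≠ 0 := by simp [hε]
  have hε4 : ε / 2 / 2 ≠ 0 := by simp [hε]
  obtain ⟨φ, hφ, e1, e2⟩ := exists_smooth_approx hU h hf hg hε2
  have hφ1 : ContDiff ℝ 1 φ := hφ.of_le (by simp)
  have hop : Continuous (opApply A B φ) := continuous_opApply hφ1
  have m1 : MemLp φ 2 (volume.restrict U) := by
    have : MemLp (φ - f) 2 (volume.restrict U) :=
      ⟨hφ.continuous.aestronglyMeasurable.sub hf.1, e1.trans_lt (ENNReal.div_lt_top hεt (by simp))⟩
    simpa using this.add hf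
  have m2 : MemLp (opApply A B φ) 2 (volume.restrict U) := by
    have : MemLp (opApply A B φ - g) 2 (volume.restrict U) :=
      ⟨hop.aestronglyMeasurable.sub hg.1, e2.trans_lt (ENNReal.div_lt_top hεt (by simp))⟩
    simpa using this.add hg
  obtain ⟨θ, C, t1, t2, t3, t4, t5⟩ := exists_cutoff
  have t6 : ∀ n, Continuous (θ n) := fun n => (t1 n).continuous
  have l1 := tendsto_eLpNorm_cutoff t6 t3 t4 m1
  have l2 := tendsto_eLpNorm_cutoff t6 t3 t4 m2
  have m3 : MemLp (fun x => ∑ j, ‖A j (φ x)‖) 2 (volume.restrict U) :=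
    memLp_finsetSum _ fun j _ => ((A j).comp_memLp' m1).norm
  have l3 : Tendsto (fun n : ℕ => ENNReal.ofReal (C / (n + 1)) *
      eLpNorm (fun x => ∑ j, ‖A j (φ x)‖) 2 (volume.restrict U)) atTop (𝓝 0) := by
    have hC : Tendsto (fun n : ℕ => ENNReal.ofReal (C / (n + 1))) atTop (𝓝 0) := by
      rw [← ENNReal.ofReal_zero]
      refine ENNReal.tendsto_ofReal ?_
      have := (tendsto_one_div_add_atTop_nhds_zero_nat (𝕜 := ℝ)).const_mul C
      simpa [div_eq_mul_inv] using this
    have := ENNReal.Tendsto.mul_const hC (Or.inr m3.eLpNorm_ne_top)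
    simpa using this
  have ev := ((l1.eventually (ge_mem_nhds (pos_iff_ne_zero.2 hε4))).and
    (l2.eventually (ge_mem_nhds (pos_iff_ne_zero.2 hε4)))).and
    (l3.eventually (ge_mem_nhds (pos_iff_ne_zero.2 hε4)))
  obtain ⟨n, ⟨n1, n2⟩, n3⟩ := ev.exists
  have hle : ε / 2 / 2 ≤ ε / 2 := ENNReal.half_le_self
  refine ⟨fun x => θ n x • φ x, ⟨(t1 n).smul hφ, (t2 n).smul_right, subset_univ _⟩, ?_, ?_⟩
  · have e : (fun x => θ n x • φ x) - f = (fun x => θ n x • φ x - φ x) + (φ - f) := by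
      ext1 x; simp
    rw [e]
    refine (eLpNorm_add_le ?_ (hφ.continuous.aestronglyMeasurable.sub hf.1) (by norm_num)).trans ?_
    · exact (((t6 n).smul hφ.continuous).sub hφ.continuous).aestronglyMeasurable
    · exact (add_le_add (n1.trans hle) e1).trans (ENNReal.add_halves ε).le
  -- The commutator of the operator with the cut-off; it tends to zero since the gradient of `θ n`
  -- is of order 1/n.
  · let d : E3 → F := fun x => ∑ j, pd j (θ n) x • A j (φ x)
    have e : opApply A B (fun x => θ n x • φ x) - g =
        ((fun x => θ n x • opApply A B φ x - opApply A B φ x) + d) + (opApply A B φ - g) := by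
      ext1 x
      have hd := fun j => pd_smul_fun ((t1 n).differentiable (by simp) x)
        (hφ.differentiable (by simp) x) j
      simp only [opApply, hd, d, Pi.sub_apply, Pi.add_apply, map_add, map_smul, smul_add,
        Finset.sum_add_distrib, Finset.smul_sum]
      abel
    have hdc : Continuous d := continuous_finsetSum _ fun j _ =>
      (continuous_pd j ((t1 n).of_le (by simp))).smul ((A j).continuous.comp hφ.continuous)
    have hd : eLpNorm d 2 (volume.restrict U) ≤ ε / 2 / 2 := by
      refine (eLpNorm_le_mul_eLpNorm_of_ae_le_mul (c := C / (n + 1)) (ae_of_all _ fun x => ?_)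
        2).trans n3
      rw [Real.norm_of_nonneg (Finset.sum_nonneg fun j _ => norm_nonneg _), Finset.mul_sum]
      refine (norm_sum_le _ _).trans (Finset.sum_le_sum fun j _ => ?_)
      rw [norm_smul]
      gcongr
      exact (norm_pd_le j _ x).trans (t5 n x)
    have hc1 : Continuous (fun x => θ n x • opApply A B φ x - opApply A B φ x) :=
      ((t6 n).smul hop).sub hop
    rw [e]
    refine (eLpNorm_add_le ((hc1.add hdc).aestronglyMeasurable)
      (hop.aestronglyMeasurable.sub hg.1) (by norm_num)).trans ?_
    refine (add_le_add ((eLpNorm_add_le hc1.aestronglyMeasurable hdc.aestronglyMeasurable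
      (by norm_num)).trans (add_le_add n2 hd)) e2).trans ?_
    rw [ENNReal.add_halves, ENNReal.add_halves]

end Density

/-! ### The surface measure in graph coordinates -/

section Area

/-- The hypothesis makes `f` factor through `g` by a `K`-Lipschitz map on `g '' s`, without any
injectivity. In the area formula it is used in both directions between the graph parametrization and
its derivative. -/
lemma euclideanHausdorffMeasure_image_le {X Y : Type*} {α : Type*} [MetricSpace X]
    [MeasurableSpace X] [BorelSpace X] [MetricSpace Y] [MeasurableSpace Y] [BorelSpace Y]
    {f : α → X} {g : α → Y} {s : Set α} {K : NNReal}
    (h : ∀ x ∈ s, ∀ y ∈ s, dist (f x) (f y) ≤ K * dist (g x) (g y)) (d : ℕ) :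
    (Measure.euclideanHausdorffMeasure d : Measure X) (f '' s) ≤
      (K : ℝ≥0∞) ^ d * (Measure.euclideanHausdorffMeasure d : Measure Y) (g '' s) := by
  rcases s.eq_empty_or_nonempty with rfl | ⟨x₀, hx₀⟩
  · simp
  have : Nonempty α := ⟨x₀⟩
  let k : Y → X := fun y => f (Function.invFunOn g s y)
  have hk : ∀ x ∈ s, k (g x) = f x := by
    intro x hx
    have hm : ∃ a ∈ s, g a = g x := ⟨x, hx, rfl⟩
    have := h _ (Function.invFunOn_mem hm) x hx
    rw [Function.invFunOn_eq hm, dist_self, mul_zero] at this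
    exact dist_le_zero.1 this
  have hL : LipschitzOnWith K k (g '' s) := by
    refine LipschitzOnWith.of_dist_le_mul ?_
    rintro _ ⟨x, hx, rfl⟩ _ ⟨y, hy, rfl⟩
    rw [hk x hx, hk y hy]
    exact h x hx y hy
  have himg : f '' s = k '' (g '' s) := by
    rw [image_image]
    exact image_congr fun x hx => (hk x hx).symm
  have := hL.hausdorffMeasure_image_le (Nat.cast_nonneg d)
  rw [ENNReal.rpow_natCast] at this
  rw [himg, Measure.euclideanHausdorffMeasure_def, Measure.euclideanHausdorffMeasure_def,
    Measure.smul_apply, Measure.smul_apply]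
  simp only [ENNReal.smul_def, smul_eq_mul]
  rw [mul_left_comm]
  gcongr

/-- A measure is dominated by another one if it is so locally. -/
lemma measure_le_of_locally {X : Type*} [TopologicalSpace X] [SecondCountableTopology X]
    [MeasurableSpace X] [OpensMeasurableSpace X] {μ ν : Measure X}
    (h : ∀ x, ∃ u, IsOpen u ∧ x ∈ u ∧ ∀ s, MeasurableSet s → s ⊆ u → μ s ≤ ν s) : μ ≤ ν := by
  choose u huo hxu hu using h
  rcases isEmpty_or_nonempty X with hX | hX
  · intro s; rw [Subsingleton.elim s ∅]; simp
  -- A countable subcover is made disjoint, so that the local inequalities add up.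
  obtain ⟨t, htc, ht⟩ := TopologicalSpace.countable_cover_nhds fun x => (huo x).mem_nhds (hxu x)
  have hne : t.Nonempty := by
    by_contra hne
    rw [not_nonempty_iff_eq_empty] at hne
    simp [hne] at ht
    exact (empty_ne_univ ht).elim
  obtain ⟨a, rfl⟩ := htc.exists_eq_range hne
  refine Measure.le_iff.2 fun s hs => ?_
  let v : ℕ → Set X := disjointed fun n => u (a n)
  have hv : ∀ n, MeasurableSet (v n) := fun n =>
    MeasurableSet.disjointed (fun n => (huo (a n)).measurableSet) n
  have hcov : ⋃ n, s ∩ v n = s := by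
    rw [← inter_iUnion, iUnion_disjointed, ← biUnion_range (f := a) (g := u), ht, inter_univ]
  have hd : Pairwise (Function.onFun Disjoint fun n => s ∩ v n) := fun i j hij =>
    (disjoint_disjointed _ hij).mono inter_subset_right inter_subset_right
  rw [← hcov, measure_iUnion hd fun n => hs.inter (hv n),
    measure_iUnion hd fun n => hs.inter (hv n)]
  exact ENNReal.tsum_le_tsum fun n => hu (a n) _ (hs.inter (hv n))
    (inter_subset_right.trans (disjointed_subset _ n))

/-! ### The area formula for a graph. -/

namespace Chart

variable {U : Set E3} (c : Chart U)

/-- The partial derivatives of the graph function. -/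
def dh (k : Fin 2) (z : E2) : ℝ := fderiv ℝ c.h z (EuclideanSpace.single k 1)

/-- The area density of the graph. -/
def jac (z : E2) : ℝ := √(1 + c.dh 0 z ^ 2 + c.dh 1 z ^ 2)

lemma continuous_dh (k : Fin 2) : Continuous (c.dh k) :=
  (c.contDiff.continuous_fderiv two_ne_zero).clm_apply continuous_const

lemma continuous_jac : Continuous c.jac :=
  ((continuous_const.add ((c.continuous_dh 0).pow 2)).add ((c.continuous_dh 1).pow 2)).sqrt

lemma one_le_jac (z : E2) : 1 ≤ c.jac z := by
  rw [jac, Real.one_le_sqrt]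
  nlinarith [sq_nonneg (c.dh 0 z), sq_nonneg (c.dh 1 z)]

lemma abs_dh_le (k : Fin 2) (z : E2) : |c.dh k z| ≤ c.lip := by
  refine ((fderiv ℝ c.h z).le_opNorm _).trans ?_
  simp only [PiLp.norm_single, norm_one, mul_one]
  exact norm_fderiv_le_of_lipschitz ℝ c.lipschitz

lemma jac_le (z : E2) : c.jac z ≤ 1 + 2 * c.lip := by
  have h0 := abs_le.1 (c.abs_dh_le 0 z)
  have h1 := abs_le.1 (c.abs_dh_le 1 z)
  have hL : (0 : ℝ) ≤ c.lip := c.lip.2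
  rw [jac, Real.sqrt_le_left (by positivity)]
  nlinarith

lemma jac_sq (z : E2) : c.jac z ^ 2 = 1 + c.dh 0 z ^ 2 + c.dh 1 z ^ 2 :=
  Real.sq_sqrt (by positivity)

lemma gr_apply (z : E2) : c.gr z = c.e.symm (join (z, c.h z)) := by simp [gr, lift]

lemma proj_gr (z : E2) : c.proj (c.gr z) = (z, 0) := c.proj_lift _

lemma dist_proj_fst_le (y w : E3) : dist (c.proj y).1 (c.proj w).1 ≤ dist y w := by
  have h := norm_join_symm_fst_le (c.e y - c.e w)
  rw [map_sub, Prod.fst_sub, ← dist_eq_norm, ← dist_eq_norm, c.e.dist_map] at h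
  exact h

/-- The derivative of the graph parametrization. -/
def dgr (z : E2) : E2 →L[ℝ] E3 :=
  (c.e.symm.toContinuousLinearEquiv : E3 →L[ℝ] E3).comp ((join : E2 × ℝ →L[ℝ] E3).comp
    ((ContinuousLinearMap.id ℝ E2).prod (fderiv ℝ c.h z)))

lemma dgr_apply (z v : E2) : c.dgr z v = c.e.symm (join (v, fderiv ℝ c.h z v)) := rfl

lemma hasStrictFDerivAt_gr (z : E2) : HasStrictFDerivAt c.gr (c.dgr z) z := by
  have h1 : HasStrictFDerivAt c.h (fderiv ℝ c.h z) z :=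
    c.contDiff.contDiffAt.hasStrictFDerivAt two_ne_zero
  have h2 := (c.e.symm.toContinuousLinearEquiv.hasStrictFDerivAt (x := join (z, c.h z))).comp z
    ((join.hasStrictFDerivAt (x := (z, c.h z))).comp z ((hasStrictFDerivAt_id z).prodMk h1))
  have e : c.gr = (c.e.symm.toContinuousLinearEquiv) ∘ (join ∘ fun z => (z, c.h z)) := by
    funext z
    exact c.gr_apply z
  rw [e]
  exact h2

lemma norm_le_norm_dgr (z v : E2) : ‖v‖ ≤ ‖c.dgr z v‖ := by
  rw [dgr_apply, LinearIsometryEquiv.norm_map]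
  refine le_of_sq_le_sq ?_ (norm_nonneg _)
  rw [norm_join_sq]
  nlinarith [sq_nonneg (fderiv ℝ c.h z v)]

lemma dist_le_dist_gr (z w : E2) : dist z w ≤ dist (c.gr z) (c.gr w) := by
  rw [gr_apply, gr_apply, LinearIsometryEquiv.dist_map, dist_eq_norm, dist_eq_norm, ← map_sub]
  refine le_of_sq_le_sq ?_ (norm_nonneg _)
  rw [norm_join_sq]
  simp only [Prod.fst_sub, Prod.snd_sub]
  nlinarith [sq_nonneg (c.h z - c.h w)]

lemma dist_gr_le (z w : E2) : dist (c.gr z) (c.gr w) ≤ (1 + c.lip) * dist z w := by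
  rw [gr_apply, gr_apply, LinearIsometryEquiv.dist_map, dist_eq_norm, ← map_sub]
  refine (norm_join_le _).trans ?_
  have := c.lipschitz.dist_le_mul z w
  rw [Real.dist_eq] at this
  simp only [Prod.fst_sub, Prod.snd_sub, ← dist_eq_norm]
  linarith

/-- The Gram matrix of the tangent vectors (e₁, ∂₁h) and (e₂, ∂₂h) has determinant 1 + |∇h|². -/
lemma normDet_dgr (z : E2) : (c.dgr z : E2 →ₗ[ℝ] E3).normDet = c.jac z := by
  have h := LinearMap.normDet_sq_eq_det_gram (c.dgr z : E2 →ₗ[ℝ] E3)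
    (EuclideanSpace.basisFun (Fin 2) ℝ)
  rw [← pow_left_inj₀ (LinearMap.normDet_nonneg _) (zero_le_one.trans (c.one_le_jac z)) two_ne_zero,
    jac_sq]
  refine Eq.trans (by simpa using h) ?_
  rw [Matrix.det_fin_two]
  simp only [Matrix.gram_apply, dgr_apply,
    LinearIsometryEquiv.inner_map_map, inner_join, dh]
  simp [EuclideanSpace.inner_single_left]
  ring

lemma measure_dgr_image (z : E2) (s : Set E2) :
    (Measure.euclideanHausdorffMeasure 2 : Measure E3) (c.dgr z '' s) =
      ENNReal.ofReal (c.jac z) * volume s := by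
  have := LinearMap.euclideanHausdorffMeasure_image_eq_normDet_mul_volume
    (c.dgr z : E2 →ₗ[ℝ] E3) s
  rw [normDet_dgr, finrank_euclideanSpace_fin] at this
  exact this

lemma isClosedEmbedding_gr : IsClosedEmbedding c.gr :=
  (c.homeo.isClosedEmbedding).comp
    (isClosedEmbedding_iff .. |>.2 ⟨isEmbedding_prodMkLeft 0, by
      have : range (fun z : E2 => (z, (0 : ℝ))) = univ ×ˢ {0} := by
        ext p; simp [Prod.ext_iff, eq_comm]
      rw [this]; exact isClosed_univ.prod isClosed_singleton⟩)

lemma measurableEmbedding_gr : MeasurableEmbedding c.gr :=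
  c.isClosedEmbedding_gr.measurableEmbedding

/-- The local comparison of the area of the graph with its density. -/
lemma exists_area_compare (a : E2) {θ : ℝ} (hθ : 1 < θ) :
    ∃ u, IsOpen u ∧ a ∈ u ∧ ∀ s, MeasurableSet s → s ⊆ u →
      (Measure.euclideanHausdorffMeasure 2 : Measure E3) (c.gr '' s) ≤
        ENNReal.ofReal (θ ^ 3) * ∫⁻ z in s, ENNReal.ofReal (c.jac z) ∧
      ∫⁻ z in s, ENNReal.ofReal (c.jac z) ≤ ENNReal.ofReal (θ ^ 3) *
        (Measure.euclideanHausdorffMeasure 2 : Measure E3) (c.gr '' s) := by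
  have hθ0 : 0 < θ := by linarith
  -- With this `δ` one has 1 - δ = 1/θ, and 1 + δ ≤ θ because (θ - 1)² ≥ 0. Hence the
  -- parametrization and its derivative at `a` are `θ`-Lipschitz with respect to each other.
  set δ : ℝ := 1 - θ⁻¹ with hδ
  have hθi : θ⁻¹ < 1 := inv_lt_one_of_one_lt₀ hθ
  have hδ0 : 0 < δ := by linarith
  have hδθ : 1 + δ ≤ θ := by
    have : θ * θ⁻¹ = 1 := mul_inv_cancel₀ hθ0.ne'
    have h0 : 0 < θ⁻¹ := by positivity
    nlinarith [sq_nonneg (θ - 1)]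
  -- Strict differentiability is what controls increments between two points that both vary near
  -- `a`.
  have h1 := (c.hasStrictFDerivAt_gr a).isLittleO.def hδ0
  rw [nhds_prod_eq] at h1
  obtain ⟨u₁, hu₁, hu₁'⟩ := (eventually_prod_self_iff (r := fun x y =>
    ‖c.gr x - c.gr y - c.dgr a (x - y)‖ ≤ δ * ‖x - y‖)).1 h1
  obtain ⟨v, hv1, hvo, hav⟩ := mem_nhds_iff.1 hu₁
  have hja : 0 < c.jac a := zero_lt_one.trans_le (c.one_le_jac a)
  let w : Set E2 := {z | c.jac z < θ * c.jac a} ∩ {z | c.jac a < θ * c.jac z}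
  have hwo : IsOpen w := (isOpen_lt c.continuous_jac continuous_const).inter
    (isOpen_lt continuous_const (continuous_const.mul c.continuous_jac))
  have haw : a ∈ w := by
    constructor <;> (change c.jac a < θ * c.jac a; nlinarith)
  refine ⟨v ∩ w, hvo.inter hwo, ⟨hav, haw⟩, fun s hs hsu => ?_⟩
  have hclose : ∀ x ∈ s, ∀ y ∈ s, ‖c.gr x - c.gr y - c.dgr a (x - y)‖ ≤ δ * ‖c.dgr a (x - y)‖ := by
    intro x hx y hy
    refine (hu₁' x (hv1 (hsu hx).1) y (hv1 (hsu hy).1)).trans ?_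
    gcongr
    exact c.norm_le_norm_dgr a _
  have hup : ∀ x ∈ s, ∀ y ∈ s,
      dist (c.gr x) (c.gr y) ≤ θ.toNNReal * dist (c.dgr a x) (c.dgr a y) := by
    intro x hx y hy
    rw [Real.coe_toNNReal _ hθ0.le, dist_eq_norm, dist_eq_norm, ← map_sub]
    have := norm_add_le (c.gr x - c.gr y - c.dgr a (x - y)) (c.dgr a (x - y))
    rw [sub_add_cancel] at this
    nlinarith [hclose x hx y hy, norm_nonneg (c.dgr a (x - y))]
  have hlow : ∀ x ∈ s, ∀ y ∈ s,
      dist (c.dgr a x) (c.dgr a y) ≤ θ.toNNReal * dist (c.gr x) (c.gr y) := by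
    intro x hx y hy
    rw [Real.coe_toNNReal _ hθ0.le, dist_eq_norm, dist_eq_norm, ← map_sub]
    have h2 := norm_sub_le (c.gr x - c.gr y) (c.gr x - c.gr y - c.dgr a (x - y))
    rw [sub_sub_cancel] at h2
    have h3 : θ⁻¹ * ‖c.dgr a (x - y)‖ ≤ ‖c.gr x - c.gr y‖ := by
      nlinarith [hclose x hx y hy]
    rwa [inv_mul_le_iff₀ hθ0] at h3
  have m1 := euclideanHausdorffMeasure_image_le hup 2
  have m2 := euclideanHausdorffMeasure_image_le hlow 2
  rw [measure_dgr_image] at m1 m2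
  -- Two factors `θ` come from the scaling of two-dimensional Hausdorff measure and the third from
  -- the oscillation of the density on `s`.
  have e3 : ENNReal.ofReal (θ ^ 3) = (θ.toNNReal : ℝ≥0∞) ^ 2 * ENNReal.ofReal θ := by
    change _ = ENNReal.ofReal θ ^ 2 * ENNReal.ofReal θ
    rw [← pow_succ, ENNReal.ofReal_pow hθ0.le]
  have j1 : ENNReal.ofReal (c.jac a) * volume s ≤
      ENNReal.ofReal θ * ∫⁻ z in s, ENNReal.ofReal (c.jac z) := by
    rw [← lintegral_const_mul' _ _ ENNReal.ofReal_ne_top, ← setLIntegral_const]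
    refine setLIntegral_mono' hs fun z hz => ?_
    rw [← ENNReal.ofReal_mul hθ0.le]
    exact ENNReal.ofReal_le_ofReal (hsu hz).2.2.le
  have j2 : ∫⁻ z in s, ENNReal.ofReal (c.jac z) ≤
      ENNReal.ofReal θ * (ENNReal.ofReal (c.jac a) * volume s) := by
    rw [← mul_assoc, ← setLIntegral_const]
    refine setLIntegral_mono' hs fun z hz => ?_
    rw [← ENNReal.ofReal_mul hθ0.le]
    exact ENNReal.ofReal_le_ofReal (hsu hz).2.1.le
  constructor
  · refine m1.trans ?_
    rw [e3, mul_assoc]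
    gcongr
  · refine j2.trans ?_
    rw [e3, mul_right_comm, mul_comm (ENNReal.ofReal θ)]
    gcongr

/-- The area formula for the graph. -/
lemma comap_gr : (Measure.euclideanHausdorffMeasure 2 : Measure E3).comap c.gr =
    volume.withDensity fun z => ENNReal.ofReal (c.jac z) := by
  have hlim : Tendsto (fun θ : ℝ => ENNReal.ofReal (θ ^ 3)) (𝓝[>] 1) (𝓝 1) := by
    have h : Continuous fun θ : ℝ => ENNReal.ofReal (θ ^ 3) :=
      ENNReal.continuous_ofReal.comp (continuous_pow 3)
    simpa using (h.tendsto 1).mono_left nhdsWithin_le_nhds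
  -- Both inequalities hold up to the factor `θ ^ 3`; letting `θ` decrease to 1 removes it.
  have key : ∀ {μ ν : Measure E2}, (∀ θ : ℝ, 1 < θ → μ ≤ ENNReal.ofReal (θ ^ 3) • ν) → μ ≤ ν := by
    intro μ ν h
    refine Measure.le_iff.2 fun s _ => ?_
    have h2 : Tendsto (fun θ : ℝ => ENNReal.ofReal (θ ^ 3) * ν s) (𝓝[>] 1) (𝓝 (1 * ν s)) :=
      ENNReal.Tendsto.mul_const hlim (Or.inl one_ne_zero)
    rw [one_mul] at h2
    refine ge_of_tendsto h2 ?_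
    filter_upwards [self_mem_nhdsWithin] with θ hθ
    exact h θ hθ s
  refine le_antisymm (key fun θ hθ => measure_le_of_locally fun a => ?_)
    (key fun θ hθ => measure_le_of_locally fun a => ?_)
  · obtain ⟨u, hu, ha, h⟩ := c.exists_area_compare a hθ
    refine ⟨u, hu, ha, fun s hs hsu => ?_⟩
    rw [c.measurableEmbedding_gr.comap_apply, Measure.smul_apply, withDensity_apply _ hs]
    exact (h s hs hsu).1
  · obtain ⟨u, hu, ha, h⟩ := c.exists_area_compare a hθ
    refine ⟨u, hu, ha, fun s hs hsu => ?_⟩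
    rw [Measure.smul_apply, c.measurableEmbedding_gr.comap_apply, withDensity_apply _ hs]
    exact (h s hs hsu).2

variable {c} in
lemma mem_frontier_iff_range (hU : IsOpen U) {y : E3} (hy : y ∈ Metric.ball c.x c.r) :
    y ∈ frontier U ↔ y ∈ range c.gr := by
  rw [mem_frontier_iff hU hy]
  constructor
  · intro h
    exact ⟨(c.proj y).1, by rw [gr, ← h]; exact c.lift_proj y⟩
  · rintro ⟨z, rfl⟩
    rw [proj_gr]

lemma restrict_surf (hU : IsOpen U) : (surf U).restrict (Metric.ball c.x c.r) =
    ((volume.withDensity fun z => ENNReal.ofReal (c.jac z)).map c.gr).restrict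
      (Metric.ball c.x c.r) := by
  rw [← comap_gr, c.measurableEmbedding_gr.map_comap, surf,
    Measure.restrict_restrict measurableSet_ball, Measure.restrict_restrict measurableSet_ball]
  congr 1
  ext y
  simp only [mem_inter_iff]
  exact and_congr_right fun hy => mem_frontier_iff_range hU hy

/-- No measurability of `G` is needed: the parametrization is a measurable embedding and the density
is finite everywhere. -/
lemma lintegral_surf (hU : IsOpen U) {G : E3 → ℝ≥0∞} (hG : ∀ y ∉ Metric.ball c.x c.r, G y = 0) :
    ∫⁻ y, G y ∂(surf U) = ∫⁻ z, ENNReal.ofReal (c.jac z) * G (c.gr z) := by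
  have h1 : ∀ μ : Measure E3, ∫⁻ y, G y ∂μ = ∫⁻ y in Metric.ball c.x c.r, G y ∂μ := fun μ =>
    (setLIntegral_eq_of_support_subset
      (fun y hy => by by_contra h; exact hy (hG y h))).symm
  rw [h1, c.restrict_surf hU, ← h1, c.measurableEmbedding_gr.lintegral_map,
    lintegral_withDensity_eq_lintegral_mul_non_measurable _
      (c.continuous_jac.measurable.ennreal_ofReal) (ae_of_all _ fun z => ENNReal.ofReal_lt_top)]
  rfl

lemma integral_surf (hU : IsOpen U) {E : Type*} [NormedAddCommGroup E] [NormedSpace ℝ E]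
    {G : E3 → E} (hG : ∀ y ∉ Metric.ball c.x c.r, G y = 0) :
    ∫ y, G y ∂(surf U) = ∫ z, c.jac z • G (c.gr z) := by
  have h1 : ∀ μ : Measure E3, ∫ y, G y ∂μ = ∫ y in Metric.ball c.x c.r, G y ∂μ := fun μ =>
    (setIntegral_eq_integral_of_forall_compl_eq_zero hG).symm
  rw [h1, c.restrict_surf hU, ← h1, c.measurableEmbedding_gr.integral_map,
    integral_withDensity_eq_integral_toReal_smul
      (c.continuous_jac.measurable.ennreal_ofReal) (ae_of_all _ fun z => ENNReal.ofReal_lt_top)]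
  refine integral_congr_ae (ae_of_all _ fun z => ?_)
  simp only
  rw [ENNReal.toReal_ofReal (zero_le_one.trans (c.one_le_jac z))]

end Chart

lemma isFiniteMeasure_surf {U : Set E3} (hU : IsC2 U) : IsFiniteMeasure (surf U) := by
  refine ⟨?_⟩
  have h0 : surf U univ = surf U (frontier U) := by simp [surf]
  rw [h0]
  refine hU.isCompact_frontier.measure_lt_top_of_nhdsWithin fun x hx => ?_
  obtain ⟨c, rfl⟩ := hU.exists_chart hx
  refine ⟨Metric.ball c.x c.r, mem_nhdsWithin_of_mem_nhds (Metric.ball_mem_nhds _ c.r_pos), ?_⟩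
  have h1 := c.lintegral_surf hU.isOpen (G := (Metric.ball c.x c.r).indicator 1)
    (fun y hy => indicator_of_notMem hy _)
  rw [lintegral_indicator_one measurableSet_ball] at h1
  rw [h1]
  have hsub : c.gr ⁻¹' Metric.ball c.x c.r ⊆ Metric.ball (c.proj c.x).1 c.r := by
    intro z hz
    have h2 := c.dist_proj_fst_le (c.gr z) c.x
    rw [c.proj_gr] at h2
    exact h2.trans_lt hz
  calc ∫⁻ z, ENNReal.ofReal (c.jac z) * (Metric.ball c.x c.r).indicator 1 (c.gr z)
      ≤ ∫⁻ z, (Metric.ball (c.proj c.x).1 c.r).indicator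
          (fun _ => ENNReal.ofReal (1 + 2 * c.lip)) z := by
        refine lintegral_mono fun z => ?_
        by_cases hz : c.gr z ∈ Metric.ball c.x c.r
        · rw [indicator_of_mem hz, indicator_of_mem (hsub hz), Pi.one_apply, mul_one]
          exact ENNReal.ofReal_le_ofReal (c.jac_le z)
        · simp [indicator_of_notMem hz]
    _ < ⊤ := by
        rw [lintegral_indicator_const measurableSet_ball]
        exact ENNReal.mul_lt_top ENNReal.ofReal_lt_top measure_ball_lt_top

end Area

/-! ### The outer normal and the Gauss–Green formula -/

section GaussGreen

/-- If the two normals differed, the direction n' - n would make an obtuse angle with `n` and an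
acute one with `n'`, so short steps along it would lie both in `U` and in its exterior. -/
lemma IsOuterUnitNormal.unique {U : Set E3} {x n n' : E3} (h : IsOuterUnitNormal U x n)
    (h' : IsOuterUnitNormal U x n') : n = n' := by
  by_contra hne
  have hlt : inner ℝ n n' < 1 := (inner_lt_one_iff_real_of_norm_eq_one h.1 h'.1).2 hne
  have h1 : inner ℝ (n' - n) n < 0 := by
    rw [inner_sub_left, real_inner_self_eq_norm_sq, h.1, real_inner_comm]; linarith
  have h2 : 0 < inner ℝ (n' - n) n' := by
    rw [inner_sub_left, real_inner_self_eq_norm_sq, h'.1]; linarith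
  obtain ⟨t, ht1, ht2⟩ := (((h.2 _).1 h1).and ((h'.2 _).2 h2)).exists
  exact ht2 (subset_closure ht1)

lemma IsOuterUnitNormal.normal_eq {U : Set E3} {x n : E3} (h : IsOuterUnitNormal U x n) :
    normal U x = n := by
  have hex : ∃ n, IsOuterUnitNormal U x n := ⟨n, h⟩
  rw [normal, dif_pos hex]
  exact hex.choose_spec.unique h

lemma IsOuterUnitNormal.exterior {U : Set E3} (hU : IsOpen U) {x n : E3}
    (h : IsOuterUnitNormal U x n) : IsOuterUnitNormal (exterior U) x (-n) := by
  have hsub : U ⊆ DiracShell.exterior (DiracShell.exterior U) := by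
    rw [DiracShell.exterior, DiracShell.exterior, closure_compl, compl_compl]
    exact hU.subset_interior_iff.2 subset_closure
  refine ⟨by rw [norm_neg, h.1], fun v => ⟨fun hv => ?_, fun hv => ?_⟩⟩
  · rw [inner_neg_right, neg_lt_zero] at hv
    exact (h.2 v).2 hv
  · rw [inner_neg_right, neg_pos] at hv
    exact ((h.2 v).1 hv).mono fun t ht => hsub ht

/-! ### The normal of a graph. -/

namespace Chart

variable {U : Set E3} (c : Chart U)

/-- The upward unit normal of the graph. -/
def nrm (z : E2) : E3 := (c.jac z)⁻¹ • c.e.symm (join (!₂[-c.dh 0 z, -c.dh 1 z], 1))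

lemma fderiv_h_apply (z v : E2) : fderiv ℝ c.h z v = v 0 * c.dh 0 z + v 1 * c.dh 1 z := by
  have : v = v 0 • EuclideanSpace.single 0 1 + v 1 • EuclideanSpace.single 1 1 := by
    ext i; fin_cases i <;> simp
  conv_lhs => rw [this]
  simp [dh]

lemma jac_pos (z : E2) : 0 < c.jac z := zero_lt_one.trans_le (c.one_le_jac z)

lemma inner_nrm (z : E2) (v : E3) : inner ℝ v (c.nrm z) = (c.jac z)⁻¹ *
    ((join.symm (c.e v)).2 - fderiv ℝ c.h z (join.symm (c.e v)).1) := by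
  have : v = c.e.symm (join (join.symm (c.e v))) := by simp
  conv_lhs => rw [this]
  rw [nrm, inner_smul_right, LinearIsometryEquiv.inner_map_map, inner_join, fderiv_h_apply]
  simp [PiLp.inner_apply]
  left
  ring

lemma norm_nrm (z : E2) : ‖c.nrm z‖ = 1 := by
  rw [← pow_left_inj₀ (norm_nonneg _) zero_le_one two_ne_zero, nrm, norm_smul, mul_pow,
    LinearIsometryEquiv.norm_map, norm_join_sq, norm_inv, Real.norm_of_nonneg (c.jac_pos z).le,
    inv_pow, c.jac_sq, EuclideanSpace.norm_sq_eq]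
  simp only [Fin.sum_univ_two]
  have : 1 + c.dh 0 z ^ 2 + c.dh 1 z ^ 2 ≠ 0 := by positivity
  simp
  field_simp
  ring

/-- The sign of this derivative decides on which side of the graph a ray starts, and this identifies
`nrm` as the outer normal. -/
lemma hasDerivAt_height (z : E2) (v : E3) :
    HasDerivAt (fun t : ℝ => (c.proj (c.gr z + t • v)).2) (-(c.jac z * inner ℝ v (c.nrm z))) 0 := by
  rw [inner_nrm, mul_inv_cancel_left₀ (c.jac_pos z).ne', neg_sub]
  have e : (fun t : ℝ => (c.proj (c.gr z + t • v)).2) = fun t : ℝ =>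
      c.h (z + t • (join.symm (c.e v)).1) - (c.h z + t * (join.symm (c.e v)).2) := by
    funext t
    simp [proj, gr_apply]
  rw [e]
  have h1 : HasFDerivAt c.h (fderiv ℝ c.h z) (z + (0 : ℝ) • (join.symm (c.e v)).1) := by
    rw [zero_smul, add_zero]
    exact (c.contDiff.differentiable two_ne_zero z).hasFDerivAt
  have h2 : HasDerivAt (fun t : ℝ => z + t • (join.symm (c.e v)).1) (join.symm (c.e v)).1 0 := by
    simpa using ((hasDerivAt_id (0 : ℝ)).smul_const (join.symm (c.e v)).1).const_add z
  have h3 : HasDerivAt (fun t : ℝ => c.h z + t * (join.symm (c.e v)).2) (join.symm (c.e v)).2 0 := by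
    simpa using ((hasDerivAt_id (0 : ℝ)).mul_const (join.symm (c.e v)).2).const_add (c.h z)
  exact (h1.comp_hasDerivAt 0 h2).sub h3

lemma isOuterUnitNormal {z : E2} (hz : c.gr z ∈ Metric.ball c.x c.r) :
    IsOuterUnitNormal U (c.gr z) (c.nrm z) := by
  refine ⟨c.norm_nrm z, fun v => ?_⟩
  have hslope := (hasDerivAt_iff_tendsto_slope.1 (c.hasDerivAt_height z v)).mono_left
    (nhdsWithin_mono 0 fun t (ht : 0 < t) => ht.ne' : 𝓝[>] (0 : ℝ) ≤ 𝓝[≠] 0)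
  have hball : ∀ᶠ t : ℝ in 𝓝[>] 0, c.gr z + t • v ∈ Metric.ball c.x c.r := by
    have hcont : Continuous fun t : ℝ => c.gr z + t • v := by fun_prop
    have := hcont.tendsto 0
    rw [zero_smul, add_zero] at this
    exact (this.mono_left nhdsWithin_le_nhds).eventually (Metric.isOpen_ball.mem_nhds hz)
  have h0 : (c.proj (c.gr z + (0 : ℝ) • v)).2 = 0 := by rw [zero_smul, add_zero, proj_gr]
  have hj := c.jac_pos z
  constructor
  · intro hv
    have hpos : 0 < -(c.jac z * inner ℝ v (c.nrm z)) := by nlinarith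
    filter_upwards [hslope.eventually (lt_mem_nhds hpos), hball, self_mem_nhdsWithin] with t h1 h2 h3
    have h3 : 0 < t := h3
    rw [slope_def_field, h0, sub_zero, sub_zero] at h1
    rw [mem_iff h2]
    exact (div_pos_iff_of_pos_right h3).1 h1
  · intro hv
    have hneg : -(c.jac z * inner ℝ v (c.nrm z)) < 0 := by nlinarith
    filter_upwards [hslope.eventually (gt_mem_nhds hneg), hball, self_mem_nhdsWithin] with t h1 h2 h3
    have h3 : 0 < t := h3
    rw [slope_def_field, h0, sub_zero, sub_zero] at h1
    rw [mem_exterior_iff h2]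
    exact (div_neg_iff.1 h1).resolve_left (fun h => h.2.not_gt h3) |>.1

lemma normal_gr {z : E2} (hz : c.gr z ∈ Metric.ball c.x c.r) : normal U (c.gr z) = c.nrm z :=
  (c.isOuterUnitNormal hz).normal_eq

end Chart

lemma IsC2.isOuterUnitNormal_normal {U : Set E3} (hU : IsC2 U) {x : E3} (hx : x ∈ frontier U) :
    IsOuterUnitNormal U x (normal U x) := by
  obtain ⟨c, rfl⟩ := hU.exists_chart hx
  have hb := Metric.mem_ball_self (x := c.x) c.r_pos
  obtain ⟨z, hz⟩ := (Chart.mem_frontier_iff_range hU.isOpen hb).1 hx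
  have := c.isOuterUnitNormal (z := z) (hz ▸ hb)
  rw [hz] at this
  rwa [this.normal_eq]

lemma IsC2.normal_exterior {U : Set E3} (hU : IsC2 U) {x : E3} (hx : x ∈ frontier U) :
    normal (DiracShell.exterior U) x = -normal U x :=
  ((hU.isOuterUnitNormal_normal hx).exterior hU.isOpen).normal_eq

lemma IsC2.surf_exterior {U : Set E3} (hU : IsC2 U) : surf (DiracShell.exterior U) = surf U := by
  rw [surf, surf, hU.frontier_exterior]

lemma ae_surf_mem {U : Set E3} : ∀ᵐ x ∂(surf U), x ∈ frontier U :=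
  ae_restrict_mem isClosed_frontier.measurableSet

/-- One derivative of the graph function is spent, so a C² boundary has a C¹ normal. This is the
regularity used to see that multiplication by α·ν preserves traces of H¹ functions. -/
lemma Chart.contDiff_nrm {U : Set E3} (c : Chart U) : ContDiff ℝ 1 c.nrm := by
  have hd : ∀ k, ContDiff ℝ 1 (c.dh k) := fun k =>
    (c.contDiff.fderiv_right (m := 1) (by norm_num)).clm_apply contDiff_const
  have hj : ContDiff ℝ 1 c.jac :=
    ((contDiff_const.add ((hd 0).pow 2)).add ((hd 1).pow 2)).sqrt fun z => by positivity
  refine (hj.inv fun z => (c.jac_pos z).ne').smul (c.e.symm.contDiff.comp (join.contDiff.comp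
    (ContDiff.prodMk ?_ contDiff_const)))
  rw [contDiff_euclidean]
  intro i
  fin_cases i
  · exact (hd 0).neg
  · exact (hd 1).neg

/-- The normal field extends to a compactly supported `C¹` field. -/
lemma IsC2.exists_normal_extension {U : Set E3} (hU : IsC2 U) : ∃ N : E3 → E3,
    ContDiff ℝ 1 N ∧ HasCompactSupport N ∧ ∀ x ∈ frontier U, N x = normal U x := by
  obtain ⟨T⟩ := hU.nonempty_atlas
  have hs : ∀ i, HasCompactSupport (T.χ (some i)) := fun i =>
    HasCompactSupport.of_support_subset_isCompact (isCompact_closedBall (T.c i).x ((T.c i).r / 2))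
      ((subset_tsupport _).trans ((T.tsupport_some i).trans Metric.ball_subset_closedBall))
  refine ⟨fun y => ∑ i, T.χ (some i) y • (T.c i).nrm ((T.c i).proj y).1, ?_, ?_, ?_⟩
  · exact ContDiff.sum fun i _ => ((T.contDiff _).of_le (by simp)).smul
      ((T.c i).contDiff_nrm.comp ((T.c i).contDiff_proj.fst.of_le one_le_two))
  · have : ∀ s : Finset T.ι, HasCompactSupport fun y =>
        ∑ i ∈ s, T.χ (some i) y • (T.c i).nrm ((T.c i).proj y).1 := by
      classical
      intro s
      induction s using Finset.induction_on with
      | empty =>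
        simp only [Finset.sum_empty]
        exact HasCompactSupport.zero
      | insert i s hi ih =>
        simp only [Finset.sum_insert hi]
        exact ((hs i).smul_right).add ih
    exact this _
  · intro x hx
    have h1 : ∀ i, T.χ (some i) x • (T.c i).nrm ((T.c i).proj x).1 =
        T.χ (some i) x • normal U x := by
      intro i
      by_cases hxi : T.χ (some i) x = 0
      · rw [hxi, zero_smul, zero_smul]
      · have hb : x ∈ Metric.ball (T.c i).x (T.c i).r :=
          Metric.ball_subset_ball (by linarith [(T.c i).r_pos])
            (T.tsupport_some i (subset_tsupport _ hxi))
        obtain ⟨z, rfl⟩ := (Chart.mem_frontier_iff_range hU.isOpen hb).1 hx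
        rw [Chart.normal_gr _ hb, Chart.proj_gr]
    simp only [h1, ← Finset.sum_smul]
    have h2 := T.sum_eq x
    rw [Fintype.sum_option, image_eq_zero_of_notMem_tsupport fun h => T.tsupport_none h hx,
      zero_add] at h2
    rw [h2, one_smul]

variable {G : Type*} [NormedAddCommGroup G] [NormedSpace ℝ G]

lemma integral_fderiv_eq_zero {V : Type*} [NormedAddCommGroup V] [NormedSpace ℝ V]
    [FiniteDimensional ℝ V] [MeasurableSpace V] [BorelSpace V] {μ : Measure V} [μ.IsAddHaarMeasure]
    {g : V → G} (hg : ContDiff ℝ 1 g) (hc : HasCompactSupport g) (v : V) :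
    ∫ x, fderiv ℝ g x v ∂μ = 0 := by
  have h := integral_smul_fderiv_eq_neg_fderiv_smul_of_integrable (μ := μ) (𝕜 := ℝ)
    (f := fun _ => (1 : ℝ)) (g := g) (v := v) (by simp)
    (by simpa using ((hg.continuous_fderiv one_ne_zero).clm_apply
      continuous_const).integrable_of_hasCompactSupport (hc.fderiv_apply ℝ v))
    (by simpa using hg.continuous.integrable_of_hasCompactSupport hc)
    (fun x _ => differentiableAt_const _) (fun x _ => hg.differentiable one_ne_zero x)
  simpa using h

/-- The restriction to one side of a function that vanishes near the boundary is smooth. -/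
lemma contDiff_indicator {U : Set E3} {φ : E3 → G} {n : WithTop ℕ∞} (hφ : ContDiff ℝ n φ)
    (hs : tsupport φ ⊆ (frontier U)ᶜ) : ContDiff ℝ n (U.indicator φ) := by
  rw [contDiff_iff_contDiffAt]
  intro x
  by_cases hx : x ∈ tsupport φ
  · have hxf := hs hx
    by_cases hxU : x ∈ interior U
    · refine hφ.contDiffAt.congr_of_eventuallyEq ?_
      filter_upwards [isOpen_interior.mem_nhds hxU] with y hy
      exact indicator_of_mem (interior_subset hy) φ
    · have hxc : x ∈ (closure U)ᶜ := fun hcl => hxf ⟨hcl, hxU⟩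
      refine (contDiffAt_const (c := (0 : G))).congr_of_eventuallyEq ?_
      filter_upwards [isClosed_closure.isOpen_compl.mem_nhds hxc] with y hy
      exact indicator_of_notMem (fun h => hy (subset_closure h)) φ
  · refine (contDiffAt_const (c := (0 : G))).congr_of_eventuallyEq ?_
    filter_upwards [(isClosed_tsupport φ).isOpen_compl.mem_nhds hx] with y hy
    have : φ y = 0 := image_eq_zero_of_notMem_tsupport hy
    simp [indicator, this]

lemma fderiv_indicator {U : Set E3} (hU : IsOpen U) (φ : E3 → G) {x : E3} (hx : x ∈ U) :
    fderiv ℝ (U.indicator φ) x = fderiv ℝ φ x := by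
  refine Filter.EventuallyEq.fderiv_eq ?_
  filter_upwards [hU.mem_nhds hx] with y hy
  exact indicator_of_mem hy φ

lemma fderiv_indicator_of_notMem {U : Set E3} {φ : E3 → G} (hU : IsOpen U)
    (hs : tsupport φ ⊆ (frontier U)ᶜ) {x : E3} (hx : x ∉ U) : fderiv ℝ (U.indicator φ) x = 0 := by
  have : U.indicator φ =ᶠ[𝓝 x] fun _ => 0 := by
    by_cases hxt : x ∈ tsupport φ
    · have hxc : x ∈ (closure U)ᶜ := fun hcl => hs hxt (hU.frontier_eq ▸ ⟨hcl, hx⟩)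
      filter_upwards [isClosed_closure.isOpen_compl.mem_nhds hxc] with y hy
      exact indicator_of_notMem (fun h => hy (subset_closure h)) φ
    · filter_upwards [(isClosed_tsupport φ).isOpen_compl.mem_nhds hxt] with y hy
      have : φ y = 0 := image_eq_zero_of_notMem_tsupport hy
      simp [indicator, this]
  rw [this.fderiv_eq]
  simp

/-- Cut off to `U`, the function remains C¹ on ℝ³, so the integral of its derivative vanishes; the
surface integral vanishes because the function is zero on the boundary. -/
lemma gaussGreen_interior {U : Set E3} (hU : IsC2 U) {φ : E3 → G} (hφ : ContDiff ℝ 1 φ)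
    (hc : HasCompactSupport φ) (hs : tsupport φ ⊆ (frontier U)ᶜ) (v : E3) :
    ∫ y in U, fderiv ℝ φ y v = ∫ y, inner ℝ v (normal U y) • φ y ∂(surf U) := by
  have h1 : ∫ y, inner ℝ v (normal U y) • φ y ∂(surf U) = 0 := by
    refine integral_eq_zero_of_ae ?_
    filter_upwards [ae_surf_mem] with y hy
    have : φ y = 0 := image_eq_zero_of_notMem_tsupport fun h => hs h hy
    simp [this]
  rw [h1, ← integral_indicator hU.isOpen.measurableSet]
  have h2 := integral_fderiv_eq_zero (μ := volume) (contDiff_indicator hφ hs) (hc.mono (by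
    intro x hx hx'; exact hx (by simp [indicator, hx']))) v
  rw [← h2]
  refine integral_congr_ae (ae_of_all _ fun y => ?_)
  by_cases hy : y ∈ U
  · simp only [indicator_of_mem hy, fderiv_indicator hU.isOpen φ hy]
  · simp only [indicator_of_notMem hy, fderiv_indicator_of_notMem hU.isOpen hs hy]
    rfl

/-! ### The Gauss–Green formula in a chart. -/

namespace Chart

variable {U : Set E3} (c : Chart U)

/-- The derivative of the flattening map. -/
def dlift (p : E2 × ℝ) : E2 × ℝ →L[ℝ] E3 :=
  (c.e.symm.toContinuousLinearEquiv : E3 →L[ℝ] E3).comp ((join : E2 × ℝ →L[ℝ] E3).comp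
    ((ContinuousLinearMap.fst ℝ E2 ℝ).prod
      ((fderiv ℝ c.h p.1).comp (ContinuousLinearMap.fst ℝ E2 ℝ) - ContinuousLinearMap.snd ℝ E2 ℝ)))

lemma dlift_apply (p q : E2 × ℝ) :
    c.dlift p q = c.e.symm (join (q.1, fderiv ℝ c.h p.1 q.1 - q.2)) := rfl

lemma hasFDerivAt_lift (p : E2 × ℝ) : HasFDerivAt c.lift (c.dlift p) p := by
  have h1 : HasFDerivAt c.h (fderiv ℝ c.h p.1) p.1 :=
    (c.contDiff.differentiable two_ne_zero p.1).hasFDerivAt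
  have h2 : HasFDerivAt (fun q : E2 × ℝ => (q.1, c.h q.1 - q.2)) _ p :=
    (hasFDerivAt_fst (𝕜 := ℝ)).prodMk ((h1.comp p hasFDerivAt_fst).sub hasFDerivAt_snd)
  exact (c.e.symm.toContinuousLinearEquiv.hasFDerivAt).comp p ((join.hasFDerivAt).comp p h2)

lemma fderiv_comp_lift {φ : E3 → G} (hφ : ContDiff ℝ 1 φ) (p q : E2 × ℝ) :
    fderiv ℝ (fun p => φ (c.lift p)) p q = fderiv ℝ φ (c.lift p) (c.dlift p q) := by
  have := ((hφ.differentiable one_ne_zero _).hasFDerivAt.comp p (c.hasFDerivAt_lift p)).fderiv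
  exact DFunLike.congr_fun this q

lemma contDiff_comp_lift {φ : E3 → G} (hφ : ContDiff ℝ 1 φ) :
    ContDiff ℝ 1 fun p => φ (c.lift p) :=
  hφ.comp (c.contDiff_lift.of_le one_le_two)

lemma hasCompactSupport_comp_lift {φ : E3 → G} (hφ : HasCompactSupport φ) :
    HasCompactSupport fun p => φ (c.lift p) :=
  hφ.comp_homeomorph c.homeo

/-- A fixed direction splits into a derivative in the graph parameter and a height derivative whose
coefficient does not depend on the height. The coefficient is the area density times the normal
component of `v`, exactly the weight of the surface integral. -/
lemma fderiv_apply_eq {φ : E3 → G} (hφ : ContDiff ℝ 1 φ) (p : E2 × ℝ) (v : E3) :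
    fderiv ℝ φ (c.lift p) v =
      fderiv ℝ (fun p => φ (c.lift p)) p ((join.symm (c.e v)).1, 0) -
      (c.jac p.1 * inner ℝ v (c.nrm p.1)) • fderiv ℝ (fun p => φ (c.lift p)) p (0, 1) := by
  rw [inner_nrm, mul_inv_cancel_left₀ (c.jac_pos _).ne', ← map_smul, ← map_sub,
    c.fderiv_comp_lift hφ]
  congr 1
  rw [dlift_apply, LinearIsometryEquiv.eq_symm_apply, ← ContinuousLinearEquiv.symm_apply_eq]
  ext1 <;> simp

/-- Integrals over `U` of functions supported in a chart, in flattening coordinates. -/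
lemma setIntegral_eq (hU : IsOpen U) {φ : E3 → G} (hφ : ∀ y ∉ Metric.ball c.x c.r, φ y = 0) :
    ∫ y in U, φ y = ∫ p in univ ×ˢ Ioi (0 : ℝ), φ (c.lift p) := by
  rw [← integral_indicator hU.measurableSet,
    ← c.measurePreserving_lift.integral_comp c.measurableEmbedding_lift,
    ← integral_indicator (MeasurableSet.univ.prod measurableSet_Ioi)]
  refine integral_congr_ae (ae_of_all _ fun p => ?_)
  by_cases hb : c.lift p ∈ Metric.ball c.x c.r
  · have : c.lift p ∈ U ↔ p ∈ univ ×ˢ Ioi (0 : ℝ) := by rw [mem_iff hb, proj_lift]; simp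
    by_cases hp : c.lift p ∈ U
    · simp only [indicator_of_mem hp, indicator_of_mem (this.1 hp)]
    · simp only [indicator_of_notMem hp, indicator_of_notMem fun h => hp (this.2 h)]
  · simp [indicator, hφ _ hb]

/-- On every slice of constant height the parameter derivative integrates to zero. Along every
vertical line the height derivative leaves minus the boundary value by the fundamental theorem of
calculus. -/
lemma gaussGreen [CompleteSpace G] (hU : IsOpen U) {φ : E3 → G} (hφ : ContDiff ℝ 1 φ)
    (hc : HasCompactSupport φ) (hs : tsupport φ ⊆ Metric.ball c.x c.r) (v : E3) :
    ∫ y in U, fderiv ℝ φ y v = ∫ y, inner ℝ v (normal U y) • φ y ∂(surf U) := by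
  have hz : ∀ y ∉ Metric.ball c.x c.r, φ y = 0 := fun y hy =>
    image_eq_zero_of_notMem_tsupport fun h => hy (hs h)
  have hz' : ∀ y ∉ Metric.ball c.x c.r, fderiv ℝ φ y v = 0 := fun y hy => by
    rw [fderiv_of_notMem_tsupport (𝕜 := ℝ) fun h => hy (hs h)]; rfl
  set u : E2 × ℝ → G := fun p => φ (c.lift p) with hu
  have hu1 : ContDiff ℝ 1 u := c.contDiff_comp_lift hφ
  have huc : HasCompactSupport u := c.hasCompactSupport_comp_lift hc
  rw [c.setIntegral_eq hU hz', c.integral_surf hU (fun y hy => by rw [hz y hy, smul_zero])]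
  simp only [c.fderiv_apply_eq hφ]
  rw [← hu]
  set w := (join.symm (c.e v)).1
  let k : E2 → ℝ := fun z => c.jac z * inner ℝ v (c.nrm z)
  have hk : Continuous k := by
    have : k = fun z => (join.symm (c.e v)).2 - fderiv ℝ c.h z (join.symm (c.e v)).1 := by
      funext z
      simp only [k, inner_nrm, mul_inv_cancel_left₀ (c.jac_pos z).ne']
    rw [this]
    exact continuous_const.sub
      ((c.contDiff.continuous_fderiv two_ne_zero).clm_apply continuous_const)
  have i1 : Integrable (fun p => fderiv ℝ u p (w, 0)) :=
    ((hu1.continuous_fderiv one_ne_zero).clm_apply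
      continuous_const).integrable_of_hasCompactSupport (huc.fderiv_apply ℝ _)
  have i2 : Integrable (fun p : E2 × ℝ => k p.1 • fderiv ℝ u p (0, 1)) :=
    ((hk.comp continuous_fst).smul ((hu1.continuous_fderiv one_ne_zero).clm_apply
      continuous_const)).integrable_of_hasCompactSupport ((huc.fderiv_apply ℝ _).smul_left)
  have hpr : (volume : Measure (E2 × ℝ)).restrict (univ ×ˢ Ioi (0 : ℝ)) =
      (volume : Measure E2).prod (volume.restrict (Ioi (0 : ℝ))) := by
    rw [Measure.volume_eq_prod, ← Measure.prod_restrict, Measure.restrict_univ]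
  have hfib : ∀ t : ℝ, ∫ z, fderiv ℝ u (z, t) (w, 0) = 0 := by
    intro t
    have hut : ContDiff ℝ 1 fun z => u (z, t) := hu1.comp (contDiff_id.prodMk contDiff_const)
    have hutc : HasCompactSupport fun z => u (z, t) :=
      huc.comp_isClosedEmbedding (isClosedEmbedding_iff .. |>.2 ⟨isEmbedding_prodMkLeft t, by
        have : range (fun z : E2 => (z, t)) = univ ×ˢ {t} := by
          ext p; simp [Prod.ext_iff, eq_comm]
        rw [this]; exact isClosed_univ.prod isClosed_singleton⟩)
    rw [← integral_fderiv_eq_zero (μ := volume) hut hutc w]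
    refine integral_congr_ae (ae_of_all _ fun z => ?_)
    have h1 := (hu1.differentiable one_ne_zero (z, t)).hasFDerivAt.comp z
      ((hasFDerivAt_id (𝕜 := ℝ) z).prodMk (hasFDerivAt_const t z))
    have h2 : fderiv ℝ (fun z => u (z, t)) z = _ := h1.fderiv
    simp [h2]
  have hline : ∀ z : E2, ∫ t in Ioi (0 : ℝ), fderiv ℝ u (z, t) (0, 1) = -u (z, 0) := by
    intro z
    have hut : ContDiff ℝ 1 fun t => u (z, t) := hu1.comp (contDiff_const.prodMk contDiff_id)
    have hutc : HasCompactSupport fun t => u (z, t) :=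
      huc.comp_isClosedEmbedding (isClosedEmbedding_iff .. |>.2 ⟨isEmbedding_prodMkRight z, by
        have : range (fun t : ℝ => (z, t)) = {z} ×ˢ univ := by
          ext p; simp [Prod.ext_iff, eq_comm]
        rw [this]; exact isClosed_singleton.prod isClosed_univ⟩)
    rw [← hutc.integral_Ioi_deriv_eq hut 0]
    refine integral_congr_ae (ae_of_all _ fun t => ?_)
    have h1 := (hu1.differentiable one_ne_zero (z, t)).hasFDerivAt.comp_hasDerivAt t
      ((hasDerivAt_const t z).prodMk (hasDerivAt_id t))
    exact h1.deriv.symm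
  rw [integral_sub i1.integrableOn i2.integrableOn]
  have j1 := i1.integrableOn (s := univ ×ˢ Ioi (0 : ℝ))
  have j2 := i2.integrableOn (s := univ ×ˢ Ioi (0 : ℝ))
  rw [IntegrableOn, hpr] at j1 j2
  rw [hpr, integral_prod_symm _ j1, integral_prod _ j2]
  simp only [hfib, integral_zero, integral_smul, hline, zero_sub, smul_neg, integral_neg, neg_neg]
  refine integral_congr_ae (ae_of_all _ fun z => ?_)
  simp only [k, hu]
  change (c.jac z * inner ℝ v (c.nrm z)) • φ (c.gr z) = _
  by_cases hb : c.gr z ∈ Metric.ball c.x c.r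
  · rw [c.normal_gr hb, mul_smul]
  · simp [hz _ hb]

end Chart

/-- The Gauss–Green formula. -/
theorem gaussGreen [CompleteSpace G] {U : Set E3} (hU : IsC2 U) {φ : E3 → G} (hφ : ContDiff ℝ 1 φ)
    (hc : HasCompactSupport φ) (v : E3) :
    ∫ y in U, fderiv ℝ φ y v = ∫ y, inner ℝ v (normal U y) • φ y ∂(surf U) := by
  obtain ⟨T⟩ := hU.nonempty_atlas
  have := isFiniteMeasure_surf hU
  let ψ : Option T.ι → E3 → G := fun i y => T.χ i y • φ y
  have hψ : ∀ i, ContDiff ℝ 1 (ψ i) := fun i => ((T.contDiff i).of_le (by simp)).smul hφ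
  have hψc : ∀ i, HasCompactSupport (ψ i) := fun i => hc.smul_left
  have hψs : ∀ i, tsupport (ψ i) ⊆ tsupport (T.χ i) := fun i =>
    closure_mono (Function.support_smul_subset_left _ _)
  have hsum : ∀ y, ∑ i, ψ i y = φ y := fun y => by
    simp only [ψ, ← Finset.sum_smul, T.sum_eq, one_smul]
  have key : ∀ i, ∫ y in U, fderiv ℝ (ψ i) y v =
      ∫ y, inner ℝ v (normal U y) • ψ i y ∂(surf U) := by
    rintro (_ | i)
    · exact gaussGreen_interior hU (hψ _) (hψc _) ((hψs _).trans T.tsupport_none) v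
    · refine (T.c i).gaussGreen hU.isOpen (hψ _) (hψc _) ((hψs _).trans
        ((T.tsupport_some i).trans (Metric.ball_subset_ball ?_))) v
      linarith [(T.c i).r_pos]
  have e1 : ∫ y in U, fderiv ℝ φ y v = ∑ i, ∫ y in U, fderiv ℝ (ψ i) y v := by
    rw [← integral_finsetSum]
    · refine integral_congr_ae (ae_of_all _ fun y => ?_)
      have : φ = fun y => ∑ i, ψ i y := funext fun y => (hsum y).symm
      simp only
      rw [this, fderiv_fun_sum fun i _ => (hψ i).differentiable one_ne_zero y, sum_apply]
    · intro i _
      exact (((hψ i).continuous_fderiv one_ne_zero).clm_apply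
        continuous_const).integrable_of_hasCompactSupport
        ((hψc i).fderiv_apply ℝ v) |>.integrableOn
  -- On Σ the normal is replaced by a continuous extension, which supplies integrability with
  -- respect to the surface measure.
  obtain ⟨N, hN, -, hNn⟩ := hU.exists_normal_extension
  have e2 : ∀ i, ∫ y, inner ℝ v (normal U y) • ψ i y ∂(surf U) =
      ∫ y, inner ℝ v (N y) • ψ i y ∂(surf U) := fun i => by
    refine integral_congr_ae ?_
    filter_upwards [ae_surf_mem] with y hy
    rw [hNn y hy]
  rw [e1, Finset.sum_congr rfl fun i _ => (key i).trans (e2 i), ← integral_finsetSum]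
  · refine integral_congr_ae ?_
    filter_upwards [ae_surf_mem] with y hy
    rw [← Finset.smul_sum, hsum, hNn y hy]
  · intro i _
    exact ((continuous_const.inner hN.continuous).smul
      (hψ i).continuous).integrable_of_hasCompactSupport (hψc i).smul_left

end GaussGreen

/-! ### The trace inequality in the half space -/

section HalfSpace

variable {G : Type*} [NormedAddCommGroup G]

lemma enorm_sum_sq_le {ι : Type*} (s : Finset ι) (a : ι → G) :
    ‖∑ i ∈ s, a i‖ₑ ^ 2 ≤ s.card * ∑ i ∈ s, ‖a i‖ₑ ^ 2 := by
  have h1 : ‖∑ i ∈ s, a i‖₊ ^ 2 ≤ (∑ i ∈ s, ‖a i‖₊) ^ 2 := by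
    gcongr
    exact nnnorm_sum_le _ _
  have h2 := h1.trans (sq_sum_le_card_mul_sum_sq (s := s) (f := fun i => ‖a i‖₊))
  simp only [enorm_eq_nnnorm]
  exact_mod_cast h2

lemma enorm_add_sq_le (a b : G) : ‖a + b‖ₑ ^ 2 ≤ 2 * (‖a‖ₑ ^ 2 + ‖b‖ₑ ^ 2) := by
  simpa [Fin.sum_univ_two] using enorm_sum_sq_le Finset.univ ![a, b]

lemma enorm_sub_sq_le (a b : G) : ‖a - b‖ₑ ^ 2 ≤ 2 * (‖a‖ₑ ^ 2 + ‖b‖ₑ ^ 2) := by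
  simpa [sub_eq_add_neg] using enorm_add_sq_le a (-b)

lemma enorm_add_add_sq_le (a b c : G) :
    ‖a + b + c‖ₑ ^ 2 ≤ 3 * (‖a‖ₑ ^ 2 + ‖b‖ₑ ^ 2 + ‖c‖ₑ ^ 2) := by
  simpa [Fin.sum_univ_three] using enorm_sum_sq_le Finset.univ ![a, b, c]

/-- The Sobolev–Slobodeckij seminorm of order `1/2` on the plane, squared. -/
def slob (g : E2 → G) : ℝ≥0∞ := ∫⁻ x, ∫⁻ y, ‖g x - g y‖ₑ ^ 2 / edist x y ^ 3

/-- The area of the unit circle. -/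
def circ : ℝ≥0∞ := (volume : Measure E2).toSphere univ

lemma circ_ne_top : circ ≠ ⊤ := measure_ne_top _ _

lemma lintegral_radial {f : ℝ → ℝ≥0∞} (hf : Measurable f) :
    ∫⁻ z : E2, f ‖z‖ = circ * ∫⁻ r in Ioi (0 : ℝ), ENNReal.ofReal r * f r := by
  have hd : Module.finrank ℝ E2 - 1 = 1 := by simp
  calc ∫⁻ z : E2, f ‖z‖ = ∫⁻ z : ({(0)}ᶜ : Set E2), f ‖z.1‖ ∂((volume : Measure E2).comap (↑)) := by
        rw [lintegral_subtype_comap (measurableSet_singleton _).compl fun x : E2 => f ‖x‖,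
          restrict_compl_singleton]
    _ = ∫⁻ p, f p.2 ∂(volume : Measure E2).toSphere.prod (.volumeIoiPow (Module.finrank ℝ E2 - 1)) := by
        rw [← (volume : Measure E2).measurePreserving_homeomorphUnitSphereProd.lintegral_comp_emb
          (Homeomorph.measurableEmbedding _)]
        simp
    _ = circ * ∫⁻ r : Ioi (0 : ℝ), f r ∂.volumeIoiPow 1 := by
        rw [hd, lintegral_prod _ (by fun_prop)]
        simp [circ, mul_comm]
    _ = _ := by
        rw [Measure.volumeIoiPow, lintegral_withDensity_eq_lintegral_mul _ (by fun_prop)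
          (by fun_prop)]
        congr 1
        simp only [pow_one]
        exact lintegral_subtype_comap measurableSet_Ioi fun r => ENNReal.ofReal r * f r

lemma lintegral_Ioi_scale {f : ℝ → ℝ≥0∞} (hf : Measurable f) {s : ℝ} (hs : 0 < s) :
    ENNReal.ofReal s * ∫⁻ r in Ioi (0 : ℝ), f (s * r) = ∫⁻ r in Ioi (0 : ℝ), f r := by
  rw [← lintegral_indicator measurableSet_Ioi, ← lintegral_indicator measurableSet_Ioi]
  have hm : Measurable ((Ioi (0 : ℝ)).indicator f) := hf.indicator measurableSet_Ioi
  have e : (fun r => (Ioi (0 : ℝ)).indicator (fun r => f (s * r)) r) =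
      fun r => (Ioi (0 : ℝ)).indicator f (s * r) := by
    funext r
    by_cases hr : 0 < r
    · rw [indicator_of_mem (show r ∈ Ioi (0 : ℝ) from hr),
        indicator_of_mem (show s * r ∈ Ioi (0 : ℝ) from mul_pos hs hr)]
    · rw [indicator_of_notMem (show r ∉ Ioi (0 : ℝ) from hr), indicator_of_notMem]
      exact fun h => hr (pos_of_mul_pos_right h hs.le |> fun h => h)
  rw [e, ← lintegral_map (g := fun r : ℝ => s * r) hm (by fun_prop),
    Real.map_volume_mul_left hs.ne', lintegral_smul_measure, smul_eq_mul, ← mul_assoc,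
    ← ENNReal.ofReal_mul hs.le, abs_of_pos (inv_pos.2 hs), mul_inv_cancel₀ hs.ne',
    ENNReal.ofReal_one, one_mul]

/-- The constant `∫₀¹ s^{-1/2} ds`. -/
def hardy : ℝ≥0∞ := ∫⁻ s in Ioo (0 : ℝ) 1, ENNReal.ofReal (s ^ (-(1 / 2) : ℝ))

lemma hardy_ne_top : hardy ≠ ⊤ := by
  have h : IntegrableOn (fun s : ℝ => s ^ (-(1 / 2) : ℝ)) (Ioo 0 1) :=
    (intervalIntegral.integrableOn_Ioo_rpow_iff one_pos).2 (by norm_num)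
  exact (Integrable.lintegral_lt_top h).ne

variable [NormedSpace ℝ G] [CompleteSpace G]

lemma enorm_sub_le_lintegral_deriv {γ γ' : ℝ → G} (h : ∀ t, HasDerivAt γ (γ' t) t)
    (hc : Continuous γ') {a b : ℝ} (hab : a ≤ b) :
    ‖γ b - γ a‖ₑ ≤ ∫⁻ t in Ioo a b, ‖γ' t‖ₑ := by
  rw [← intervalIntegral.integral_eq_sub_of_hasDerivAt (fun t _ => h t)
    (hc.intervalIntegrable a b), intervalIntegral.integral_of_le hab,
    ← restrict_Ioo_eq_restrict_Ioc]
  exact enorm_integral_le_lintegral_enorm _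

lemma enorm_sub_le_lintegral_fderiv {V : Type*} [NormedAddCommGroup V] [NormedSpace ℝ V]
    {u : V → G} (hu : ContDiff ℝ 1 u) (a v : V) :
    ‖u (a + v) - u a‖ₑ ≤ ‖v‖ₑ * ∫⁻ s in Ioo (0 : ℝ) 1, ‖fderiv ℝ u (a + s • v)‖ₑ := by
  have h : ∀ t : ℝ, HasDerivAt (fun s : ℝ => u (a + s • v)) (fderiv ℝ u (a + t • v) v) t := by
    intro t
    have h2 : HasDerivAt (fun s : ℝ => a + s • v) v t := by
      simpa using ((hasDerivAt_id t).smul_const v).const_add a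
    exact (hu.differentiable one_ne_zero _).hasFDerivAt.comp_hasDerivAt t h2
  have hc : Continuous fun t : ℝ => fderiv ℝ u (a + t • v) v :=
    ((hu.continuous_fderiv one_ne_zero).comp (by fun_prop)).clm_apply continuous_const
  have := enorm_sub_le_lintegral_deriv h hc zero_le_one
  simp only [one_smul, zero_smul, add_zero] at this
  refine this.trans ?_
  rw [← lintegral_const_mul' _ _ (by simp)]
  refine lintegral_mono fun s => ?_
  rw [mul_comm]
  exact ContinuousLinearMap.le_opENorm _ _

lemma sq_lintegral_Ioo_le {D : ℝ → ℝ≥0∞} (hD : Measurable D) :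
    (∫⁻ s in Ioo (0 : ℝ) 1, D s) ^ 2 ≤ ∫⁻ s in Ioo (0 : ℝ) 1, D s ^ 2 := by
  have := lintegral_mul_sq_le (μ := volume.restrict (Ioo (0 : ℝ) 1)) (f := fun _ => 1) (g := D)
    (by fun_prop) hD.aemeasurable
  simpa using this

/-- With plain Cauchy–Schwarz the later substitution r ↦ s r would leave the divergent integral of
s⁻¹ over (0, 1). The weight s^{1/2} distributes the singularity over two convergent integrals of
s^{-1/2}, which is why `traceConst` contains `hardy` squared. -/
lemma sq_lintegral_Ioo_le_hardy {D : ℝ → ℝ≥0∞} (hD : Measurable D) :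
    (∫⁻ s in Ioo (0 : ℝ) 1, D s) ^ 2 ≤
      hardy * ∫⁻ s in Ioo (0 : ℝ) 1, ENNReal.ofReal (s ^ (1 / 2 : ℝ)) * D s ^ 2 := by
  have hw : Measurable fun s : ℝ => ENNReal.ofReal (s ^ (-(1 / 2) : ℝ)) := by fun_prop
  have hv : Measurable fun s : ℝ => ENNReal.ofReal (s ^ (1 / 2 : ℝ)) := by fun_prop
  have e : ∀ s ∈ Ioo (0 : ℝ) 1,
      ENNReal.ofReal (s ^ (-(1 / 2) : ℝ)) * ENNReal.ofReal (s ^ (1 / 2 : ℝ)) = 1 := by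
    intro s hs
    rw [← ENNReal.ofReal_mul (by have := hs.1; positivity), ← Real.rpow_add hs.1]
    norm_num
  have := lintegral_weight_mul_sq_le (μ := volume.restrict (Ioo (0 : ℝ) 1)) hw.aemeasurable
    (hv.mul hD).aemeasurable
  refine le_trans (le_of_eq ?_) (this.trans (le_of_eq ?_))
  · congr 1
    refine setLIntegral_congr_fun measurableSet_Ioo fun s hs => ?_
    simp only [Pi.mul_apply]
    rw [← mul_assoc, e s hs, one_mul]
  · congr 1
    refine setLIntegral_congr_fun measurableSet_Ioo fun s hs => ?_
    simp only [Pi.mul_apply]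
    rw [mul_pow, pow_two (ENNReal.ofReal (s ^ (1 / 2 : ℝ))), ← mul_assoc, ← mul_assoc, e s hs,
      one_mul]

lemma sq_mul_div_cube_le {a X : ℝ≥0∞} (ha : a ≠ ⊤) : a ^ 2 * X / a ^ 3 ≤ X / a := by
  rcases eq_or_ne a 0 with rfl | h0
  · simp
  · rw [pow_succ a 2, ENNReal.mul_div_mul_left _ _ (pow_ne_zero 2 h0) (ENNReal.pow_ne_top ha)]

/-- The constant in the trace inequality of the half space. -/
def traceConst : ℝ≥0∞ := 3 * (2 * (hardy * hardy * circ) + circ)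

lemma traceConst_ne_top : traceConst ≠ ⊤ := by
  have h1 := hardy_ne_top
  have h2 := circ_ne_top
  unfold traceConst
  finiteness

section

variable {u : E2 × ℝ → G}

lemma measurable_enorm_fderiv_sq (hu : ContDiff ℝ 1 u) : Measurable fun p => ‖fderiv ℝ u p‖ₑ ^ 2 :=
  (hu.continuous_fderiv one_ne_zero).enorm.measurable.pow_const 2

lemma lintegral_vertical_le (hu : ContDiff ℝ 1 u) (r : ℝ) :
    ∫⁻ x : E2, ‖u (x, r) - u (x, 0)‖ₑ ^ 2 ≤ ‖r‖ₑ ^ 2 * (hardy *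
      ∫⁻ s in Ioo (0 : ℝ) 1, ENNReal.ofReal (s ^ (1 / 2 : ℝ)) *
        ∫⁻ x : E2, ‖fderiv ℝ u (x, s * r)‖ₑ ^ 2) := by
  have hm := measurable_enorm_fderiv_sq hu
  have hc := hu.continuous_fderiv one_ne_zero
  calc ∫⁻ x : E2, ‖u (x, r) - u (x, 0)‖ₑ ^ 2
      ≤ ∫⁻ x : E2, ‖r‖ₑ ^ 2 * (hardy * ∫⁻ s in Ioo (0 : ℝ) 1,
          ENNReal.ofReal (s ^ (1 / 2 : ℝ)) * ‖fderiv ℝ u (x, s * r)‖ₑ ^ 2) := by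
        refine lintegral_mono fun x => ?_
        have h := enorm_sub_le_lintegral_fderiv hu (x, (0 : ℝ)) ((0 : E2), r)
        have hn : ‖((0 : E2), r)‖ₑ = ‖r‖ₑ := by
          rw [← ofReal_norm, ← ofReal_norm]; simp
        simp only [Prod.mk_add_mk, add_zero, zero_add, Prod.smul_mk, smul_zero, smul_eq_mul,
          hn] at h
        have h2 := sq_lintegral_Ioo_le_hardy (D := fun s => ‖fderiv ℝ u (x, s * r)‖ₑ)
          (by exact (hc.comp (by fun_prop)).enorm.measurable)
        calc ‖u (x, r) - u (x, 0)‖ₑ ^ 2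
            ≤ (‖r‖ₑ * ∫⁻ s in Ioo (0 : ℝ) 1, ‖fderiv ℝ u (x, s * r)‖ₑ) ^ 2 := by gcongr
          _ ≤ _ := by rw [mul_pow]; gcongr
    _ = _ := by
        rw [lintegral_const_mul' _ _ (by simp), lintegral_const_mul' _ _ hardy_ne_top,
          lintegral_lintegral_swap]
        · simp only [lintegral_const_mul' _ _ ENNReal.ofReal_ne_top]
        · refine Measurable.aemeasurable ?_
          exact (by fun_prop : Measurable fun p : E2 × ℝ => ENNReal.ofReal (p.2 ^ (1 / 2 : ℝ))).mul
            (hm.comp (by fun_prop : Measurable fun p : E2 × ℝ => (p.1, p.2 * r)))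

lemma lintegral_horizontal_le (hu : ContDiff ℝ 1 u) (z : E2) (r : ℝ) :
    ∫⁻ x : E2, ‖u (x + z, r) - u (x, r)‖ₑ ^ 2 ≤
      ‖z‖ₑ ^ 2 * ∫⁻ x : E2, ‖fderiv ℝ u (x, r)‖ₑ ^ 2 := by
  have hm := measurable_enorm_fderiv_sq hu
  have hc := hu.continuous_fderiv one_ne_zero
  calc ∫⁻ x : E2, ‖u (x + z, r) - u (x, r)‖ₑ ^ 2
      ≤ ∫⁻ x : E2, ‖z‖ₑ ^ 2 * ∫⁻ s in Ioo (0 : ℝ) 1, ‖fderiv ℝ u (x + s • z, r)‖ₑ ^ 2 := by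
        refine lintegral_mono fun x => ?_
        have h := enorm_sub_le_lintegral_fderiv hu (x, r) (z, (0 : ℝ))
        have hn : ‖(z, (0 : ℝ))‖ₑ = ‖z‖ₑ := by
          rw [← ofReal_norm, ← ofReal_norm]; simp
        simp only [Prod.mk_add_mk, add_zero, Prod.smul_mk, smul_zero, hn] at h
        have h2 := sq_lintegral_Ioo_le (D := fun s => ‖fderiv ℝ u (x + s • z, r)‖ₑ)
          (by exact (hc.comp (by fun_prop)).enorm.measurable)
        calc ‖u (x + z, r) - u (x, r)‖ₑ ^ 2
            ≤ (‖z‖ₑ * ∫⁻ s in Ioo (0 : ℝ) 1, ‖fderiv ℝ u (x + s • z, r)‖ₑ) ^ 2 := by gcongr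
          _ ≤ _ := by rw [mul_pow]; gcongr
    _ = ‖z‖ₑ ^ 2 * ∫⁻ s in Ioo (0 : ℝ) 1, ∫⁻ x : E2, ‖fderiv ℝ u (x + s • z, r)‖ₑ ^ 2 := by
        rw [lintegral_const_mul' _ _ (by simp), lintegral_lintegral_swap]
        refine Measurable.aemeasurable ?_
        exact hm.comp (by fun_prop : Measurable fun p : E2 × ℝ => (p.1 + p.2 • z, r))
    _ = _ := by
        simp only [lintegral_add_right_eq_self (fun x : E2 => ‖fderiv ℝ u (x, r)‖ₑ ^ 2)]
        simp

/-- The trace inequality of order `1/2` in the half space. -/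
lemma slob_trace_le (hu : ContDiff ℝ 1 u) : slob (fun x => u (x, 0)) ≤
    traceConst * ∫⁻ t in Ioi (0 : ℝ), ∫⁻ x : E2, ‖fderiv ℝ u (x, t)‖ₑ ^ 2 := by
  have hm := measurable_enorm_fderiv_sq hu
  let N : ℝ → ℝ≥0∞ := fun t => ∫⁻ x : E2, ‖fderiv ℝ u (x, t)‖ₑ ^ 2
  have hN : Measurable N := by
    exact (hm.comp measurable_swap).lintegral_prod_right'
  let P : ℝ → ℝ≥0∞ := fun r => hardy *
      ∫⁻ s in Ioo (0 : ℝ) 1, ENNReal.ofReal (s ^ (1 / 2 : ℝ)) * N (s * r)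
  have hint : Measurable fun p : ℝ × ℝ => ENNReal.ofReal (p.2 ^ (1 / 2 : ℝ)) * N (p.2 * p.1) :=
    (by fun_prop : Measurable fun p : ℝ × ℝ => ENNReal.ofReal (p.2 ^ (1 / 2 : ℝ))).mul
      (hN.comp (by fun_prop))
  have hP : Measurable P := hint.lintegral_prod_right'.const_mul _
  have huc := hu.continuous
  -- To compare the boundary values at `x` and `x + z`, one goes up to height |z|, across at that
  -- height, and down again. Taking the height equal to the distance makes all three contributions
  -- of order |z|².
  have step : ∀ z : E2, ∫⁻ x : E2, ‖u (x, 0) - u (x + z, 0)‖ₑ ^ 2 ≤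
      ‖z‖ₑ ^ 2 * (3 * (2 * P ‖z‖ + N ‖z‖)) := by
    intro z
    have hz : ‖(‖z‖ : ℝ)‖ₑ = ‖z‖ₑ := enorm_norm z
    have hA := lintegral_vertical_le hu ‖z‖
    have hA' : ∫⁻ x : E2, ‖u (x + z, ‖z‖) - u (x + z, 0)‖ₑ ^ 2 ≤ ‖(‖z‖ : ℝ)‖ₑ ^ 2 * P ‖z‖ := by
      rw [lintegral_add_right_eq_self (fun x : E2 => ‖u (x, ‖z‖) - u (x, 0)‖ₑ ^ 2) z]
      exact hA
    have hB := lintegral_horizontal_le hu z ‖z‖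
    rw [hz] at hA hA'
    calc ∫⁻ x : E2, ‖u (x, 0) - u (x + z, 0)‖ₑ ^ 2
        ≤ ∫⁻ x : E2, 3 * (‖u (x, ‖z‖) - u (x, 0)‖ₑ ^ 2 + ‖u (x + z, ‖z‖) - u (x, ‖z‖)‖ₑ ^ 2 +
            ‖u (x + z, ‖z‖) - u (x + z, 0)‖ₑ ^ 2) := by
          refine lintegral_mono fun x => ?_
          have e : u (x, 0) - u (x + z, 0) = -(u (x, ‖z‖) - u (x, 0)) +
            (-(u (x + z, ‖z‖) - u (x, ‖z‖))) + (u (x + z, ‖z‖) - u (x + z, 0)) := by abel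
          rw [e]
          refine (enorm_add_add_sq_le _ _ _).trans (le_of_eq ?_)
          rw [enorm_neg, enorm_neg]
      _ = 3 * ((∫⁻ x : E2, ‖u (x, ‖z‖) - u (x, 0)‖ₑ ^ 2) +
            (∫⁻ x : E2, ‖u (x + z, ‖z‖) - u (x, ‖z‖)‖ₑ ^ 2) +
            ∫⁻ x : E2, ‖u (x + z, ‖z‖) - u (x + z, 0)‖ₑ ^ 2) := by
          rw [lintegral_const_mul' _ _ (by simp), lintegral_add_left, lintegral_add_left]
          · exact ((huc.comp (by fun_prop)).sub (huc.comp (by fun_prop))).enorm.measurable.pow_const 2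
          · exact (((huc.comp (by fun_prop)).sub (huc.comp (by fun_prop))).enorm.measurable.pow_const
              2).add (((huc.comp (by fun_prop)).sub
              (huc.comp (by fun_prop))).enorm.measurable.pow_const 2)
      _ ≤ 3 * (‖z‖ₑ ^ 2 * P ‖z‖ + ‖z‖ₑ ^ 2 * N ‖z‖ + ‖z‖ₑ ^ 2 * P ‖z‖) := by
          gcongr
      _ = _ := by ring
  have hD : Measurable fun p : E2 × E2 => ‖u (p.1, 0) - u (p.1 + p.2, 0)‖ₑ ^ 2 / ‖p.2‖ₑ ^ 3 :=
    (((huc.comp (by fun_prop)).sub (huc.comp (by fun_prop))).enorm.measurable.pow_const 2).div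
      ((measurable_snd.enorm).pow_const 3)
  calc slob (fun x => u (x, 0))
      = ∫⁻ x : E2, ∫⁻ z : E2, ‖u (x, 0) - u (x + z, 0)‖ₑ ^ 2 / ‖z‖ₑ ^ 3 := by
        refine lintegral_congr fun x => ?_
        rw [← lintegral_add_left_eq_self _ x]
        refine lintegral_congr fun z => ?_
        rw [edist_comm, edist_eq_enorm_sub, add_sub_cancel_left]
    _ = ∫⁻ z : E2, ∫⁻ x : E2, ‖u (x, 0) - u (x + z, 0)‖ₑ ^ 2 / ‖z‖ₑ ^ 3 :=
        lintegral_lintegral_swap hD.aemeasurable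
    _ ≤ ∫⁻ z : E2, 3 * (2 * P ‖z‖ + N ‖z‖) / ENNReal.ofReal ‖z‖ := by
        refine lintegral_mono fun z => ?_
        simp only [div_eq_mul_inv]
        rw [lintegral_mul_const _ (by
          exact ((huc.comp (by fun_prop)).sub (huc.comp (by fun_prop))).enorm.measurable.pow_const 2)]
        rw [← div_eq_mul_inv, ← div_eq_mul_inv, ofReal_norm]
        exact (ENNReal.div_le_div_right (step z) _).trans (sq_mul_div_cube_le (by simp))
    -- The remaining factor 1/|z| is cancelled by the Jacobian `r` of polar coordinates.
    _ = circ * ∫⁻ r in Ioi (0 : ℝ), 3 * (2 * P r + N r) := by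
        rw [lintegral_radial (f := fun r => 3 * (2 * P r + N r) / ENNReal.ofReal r) (by fun_prop)]
        congr 1
        refine setLIntegral_congr_fun measurableSet_Ioi fun r hr => ?_
        exact ENNReal.mul_div_cancel (by simpa using hr) ENNReal.ofReal_ne_top
    _ = circ * (3 * (2 * (∫⁻ r in Ioi (0 : ℝ), P r) + ∫⁻ r in Ioi (0 : ℝ), N r)) := by
        rw [lintegral_const_mul' _ _ (by simp), lintegral_add_right _ hN,
          lintegral_const_mul' _ _ (by simp)]
    _ = _ := by
        have hPi : ∫⁻ r in Ioi (0 : ℝ), P r = hardy * (hardy * ∫⁻ r in Ioi (0 : ℝ), N r) := by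
          simp only [P]
          rw [lintegral_const_mul' _ _ hardy_ne_top, lintegral_lintegral_swap hint.aemeasurable]
          congr 1
          rw [hardy, ← lintegral_mul_const _ (by fun_prop)]
          refine setLIntegral_congr_fun measurableSet_Ioo fun s hs => ?_
          rw [lintegral_const_mul' _ _ ENNReal.ofReal_ne_top, ← lintegral_Ioi_scale hN hs.1,
            ← mul_assoc, ← ENNReal.ofReal_mul (by have := hs.1; positivity)]
          congr 2
          nth_rewrite 3 [← Real.rpow_one s]
          rw [← Real.rpow_add hs.1]
          norm_num
        rw [hPi, traceConst]
        ring

/-- The trace inequality in `L²` in the half space. -/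
lemma lintegral_trace_le (hu : ContDiff ℝ 1 u) : ∫⁻ x : E2, ‖u (x, 0)‖ₑ ^ 2 ≤
    2 * ((∫⁻ t in Ioi (0 : ℝ), ∫⁻ x : E2, ‖u (x, t)‖ₑ ^ 2) +
      ∫⁻ t in Ioi (0 : ℝ), ∫⁻ x : E2, ‖fderiv ℝ u (x, t)‖ₑ ^ 2) := by
  have hm := measurable_enorm_fderiv_sq hu
  have hc := hu.continuous_fderiv one_ne_zero
  have huc := hu.continuous
  have hmu : Measurable fun p => ‖u p‖ₑ ^ 2 := huc.enorm.measurable.pow_const 2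
  have hsub : Ioo (0 : ℝ) 1 ⊆ Ioi 0 := fun t ht => ht.1
  -- The boundary value is compared with the value at every height in (0, 1); integrating over these
  -- heights then yields the bound.
  have h1 : ∀ (x : E2), ∀ t ∈ Ioo (0 : ℝ) 1, ‖u (x, 0)‖ₑ ^ 2 ≤
      2 * (‖u (x, t)‖ₑ ^ 2 + ∫⁻ τ in Ioo (0 : ℝ) 1, ‖fderiv ℝ u (x, τ)‖ₑ ^ 2) := by
    intro x t ht
    have hd : ∀ τ : ℝ, HasDerivAt (fun s : ℝ => u (x, s)) (fderiv ℝ u (x, τ) (0, 1)) τ := fun τ =>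
      (hu.differentiable one_ne_zero _).hasFDerivAt.comp_hasDerivAt τ
        ((hasDerivAt_const τ x).prodMk (hasDerivAt_id τ))
    have h2 := enorm_sub_le_lintegral_deriv hd
      ((hc.comp (by fun_prop)).clm_apply continuous_const) ht.1.le
    have h3 : ‖u (x, t) - u (x, 0)‖ₑ ≤ ∫⁻ τ in Ioo (0 : ℝ) 1, ‖fderiv ℝ u (x, τ)‖ₑ := by
      refine h2.trans ((lintegral_mono_set (Ioo_subset_Ioo_right ht.2.le)).trans
        (lintegral_mono fun τ => ?_))
      refine (ContinuousLinearMap.le_opENorm _ _).trans (le_of_eq ?_)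
      rw [← ofReal_norm ((0 : E2), (1 : ℝ))]
      simp
    have h4 := sq_lintegral_Ioo_le (D := fun s => ‖fderiv ℝ u (x, s)‖ₑ)
      (by exact (hc.comp (by fun_prop)).enorm.measurable)
    have e : u (x, 0) = u (x, t) - (u (x, t) - u (x, 0)) := by abel
    calc ‖u (x, 0)‖ₑ ^ 2 = ‖u (x, t) - (u (x, t) - u (x, 0))‖ₑ ^ 2 := by rw [← e]
      _ ≤ _ := (enorm_sub_sq_le _ _).trans (by gcongr; exact (by gcongr : _ ≤ _).trans h4)
  calc ∫⁻ x : E2, ‖u (x, 0)‖ₑ ^ 2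
      = ∫⁻ t in Ioo (0 : ℝ) 1, ∫⁻ x : E2, ‖u (x, 0)‖ₑ ^ 2 := by simp
    _ ≤ ∫⁻ t in Ioo (0 : ℝ) 1, ∫⁻ x : E2,
          2 * (‖u (x, t)‖ₑ ^ 2 + ∫⁻ τ in Ioo (0 : ℝ) 1, ‖fderiv ℝ u (x, τ)‖ₑ ^ 2) :=
        setLIntegral_mono' measurableSet_Ioo fun t ht => lintegral_mono fun x => h1 x t ht
    _ = 2 * ((∫⁻ t in Ioo (0 : ℝ) 1, ∫⁻ x : E2, ‖u (x, t)‖ₑ ^ 2) +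
          ∫⁻ t in Ioo (0 : ℝ) 1, ∫⁻ x : E2, ‖fderiv ℝ u (x, t)‖ₑ ^ 2) := by
        have e : ∀ t, ∫⁻ x : E2, 2 * (‖u (x, t)‖ₑ ^ 2 +
            ∫⁻ τ in Ioo (0 : ℝ) 1, ‖fderiv ℝ u (x, τ)‖ₑ ^ 2) = 2 * ((∫⁻ x : E2, ‖u (x, t)‖ₑ ^ 2) +
            ∫⁻ t in Ioo (0 : ℝ) 1, ∫⁻ x : E2, ‖fderiv ℝ u (x, t)‖ₑ ^ 2) := fun t => by
          have hmt : Measurable fun x : E2 => ‖u (x, t)‖ₑ ^ 2 :=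
            hmu.comp (by fun_prop : Measurable fun x : E2 => (x, t))
          rw [lintegral_const_mul' _ _ (by simp), lintegral_add_left hmt,
            lintegral_lintegral_swap hm.aemeasurable]
        simp only [e]
        rw [lintegral_const_mul' _ _ (by simp), lintegral_add_right _ measurable_const]
        simp
    _ ≤ _ := by
        gcongr

end

end HalfSpace

/-! ### The trace inequality on a compact surface -/

section SurfaceTrace

variable {G : Type*} [NormedAddCommGroup G]

/-- The squared Sobolev–Slobodeckij seminorm of order `1/2` on `∂U`. -/
def surfSlob (U : Set E3) (g : E3 → G) : ℝ≥0∞ :=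
  ∫⁻ x, ∫⁻ y, ‖g x - g y‖ₑ ^ 2 / edist x y ^ 3 ∂(surf U) ∂(surf U)

variable [NormedSpace ℝ G] [CompleteSpace G]

/-- The squared norm of `H¹(U)`. -/
def sobSq (U : Set E3) (w : E3 → G) : ℝ≥0∞ :=
  (∫⁻ y in U, ‖w y‖ₑ ^ 2) + ∫⁻ y in U, ‖fderiv ℝ w y‖ₑ ^ 2

lemma measurable_slob_integrand {X : Type*} [MeasurableSpace X] [PseudoEMetricSpace X]
    [OpensMeasurableSpace X] [SecondCountableTopology X] {w : X → G} (hw : Continuous w) :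
    Measurable fun p : X × X => ‖w p.1 - w p.2‖ₑ ^ 2 / edist p.1 p.2 ^ 3 :=
  (by fun_prop : Continuous fun p : X × X => ‖w p.1 - w p.2‖ₑ).measurable.pow_const 2 |>.div
    (continuous_edist.measurable.pow_const 3)

lemma measurable_slob_integrand_right {w : E3 → G} (hw : Continuous w) (x : E3) :
    Measurable fun y => ‖w x - w y‖ₑ ^ 2 / edist x y ^ 3 :=
  (continuous_const.sub hw).enorm.measurable.pow_const 2 |>.div
    ((continuous_const.edist continuous_id).measurable.pow_const 3)

namespace Chart

variable {U : Set E3} (c : Chart U)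

/-- Integrals over `U` of functions supported in a chart, in flattening coordinates. -/
lemma setLIntegral_eq (hU : IsOpen U) {F : E3 → ℝ≥0∞} (hm : Measurable F)
    (hF : ∀ y ∉ Metric.ball c.x c.r, F y = 0) :
    ∫⁻ y in U, F y = ∫⁻ t in Ioi (0 : ℝ), ∫⁻ x : E2, F (c.lift (x, t)) := by
  have hpr : (volume : Measure (E2 × ℝ)).restrict (univ ×ˢ Ioi (0 : ℝ)) =
      (volume : Measure E2).prod (volume.restrict (Ioi (0 : ℝ))) := by
    rw [Measure.volume_eq_prod, ← Measure.prod_restrict, Measure.restrict_univ]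
  have hm' : Measurable fun p => F (c.lift p) := hm.comp c.measurableEmbedding_lift.measurable
  rw [← lintegral_prod_symm (fun p : E2 × ℝ => F (c.lift p)) hm'.aemeasurable, ← hpr,
    ← lintegral_indicator hU.measurableSet,
    ← c.measurePreserving_lift.lintegral_comp_emb c.measurableEmbedding_lift,
    ← lintegral_indicator (MeasurableSet.univ.prod measurableSet_Ioi)]
  refine lintegral_congr fun p => ?_
  by_cases hb : c.lift p ∈ Metric.ball c.x c.r
  · have : c.lift p ∈ U ↔ p ∈ univ ×ˢ Ioi (0 : ℝ) := by rw [mem_iff hb, proj_lift]; simp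
    by_cases hp : c.lift p ∈ U
    · simp only [indicator_of_mem hp, indicator_of_mem (this.1 hp)]
    · simp only [indicator_of_notMem hp, indicator_of_notMem fun h => hp (this.2 h)]
  · simp [indicator, hF _ hb]

lemma norm_dlift_le (p : E2 × ℝ) : ‖c.dlift p‖ ≤ 2 + c.lip := by
  refine ContinuousLinearMap.opNorm_le_bound _ (by positivity) fun q => ?_
  rw [dlift_apply, LinearIsometryEquiv.norm_map]
  have h1 : ‖fderiv ℝ c.h p.1 q.1‖ ≤ c.lip * ‖q.1‖ :=
    (fderiv ℝ c.h p.1).le_of_opNorm_le (norm_fderiv_le_of_lipschitz ℝ c.lipschitz) q.1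
  have h2 : ‖q.1‖ ≤ ‖q‖ := norm_fst_le q
  have h3 : ‖q.2‖ ≤ ‖q‖ := norm_snd_le q
  have h4 : ‖fderiv ℝ c.h p.1 q.1 - q.2‖ ≤ c.lip * ‖q.1‖ + ‖q.2‖ :=
    (norm_sub_le _ _).trans (by gcongr)
  have h5 : (c.lip : ℝ) * ‖q.1‖ ≤ c.lip * ‖q‖ := by gcongr
  refine (norm_join_le _).trans ?_
  simp only [Real.norm_eq_abs] at *
  linarith

lemma enorm_fderiv_comp_lift_le {w : E3 → G} (hw : ContDiff ℝ 1 w) (p : E2 × ℝ) :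
    ‖fderiv ℝ (fun p => w (c.lift p)) p‖ₑ ^ 2 ≤
      ENNReal.ofReal ((2 + c.lip) ^ 2) * ‖fderiv ℝ w (c.lift p)‖ₑ ^ 2 := by
  have h : ‖fderiv ℝ (fun p => w (c.lift p)) p‖ ≤ (2 + c.lip) * ‖fderiv ℝ w (c.lift p)‖ := by
    refine ContinuousLinearMap.opNorm_le_bound _ (by positivity) fun q => ?_
    rw [c.fderiv_comp_lift hw]
    calc _ ≤ ‖fderiv ℝ w (c.lift p)‖ * ‖c.dlift p q‖ := ContinuousLinearMap.le_opNorm _ _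
      _ ≤ ‖fderiv ℝ w (c.lift p)‖ * ((2 + c.lip) * ‖q‖) := by
          gcongr
          exact (c.dlift p).le_of_opNorm_le (c.norm_dlift_le p) q
      _ = _ := by ring
  rw [← ofReal_norm, ← ofReal_norm, ← ENNReal.ofReal_pow (by positivity),
    ← ENNReal.ofReal_pow (by positivity), ← ENNReal.ofReal_mul (by positivity), ← mul_pow]
  gcongr

/-- The bound for the density of the surface measure in a chart. -/
def jacBound : ℝ≥0∞ := ENNReal.ofReal (1 + 2 * c.lip)

lemma jacBound_ne_top : c.jacBound ≠ ⊤ := ENNReal.ofReal_ne_top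

lemma ofReal_jac_le (z : E2) : ENNReal.ofReal (c.jac z) ≤ c.jacBound :=
  ENNReal.ofReal_le_ofReal (c.jac_le z)

lemma lintegral_surf_le (hU : IsOpen U) {F : E3 → ℝ≥0∞} (hF : ∀ y ∉ Metric.ball c.x c.r, F y = 0) :
    ∫⁻ y, F y ∂(surf U) ≤ c.jacBound * ∫⁻ z, F (c.gr z) := by
  rw [c.lintegral_surf hU hF, ← lintegral_const_mul' _ _ c.jacBound_ne_top]
  gcongr with z
  exact c.ofReal_jac_le z

lemma edist_le_edist_gr (z w : E2) : edist z w ≤ edist (c.gr z) (c.gr w) := by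
  rw [edist_dist, edist_dist]
  exact ENNReal.ofReal_le_ofReal (c.dist_le_dist_gr z w)

/-- The constant for the part of the Slobodeckij integral away from the diagonal. -/
def farConst : ℝ≥0∞ := (ENNReal.ofReal (c.r / 2) ^ 3)⁻¹

lemma farConst_ne_top : c.farConst ≠ ⊤ := by
  have := c.r_pos
  simp only [farConst, ne_eq, ENNReal.inv_eq_top]
  exact pow_ne_zero _ (by simpa using by linarith)

/-- A point of the support is within r/2 of the centre and `y` is at distance at least `r`, so the
two are at least r/2 apart and the kernel is bounded. -/
lemma far_le {w : E3 → G} (hw : Function.support w ⊆ Metric.ball c.x (c.r / 2)) {x y : E3}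
    (hy : y ∉ Metric.ball c.x c.r) : ‖w x‖ₑ ^ 2 / edist x y ^ 3 ≤ c.farConst * ‖w x‖ₑ ^ 2 := by
  by_cases hx : w x = 0
  · simp [hx]
  · have h1 : dist x c.x < c.r / 2 := hw hx
    have h2 : c.r ≤ dist y c.x := by simpa using hy
    have h3 : c.r / 2 ≤ dist x y := by
      have := dist_triangle y x c.x
      rw [dist_comm y x] at this
      linarith
    rw [div_eq_mul_inv, mul_comm, farConst, edist_dist]
    gcongr

/-- Pairs inside the chart ball are left to the plane. In any other pair `w` vanishes at one of the
points, and `far_le` applies to the other. -/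
lemma slob_integrand_le {w : E3 → G} (hw : Function.support w ⊆ Metric.ball c.x (c.r / 2))
    (x y : E3) : ‖w x - w y‖ₑ ^ 2 / edist x y ^ 3 ≤
      (Metric.ball c.x c.r).indicator (fun x => (Metric.ball c.x c.r).indicator
        (fun y => ‖w x - w y‖ₑ ^ 2 / edist x y ^ 3) y) x +
      c.farConst * (‖w x‖ₑ ^ 2 + ‖w y‖ₑ ^ 2) := by
  have hz : ∀ y ∉ Metric.ball c.x c.r, w y = 0 := fun y hy => by
    by_contra h
    exact hy (Metric.ball_subset_ball (by linarith [c.r_pos]) (hw h))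
  by_cases hx : x ∈ Metric.ball c.x c.r
  · by_cases hy : y ∈ Metric.ball c.x c.r
    · rw [indicator_of_mem hx, indicator_of_mem hy]
      exact le_self_add
    · rw [indicator_of_mem hx, indicator_of_notMem hy, zero_add, hz y hy, sub_zero]
      refine (c.far_le hw hy).trans ?_
      gcongr
      exact le_self_add
  · rw [indicator_of_notMem hx, zero_add, hz x hx, zero_sub, enorm_neg, edist_comm]
    refine (c.far_le hw hx).trans ?_
    gcongr
    exact le_add_self

/-- The parametrization does not decrease distances, so the kernel on the surface is dominated by
the planar one; the two surface integrations cost one factor `jacBound` each. The pairs away from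
the diagonal are absorbed in the `L²` norm because the surface has finite area. -/
lemma surfSlob_le (hU : IsC2 U) {w : E3 → G} (hc : Continuous w)
    (hw : Function.support w ⊆ Metric.ball c.x (c.r / 2)) :
    surfSlob U w ≤ c.jacBound ^ 2 * slob (fun z => w (c.gr z)) +
      2 * c.farConst * surf U univ * ∫⁻ y, ‖w y‖ₑ ^ 2 ∂(surf U) := by
  have := isFiniteMeasure_surf hU
  have hw2 : Measurable fun y => ‖w y‖ₑ ^ 2 := hc.enorm.measurable.pow_const 2
  set S := ∫⁻ y, ‖w y‖ₑ ^ 2 ∂(surf U) with hS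
  let B := Metric.ball c.x c.r
  let K : E3 → E3 → ℝ≥0∞ := fun x y => ‖w x - w y‖ₑ ^ 2 / edist x y ^ 3
  have h1 : ∀ x, ∫⁻ y, B.indicator (fun x => B.indicator (K x) y) x ∂(surf U) ≤
      B.indicator (fun x => c.jacBound * ∫⁻ z', K x (c.gr z')) x := by
    intro x
    by_cases hx : x ∈ B
    · simp only [indicator_of_mem hx]
      refine (c.lintegral_surf_le hU.isOpen fun y hy => indicator_of_notMem hy _).trans ?_
      exact mul_le_mul' le_rfl (lintegral_mono fun z => indicator_le_self _ _ _)
    · simp [indicator_of_notMem hx]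
  have h2 : ∫⁻ x, B.indicator (fun x => c.jacBound * ∫⁻ z', K x (c.gr z')) x ∂(surf U) ≤
      c.jacBound ^ 2 * slob (fun z => w (c.gr z)) := by
    refine (c.lintegral_surf_le hU.isOpen fun y hy => indicator_of_notMem hy _).trans ?_
    rw [sq, mul_assoc]
    refine mul_le_mul' le_rfl ?_
    rw [slob, ← lintegral_const_mul' _ _ c.jacBound_ne_top]
    refine lintegral_mono fun z => (indicator_le_self _ _ _).trans ?_
    simp only [K]
    gcongr with z'
    exact c.edist_le_edist_gr z z'
  have h3 : ∫⁻ x, ∫⁻ y, c.farConst * (‖w x‖ₑ ^ 2 + ‖w y‖ₑ ^ 2) ∂(surf U) ∂(surf U) =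
      2 * c.farConst * surf U univ * S := by
    have : ∀ x, ∫⁻ y, c.farConst * (‖w x‖ₑ ^ 2 + ‖w y‖ₑ ^ 2) ∂(surf U) =
        c.farConst * (surf U univ * ‖w x‖ₑ ^ 2 + S) := fun x => by
      rw [lintegral_const_mul' _ _ c.farConst_ne_top, lintegral_add_left measurable_const,
        lintegral_const, mul_comm (surf U univ)]
    simp only [this]
    rw [lintegral_const_mul' _ _ c.farConst_ne_top, lintegral_add_right _ measurable_const,
      lintegral_const_mul' _ _ (measure_ne_top _ _), lintegral_const, ← hS]
    ring
  calc surfSlob U w ≤ ∫⁻ x, ∫⁻ y, (B.indicator (fun x => B.indicator (K x) y) x +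
        c.farConst * (‖w x‖ₑ ^ 2 + ‖w y‖ₑ ^ 2)) ∂(surf U) ∂(surf U) :=
        lintegral_mono fun x => lintegral_mono fun y => c.slob_integrand_le hw x y
    _ = (∫⁻ x, ∫⁻ y, B.indicator (fun x => B.indicator (K x) y) x ∂(surf U) ∂(surf U)) +
        ∫⁻ x, ∫⁻ y, c.farConst * (‖w x‖ₑ ^ 2 + ‖w y‖ₑ ^ 2) ∂(surf U) ∂(surf U) := by
        rw [← lintegral_add_right]
        · refine lintegral_congr fun x => ?_
          rw [lintegral_add_right]
          exact (hw2.const_add _).const_mul _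
        · exact Measurable.lintegral_prod_right' (f := fun p : E3 × E3 =>
            c.farConst * (‖w p.1‖ₑ ^ 2 + ‖w p.2‖ₑ ^ 2))
            (((hw2.comp measurable_fst).add (hw2.comp measurable_snd)).const_mul _)
    _ ≤ _ := by
        rw [h3]
        gcongr
        exact (lintegral_mono h1).trans h2

/-- The trace inequality for functions supported in a chart. -/
lemma exists_trace_le (hU : IsC2 U) : ∃ C : ℝ≥0∞, C ≠ ⊤ ∧ ∀ w : E3 → G, ContDiff ℝ 1 w →
    tsupport w ⊆ Metric.ball c.x (c.r / 2) →
    (∫⁻ y, ‖w y‖ₑ ^ 2 ∂(surf U)) + surfSlob U w ≤ C * sobSq U w := by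
  have := isFiniteMeasure_surf hU
  have hJ := c.jacBound_ne_top
  have hfar := c.farConst_ne_top
  have hsig : surf U univ ≠ ⊤ := measure_ne_top _ _
  have htc := traceConst_ne_top
  set L : ℝ≥0∞ := ENNReal.ofReal ((2 + c.lip) ^ 2) with hL
  have hL1 : 1 ≤ L := by
    rw [hL, ENNReal.one_le_ofReal]
    have : (0 : ℝ) ≤ c.lip := c.lip.2
    nlinarith
  have hLt : L ≠ ⊤ := ENNReal.ofReal_ne_top
  set D : ℝ≥0∞ := c.jacBound * (2 * L) with hD
  refine ⟨D + (c.jacBound ^ 2 * (traceConst * L) + 2 * c.farConst * surf U univ * D),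
    by finiteness, fun w hw hs => ?_⟩
  have hsup : Function.support w ⊆ Metric.ball c.x (c.r / 2) := (subset_tsupport _).trans hs
  have hsub : Metric.ball c.x (c.r / 2) ⊆ Metric.ball c.x c.r :=
    Metric.ball_subset_ball (by linarith [c.r_pos])
  have hz : ∀ y ∉ Metric.ball c.x c.r, w y = 0 := fun y hy => by
    by_contra h
    exact hy (hsub (hsup h))
  have hz' : ∀ y ∉ Metric.ball c.x c.r, fderiv ℝ w y = 0 := fun y hy =>
    fderiv_of_notMem_tsupport (𝕜 := ℝ) fun h => hy (hsub (hs h))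
  have hu := c.contDiff_comp_lift hw
  have e1 := c.setLIntegral_eq hU.isOpen (F := fun y => ‖w y‖ₑ ^ 2)
    (hw.continuous.enorm.measurable.pow_const 2) (fun y hy => by simp [hz y hy])
  have e2 := c.setLIntegral_eq hU.isOpen (F := fun y => ‖fderiv ℝ w y‖ₑ ^ 2)
    ((hw.continuous_fderiv one_ne_zero).enorm.measurable.pow_const 2)
    (fun y hy => by
      rw [← ofReal_norm, hz' y hy, norm_zero, ENNReal.ofReal_zero, zero_pow two_ne_zero])
  have e3 : ∫⁻ t in Ioi (0 : ℝ), ∫⁻ x : E2, ‖fderiv ℝ (fun p => w (c.lift p)) (x, t)‖ₑ ^ 2 ≤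
      L * ∫⁻ y in U, ‖fderiv ℝ w y‖ₑ ^ 2 := by
    rw [e2, ← lintegral_const_mul' _ _ hLt]
    gcongr with t
    rw [← lintegral_const_mul' _ _ hLt]
    gcongr with x
    exact c.enorm_fderiv_comp_lift_le hw (x, t)
  have h1 : ∫⁻ y, ‖w y‖ₑ ^ 2 ∂(surf U) ≤ D * sobSq U w := by
    refine (c.lintegral_surf_le hU.isOpen fun y hy => by simp [hz y hy]).trans ?_
    rw [hD, mul_assoc]
    gcongr
    refine (lintegral_trace_le hu).trans ?_
    rw [mul_assoc]
    gcongr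
    rw [sobSq, mul_add]
    refine add_le_add ?_ e3
    rw [e1]
    exact le_mul_of_one_le_left (zero_le) hL1
  have h2 : slob (fun z => w (c.gr z)) ≤ traceConst * L * sobSq U w := by
    refine (slob_trace_le hu).trans ?_
    rw [mul_assoc]
    gcongr
    refine e3.trans ?_
    gcongr
    exact le_add_self
  calc (∫⁻ y, ‖w y‖ₑ ^ 2 ∂(surf U)) + surfSlob U w
      ≤ D * sobSq U w + (c.jacBound ^ 2 * (traceConst * L * sobSq U w) +
        2 * c.farConst * surf U univ * (D * sobSq U w)) := by
        refine add_le_add h1 ((c.surfSlob_le hU hw.continuous hsup).trans ?_)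
        gcongr
    _ = _ := by ring

end Chart

lemma enorm_fderiv_sq_le (φ : E3 → G) (y : E3) :
    ‖fderiv ℝ φ y‖ₑ ^ 2 ≤ 3 * ∑ j, ‖pd j φ y‖ₑ ^ 2 := by
  set A := fderiv ℝ φ y with hA
  have h1 : A = ∑ j, (EuclideanSpace.proj (𝕜 := ℝ) j : E3 →L[ℝ] ℝ).smulRight (pd j φ y) := by
    ext v
    have : v = ∑ j, v j • EuclideanSpace.single j (1 : ℝ) := by
      ext k
      simp [Finset.sum_apply, Pi.single_apply]
    conv_lhs => rw [this]
    simp [pd, ← hA]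
  have h2 := enorm_sum_sq_le Finset.univ fun j =>
    (EuclideanSpace.proj (𝕜 := ℝ) j : E3 →L[ℝ] ℝ).smulRight (pd j φ y)
  rw [← h1] at h2
  refine h2.trans ?_
  simp only [Finset.card_univ, Fintype.card_fin, Nat.cast_ofNat]
  gcongr with j
  rw [← ofReal_norm, ← ofReal_norm]
  refine ENNReal.ofReal_le_ofReal (ContinuousLinearMap.opNorm_le_bound _ (norm_nonneg _) fun v => ?_)
  rw [ContinuousLinearMap.smulRight_apply, norm_smul, mul_comm]
  gcongr
  exact PiLp.norm_apply_le v j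

lemma sobSq_smul_le {U : Set E3} {χ : E3 → ℝ} (hχ : ContDiff ℝ 1 χ) {M : ℝ} (hM : ∀ y, |χ y| ≤ M)
    (hM' : ∀ y, ‖fderiv ℝ χ y‖ ≤ M) {φ : E3 → G} (hφ : ContDiff ℝ 1 φ) :
    sobSq U (fun y => χ y • φ y) ≤ 3 * ENNReal.ofReal (M ^ 2) * sobSq U φ := by
  have hM0 : 0 ≤ M := (abs_nonneg _).trans (hM 0)
  have h1 : ∀ y, ‖χ y • φ y‖ₑ ^ 2 ≤ ENNReal.ofReal (M ^ 2) * ‖φ y‖ₑ ^ 2 := fun y => by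
    rw [enorm_smul, mul_pow, ENNReal.ofReal_pow hM0]
    gcongr
    rw [← ofReal_norm]
    exact ENNReal.ofReal_le_ofReal (hM y)
  have h2 : ∀ y, ‖fderiv ℝ (fun y => χ y • φ y) y‖ₑ ^ 2 ≤
      2 * ENNReal.ofReal (M ^ 2) * (‖fderiv ℝ φ y‖ₑ ^ 2 + ‖φ y‖ₑ ^ 2) := fun y => by
    rw [fderiv_fun_smul (hχ.differentiable one_ne_zero y) (hφ.differentiable one_ne_zero y)]
    refine (enorm_add_sq_le _ _).trans ?_
    rw [mul_assoc, mul_add (ENNReal.ofReal _)]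
    refine mul_le_mul_right (add_le_add ?_ ?_) 2
    · rw [enorm_smul, mul_pow, ENNReal.ofReal_pow hM0]
      gcongr
      rw [← ofReal_norm]
      exact ENNReal.ofReal_le_ofReal (hM y)
    · rw [← ofReal_norm, ContinuousLinearMap.norm_smulRight_apply,
        ENNReal.ofReal_mul (norm_nonneg _), mul_pow, ENNReal.ofReal_pow hM0, ofReal_norm (φ y)]
      gcongr
      exact hM' y
  have m1 : Measurable fun y => ‖fderiv ℝ φ y‖ₑ ^ 2 :=
    (hφ.continuous_fderiv one_ne_zero).enorm.measurable.pow_const 2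
  calc sobSq U (fun y => χ y • φ y)
      ≤ (∫⁻ y in U, ENNReal.ofReal (M ^ 2) * ‖φ y‖ₑ ^ 2) +
        ∫⁻ y in U, 2 * ENNReal.ofReal (M ^ 2) * (‖fderiv ℝ φ y‖ₑ ^ 2 + ‖φ y‖ₑ ^ 2) :=
        add_le_add (lintegral_mono h1) (lintegral_mono h2)
    _ = ENNReal.ofReal (M ^ 2) * (∫⁻ y in U, ‖φ y‖ₑ ^ 2) + 2 * ENNReal.ofReal (M ^ 2) *
        ((∫⁻ y in U, ‖fderiv ℝ φ y‖ₑ ^ 2) + ∫⁻ y in U, ‖φ y‖ₑ ^ 2) := by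
        rw [lintegral_const_mul' _ _ ENNReal.ofReal_ne_top, lintegral_const_mul' _ _ (by finiteness),
          lintegral_add_left m1]
    _ = 3 * ENNReal.ofReal (M ^ 2) * (∫⁻ y in U, ‖φ y‖ₑ ^ 2) +
        2 * ENNReal.ofReal (M ^ 2) * (∫⁻ y in U, ‖fderiv ℝ φ y‖ₑ ^ 2) := by ring
    _ ≤ _ := by
        rw [sobSq, mul_add]
        gcongr
        norm_num

/-- The trace inequality. -/
theorem exists_trace_le {U : Set E3} (hU : IsC2 U) : ∃ C : ℝ≥0∞, C ≠ ⊤ ∧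
    ∀ φ : E3 → G, ContDiff ℝ 1 φ →
      (∫⁻ y, ‖φ y‖ₑ ^ 2 ∂(surf U)) + surfSlob U φ ≤ C * sobSq U φ := by
  obtain ⟨T⟩ := hU.nonempty_atlas
  have := isFiniteMeasure_surf hU
  obtain ⟨M, hM⟩ := T.exists_bound
  choose C hC hCle using fun i => (T.c i).exists_trace_le (G := G) hU
  set N : ℝ≥0∞ := (((Finset.univ : Finset T.ι).card : ℕ) : ℝ≥0∞) with hN
  have hNt : N ≠ ⊤ := by simp [hN]
  refine ⟨N * ∑ i, C i * (3 * ENNReal.ofReal (M ^ 2)), ?_, fun φ hφ => ?_⟩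
  · refine ENNReal.mul_ne_top hNt (ENNReal.sum_ne_top.2 fun i _ => ?_)
    have := hC i
    finiteness
  let w : T.ι → E3 → G := fun i y => T.χ (some i) y • φ y
  have hw : ∀ i, ContDiff ℝ 1 (w i) := fun i => ((T.contDiff _).of_le (by simp)).smul hφ
  have hs : ∀ i, tsupport (w i) ⊆ Metric.ball (T.c i).x ((T.c i).r / 2) := fun i =>
    (closure_mono (Function.support_smul_subset_left _ _)).trans (T.tsupport_some i)
  -- The interior member of the partition vanishes on the boundary, so there the chart members alone
  -- add up to one.
  have hsum : ∀ y ∈ frontier U, φ y = ∑ i, w i y := fun y hy => by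
    have h1 := T.sum_eq y
    rw [Fintype.sum_option, image_eq_zero_of_notMem_tsupport fun h => T.tsupport_none h hy,
      zero_add] at h1
    simp only [w, ← Finset.sum_smul, h1, one_smul]
  have h1 : ∫⁻ y, ‖φ y‖ₑ ^ 2 ∂(surf U) ≤ N * ∑ i, ∫⁻ y, ‖w i y‖ₑ ^ 2 ∂(surf U) := by
    rw [← lintegral_finsetSum _ fun i _ => (hw i).continuous.enorm.measurable.pow_const 2,
      ← lintegral_const_mul' _ _ hNt]
    refine lintegral_mono_ae ?_
    filter_upwards [ae_surf_mem] with y hy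
    rw [hsum y hy]
    exact enorm_sum_sq_le _ _
  have h2 : surfSlob U φ ≤ N * ∑ i, surfSlob U (w i) := by
    simp only [surfSlob]
    rw [← lintegral_finsetSum _ fun i _ =>
      (measurable_slob_integrand (hw i).continuous).lintegral_prod_right',
      ← lintegral_const_mul' _ _ hNt]
    refine lintegral_mono_ae ?_
    filter_upwards [ae_surf_mem] with x hx
    have hmx : ∀ i, Measurable fun y => ‖w i x - w i y‖ₑ ^ 2 / edist x y ^ 3 := fun i =>
      measurable_slob_integrand_right (hw i).continuous x
    rw [← lintegral_finsetSum _ fun i _ => hmx i, ← lintegral_const_mul' _ _ hNt]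
    refine lintegral_mono_ae ?_
    filter_upwards [ae_surf_mem] with y hy
    simp only [div_eq_mul_inv, ← Finset.sum_mul]
    rw [hsum x hx, hsum y hy, ← Finset.sum_sub_distrib, ← mul_assoc]
    gcongr
    exact enorm_sum_sq_le _ _
  calc (∫⁻ y, ‖φ y‖ₑ ^ 2 ∂(surf U)) + surfSlob U φ
      ≤ N * ∑ i, ((∫⁻ y, ‖w i y‖ₑ ^ 2 ∂(surf U)) + surfSlob U (w i)) := by
        rw [Finset.sum_add_distrib, mul_add]
        exact add_le_add h1 h2
    _ ≤ N * ∑ i, C i * (3 * ENNReal.ofReal (M ^ 2) * sobSq U φ) := by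
        gcongr with i
        refine (hCle i _ (hw i) (hs i)).trans ?_
        gcongr
        exact sobSq_smul_le ((T.contDiff _).of_le (by simp)) (fun y => (hM _ y).1)
          (fun y => (hM _ y).2) hφ
    _ = _ := by
        rw [mul_assoc N, Finset.sum_mul]
        simp only [mul_assoc]

end SurfaceTrace

/-! ### Weak derivatives and traces -/

section Traces

lemma tendsto_zero_of_sq {ι : Type*} {l : Filter ι} {a : ι → ℝ≥0∞}
    (h : Tendsto (fun i => a i ^ 2) l (𝓝 0)) : Tendsto a l (𝓝 0) := by
  have h1 := (ENNReal.continuous_rpow_const (y := 1 / 2)).tendsto 0 |>.comp h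
  simp only [Function.comp_def, ← ENNReal.rpow_two, ← ENNReal.rpow_mul] at h1
  simpa using h1

lemma exists_limit_of_cauchy {α E : Type*} [MeasurableSpace α] {μ : Measure α}
    [NormedAddCommGroup E] [CompleteSpace E] {f : ℕ → α → E} (hf : ∀ n, MemLp (f n) 2 μ)
    (h : Tendsto (fun p : ℕ × ℕ => eLpNorm (f p.1 - f p.2) 2 μ) atTop (𝓝 0)) :
    ∃ g, MemLp g 2 μ ∧ Tendsto (fun n => eLpNorm (f n - g) 2 μ) atTop (𝓝 0) := by
  have hc : CauchySeq fun n => (hf n).toLp (f n) := by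
    rw [EMetric.cauchySeq_iff]
    intro ε hε
    rw [ENNReal.tendsto_atTop_zero] at h
    obtain ⟨b, hb0, hb⟩ := exists_between hε
    obtain ⟨⟨N, M⟩, hN⟩ := h b hb0
    refine ⟨max N M, fun m hm n hn => ?_⟩
    rw [Lp.edist_toLp_toLp]
    exact (hN (m, n) ⟨(le_max_left _ _).trans hm, (le_max_right _ _).trans hn⟩).trans_lt hb
  obtain ⟨g, hg⟩ := cauchySeq_tendsto_of_complete hc
  refine ⟨g, Lp.memLp g, ?_⟩
  rw [Lp.tendsto_Lp_iff_tendsto_eLpNorm'] at hg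
  refine hg.congr fun n => eLpNorm_congr_ae ?_
  filter_upwards [(hf n).coeFn_toLp] with x hx
  simp [hx]

lemma setIntegral_test {G : Type*} [NormedAddCommGroup G] [NormedSpace ℝ G] {U : Set E3}
    {φ : E3 → ℝ} (h : tsupport φ ⊆ U) (f : E3 → G) : ∫ x in U, φ x • f x = ∫ x, φ x • f x :=
  setIntegral_eq_integral_of_forall_compl_eq_zero fun x hx => by
    rw [image_eq_zero_of_notMem_tsupport fun hx' => hx (h hx'), zero_smul]

lemma ae_eq_of_forall_test {U : Set E3} (hU : IsOpen U) {f g : E3 → C4}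
    (hf : MemLp f 2 (volume.restrict U)) (hg : MemLp g 2 (volume.restrict U))
    (h : ∀ φ : E3 → ℝ, IsTest U φ → ∫ x in U, φ x • f x = ∫ x in U, φ x • g x) :
    f =ᵐ[volume.restrict U] g := by
  have hfg := hf.sub hg
  have hl : LocallyIntegrableOn (f - g) U volume := by
    exact locallyIntegrableOn_of_locallyIntegrable_restrict (hfg.locallyIntegrable (by norm_num))
  have := hU.ae_eq_zero_of_integral_contDiff_smul_eq_zero hl fun φ h1 h2 h3 => by
    have ht : IsTest U φ := ⟨h1, h2, h3⟩
    rw [← setIntegral_test h3]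
    simp only [Pi.sub_apply, smul_sub]
    rw [integral_sub (ht.integrable hf) (ht.integrable hg), h φ ht, sub_self]
  rw [Filter.EventuallyEq, ae_restrict_iff' hU.measurableSet]
  filter_upwards [this] with x hx hxU
  exact sub_eq_zero.1 (hx hxU)

lemma IsWeakPD.ae_eq {U : Set E3} (hU : IsOpen U) {j : Fin 3} {f d d' : E3 → C4}
    (hd : MemLp d 2 (volume.restrict U)) (hd' : MemLp d' 2 (volume.restrict U))
    (h : IsWeakPD U j f d) (h' : IsWeakPD U j f d') : d =ᵐ[volume.restrict U] d' :=
  ae_eq_of_forall_test hU hd hd' fun φ hφ => (h φ hφ).trans (h' φ hφ).symm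

lemma isWeakPD_of_contDiff {U : Set E3} {φ : E3 → C4} (hφ : ContDiff ℝ 1 φ) (j : Fin 3) :
    IsWeakPD U j φ (pd j φ) := by
  intro ψ hψ
  have hψ1 : ContDiff ℝ 1 ψ := hψ.1.of_le (by simp)
  have hc' : HasCompactSupport (pd j ψ) := hψ.2.1.fderiv_apply ℝ _
  have hs' : tsupport (pd j ψ) ⊆ U :=
    ((closure_mono fun x hx => by
      by_contra h
      exact hx (by rw [pd, fderiv_of_notMem_tsupport (𝕜 := ℝ) h]; rfl)).trans
      (isClosed_tsupport ψ).closure_subset).trans hψ.2.2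
  rw [setIntegral_test hψ.2.2, setIntegral_test hs', ← sub_eq_zero, sub_neg_eq_add,
    ← integral_add, ← integral_fderiv_eq_zero (μ := volume) (hψ1.smul hφ)
      (hψ.2.1.smul_right (f' := φ)) (EuclideanSpace.single j 1)]
  · refine integral_congr_ae (ae_of_all _ fun x => ?_)
    simp only [pd]
    rw [fderiv_smul (hψ1.differentiable one_ne_zero x) (hφ.differentiable one_ne_zero x)]
    simp
  · exact (hψ.1.continuous.smul (continuous_pd j hφ)).integrable_of_hasCompactSupport
      hψ.2.1.smul_right
  · exact ((hψ.continuous_pd j).smul hφ.continuous).integrable_of_hasCompactSupport hc'.smul_right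

/-- Testing is continuous with respect to convergence in `L²`. -/
lemma tendsto_setIntegral_smul {U : Set E3} {ψ : E3 → ℝ} (hψ : Continuous ψ)
    (hc : HasCompactSupport ψ) {u : ℕ → E3 → C4} {f : E3 → C4}
    (hu : ∀ n, MemLp (u n) 2 (volume.restrict U)) (hf : MemLp f 2 (volume.restrict U))
    (h : Tendsto (fun n => eLpNorm (u n - f) 2 (volume.restrict U)) atTop (𝓝 0)) :
    Tendsto (fun n => ∫ x in U, ψ x • u n x) atTop (𝓝 (∫ x in U, ψ x • f x)) := by
  have hp : MemLp ψ 2 (volume.restrict U) :=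
    (hψ.memLp_of_hasCompactSupport hc (p := 2) (μ := volume)).restrict U
  refine tendsto_integral_of_L1 _ (integrable_smul hψ hc hf).1
    (Eventually.of_forall fun n => integrable_smul hψ hc (hu n)) ?_
  have h1 := ENNReal.Tendsto.const_mul (a := eLpNorm ψ 2 (volume.restrict U)) h
    (Or.inr hp.eLpNorm_ne_top)
  rw [mul_zero] at h1
  refine tendsto_of_tendsto_of_tendsto_of_le_of_le tendsto_const_nhds h1 (fun _ => zero_le)
    fun n => ?_
  have := eLpNorm_smul_le_mul_eLpNorm (p := 2) (q := 2) (r := 1) ((hu n).sub hf).1 hp.1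
  rw [eLpNorm_one_eq_lintegral_enorm] at this
  simpa [smul_sub] using this

lemma IsWeakPD.of_tendsto {U : Set E3} {j : Fin 3} {φ e : ℕ → E3 → C4} {f d : E3 → C4}
    (hφ : ∀ n, IsWeakPD U j (φ n) (e n)) (hu : ∀ n, MemLp (φ n) 2 (volume.restrict U))
    (hu' : ∀ n, MemLp (e n) 2 (volume.restrict U))
    (hf : MemLp f 2 (volume.restrict U)) (hd : MemLp d 2 (volume.restrict U))
    (h : Tendsto (fun n => eLpNorm (φ n - f) 2 (volume.restrict U)) atTop (𝓝 0))
    (h' : Tendsto (fun n => eLpNorm (e n - d) 2 (volume.restrict U)) atTop (𝓝 0)) :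
    IsWeakPD U j f d := by
  intro ψ hψ
  have h1 := tendsto_setIntegral_smul hψ.1.continuous hψ.2.1 hu' hd h'
  have h2 := (tendsto_setIntegral_smul (hψ.continuous_pd j) (hψ.2.1.fderiv_apply ℝ _) hu hf h).neg
  exact tendsto_nhds_unique h1 (h2.congr fun n => (hφ n ψ hψ).symm)

lemma pd_sub' {φ ψ : E3 → C4} (hφ : ContDiff ℝ 1 φ) (hψ : ContDiff ℝ 1 ψ) (j : Fin 3) :
    pd j (φ - ψ) = pd j φ - pd j ψ := by
  ext1 x
  simp [pd, fderiv_sub (hφ.differentiable one_ne_zero x) (hψ.differentiable one_ne_zero x)]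

/-- The distance in `H¹(U)` between a `C¹` function and a function `f` with weak gradient `d`. -/
def h1Err (U : Set E3) (φ f : E3 → C4) (d : Fin 3 → E3 → C4) : ℝ≥0∞ :=
  eLpNorm (φ - f) 2 (volume.restrict U) + ∑ j, eLpNorm (pd j φ - d j) 2 (volume.restrict U)

lemma sobSq_le_h1Err {U : Set E3} {φ : E3 → C4} (hφ : ContDiff ℝ 1 φ) :
    sobSq U φ ≤ 3 * h1Err U φ 0 0 ^ 2 := by
  have h1 : sobSq U φ ≤ eLpNorm φ 2 (volume.restrict U) ^ 2 +
      3 * ∑ j, eLpNorm (pd j φ) 2 (volume.restrict U) ^ 2 := by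
    simp only [eLpNorm_two_sq, sobSq]
    gcongr
    rw [← lintegral_finsetSum _ fun j _ => (continuous_pd j hφ).enorm.measurable.pow_const 2,
      ← lintegral_const_mul' _ _ (by simp)]
    exact lintegral_mono fun y => enorm_fderiv_sq_le φ y
  refine h1.trans ?_
  simp only [h1Err, sub_zero, Pi.zero_apply, Fin.sum_univ_three]
  generalize eLpNorm φ 2 (volume.restrict U) = a
  generalize eLpNorm (pd 0 φ) 2 (volume.restrict U) = b₀
  generalize eLpNorm (pd 1 φ) 2 (volume.restrict U) = b₁
  generalize eLpNorm (pd 2 φ) 2 (volume.restrict U) = b₂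
  have e : 3 * (a + (b₀ + b₁ + b₂)) ^ 2 = a ^ 2 + 3 * (b₀ ^ 2 + b₁ ^ 2 + b₂ ^ 2) +
      (2 * a ^ 2 + 6 * (a * b₀ + a * b₁ + a * b₂ + b₀ * b₁ + b₀ * b₂ + b₁ * b₂)) := by ring
  rw [e]
  exact le_self_add

lemma eLpNorm_sq_le_sobSq (U : Set E3) (φ : E3 → C4) :
    eLpNorm φ 2 (volume.restrict U) ^ 2 ≤ sobSq U φ := by
  rw [eLpNorm_two_sq]
  exact le_self_add

lemma eLpNorm_pd_sq_le_sobSq (U : Set E3) (φ : E3 → C4) (j : Fin 3) :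
    eLpNorm (pd j φ) 2 (volume.restrict U) ^ 2 ≤ sobSq U φ := by
  rw [eLpNorm_two_sq]
  refine le_trans (lintegral_mono fun y => ?_) le_add_self
  gcongr
  rw [← ofReal_norm, ← ofReal_norm]
  exact ENNReal.ofReal_le_ofReal (norm_pd_le j φ y)

lemma h1Err_sub_le {U : Set E3} {φ ψ f : E3 → C4} {d : Fin 3 → E3 → C4} (hφ : ContDiff ℝ 1 φ)
    (hψ : ContDiff ℝ 1 ψ) (hf : MemLp f 2 (volume.restrict U))
    (hd : ∀ j, MemLp (d j) 2 (volume.restrict U)) :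
    h1Err U (φ - ψ) 0 0 ≤ h1Err U φ f d + h1Err U ψ f d := by
  have key : ∀ {a b c : E3 → C4}, Continuous a → Continuous b → MemLp c 2 (volume.restrict U) →
      eLpNorm (a - b) 2 (volume.restrict U) ≤ eLpNorm (a - c) 2 (volume.restrict U) +
        eLpNorm (b - c) 2 (volume.restrict U) := fun {a b c} ha hb hc => by
    have e : a - b = (a - c) - (b - c) := by abel
    rw [e]
    exact eLpNorm_sub_le (ha.aestronglyMeasurable.sub hc.1) (hb.aestronglyMeasurable.sub hc.1)
      (by norm_num)
  simp only [h1Err, sub_zero, Pi.zero_apply]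
  rw [add_add_add_comm, ← Finset.sum_add_distrib]
  refine add_le_add (key hφ.continuous hψ.continuous hf) (Finset.sum_le_sum fun j _ => ?_)
  rw [pd_sub' hφ hψ]
  exact key (continuous_pd j hφ) (continuous_pd j hψ) (hd j)

lemma exists_trace_norm_le {U : Set E3} (hU : IsC2 U) : ∃ K : ℝ≥0∞, K ≠ ⊤ ∧
    ∀ φ : E3 → C4, ContDiff ℝ 1 φ → eLpNorm φ 2 (surf U) ≤ K * h1Err U φ 0 0 ∧
      surfSlob U φ ≤ K * h1Err U φ 0 0 ^ 2 := by
  obtain ⟨C, hC, h⟩ := exists_trace_le (G := C4) hU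
  -- One constant serves both bounds: the norm bound needs K² ≥ 3C and the seminorm bound needs K ≥
  -- 3C.
  refine ⟨C * 3 + 1, by finiteness, fun φ hφ => ?_⟩
  have h1 : C * sobSq U φ ≤ C * 3 * h1Err U φ 0 0 ^ 2 := by
    rw [mul_assoc]
    gcongr
    exact sobSq_le_h1Err hφ
  constructor
  · refine eLpNorm_two_le ?_
    refine (le_self_add.trans (h φ hφ)).trans (h1.trans ?_)
    rw [mul_pow]
    gcongr
    rw [show (C * 3 + 1) ^ 2 = C * 3 + (C * 3 * (C * 3) + C * 3 + 1) by ring]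
    exact le_self_add
  · refine (le_add_self.trans (h φ hφ)).trans (h1.trans ?_)
    gcongr
    exact le_self_add

/-- Density of test functions in H¹(U). The gradient is the first order system with zero `B` whose
`A j` places its argument in the slot `j` of the triple, so the general approximation theorem
applies. -/
lemma exists_h1Err_le {U : Set E3} (hU : IsC2 U) {f : E3 → C4} {d : Fin 3 → E3 → C4}
    (hf : MemLp f 2 (volume.restrict U)) (hd : ∀ j, MemLp (d j) 2 (volume.restrict U))
    (hw : ∀ j, IsWeakPD U j f (d j)) {ε : ℝ≥0∞} (hε : ε ≠ 0) :
    ∃ ψ, IsTest univ ψ ∧ h1Err U ψ f d ≤ ε := by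
  let A : Fin 3 → C4 →L[ℝ] (Fin 3 → C4) := ContinuousLinearMap.single ℝ (fun _ => C4)
  let g : E3 → Fin 3 → C4 := fun x j => d j x
  have hg : MemLp g 2 (volume.restrict U) := memLp_pi_iff.2 hd
  have hop : IsWeakOp A 0 U f g := by
    intro φ hφ
    have e : ∀ x, (φ x • g x + ∑ j, pd j φ x • A j (f x) - φ x • (0 : C4 →L[ℝ] (Fin 3 → C4)) (f x))
        = fun k => φ x • d k x + pd k φ x • f x := fun x => by
      funext k
      simp [A, g, Finset.sum_apply, Pi.single_apply]
    simp only [e]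
    have hi : ∀ k, IntegrableOn (fun x => φ x • d k x + pd k φ x • f x) U := fun k =>
      (hφ.integrable (hd k)).add (hφ.integrable_pd k hf)
    funext k
    rw [eval_integral fun k => hi k, integral_add (hφ.integrable (hd k)) (hφ.integrable_pd k hf),
      hw k φ hφ, neg_add_cancel]
    rfl
  obtain ⟨ψ, hψ, h1, h2⟩ := exists_test_approx hU hop hf hg (ε := ε / 4) (by simp [hε])
  refine ⟨ψ, hψ, ?_⟩
  have h3 : ∀ j, eLpNorm (pd j ψ - d j) 2 (volume.restrict U) ≤ ε / 4 := fun j => by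
    refine le_trans (eLpNorm_mono fun x => ?_) h2
    have e : opApply A 0 ψ x - g x = fun k => pd k ψ x - d k x := by
      funext k
      simp [opApply, A, g, Finset.sum_apply, Pi.single_apply]
    rw [Pi.sub_apply, Pi.sub_apply, e]
    exact norm_le_pi_norm (fun k => pd k ψ x - d k x) j
  calc h1Err U ψ f d ≤ ε / 4 + ∑ _j : Fin 3, ε / 4 := add_le_add h1 (Finset.sum_le_sum fun j _ => h3 j)
    _ = 4 * (ε / 4) := by simp only [Fin.sum_univ_three]; ring
    _ = ε := ENNReal.mul_div_cancel (by simp) (by simp)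

lemma tendsto_h1Err {U : Set E3} {φ : ℕ → E3 → C4} {f : E3 → C4} {d : Fin 3 → E3 → C4}
    (h0 : Tendsto (fun n => eLpNorm (φ n - f) 2 (volume.restrict U)) atTop (𝓝 0))
    (h1 : ∀ j, Tendsto (fun n => eLpNorm (pd j (φ n) - d j) 2 (volume.restrict U)) atTop (𝓝 0)) :
    Tendsto (fun n => h1Err U (φ n) f d) atTop (𝓝 0) := by
  have := h0.add (tendsto_finsetSum Finset.univ fun j _ => h1 j)
  simpa [h1Err] using this

lemma h1Tendsto_of_h1Err {U : Set E3} {φ : ℕ → E3 → C4} {f : E3 → C4} {d : Fin 3 → E3 → C4}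
    (hd : ∀ j, MemLp (d j) 2 (volume.restrict U)) (hw : ∀ j, IsWeakPD U j f (d j))
    (h : Tendsto (fun n => h1Err U (φ n) f d) atTop (𝓝 0)) : H1Tendsto U φ f := by
  refine ⟨tendsto_of_tendsto_of_tendsto_of_le_of_le tendsto_const_nhds h (fun _ => zero_le)
    fun n => le_self_add, fun j => ⟨d j, hd j, hw j, ?_⟩⟩
  refine tendsto_of_tendsto_of_tendsto_of_le_of_le tendsto_const_nhds h (fun _ => zero_le)
    fun n => ?_
  exact (Finset.single_le_sum (f := fun j => eLpNorm (pd j (φ n) - d j) 2 (volume.restrict U))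
    (fun _ _ => zero_le) (Finset.mem_univ j)).trans le_add_self

lemma H1Tendsto.exists_h1Err {U : Set E3} {φ : ℕ → E3 → C4} {f : E3 → C4} (h : H1Tendsto U φ f) :
    ∃ d : Fin 3 → E3 → C4, (∀ j, MemLp (d j) 2 (volume.restrict U)) ∧
      (∀ j, IsWeakPD U j f (d j)) ∧ Tendsto (fun n => h1Err U (φ n) f d) atTop (𝓝 0) := by
  choose d hd hw ht using h.2
  exact ⟨d, hd, hw, tendsto_h1Err h.1 ht⟩

lemma h1Err_congr {U : Set E3} {φ f : E3 → C4} {d d' : Fin 3 → E3 → C4}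
    (h : ∀ j, d j =ᵐ[volume.restrict U] d' j) : h1Err U φ f d = h1Err U φ f d' := by
  unfold h1Err
  congr 1
  refine Finset.sum_congr rfl fun j _ => eLpNorm_congr_ae ?_
  filter_upwards [h j] with x hx
  simp [hx]

lemma memLp_of_test {F : Type*} [NormedAddCommGroup F] {φ : E3 → F} (hφ : Continuous φ)
    (hc : HasCompactSupport φ) (μ : Measure E3) [IsFiniteMeasureOnCompacts μ] : MemLp φ 2 μ :=
  hφ.memLp_of_hasCompactSupport hc

/-- A trace may be computed with continuously differentiable approximations. -/
lemma hasTrace_of_tendsto {U : Set E3} (hU : IsC2 U) {φ : ℕ → E3 → C4} {f g : E3 → C4}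
    {d : Fin 3 → E3 → C4} (hφ : ∀ n, ContDiff ℝ 1 (φ n)) (hf : MemLp f 2 (volume.restrict U))
    (hd : ∀ j, MemLp (d j) 2 (volume.restrict U)) (hw : ∀ j, IsWeakPD U j f (d j))
    (h : Tendsto (fun n => h1Err U (φ n) f d) atTop (𝓝 0)) (hgm : AEStronglyMeasurable g (surf U))
    (hg : Tendsto (fun n => eLpNorm (φ n - g) 2 (surf U)) atTop (𝓝 0)) : HasTrace U U f g := by
  obtain ⟨K, hK, hKle⟩ := exists_trace_norm_le hU
  have hε : ∀ n : ℕ, ((n : ℝ≥0∞) + 1)⁻¹ ≠ 0 := fun n => by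
    simp only [ne_eq, ENNReal.inv_eq_zero]; finiteness
  -- The given sequence is only C¹ and need not have compact support. Test functions approximating
  -- `f` in H¹(U) replace it, and the trace inequality carries the convergence on the surface over
  -- to them.
  choose ψ hψ hψe using fun n => exists_h1Err_le hU hf hd hw (hε n)
  have he : Tendsto (fun n : ℕ => ((n : ℝ≥0∞) + 1)⁻¹) atTop (𝓝 0) := by
    have := (tendsto_add_atTop_iff_nat (f := fun n : ℕ => ((n : ℝ≥0∞))⁻¹) 1).2
      ENNReal.tendsto_inv_nat_nhds_zero
    simpa using this
  have hψt : Tendsto (fun n => h1Err U (ψ n) f d) atTop (𝓝 0) :=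
    tendsto_of_tendsto_of_tendsto_of_le_of_le tendsto_const_nhds he (fun _ => zero_le) hψe
  refine ⟨ψ, hψ, h1Tendsto_of_h1Err hd hw hψt, ?_⟩
  have h1 := (ENNReal.Tendsto.const_mul (hψt.add h) (Or.inr hK)).add hg
  simp only [add_zero, mul_zero] at h1
  refine tendsto_of_tendsto_of_tendsto_of_le_of_le tendsto_const_nhds h1 (fun _ => zero_le)
    fun n => ?_
  have hψ1 : ContDiff ℝ 1 (ψ n) := (hψ n).1.of_le (by simp)
  have e : ψ n - g = (ψ n - φ n) + (φ n - g) := by abel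
  calc eLpNorm (ψ n - g) 2 (surf U)
      ≤ eLpNorm (ψ n - φ n) 2 (surf U) + eLpNorm (φ n - g) 2 (surf U) := by
        rw [e]
        exact eLpNorm_add_le (hψ1.continuous.sub (hφ n).continuous).aestronglyMeasurable
          ((hφ n).continuous.aestronglyMeasurable.sub hgm) (by norm_num)
    _ ≤ _ := by
        gcongr
        refine (hKle _ (hψ1.sub (hφ n))).1.trans ?_
        gcongr
        exact h1Err_sub_le hψ1 (hφ n) hf hd

/-- Functions in `H¹(U)` have traces. -/
theorem exists_hasTrace {U : Set E3} (hU : IsC2 U) {f : E3 → C4} {d : Fin 3 → E3 → C4}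
    (hf : MemLp f 2 (volume.restrict U))
    (hd : ∀ j, MemLp (d j) 2 (volume.restrict U)) (hw : ∀ j, IsWeakPD U j f (d j)) :
    ∃ g, MemLp g 2 (surf U) ∧ HasTrace U U f g := by
  have := isFiniteMeasure_surf hU
  obtain ⟨K, hK, hKle⟩ := exists_trace_norm_le hU
  have hε : ∀ n : ℕ, ((n : ℝ≥0∞) + 1)⁻¹ ≠ 0 := fun n => by
    simp only [ne_eq, ENNReal.inv_eq_zero]; finiteness
  choose ψ hψ hψe using fun n => exists_h1Err_le hU hf hd hw (hε n)
  have he : Tendsto (fun n : ℕ => ((n : ℝ≥0∞) + 1)⁻¹) atTop (𝓝 0) := by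
    have := (tendsto_add_atTop_iff_nat (f := fun n : ℕ => ((n : ℝ≥0∞))⁻¹) 1).2
      ENNReal.tendsto_inv_nat_nhds_zero
    simpa using this
  have hψt : Tendsto (fun n => h1Err U (ψ n) f d) atTop (𝓝 0) :=
    tendsto_of_tendsto_of_tendsto_of_le_of_le tendsto_const_nhds he (fun _ => zero_le) hψe
  have hψ1 : ∀ n, ContDiff ℝ 1 (ψ n) := fun n => (hψ n).1.of_le (by simp)
  obtain ⟨g, hg, hgt⟩ := exists_limit_of_cauchy (μ := surf U) (f := ψ)
    (fun n => memLp_of_test (hψ n).1.continuous (hψ n).2.1 _) (by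
      have h1 := ENNReal.Tendsto.const_mul ((hψt.comp tendsto_fst).add (hψt.comp tendsto_snd))
        (Or.inr hK)
      rw [add_zero, mul_zero, prod_atTop_atTop_eq] at h1
      refine tendsto_of_tendsto_of_tendsto_of_le_of_le tendsto_const_nhds h1 (fun _ => zero_le)
        fun p => ?_
      refine (hKle _ ((hψ1 p.1).sub (hψ1 p.2))).1.trans ?_
      gcongr
      exact h1Err_sub_le (hψ1 _) (hψ1 _) hf hd)
  exact ⟨g, hg, ψ, hψ, h1Tendsto_of_h1Err hd hw hψt, hgt⟩

/-- Traces are unique. -/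
theorem HasTrace.ae_eq {U : Set E3} (hU : IsC2 U) {f g g' : E3 → C4}
    (hf : MemLp f 2 (volume.restrict U)) (hg : AEStronglyMeasurable g (surf U))
    (hg' : AEStronglyMeasurable g' (surf U)) (h : HasTrace U U f g) (h' : HasTrace U U f g') :
    g =ᵐ[surf U] g' := by
  obtain ⟨K, hK, hKle⟩ := exists_trace_norm_le hU
  obtain ⟨φ, hφ, h1, h2⟩ := h
  obtain ⟨φ', hφ', h1', h2'⟩ := h'
  obtain ⟨d, hd, hw, ht⟩ := h1.exists_h1Err
  obtain ⟨d', hd', hw', ht'⟩ := h1'.exists_h1Err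
  simp only [fun n => h1Err_congr (φ := φ' n) (f := f)
    fun j => (hw' j).ae_eq hU.isOpen (hd' j) (hd j) (hw j)] at ht'
  have hφ1 : ∀ n, ContDiff ℝ 1 (φ n) := fun n => (hφ n).1.of_le (by simp)
  have hφ1' : ∀ n, ContDiff ℝ 1 (φ' n) := fun n => (hφ' n).1.of_le (by simp)
  have hlim := (h2.add (ENNReal.Tendsto.const_mul (ht.add ht') (Or.inr hK))).add h2'
  simp only [add_zero, mul_zero] at hlim
  have hle : ∀ n, eLpNorm (g - g') 2 (surf U) ≤ eLpNorm (φ n - g) 2 (surf U) +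
      K * (h1Err U (φ n) f d + h1Err U (φ' n) f d) + eLpNorm (φ' n - g') 2 (surf U) := fun n => by
    have e : g - g' = ((φ n - φ' n) - (φ n - g)) + (φ' n - g') := by abel
    have m1 := (hφ1 n).continuous.aestronglyMeasurable.sub hg
    have m2 := (hφ1' n).continuous.aestronglyMeasurable.sub hg'
    have m3 : AEStronglyMeasurable (φ n - φ' n) (surf U) :=
      ((hφ1 n).continuous.sub (hφ1' n).continuous).aestronglyMeasurable
    rw [e, add_comm (eLpNorm (φ n - g) 2 (surf U))]
    refine (eLpNorm_add_le (m3.sub m1) m2 (by norm_num)).trans ?_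
    gcongr
    refine (eLpNorm_sub_le m3 m1 (by norm_num)).trans ?_
    gcongr
    refine (hKle _ ((hφ1 n).sub (hφ1' n))).1.trans ?_
    gcongr
    exact h1Err_sub_le (hφ1 n) (hφ1' n) hf hd
  have h0 : eLpNorm (g - g') 2 (surf U) = 0 :=
    le_antisymm (ge_of_tendsto' hlim hle) zero_le
  rw [eLpNorm_eq_zero_iff (hg.sub hg') (by norm_num)] at h0
  filter_upwards [h0] with x hx
  exact sub_eq_zero.1 hx

/-- Traces are in `H^{1/2}`. -/
theorem HasTrace.surfSlob_lt_top {U : Set E3} (hU : IsC2 U) {f g : E3 → C4}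
    (hf : MemLp f 2 (volume.restrict U)) (hg : AEStronglyMeasurable g (surf U))
    (h : HasTrace U U f g) : surfSlob U g < ⊤ := by
  have := isFiniteMeasure_surf hU
  obtain ⟨K, hK, hKle⟩ := exists_trace_norm_le hU
  obtain ⟨φ, hφ, h1, h2⟩ := h
  obtain ⟨d, hd, hw, ht⟩ := h1.exists_h1Err
  have hφ1 : ∀ n, ContDiff ℝ 1 (φ n) := fun n => (hφ n).1.of_le (by simp)
  -- A subsequence converges almost everywhere on the surface, and Fatou's lemma in each variable
  -- then gives lower semicontinuity of the seminorm.
  obtain ⟨ns, hns, hae⟩ := (tendstoInMeasure_of_tendsto_eLpNorm (by norm_num)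
    (fun n => (hφ1 n).continuous.aestronglyMeasurable) hg h2).exists_seq_tendsto_ae
  have hfin : h1Err U 0 f d ≠ ⊤ := by
    have e : ∀ {a : E3 → C4}, MemLp a 2 (volume.restrict U) →
        eLpNorm (0 - a) 2 (volume.restrict U) ≠ ⊤ := fun {a} ha => by
      rw [zero_sub, eLpNorm_neg]
      exact ha.eLpNorm_ne_top
    refine ENNReal.add_ne_top.2 ⟨e hf, ENNReal.sum_ne_top.2 fun j _ => ?_⟩
    rw [pd_zero]
    exact e (hd j)
  have hb : ∀ n, surfSlob U (φ n) ≤ K * (h1Err U (φ n) f d + h1Err U 0 f d) ^ 2 := fun n => by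
    refine (hKle _ (hφ1 n)).2.trans ?_
    gcongr
    have := h1Err_sub_le (hφ1 n) (contDiff_const (c := (0 : C4))) hf hd
    change h1Err U (φ n - 0) 0 0 ≤ _ at this
    rwa [sub_zero] at this
  have hlim : Tendsto (fun k => K * (h1Err U (φ (ns k)) f d + h1Err U 0 f d) ^ 2) atTop
      (𝓝 (K * (0 + h1Err U 0 f d) ^ 2)) :=
    ENNReal.Tendsto.const_mul (((ENNReal.continuous_pow 2).tendsto _).comp
      ((ht.comp hns.tendsto_atTop).add_const _)) (Or.inr hK)
  have key : surfSlob U g ≤ liminf (fun k => surfSlob U (φ (ns k))) atTop := by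
    unfold surfSlob
    refine le_trans (lintegral_mono_ae ?_) (lintegral_liminf_le fun k =>
      (measurable_slob_integrand (hφ1 (ns k)).continuous).lintegral_prod_right')
    filter_upwards [hae] with x hx
    refine le_trans (lintegral_mono_ae ?_) (lintegral_liminf_le fun k =>
      measurable_slob_integrand_right (hφ1 (ns k)).continuous x)
    filter_upwards [hae] with y hy
    -- On the diagonal the limit integrand is 0/0 = 0, and there is nothing to prove; off it the
    -- denominator is not zero.
    by_cases hxy : x = y
    · simp [hxy]
    · have h3 : Tendsto (fun k => ‖φ (ns k) x - φ (ns k) y‖ₑ ^ 2 / edist x y ^ 3) atTop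
          (𝓝 (‖g x - g y‖ₑ ^ 2 / edist x y ^ 3)) :=
        ENNReal.Tendsto.div_const (((ENNReal.continuous_pow 2).tendsto _).comp
          ((hx.sub hy).enorm)) (Or.inr (pow_ne_zero _ (by simpa using hxy)))
      rw [h3.liminf_eq]
  refine key.trans_lt ?_
  refine (liminf_le_liminf (Eventually.of_forall fun k => hb (ns k))).trans_lt ?_
  rw [hlim.liminf_eq, zero_add]
  finiteness

/-- Limits of sequences of `C¹` functions that are Cauchy in `H¹(U)`. -/
theorem exists_hasTrace_of_cauchy {U : Set E3} (hU : IsC2 U) {φ : ℕ → E3 → C4} {g : E3 → C4}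
    (hφ : ∀ n, ContDiff ℝ 1 (φ n)) (hc : ∀ n, HasCompactSupport (φ n))
    (hgm : AEStronglyMeasurable g (surf U))
    (h : Tendsto (fun p : ℕ × ℕ => sobSq U (φ p.1 - φ p.2)) atTop (𝓝 0))
    (hg : Tendsto (fun n => eLpNorm (φ n - g) 2 (surf U)) atTop (𝓝 0)) :
    ∃ f : E3 → C4, MemLp f 2 (volume.restrict U) ∧ HasTrace U U f g := by
  have hm0 : ∀ n, MemLp (φ n) 2 (volume.restrict U) := fun n =>
    memLp_of_test (hφ n).continuous (hc n) _
  have hmj : ∀ j n, MemLp (pd j (φ n)) 2 (volume.restrict U) := fun j n =>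
    memLp_of_test (continuous_pd j (hφ n)) ((hc n).fderiv_apply ℝ _) _
  have hsq : ∀ {a : ℕ × ℕ → ℝ≥0∞}, (∀ p, a p ^ 2 ≤ sobSq U (φ p.1 - φ p.2)) →
      Tendsto a atTop (𝓝 0) := fun {a} ha => tendsto_zero_of_sq
    (tendsto_of_tendsto_of_tendsto_of_le_of_le tendsto_const_nhds h (fun _ => zero_le) ha)
  obtain ⟨f, hf, hft⟩ := exists_limit_of_cauchy hm0 (hsq fun p => eLpNorm_sq_le_sobSq U _)
  choose d hd hdt using fun j => exists_limit_of_cauchy (hmj j) (hsq fun p => by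
    have := eLpNorm_pd_sq_le_sobSq U (φ p.1 - φ p.2) j
    rwa [pd_sub' (hφ _) (hφ _)] at this)
  have hw : ∀ j, IsWeakPD U j f (d j) := fun j =>
    IsWeakPD.of_tendsto (fun n => isWeakPD_of_contDiff (hφ n) j) hm0 (hmj j) hf (hd j) hft (hdt j)
  exact ⟨f, hf, hasTrace_of_tendsto hU hφ hf hd hw (tendsto_h1Err hft hdt) hgm hg⟩

end Traces

/-! ### Extension from the plane to the half space -/

section HalfSpaceExtension

variable {G : Type*} [NormedAddCommGroup G] [NormedSpace ℝ G] [CompleteSpace G]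

/-- A smooth averaging kernel in the plane, supported in the unit ball. -/
def rho : E2 → ℝ := (⟨1 / 2, 1, by norm_num, by norm_num⟩ : ContDiffBump (0 : E2)).normed volume

lemma isKernel_rho : IsKernel volume rho 1 := ContDiffBump.isKernel _ (by simp)

lemma rho_eq_zero {z : E2} (hz : 1 ≤ ‖z‖) : rho z = 0 := by
  by_contra h
  have : z ∈ Metric.ball (0 : E2) 1 := isKernel_rho.support h
  rw [mem_ball_zero_iff] at this
  linarith

lemma integrable_rho : Integrable rho :=
  isKernel_rho.contDiff.continuous.integrable_of_hasCompactSupport isKernel_rho.hasCompactSupport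

/-- The extension of a function on the plane to the half space by averages at scale `t`. -/
def avg (g : E2 → G) (p : E2 × ℝ) : G := ∫ z, rho z • g (p.1 - p.2 • z)

lemma avg_zero (g : E2 → G) (x : E2) : avg g (x, 0) = g x := by
  simp [avg, integral_smul_const, isKernel_rho.integral]

lemma avg_sub {g g' : E2 → G} (hg : Continuous g) (hg' : Continuous g') :
    avg (g - g') = avg g - avg g' := by
  funext p
  have hi : ∀ {k : E2 → G}, Continuous k → Integrable fun z => rho z • k (p.1 - p.2 • z) :=
    fun {k} hk => (isKernel_rho.contDiff.continuous.smul
      (hk.comp (by fun_prop))).integrable_of_hasCompactSupport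
        isKernel_rho.hasCompactSupport.smul_right
  simp only [avg, Pi.sub_apply, smul_sub]
  exact integral_sub (hi hg) (hi hg')

lemma lintegral_avg_le {g : E2 → G} (hg : Continuous g) (t : ℝ) :
    ∫⁻ x, ‖avg g (x, t)‖ₑ ^ 2 ≤ ∫⁻ x, ‖g x‖ₑ ^ 2 := by
  have hr := isKernel_rho.contDiff.continuous
  calc ∫⁻ x, ‖avg g (x, t)‖ₑ ^ 2
      ≤ ∫⁻ x, ∫⁻ z, ‖rho z‖ₑ * ‖g (x - t • z)‖ₑ ^ 2 := by
        refine lintegral_mono fun x => ?_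
        have hx : Continuous fun z : E2 => g (x - t • z) := hg.comp (by fun_prop)
        refine (enorm_integral_smul_sq_le hr.aestronglyMeasurable hx.aestronglyMeasurable).trans ?_
        rw [isKernel_rho.lintegral, one_mul]
    _ = ∫⁻ z, ‖rho z‖ₑ * ∫⁻ x, ‖g (x - t • z)‖ₑ ^ 2 := by
        rw [lintegral_lintegral_swap]
        · exact lintegral_congr fun z => lintegral_const_mul' _ _ (by simp)
        · exact ((hr.comp continuous_snd).enorm.measurable.mul
            ((hg.comp (by fun_prop)).enorm.measurable.pow_const 2)).aemeasurable
    _ = ∫⁻ x, ‖g x‖ₑ ^ 2 := by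
        simp only [lintegral_sub_right_eq_self (fun x => ‖g x‖ₑ ^ 2)]
        rw [lintegral_mul_const _ hr.enorm.measurable, isKernel_rho.lintegral, one_mul]

/-- The integrand of the derivative of `avg g`. -/
def davg (g : E2 → G) (p : E2 × ℝ) (z : E2) : E2 × ℝ →L[ℝ] G :=
  rho z • (fderiv ℝ g (p.1 - p.2 • z)).comp
    (ContinuousLinearMap.fst ℝ E2 ℝ - (ContinuousLinearMap.snd ℝ E2 ℝ).smulRight z)

lemma davg_apply (g : E2 → G) (p : E2 × ℝ) (z : E2) (q : E2 × ℝ) :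
    davg g p z q = rho z • fderiv ℝ g (p.1 - p.2 • z) (q.1 - q.2 • z) := by
  simp [davg]

section

variable {g : E2 → G}

lemma continuous_davg (hg : ContDiff ℝ 1 g) : Continuous fun q : (E2 × ℝ) × E2 => davg g q.1 q.2 := by
  have h1 : Continuous fun q : (E2 × ℝ) × E2 => fderiv ℝ g (q.1.1 - q.1.2 • q.2) :=
    (hg.continuous_fderiv one_ne_zero).comp (by fun_prop)
  have h2 : Continuous fun q : (E2 × ℝ) × E2 => ContinuousLinearMap.fst ℝ E2 ℝ -
      (ContinuousLinearMap.snd ℝ E2 ℝ).smulRight q.2 :=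
    continuous_const.sub ((ContinuousLinearMap.smulRightL ℝ (E2 × ℝ) E2
      (ContinuousLinearMap.snd ℝ E2 ℝ)).continuous.comp continuous_snd)
  exact (isKernel_rho.contDiff.continuous.comp continuous_snd).smul (h1.clm_comp h2)

lemma exists_norm_davg_le (hg : ContDiff ℝ 1 g) (hc : HasCompactSupport g) : ∃ B : ℝ, ∀ p z, ‖davg g p z‖ ≤ B * rho z := by
  obtain ⟨B, hB⟩ := (hc.fderiv ℝ).exists_bound_of_continuous (hg.continuous_fderiv one_ne_zero)
  have hB0 : 0 ≤ B := (norm_nonneg _).trans (hB 0)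
  refine ⟨2 * B, fun p z => ?_⟩
  have hr := isKernel_rho.nonneg z
  refine ContinuousLinearMap.opNorm_le_bound _ (by positivity) fun q => ?_
  by_cases hz : 1 ≤ ‖z‖
  · simp [davg_apply, rho_eq_zero hz]
  · have h1 : ‖q.1 - q.2 • z‖ ≤ 2 * ‖q‖ := by
      refine (norm_sub_le _ _).trans ?_
      rw [norm_smul]
      have h2 := norm_fst_le q
      have h3 := norm_snd_le q
      have h4 : ‖q.2‖ * ‖z‖ ≤ ‖q‖ * 1 := by gcongr; exact (not_le.1 hz).le
      linarith
    rw [davg_apply, norm_smul, Real.norm_of_nonneg hr]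
    calc rho z * ‖fderiv ℝ g (p.1 - p.2 • z) (q.1 - q.2 • z)‖
        ≤ rho z * (B * (2 * ‖q‖)) := by
          gcongr
          exact ((fderiv ℝ g _).le_of_opNorm_le (hB _) _).trans (by gcongr)
      _ = _ := by ring

/-- Here the derivative falls on `g`. This gives smoothness up to height zero but no bound by
differences of `g`; that bound comes from `smul_fderiv_avg`. -/
lemma hasFDerivAt_avg (hg : ContDiff ℝ 1 g) (hc : HasCompactSupport g) (p : E2 × ℝ) : HasFDerivAt (avg g) (∫ z, davg g p z) p := by
  obtain ⟨B, hB⟩ := exists_norm_davg_le hg hc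
  have hr := isKernel_rho.contDiff.continuous
  refine hasFDerivAt_integral_of_dominated_of_fderiv_le (F' := davg g) (s := univ)
    (bound := fun z => B * rho z) univ_mem ?_ ?_ ?_ ?_ (integrable_rho.const_mul B) ?_
  · exact Eventually.of_forall fun q => (hr.smul
      (hg.continuous.comp (by fun_prop))).aestronglyMeasurable
  · exact (hr.smul (hg.continuous.comp (by fun_prop))).integrable_of_hasCompactSupport
      isKernel_rho.hasCompactSupport.smul_right
  · exact ((continuous_davg hg).comp (by fun_prop : Continuous fun z : E2 => (p, z))).aestronglyMeasurable
  · exact ae_of_all _ fun z q _ => hB q z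
  · refine ae_of_all _ fun z q _ => ?_
    have h1 : HasFDerivAt (fun q : E2 × ℝ => q.1 - q.2 • z)
        (ContinuousLinearMap.fst ℝ E2 ℝ - (ContinuousLinearMap.snd ℝ E2 ℝ).smulRight z) q :=
      hasFDerivAt_fst.sub (hasFDerivAt_snd.smul_const z)
    exact ((hg.differentiable one_ne_zero _).hasFDerivAt.comp q h1).const_smul (rho z)

lemma contDiff_avg (hg : ContDiff ℝ 1 g) (hc : HasCompactSupport g) : ContDiff ℝ 1 (avg g) := by
  obtain ⟨B, hB⟩ := exists_norm_davg_le hg hc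
  refine contDiff_one_iff_hasFDerivAt.2 ⟨fun p => ∫ z, davg g p z, ?_, hasFDerivAt_avg hg hc⟩
  refine continuous_of_dominated (bound := fun z => B * rho z) (fun p => ?_)
    (fun p => ae_of_all _ fun z => hB p z) (integrable_rho.const_mul B) (ae_of_all _ fun z => ?_)
  · exact ((continuous_davg hg).comp (by fun_prop : Continuous fun z : E2 => (p, z))).aestronglyMeasurable
  · exact (continuous_davg hg).comp (by fun_prop : Continuous fun p : E2 × ℝ => (p, z))

end

/-- The kernel, multiplied by a coordinate. -/
def rhoCoord (k : Fin 2) (z : E2) : ℝ := rho z * z k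

lemma contDiff_rhoCoord (k : Fin 2) : ContDiff ℝ ∞ (rhoCoord k) :=
  isKernel_rho.contDiff.mul (EuclideanSpace.proj (𝕜 := ℝ) k).contDiff

lemma hasCompactSupport_rhoCoord (k : Fin 2) : HasCompactSupport (rhoCoord k) :=
  isKernel_rho.hasCompactSupport.mul_right

/-- The divergence of `z ↦ ρ(z) (ξ - τ z)`. -/
def divKernel (q : E2 × ℝ) (z : E2) : ℝ :=
  ∑ k, (q.1 k * fderiv ℝ rho z (EuclideanSpace.single k 1) -
    q.2 * fderiv ℝ (rhoCoord k) z (EuclideanSpace.single k 1))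

lemma exists_divKernel_le : ∃ M : ℝ, 0 ≤ M ∧ ∀ q z,
    ‖divKernel q z‖ ≤ (Metric.closedBall (0 : E2) 1).indicator (fun _ => M * ‖q‖) z := by
  have hcd : ∀ {k : E2 → ℝ}, ContDiff ℝ ∞ k → HasCompactSupport k → ∃ M : ℝ, 0 ≤ M ∧
      ∀ (i : Fin 2) z, |fderiv ℝ k z (EuclideanSpace.single i 1)| ≤ M := fun {k} hk hkc => by
    obtain ⟨B, hB⟩ := (hkc.fderiv ℝ).exists_bound_of_continuous (hk.continuous_fderiv (by simp))
    refine ⟨B, (norm_nonneg _).trans (hB 0), fun i z => ?_⟩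
    have := (fderiv ℝ k z).le_of_opNorm_le (hB z) (EuclideanSpace.single i 1)
    simpa using this
  obtain ⟨M, hM0, hM⟩ := hcd isKernel_rho.contDiff isKernel_rho.hasCompactSupport
  choose M' hM0' hM' using fun k => hcd (contDiff_rhoCoord k) (hasCompactSupport_rhoCoord k)
  have hS : 0 ≤ ∑ k, M' k := Finset.sum_nonneg fun k _ => hM0' k
  refine ⟨2 * M + ∑ k, M' k, by positivity, fun q z => ?_⟩
  have hts : tsupport rho ⊆ Metric.closedBall 0 1 :=
    (closure_mono isKernel_rho.support).trans Metric.closure_ball_subset_closedBall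
  by_cases hz : z ∈ Metric.closedBall (0 : E2) 1
  · rw [indicator_of_mem hz]
    calc ‖divKernel q z‖ ≤ ∑ k, (‖q‖ * M + ‖q‖ * M' k) := by
          refine (norm_sum_le _ _).trans (Finset.sum_le_sum fun k _ => (norm_sub_le _ _).trans ?_)
          rw [norm_mul, norm_mul]
          gcongr
          · exact (PiLp.norm_apply_le q.1 k).trans (norm_fst_le q)
          · exact hM k z
          · exact norm_snd_le q
          · exact hM' k k z
      _ = _ := by simp only [Fin.sum_univ_two]; ring
  · rw [indicator_of_notMem hz]
    have h1 : z ∉ tsupport rho := fun h => hz (hts h)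
    have h2 : ∀ k, z ∉ tsupport (rhoCoord k) := fun k h =>
      h1 (closure_mono (Function.support_mul_subset_left _ _) h)
    simp [divKernel, fderiv_of_notMem_tsupport (𝕜 := ℝ) h1,
      fun k => fderiv_of_notMem_tsupport (𝕜 := ℝ) (h2 k)]

/-- For fixed `x` and `t`, multiplying the gradient of `g` at x - t z by `t` gives minus the
`z`-gradient of z ↦ g(x - t z). Integration by parts moves this derivative to the kernel z ↦ ρ(z)(ξ
- τ z). Subtracting the constant g(x) beforehand does not change the derivative, so only differences
of `g` remain. -/
lemma smul_fderiv_avg {g : E2 → G} (hg : ContDiff ℝ 1 g) (hc : HasCompactSupport g) (x : E2) (t : ℝ)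
    (q : E2 × ℝ) : t • fderiv ℝ (avg g) (x, t) q =
      ∫ z, divKernel q z • (g (x - t • z) - g x) := by
  let ψ : E2 → G := fun z => g (x - t • z) - g x
  have hψ : ContDiff ℝ 1 ψ := by
    have h1 : ContDiff ℝ 1 fun z : E2 => x - t • z := by fun_prop
    exact (hg.comp h1).sub contDiff_const
  have hψd : ∀ z v, fderiv ℝ ψ z v = -(t • fderiv ℝ g (x - t • z) v) := fun z v => by
    have h1 : HasFDerivAt (fun z : E2 => x - t • z) (-(t • ContinuousLinearMap.id ℝ E2)) z := by
      exact ((hasFDerivAt_id (𝕜 := ℝ) z).const_smul t).const_sub x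
    have h2 := ((hg.differentiable one_ne_zero _).hasFDerivAt.comp z h1).sub_const (g x)
    have h3 : fderiv ℝ ψ z = _ := h2.fderiv
    rw [h3]
    simp
  let a : Fin 2 → E2 → ℝ := fun k z => q.1 k * rho z - q.2 * rhoCoord k z
  have ha : ∀ k, ContDiff ℝ ∞ (a k) := fun k =>
    (contDiff_const.mul isKernel_rho.contDiff).sub (contDiff_const.mul (contDiff_rhoCoord k))
  have hac : ∀ k, HasCompactSupport (a k) := fun k =>
    (isKernel_rho.hasCompactSupport.mul_left).sub ((hasCompactSupport_rhoCoord k).mul_left)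
  have had : ∀ k z, fderiv ℝ (a k) z (EuclideanSpace.single k 1) =
      q.1 k * fderiv ℝ rho z (EuclideanSpace.single k 1) -
        q.2 * fderiv ℝ (rhoCoord k) z (EuclideanSpace.single k 1) := fun k z => by
    have h1 := (((isKernel_rho.contDiff.differentiable (by simp) z).hasFDerivAt).const_mul
      (q.1 k)).sub ((((contDiff_rhoCoord k).differentiable (by simp) z).hasFDerivAt).const_mul q.2)
    have h2 : fderiv ℝ (a k) z = _ := h1.fderiv
    rw [h2]
    simp
  have ha1 : ∀ k, ContDiff ℝ 1 (a k) := fun k => (ha k).of_le (by simp)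
  have h0 : ∀ k, ∫ z, fderiv ℝ (fun z => a k z • ψ z) z (EuclideanSpace.single k 1) = 0 := fun k =>
    integral_fderiv_eq_zero ((ha1 k).smul hψ) ((hac k).smul_right (f' := ψ)) _
  have hi : ∀ k, Integrable fun z => fderiv ℝ (fun z => a k z • ψ z) z (EuclideanSpace.single k 1) :=
    fun k => ((((ha1 k).smul hψ).continuous_fderiv one_ne_zero).clm_apply
      continuous_const).integrable_of_hasCompactSupport
        (((hac k).smul_right (f' := ψ)).fderiv_apply ℝ _)
  have hsum : ∀ z, ∑ k, fderiv ℝ (fun z => a k z • ψ z) z (EuclideanSpace.single k 1) =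
      divKernel q z • ψ z - t • davg g (x, t) z q := fun z => by
    have h1 : ∀ k, fderiv ℝ (fun z => a k z • ψ z) z (EuclideanSpace.single k 1) =
        fderiv ℝ (a k) z (EuclideanSpace.single k 1) • ψ z -
          t • fderiv ℝ g (x - t • z) (a k z • EuclideanSpace.single k 1) := fun k => by
      rw [fderiv_fun_smul ((ha1 k).differentiable one_ne_zero z) (hψ.differentiable one_ne_zero z)]
      simp only [add_apply, smul_apply,
        ContinuousLinearMap.smulRight_apply, hψd, map_smul]
      rw [smul_neg, smul_comm t (a k z)]
      abel
    simp only [h1, had]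
    rw [Finset.sum_sub_distrib, ← Finset.sum_smul, ← Finset.smul_sum, ← map_sum]
    have h2 : ∑ k, a k z • (EuclideanSpace.single k 1 : E2) = rho z • (q.1 - q.2 • z) := by
      ext i
      simp only [a, rhoCoord, PiLp.smul_apply, PiLp.sub_apply, smul_eq_mul, WithLp.ofLp_sum,
        Finset.sum_apply, WithLp.ofLp_smul, Pi.smul_apply]
      fin_cases i <;> simp <;> ring
    rw [h2, map_smul, davg_apply]
    rfl
  have hdi : Integrable fun z => davg g (x, t) z := by
    obtain ⟨B, hB⟩ := exists_norm_davg_le hg hc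
    exact (integrable_rho.const_mul B).mono' ((continuous_davg hg).comp
      (by fun_prop : Continuous fun z : E2 => ((x, t), z))).aestronglyMeasurable
      (ae_of_all _ fun z => hB _ z)
  have hdq : Integrable fun z => t • davg g (x, t) z q := (hdi.apply_continuousLinearMap q).smul t
  have hI := integral_finsetSum Finset.univ fun k _ => hi k
  simp only [h0, Finset.sum_const_zero] at hI
  have hd2 : Integrable fun z => divKernel q z • ψ z := by
    have h1 := integrable_finsetSum Finset.univ fun k _ => hi k
    simp only [hsum] at h1
    refine (h1.add hdq).congr (ae_of_all _ fun z => ?_)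
    simp
  simp only [hsum] at hI
  rw [integral_sub hd2 hdq] at hI
  have hI' : ∫ z, divKernel q z • ψ z = ∫ z, t • davg g (x, t) z q := sub_eq_zero.1 hI
  change _ = ∫ z, divKernel q z • ψ z
  rw [hI', integral_smul, (hasFDerivAt_avg hg hc (x, t)).fderiv,
    ContinuousLinearMap.integral_apply hdi]

/-- The divergence kernel is bounded and supported in the unit ball, so Cauchy–Schwarz over that
ball applies; squaring the factor 1/t yields the power -2. -/
lemma exists_enorm_fderiv_avg_le : ∃ C : ℝ≥0∞, C ≠ ⊤ ∧ ∀ g : E2 → G, ContDiff ℝ 1 g →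
    HasCompactSupport g → ∀ (x : E2) (t : ℝ), 0 < t →
    ‖fderiv ℝ (avg g) (x, t)‖ₑ ^ 2 ≤ C * (ENNReal.ofReal (t ^ (-2 : ℝ)) *
      ∫⁻ z in Metric.closedBall (0 : E2) 1, ‖g (x - t • z) - g x‖ₑ ^ 2) := by
  obtain ⟨M, hM0, hM⟩ := exists_divKernel_le
  let B := Metric.closedBall (0 : E2) 1
  have hBt : volume B ≠ ⊤ := (isCompact_closedBall _ _).measure_ne_top
  refine ⟨ENNReal.ofReal M ^ 2 * volume B, by finiteness, fun g hg hc x t ht => ?_⟩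
  have hψc : Continuous fun z : E2 => g (x - t • z) - g x :=
    (hg.continuous.comp (by fun_prop)).sub continuous_const
  have hi : IntegrableOn (fun z : E2 => ‖g (x - t • z) - g x‖) B :=
    (hψc.norm.continuousOn).integrableOn_compact (isCompact_closedBall _ _)
  have h1 : ‖fderiv ℝ (avg g) (x, t)‖ ≤ t⁻¹ * (M * ∫ z in B, ‖g (x - t • z) - g x‖) := by
    have hnn : 0 ≤ ∫ z in B, ‖g (x - t • z) - g x‖ := integral_nonneg fun z => norm_nonneg _
    refine ContinuousLinearMap.opNorm_le_bound _ (by positivity) fun q => ?_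
    have h2 : ‖t • fderiv ℝ (avg g) (x, t) q‖ ≤ (M * ‖q‖) * ∫ z in B, ‖g (x - t • z) - g x‖ := by
      rw [smul_fderiv_avg hg hc, ← integral_const_mul,
        ← integral_indicator (Metric.isClosed_closedBall.measurableSet)]
      refine norm_integral_le_of_norm_le (IntegrableOn.integrable_indicator (hi.const_mul _)
        Metric.isClosed_closedBall.measurableSet) (ae_of_all _ fun z => ?_)
      rw [norm_smul]
      have h3 := hM q z
      by_cases hz : z ∈ B
      · rw [indicator_of_mem hz] at h3 ⊢
        gcongr
      · rw [indicator_of_notMem hz] at h3 ⊢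
        rw [le_antisymm h3 (norm_nonneg _), zero_mul]
    rw [norm_smul, Real.norm_of_nonneg ht.le] at h2
    rw [mul_assoc, inv_mul_eq_div, le_div_iff₀' ht]
    linarith
  have h3 : ‖fderiv ℝ (avg g) (x, t)‖ₑ ≤ ENNReal.ofReal t⁻¹ * (ENNReal.ofReal M *
      ∫⁻ z in B, ‖g (x - t • z) - g x‖ₑ) := by
    rw [← ofReal_norm]
    refine (ENNReal.ofReal_le_ofReal h1).trans (le_of_eq ?_)
    rw [ENNReal.ofReal_mul (by positivity), ENNReal.ofReal_mul hM0,
      ofReal_integral_eq_lintegral_ofReal hi (ae_of_all _ fun z => norm_nonneg _)]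
    simp only [ofReal_norm]
  have h4 : (∫⁻ z in B, ‖g (x - t • z) - g x‖ₑ) ^ 2 ≤
      volume B * ∫⁻ z in B, ‖g (x - t • z) - g x‖ₑ ^ 2 := by
    have := lintegral_mul_sq_le (μ := volume.restrict B) (f := fun _ => 1)
      (g := fun z => ‖g (x - t • z) - g x‖ₑ) aemeasurable_const hψc.enorm.measurable.aemeasurable
    simpa using this
  calc ‖fderiv ℝ (avg g) (x, t)‖ₑ ^ 2 ≤ (ENNReal.ofReal t⁻¹ * (ENNReal.ofReal M *
      ∫⁻ z in B, ‖g (x - t • z) - g x‖ₑ)) ^ 2 := by gcongr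
    _ = ENNReal.ofReal M ^ 2 * (ENNReal.ofReal t⁻¹ ^ 2 *
        (∫⁻ z in B, ‖g (x - t • z) - g x‖ₑ) ^ 2) := by ring
    _ ≤ ENNReal.ofReal M ^ 2 * (ENNReal.ofReal t⁻¹ ^ 2 *
        (volume B * ∫⁻ z in B, ‖g (x - t • z) - g x‖ₑ ^ 2)) := by gcongr
    _ = ENNReal.ofReal M ^ 2 * volume B * (ENNReal.ofReal (t ^ (-2 : ℝ)) *
        ∫⁻ z in B, ‖g (x - t • z) - g x‖ₑ ^ 2) := by
        have : ENNReal.ofReal t⁻¹ ^ 2 = ENNReal.ofReal (t ^ (-2 : ℝ)) := by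
          rw [← ENNReal.ofReal_pow (by positivity), Real.rpow_neg ht.le, inv_pow, Real.rpow_two]
        rw [this]
        ring

lemma lintegral_comp_smul_plane {f : E2 → ℝ≥0∞} (hf : Measurable f) {t : ℝ} (ht : 0 < t) :
    ∫⁻ z, f (t • z) = ENNReal.ofReal (t ^ (-2 : ℝ)) * ∫⁻ z, f z := by
  rw [← lintegral_map hf (measurable_const_smul t), Measure.map_addHaar_smul _ ht.ne',
    lintegral_smul_measure, smul_eq_mul]
  congr 2
  rw [finrank_euclideanSpace_fin, abs_of_pos (by positivity), Real.rpow_neg ht.le, Real.rpow_two]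

/-- The substitution y = x - w writes the seminorm through the squared `L²` modulus of continuity,
which is the quantity the energy of the extension produces. -/
lemma slob_eq {g : E2 → G} (hg : Continuous g) :
    slob g = ∫⁻ w, (∫⁻ x, ‖g (x - w) - g x‖ₑ ^ 2) / ‖w‖ₑ ^ 3 := by
  have h1 : ∀ x, ∫⁻ y, ‖g x - g y‖ₑ ^ 2 / edist x y ^ 3 =
      ∫⁻ w, ‖g (x - w) - g x‖ₑ ^ 2 / ‖w‖ₑ ^ 3 := fun x => by
    rw [← lintegral_sub_left_eq_self _ x]
    refine lintegral_congr fun w => ?_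
    rw [edist_eq_enorm_sub, sub_sub_cancel, ← enorm_neg (g x - _), neg_sub]
  have hm : Measurable fun p : E2 × E2 => ‖g (p.1 - p.2) - g p.1‖ₑ ^ 2 :=
    (by fun_prop : Continuous fun p : E2 × E2 => ‖g (p.1 - p.2) - g p.1‖ₑ).measurable.pow_const 2
  simp only [slob, h1]
  rw [lintegral_lintegral_swap]
  · refine lintegral_congr fun w => ?_
    simp only [div_eq_mul_inv]
    rw [lintegral_mul_const]
    exact (by fun_prop : Continuous fun x => ‖g (x - w) - g x‖ₑ).measurable.pow_const 2
  · exact (hm.div (continuous_snd.enorm.measurable.pow_const 3)).aemeasurable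

/-- Of the four powers of `t`, two come from the squared gradient bound and two from the
substitution w = t z. Integrating over t ≥ |w| reproduces the Slobodeckij kernel, with a factor 1/3
that is dropped. At w = 0 the right side is infinite. -/
lemma lintegral_Ioi_rpow_le (w : E2) :
    ∫⁻ t in Ioi (0 : ℝ), {t : ℝ | ‖w‖ ≤ t}.indicator (fun t => ENNReal.ofReal (t ^ (-4 : ℝ))) t ≤
      (‖w‖ₑ ^ 3)⁻¹ := by
  by_cases hw : w = 0
  · simp [hw]
  · have hw0 : 0 < ‖w‖ := norm_pos_iff.2 hw
    have hms : MeasurableSet {t : ℝ | ‖w‖ ≤ t} := measurableSet_Ici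
    rw [lintegral_indicator hms, Measure.restrict_restrict hms]
    have e : {t : ℝ | ‖w‖ ≤ t} ∩ Ioi 0 = Ici ‖w‖ := by
      ext t
      simp only [mem_inter_iff, mem_ofPred_eq, mem_Ioi, mem_Ici, and_iff_left_iff_imp]
      exact fun h => hw0.trans_le h
    rw [e, setLIntegral_congr Ioi_ae_eq_Ici.symm,
      ← ofReal_integral_eq_lintegral_ofReal (integrableOn_Ioi_rpow_of_lt (by norm_num) hw0),
      integral_Ioi_rpow_of_lt (by norm_num) hw0, ← ofReal_norm, ← ENNReal.ofReal_pow hw0.le,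
      ← ENNReal.ofReal_inv_of_pos (by positivity)]
    · refine ENNReal.ofReal_le_ofReal ?_
      have : ‖w‖ ^ ((-4 : ℝ) + 1) = (‖w‖ ^ 3)⁻¹ := by
        rw [show (-4 : ℝ) + 1 = -((3 : ℕ) : ℝ) by norm_num, Real.rpow_neg hw0.le,
          Real.rpow_natCast]
      rw [this]
      have hp : 0 < (‖w‖ ^ 3)⁻¹ := by positivity
      have hq : -(‖w‖ ^ 3)⁻¹ / (-4 + 1) = (‖w‖ ^ 3)⁻¹ / 3 := by ring
      linarith
    · filter_upwards [ae_restrict_mem measurableSet_Ioi] with t ht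
      exact Real.rpow_nonneg (hw0.trans ht).le _

/-- The energy of the extension is controlled by the Slobodeckij seminorm. -/
theorem exists_avg_energy_le : ∃ C : ℝ≥0∞, C ≠ ⊤ ∧ ∀ g : E2 → G, ContDiff ℝ 1 g →
    HasCompactSupport g →
    ∫⁻ t in Ioi (0 : ℝ), ∫⁻ x : E2, ‖fderiv ℝ (avg g) (x, t)‖ₑ ^ 2 ≤ C * slob g := by
  obtain ⟨C, hC, h⟩ := exists_enorm_fderiv_avg_le (G := G)
  refine ⟨C, hC, fun g hg hc => ?_⟩
  have hgc := hg.continuous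
  let B := Metric.closedBall (0 : E2) 1
  have hB : MeasurableSet B := Metric.isClosed_closedBall.measurableSet
  let N : E2 → ℝ≥0∞ := fun w => ∫⁻ x, ‖g (x - w) - g x‖ₑ ^ 2
  have hN : Measurable N := Measurable.lintegral_prod_left'
    (f := fun p : E2 × E2 => ‖g (p.1 - p.2) - g p.1‖ₑ ^ 2)
    ((by fun_prop : Continuous fun p : E2 × E2 => ‖g (p.1 - p.2) - g p.1‖ₑ).measurable.pow_const 2)
  have h1 : ∀ t ∈ Ioi (0 : ℝ), ∫⁻ x : E2, ‖fderiv ℝ (avg g) (x, t)‖ₑ ^ 2 ≤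
      C * ∫⁻ w, N w * {t : ℝ | ‖w‖ ≤ t}.indicator (fun t => ENNReal.ofReal (t ^ (-4 : ℝ))) t := by
    intro t ht
    have ht' : 0 < t := ht
    calc ∫⁻ x : E2, ‖fderiv ℝ (avg g) (x, t)‖ₑ ^ 2
        ≤ ∫⁻ x : E2, C * (ENNReal.ofReal (t ^ (-2 : ℝ)) * ∫⁻ z in B, ‖g (x - t • z) - g x‖ₑ ^ 2) :=
          lintegral_mono fun x => h g hg hc x t ht
      _ = C * (ENNReal.ofReal (t ^ (-2 : ℝ)) * ∫⁻ z in B, N (t • z)) := by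
          rw [lintegral_const_mul' _ _ hC, lintegral_const_mul' _ _ ENNReal.ofReal_ne_top,
            lintegral_lintegral_swap]
          exact ((by fun_prop : Continuous fun p : E2 × E2 =>
            ‖g (p.1 - t • p.2) - g p.1‖ₑ).measurable.pow_const 2).aemeasurable
      _ = C * (ENNReal.ofReal (t ^ (-2 : ℝ)) *
          ∫⁻ z, (fun w => (Metric.closedBall (0 : E2) t).indicator N w) (t • z)) := by
          rw [← lintegral_indicator hB]
          congr 2
          refine lintegral_congr fun z => ?_
          simp only [indicator, B, Metric.mem_closedBall, dist_zero_right, norm_smul,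
            Real.norm_of_nonneg ht'.le]
          have : t * ‖z‖ ≤ t ↔ ‖z‖ ≤ 1 := by
            constructor
            · intro h
              by_contra h'
              nlinarith
            · intro h
              nlinarith
          simp only [this]
      _ = C * ∫⁻ w, N w * {t : ℝ | ‖w‖ ≤ t}.indicator
          (fun t => ENNReal.ofReal (t ^ (-4 : ℝ))) t := by
          rw [lintegral_comp_smul_plane (hN.indicator Metric.isClosed_closedBall.measurableSet) ht',
            ← mul_assoc (ENNReal.ofReal _), ← ENNReal.ofReal_mul (by positivity),
            ← Real.rpow_add ht', ← lintegral_const_mul' _ _ ENNReal.ofReal_ne_top]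
          congr 1
          refine lintegral_congr fun w => ?_
          simp only [indicator, Metric.mem_closedBall, dist_zero_right, mem_ofPred_eq]
          norm_num
          split_ifs
          · rw [mul_comm]
          · simp
  refine (setLIntegral_mono' measurableSet_Ioi h1).trans ?_
  rw [lintegral_const_mul' _ _ hC, slob_eq hgc]
  gcongr
  rw [lintegral_lintegral_swap]
  · refine lintegral_mono fun w => ?_
    rw [lintegral_const_mul, div_eq_mul_inv]
    · gcongr
      exact lintegral_Ioi_rpow_le w
    · exact (by fun_prop : Measurable fun t : ℝ => ENNReal.ofReal (t ^ (-4 : ℝ))).indicator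
        measurableSet_Ici
  · refine Measurable.aemeasurable ?_
    refine (hN.comp measurable_snd).mul ?_
    have : (fun p : ℝ × E2 => {t : ℝ | ‖p.2‖ ≤ t}.indicator
        (fun t => ENNReal.ofReal (t ^ (-4 : ℝ))) p.1) = {p : ℝ × E2 | ‖p.2‖ ≤ p.1}.indicator
        fun p => ENNReal.ofReal (p.1 ^ (-4 : ℝ)) := by
      funext p
      simp [indicator]
    simp only [this]
    exact (by fun_prop : Measurable fun p : ℝ × E2 => ENNReal.ofReal (p.1 ^ (-4 : ℝ))).indicator
      (measurableSet_le (by fun_prop) (by fun_prop))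

end HalfSpaceExtension

/-! ### Smooth approximation and localization in the Slobodeckij seminorm -/

section Plane

variable {G : Type*} [NormedAddCommGroup G]

section

variable [NormedSpace ℝ G]

/-- The weighted difference whose square integral is the Slobodeckij seminorm. -/
def slobDiff (v : E2 → G) (p : E2 × E2) : G := (dist p.1 p.2 ^ (-(3 / 2) : ℝ)) • (v p.1 - v p.2)

lemma enorm_slobDiff_sq (v : E2 → G) (p : E2 × E2) :
    ‖slobDiff v p‖ₑ ^ 2 = ‖v p.1 - v p.2‖ₑ ^ 2 / edist p.1 p.2 ^ 3 := by
  by_cases h : p.1 = p.2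
  · simp [slobDiff, h]
  · have hd : 0 < dist p.1 p.2 := dist_pos.2 h
    rw [slobDiff, enorm_smul, mul_pow, mul_comm, edist_dist,
      Real.enorm_of_nonneg (by positivity), ← ENNReal.ofReal_pow (by positivity),
      ← ENNReal.ofReal_pow (by positivity), ENNReal.div_eq_inv_mul, mul_comm,
      ← ENNReal.ofReal_inv_of_pos (by positivity)]
    congr 2
    rw [← Real.rpow_natCast, ← Real.rpow_mul hd.le, ← Real.rpow_natCast, ← Real.rpow_neg hd.le]
    norm_num

lemma stronglyMeasurable_slobDiff {v : E2 → G} (hv : StronglyMeasurable v) :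
    StronglyMeasurable (slobDiff v) := by
  have h1 : Measurable fun p : E2 × E2 => dist p.1 p.2 ^ (-(3 / 2) : ℝ) := by fun_prop
  exact h1.stronglyMeasurable.smul ((hv.comp_measurable measurable_fst).sub
    (hv.comp_measurable measurable_snd))

lemma slob_eq_eLpNorm {v : E2 → G} (hv : StronglyMeasurable v) :
    slob v = eLpNorm (slobDiff v) 2 volume ^ 2 := by
  rw [eLpNorm_two_sq, Measure.volume_eq_prod, lintegral_prod]
  · simp only [enorm_slobDiff_sq, slob]
  · exact ((stronglyMeasurable_slobDiff hv).enorm.pow_const 2).aemeasurable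

lemma slob_sub_le {u v : E2 → G} (hu : StronglyMeasurable u) (hv : StronglyMeasurable v) :
    slob (u - v) ≤ 2 * (slob u + slob v) := by
  rw [slob_eq_eLpNorm hu, slob_eq_eLpNorm hv, slob_eq_eLpNorm (hu.sub hv)]
  simp only [eLpNorm_two_sq]
  rw [← lintegral_add_left ((stronglyMeasurable_slobDiff hu).enorm.pow_const 2),
    ← lintegral_const_mul' _ _ (by simp)]
  refine lintegral_mono fun p => ?_
  have : slobDiff (u - v) p = slobDiff u p - slobDiff v p := by
    simp only [slobDiff, Pi.sub_apply, ← smul_sub]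
    congr 1
    abel
  rw [this]
  exact enorm_sub_sq_le _ _

variable [CompleteSpace G]

/-- Mollification converges in the Slobodeckij seminorm. -/
lemma exists_mollify_slob {v : E2 → G} (hv : StronglyMeasurable v) (hv2 : MemLp v 2 volume)
    (hs : slob v ≠ ⊤) {ε : ℝ≥0∞} (hε : ε ≠ 0) :
    ∃ η > 0, ∀ κ : E2 → ℝ, IsKernel volume κ η →
      slob ((κ ⋆[ContinuousLinearMap.lsmul ℝ ℝ, volume] v) - v) ≤ ε ^ 2 := by
  have hD := stronglyMeasurable_slobDiff hv
  have hDm : MemLp (slobDiff v) 2 (volume : Measure (E2 × E2)) := by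
    refine ⟨hD.aestronglyMeasurable, ?_⟩
    rw [slob_eq_eLpNorm hv] at hs
    exact lt_top_iff_ne_top.2 fun h => hs (by simp [h])
  have hH : (volume : Measure (E2 × E2)).IsAddHaarMeasure := by
    rw [Measure.volume_eq_prod]; infer_instance
  have ht := (tendsto_eLpNorm_translate hDm).eventually (ge_mem_nhds (pos_iff_ne_zero.2 hε))
  obtain ⟨η, hη, hb⟩ := Metric.eventually_nhds_iff.1 ht
  refine ⟨η, hη, fun κ hκ => ?_⟩
  have hloc : LocallyIntegrable v volume := hv2.locallyIntegrable (by norm_num)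
  have hκc : Continuous κ := hκ.contDiff.continuous
  have hconv : Continuous (κ ⋆[ContinuousLinearMap.lsmul ℝ ℝ, volume] v) :=
    hκ.hasCompactSupport.continuous_convolution_left _ hκc hloc
  have hm : StronglyMeasurable fun q : (E2 × E2) × E2 =>
      slobDiff v (q.1 - (q.2, q.2)) - slobDiff v q.1 :=
    (hD.comp_measurable (by fun_prop)).sub (hD.comp_measurable measurable_fst)
  have hint : ∀ x, Integrable fun a => κ a • (v (x - a) - v x) := fun x => by
    have he := (hκ.hasCompactSupport.convolutionExists_left (ContinuousLinearMap.lsmul ℝ ℝ)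
      hκc hloc x).integrable
    simp only [ContinuousLinearMap.lsmul_apply] at he
    simp only [smul_sub]
    exact he.sub ((hκc.integrable_of_hasCompactSupport hκ.hasCompactSupport).smul_const _)
  -- Mollifying `v` averages its weighted difference over diagonal translations (a, a). These leave
  -- the distance of the two points unchanged, so continuity of translations in `L²` of the product
  -- plane gives the claim.
  have hrep : ∀ p, slobDiff ((κ ⋆[ContinuousLinearMap.lsmul ℝ ℝ, volume] v) - v) p =
      ∫ a, κ a • (slobDiff v (p - (a, a)) - slobDiff v p) := fun p => by
    simp only [slobDiff, Pi.sub_apply, hκ.convolution_sub hloc]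
    rw [← integral_sub (hint _) (hint _), ← integral_smul]
    refine integral_congr_ae (ae_of_all _ fun a => ?_)
    simp only [Prod.fst_sub, Prod.snd_sub, dist_sub_right, ← smul_sub]
    rw [smul_comm]
    congr 2
    abel
  rw [slob_eq_eLpNorm (hconv.stronglyMeasurable.sub hv), eLpNorm_two_sq]
  calc ∫⁻ p, ‖slobDiff ((κ ⋆[ContinuousLinearMap.lsmul ℝ ℝ, volume] v) - v) p‖ₑ ^ 2
      ≤ ∫⁻ p, ∫⁻ a, ‖κ a‖ₑ * ‖slobDiff v (p - (a, a)) - slobDiff v p‖ₑ ^ 2 := by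
        refine lintegral_mono fun p => ?_
        rw [hrep]
        refine (enorm_integral_smul_sq_le hκc.aestronglyMeasurable
          (hm.comp_measurable (measurable_prodMk_left (x := p))).aestronglyMeasurable).trans ?_
        rw [hκ.lintegral, one_mul]
        rfl
    _ = ∫⁻ a, ‖κ a‖ₑ * ∫⁻ p, ‖slobDiff v (p - (a, a)) - slobDiff v p‖ₑ ^ 2 := by
        rw [lintegral_lintegral_swap]
        · refine lintegral_congr fun a => ?_
          rw [lintegral_const_mul' _ _ (by simp)]
        · exact ((hκc.enorm.measurable.comp measurable_snd).mul (hm.enorm.pow_const 2)).aemeasurable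
    _ ≤ ε ^ 2 := by
        refine hκ.lintegral_average_le fun a ha => ?_
        rw [← eLpNorm_two_sq (f := fun p => slobDiff v (p - (a, a)) - slobDiff v p)]
        gcongr
        exact hb (by simpa using ha)

/-- Smooth approximation in the Slobodeckij norm. -/
lemma exists_contDiff_slob {v : E2 → G} (hv : StronglyMeasurable v) (hv2 : MemLp v 2 volume)
    (hc : HasCompactSupport v) (hs : slob v ≠ ⊤) {ε : ℝ≥0∞} (hε : ε ≠ 0) :
    ∃ k : E2 → G, ContDiff ℝ 1 k ∧ HasCompactSupport k ∧ eLpNorm (k - v) 2 volume ≤ ε ∧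
      slob (k - v) ≤ ε ^ 2 := by
  obtain ⟨η, hη, h1⟩ := exists_mollify_slob hv hv2 hs hε
  obtain ⟨η', hη', h2⟩ := exists_mollify_radius hv2 hε
  have hm : 0 < min η η' := lt_min hη hη'
  let b : ContDiffBump (0 : E2) := ⟨min η η' / 2, min η η', by linarith, by linarith⟩
  have hb : IsKernel volume (b.normed volume) (min η η') := b.isKernel (by simp [b])
  refine ⟨(b.normed volume) ⋆[ContinuousLinearMap.lsmul ℝ ℝ, volume] v, ?_, ?_,
    h2 _ (hb.mono (min_le_right _ _)), h1 _ (hb.mono (min_le_left _ _))⟩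
  · exact hb.hasCompactSupport.contDiff_convolution_left _ (hb.contDiff.of_le (by simp))
      (hv2.locallyIntegrable (by norm_num))
  · exact hb.hasCompactSupport.convolution _ hc

end

/-- The integral of the localization kernel. -/
def locConst : ℝ≥0∞ := ∫⁻ z : E2, min 1 (‖z‖ₑ ^ 2) / ‖z‖ₑ ^ 3

/-- In polar coordinates the integrand min(1, r²)/r² is at most 1 near the origin and r⁻² at
infinity. -/
lemma locConst_ne_top : locConst ≠ ⊤ := by
  let f : ℝ → ℝ≥0∞ := fun r => min 1 (ENNReal.ofReal r ^ 2) / ENNReal.ofReal r ^ 3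
  have hf : Measurable f := by fun_prop
  have h1 : locConst = ∫⁻ z : E2, f ‖z‖ := by
    simp only [locConst, f, ofReal_norm]
  have h2 : ∀ r ∈ Ioi (0 : ℝ), ENNReal.ofReal r * f r ≤
      (Ioc (0 : ℝ) 1).indicator 1 r + (Ioi (1 : ℝ)).indicator
        (fun r => ENNReal.ofReal (r ^ (-2 : ℝ))) r := by
    intro r hr
    have hr0 : 0 < r := hr
    have e : ENNReal.ofReal r ^ 3 = ENNReal.ofReal r ^ 2 * ENNReal.ofReal r := by ring
    have hpos : ENNReal.ofReal r ≠ 0 := by simpa using hr0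
    have e2 : ENNReal.ofReal r * f r = min 1 (ENNReal.ofReal r ^ 2) / ENNReal.ofReal r ^ 2 := by
      simp only [f, e, div_eq_mul_inv]
      rw [ENNReal.mul_inv (Or.inr ENNReal.ofReal_ne_top) (Or.inr hpos)]
      calc _ = min 1 (ENNReal.ofReal r ^ 2) * (ENNReal.ofReal r ^ 2)⁻¹ *
            (ENNReal.ofReal r * (ENNReal.ofReal r)⁻¹) := by ring
        _ = _ := by rw [ENNReal.mul_inv_cancel hpos ENNReal.ofReal_ne_top, mul_one]
    rw [e2]
    rcases le_or_gt r 1 with h | h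
    · rw [indicator_of_mem (show r ∈ Ioc (0 : ℝ) 1 from ⟨hr0, h⟩)]
      refine le_trans ?_ le_self_add
      calc _ ≤ ENNReal.ofReal r ^ 2 / ENNReal.ofReal r ^ 2 := by gcongr; exact min_le_right _ _
        _ ≤ 1 := ENNReal.div_self_le_one
    · rw [indicator_of_mem (show r ∈ Ioi (1 : ℝ) from h)]
      refine le_trans ?_ le_add_self
      calc _ ≤ 1 / ENNReal.ofReal r ^ 2 := by gcongr; exact min_le_left _ _
        _ = _ := by
          rw [one_div, ← ENNReal.ofReal_pow hr0.le, ← ENNReal.ofReal_inv_of_pos (by positivity),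
            Real.rpow_neg hr0.le, Real.rpow_two]
  rw [h1, lintegral_radial hf]
  refine ENNReal.mul_ne_top circ_ne_top (ne_top_of_le_ne_top ?_
    (setLIntegral_mono' measurableSet_Ioi h2))
  rw [lintegral_add_left (measurable_one.indicator measurableSet_Ioc),
    lintegral_indicator measurableSet_Ioc, lintegral_indicator measurableSet_Ioi]
  refine ENNReal.add_ne_top.2 ⟨?_, ?_⟩
  · simp only [Pi.one_apply, lintegral_const, one_mul, Measure.restrict_apply_univ]
    exact ne_top_of_le_ne_top (by simp) (Measure.restrict_apply_le _ _)
  · rw [Measure.restrict_restrict measurableSet_Ioi,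
      inter_eq_left.2 (Ioi_subset_Ioi zero_le_one)]
    have := (integrableOn_Ioi_rpow_of_lt (a := -2) (c := 1) (by norm_num) one_pos).2
    refine ne_top_of_le_ne_top this.ne (lintegral_mono fun r => ?_)
    exact Real.ofReal_le_enorm _

lemma lintegral_loc_kernel {v : E2 → G} (hv : StronglyMeasurable v) :
    ∫⁻ z, ∫⁻ w, min 1 (edist z w ^ 2) / edist z w ^ 3 * (‖v z‖ₑ ^ 2 + ‖v w‖ₑ ^ 2) =
      2 * locConst * ∫⁻ z, ‖v z‖ₑ ^ 2 := by
  have hk : Measurable fun p : E2 × E2 => min 1 (edist p.1 p.2 ^ 2) / edist p.1 p.2 ^ 3 := by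
    fun_prop
  have hv2 : Measurable fun z => ‖v z‖ₑ ^ 2 := hv.enorm.pow_const 2
  have hkz : ∀ z, Measurable fun w : E2 => min 1 (edist z w ^ 2) / edist z w ^ 3 := fun z => by
    fun_prop
  have hk1 : ∀ z : E2, ∫⁻ w, min 1 (edist z w ^ 2) / edist z w ^ 3 = locConst := fun z => by
    rw [← lintegral_sub_left_eq_self (fun w => min 1 (edist z w ^ 2) / edist z w ^ 3) z]
    simp only [edist_eq_enorm_sub, sub_sub_cancel]
    rfl
  have h1 : ∀ z, ∫⁻ w, min 1 (edist z w ^ 2) / edist z w ^ 3 * (‖v z‖ₑ ^ 2 + ‖v w‖ₑ ^ 2) =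
      locConst * ‖v z‖ₑ ^ 2 + ∫⁻ w, min 1 (edist z w ^ 2) / edist z w ^ 3 * ‖v w‖ₑ ^ 2 :=
    fun z => by
    simp only [mul_add]
    rw [lintegral_add_left ((hkz z).mul_const _), lintegral_mul_const _ (hkz z), hk1]
  simp only [h1]
  rw [lintegral_add_left (hv2.const_mul _), lintegral_const_mul' _ _ locConst_ne_top,
    lintegral_lintegral_swap]
  · have h2 : ∀ w, ∫⁻ z, min 1 (edist z w ^ 2) / edist z w ^ 3 * ‖v w‖ₑ ^ 2 =
        locConst * ‖v w‖ₑ ^ 2 := fun w => by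
      simp only [edist_comm _ w]
      rw [lintegral_mul_const _ (hkz w), hk1]
    simp only [h2]
    rw [lintegral_const_mul' _ _ locConst_ne_top]
    ring
  · exact (hk.mul (hv2.comp measurable_snd)).aemeasurable

variable [NormedSpace ℝ G]

/-- Multiplication with a Lipschitz cut-off function. -/
lemma slob_smul_le {χ : E2 → ℝ} {v : E2 → G} (hv : StronglyMeasurable v) {K : Set E2} {M C : ℝ≥0∞}
    (hMt : M ≠ ⊤) (hCt : C ≠ ⊤) (hχ : ∀ z ∉ K, χ z = 0)
    (hM : ∀ z, ‖χ z‖ₑ ^ 2 ≤ M)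
    (hC : ∀ z w, ‖χ z - χ w‖ₑ ^ 2 ≤ C * min 1 (edist z w ^ 2)) :
    slob (fun z => χ z • v z) ≤
      2 * M * (∫⁻ z, ∫⁻ w, K.indicator (fun z => K.indicator
        (fun w => ‖v z - v w‖ₑ ^ 2 / edist z w ^ 3) w) z) +
      2 * C * (2 * locConst * ∫⁻ z, ‖v z‖ₑ ^ 2) := by
  have hk : ∀ z, Measurable fun w : E2 => min 1 (edist z w ^ 2) / edist z w ^ 3 := fun z => by
    fun_prop
  have hk2 : Measurable fun p : E2 × E2 => min 1 (edist p.1 p.2 ^ 2) / edist p.1 p.2 ^ 3 := by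
    fun_prop
  have hv2 : Measurable fun z => ‖v z‖ₑ ^ 2 := hv.enorm.pow_const 2
  -- If both points are in `K`, the product rule for differences applies. Otherwise `χ` vanishes at
  -- one of them and only the difference of `χ` is left. Hence differences of `v` enter over `K × K`
  -- only, and those of `χ` are absorbed by the integrable kernel of `locConst`.
  have hpt : ∀ z w, ‖χ z • v z - χ w • v w‖ₑ ^ 2 / edist z w ^ 3 ≤
      2 * M * K.indicator (fun z => K.indicator
        (fun w => ‖v z - v w‖ₑ ^ 2 / edist z w ^ 3) w) z +
      2 * C * (min 1 (edist z w ^ 2) / edist z w ^ 3 * (‖v z‖ₑ ^ 2 + ‖v w‖ₑ ^ 2)) := by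
    intro z w
    have aux : ∀ y, ‖(χ z - χ w) • v y‖ₑ ^ 2 ≤ C * min 1 (edist z w ^ 2) * ‖v y‖ₑ ^ 2 := fun y => by
      rw [enorm_smul, mul_pow]
      gcongr
      exact hC z w
    have aux2 : ∀ X : ℝ≥0∞, X ≤ ‖v z‖ₑ ^ 2 + ‖v w‖ₑ ^ 2 →
        C * min 1 (edist z w ^ 2) * X / edist z w ^ 3 ≤
        2 * C * (min 1 (edist z w ^ 2) / edist z w ^ 3 * (‖v z‖ₑ ^ 2 + ‖v w‖ₑ ^ 2)) := fun X hX => by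
      calc C * min 1 (edist z w ^ 2) * X / edist z w ^ 3
          = 1 * C * (min 1 (edist z w ^ 2) / edist z w ^ 3 * X) := by
            simp only [div_eq_mul_inv]; ring
        _ ≤ _ := by gcongr; exact one_le_two
    by_cases hz : z ∈ K
    · by_cases hw : w ∈ K
      · rw [indicator_of_mem hz, indicator_of_mem hw]
        have e : χ z • v z - χ w • v w = χ z • (v z - v w) + (χ z - χ w) • v w := by
          simp only [smul_sub, sub_smul]; abel
        rw [e]
        have h1 := enorm_add_sq_le (χ z • (v z - v w)) ((χ z - χ w) • v w)
        have h2 : ‖χ z • (v z - v w)‖ₑ ^ 2 ≤ M * ‖v z - v w‖ₑ ^ 2 := by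
          rw [enorm_smul, mul_pow]
          gcongr
          exact hM z
        calc _ ≤ 2 * (M * ‖v z - v w‖ₑ ^ 2 + C * min 1 (edist z w ^ 2) * ‖v w‖ₑ ^ 2) /
              edist z w ^ 3 := by
              gcongr
              refine h1.trans ?_
              gcongr
              exact aux w
          _ = 2 * M * (‖v z - v w‖ₑ ^ 2 / edist z w ^ 3) +
              2 * C * (min 1 (edist z w ^ 2) / edist z w ^ 3 * ‖v w‖ₑ ^ 2) := by
              simp only [div_eq_mul_inv]; ring
          _ ≤ _ := by gcongr; exact le_add_self
      · have e : χ z • v z - χ w • v w = (χ z - χ w) • v z := by simp [hχ w hw]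
        rw [e]
        refine le_trans ?_ le_add_self
        exact (ENNReal.div_le_div_right (aux z) _).trans (aux2 _ le_self_add)
    · have e : χ z • v z - χ w • v w = (χ z - χ w) • v w := by simp [hχ z hz]
      rw [e]
      refine le_trans ?_ le_add_self
      exact (ENNReal.div_le_div_right (aux w) _).trans (aux2 _ le_add_self)
  have hm2 : Measurable fun p : E2 × E2 => 2 * C *
      (min 1 (edist p.1 p.2 ^ 2) / edist p.1 p.2 ^ 3 * (‖v p.1‖ₑ ^ 2 + ‖v p.2‖ₑ ^ 2)) :=
    (hk2.mul ((hv2.comp measurable_fst).add (hv2.comp measurable_snd))).const_mul _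
  have hm1 : ∀ z, Measurable fun w : E2 => 2 * C *
      (min 1 (edist z w ^ 2) / edist z w ^ 3 * (‖v z‖ₑ ^ 2 + ‖v w‖ₑ ^ 2)) := fun z =>
    ((hk z).mul (hv2.const_add _)).const_mul _
  refine (lintegral_mono fun z => lintegral_mono fun w => hpt z w).trans ?_
  simp only [fun z => lintegral_add_right (μ := (volume : Measure E2)) (fun w => 2 * M *
    K.indicator (fun z => K.indicator (fun w => ‖v z - v w‖ₑ ^ 2 / edist z w ^ 3) w) z) (hm1 z)]
  rw [lintegral_add_right _ hm2.lintegral_prod_right']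
  refine add_le_add (le_of_eq ?_) (le_of_eq ?_)
  · have h2M : 2 * M ≠ ⊤ := by finiteness
    simp only [lintegral_const_mul' _ _ h2M]
  · have h2C : 2 * C ≠ ⊤ := by finiteness
    simp only [lintegral_const_mul' _ _ h2C, lintegral_loc_kernel hv]

end Plane

/-! ### Surjectivity of the trace -/

section TraceSurjective

/-! ### Localization to a chart and extension from it. -/

namespace Chart

variable {U : Set E3} (c : Chart U)

lemma lintegral_gr_le (hU : IsOpen U) {F : E3 → ℝ≥0∞} (hF : ∀ y ∉ Metric.ball c.x c.r, F y = 0) :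
    ∫⁻ z, F (c.gr z) ≤ ∫⁻ y, F y ∂(surf U) := by
  rw [c.lintegral_surf hU hF]
  refine lintegral_mono fun z => ?_
  exact le_mul_of_one_le_left zero_le (by simpa using c.one_le_jac z)

/-- The parametrization expands distances by at most 1 + lip. The condition on `X` excludes the
value infinity of the quotient on the diagonal. -/
lemma div_edist_cube_le (z w : E2) {X : ℝ≥0∞} (hX : z = w → X = 0) :
    X / edist z w ^ 3 ≤
      ENNReal.ofReal (1 + c.lip) ^ 3 * (X / edist (c.gr z) (c.gr w) ^ 3) := by
  by_cases h : z = w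
  · simp [hX h]
  have hL0 : ENNReal.ofReal (1 + c.lip) ^ 3 ≠ 0 := pow_ne_zero _ (by
    have : (0 : ℝ) ≤ c.lip := c.lip.2
    simp only [ne_eq, ENNReal.ofReal_eq_zero, not_le]
    linarith)
  have hLt : ENNReal.ofReal (1 + c.lip) ^ 3 ≠ ⊤ := by finiteness
  have hE : edist (c.gr z) (c.gr w) ^ 3 ≤ ENNReal.ofReal (1 + c.lip) ^ 3 * edist z w ^ 3 := by
    rw [← mul_pow]
    gcongr
    rw [edist_dist, edist_dist, ← ENNReal.ofReal_mul (by positivity)]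
    exact ENNReal.ofReal_le_ofReal (c.dist_gr_le z w)
  calc X / edist z w ^ 3 = ENNReal.ofReal (1 + c.lip) ^ 3 *
        (X / (ENNReal.ofReal (1 + c.lip) ^ 3 * edist z w ^ 3)) := by
        rw [div_eq_mul_inv, div_eq_mul_inv,
          ENNReal.mul_inv (Or.inl hL0) (Or.inl hLt)]
        rw [mul_left_comm X, ← mul_assoc, ENNReal.mul_inv_cancel hL0 hLt, one_mul]
    _ ≤ _ := by gcongr

/-- A function on the surface that is cut off by `χ`, in the coordinates of the chart. -/
def localize (χ : E3 → ℝ) (g : E3 → C4) (z : E2) : C4 := χ (c.gr z) • g (c.gr z)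

section

variable {χ : E3 → ℝ} {g : E3 → C4}

lemma eq_zero_of_notMem_ball (hχs : tsupport χ ⊆ Metric.ball c.x (c.r / 2)) {y : E3} (hy : y ∉ Metric.ball c.x c.r) : χ y = 0 :=
  image_eq_zero_of_notMem_tsupport fun h =>
    hy (Metric.ball_subset_ball (by linarith [c.r_pos]) (hχs h))

lemma hasCompactSupport_cutoff (hχs : tsupport χ ⊆ Metric.ball c.x (c.r / 2)) : HasCompactSupport χ :=
  HasCompactSupport.of_support_subset_isCompact (isCompact_closedBall c.x (c.r / 2))
    ((subset_tsupport _).trans (hχs.trans Metric.ball_subset_closedBall))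

lemma hasCompactSupport_localize (hχs : tsupport χ ⊆ Metric.ball c.x (c.r / 2)) : HasCompactSupport (c.localize χ g) := by
  have h1 : HasCompactSupport fun z => χ (c.gr z) :=
    (c.hasCompactSupport_cutoff hχs).comp_isClosedEmbedding c.isClosedEmbedding_gr
  exact h1.smul_right

lemma exists_cutoff_bound (hχ : ContDiff ℝ 1 χ)
    (hχs : tsupport χ ⊆ Metric.ball c.x (c.r / 2)) : ∃ M : ℝ, 0 ≤ M ∧ (∀ z, |χ (c.gr z)| ≤ M) ∧
    ∀ z w, |χ (c.gr z) - χ (c.gr w)| ≤ M * dist z w := by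
  have hc := c.hasCompactSupport_cutoff hχs
  obtain ⟨A, hA⟩ := hc.exists_bound_of_continuous hχ.continuous
  obtain ⟨B, hB⟩ := (hc.fderiv ℝ).exists_bound_of_continuous (hχ.continuous_fderiv one_ne_zero)
  have hA0 := (norm_nonneg _).trans (hA 0)
  have hB0 := (norm_nonneg _).trans (hB 0)
  have hl : (0 : ℝ) ≤ c.lip := c.lip.2
  refine ⟨A + B * (1 + c.lip), by positivity, fun z => (hA _).trans ?_, fun z w => ?_⟩
  · have : 0 ≤ B * (1 + c.lip) := by positivity
    linarith
  · have h1 := (convex_univ (𝕜 := ℝ) (E := E3)).norm_image_sub_le_of_norm_fderiv_le (𝕜 := ℝ)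
      (fun x _ => hχ.differentiable one_ne_zero x) (fun x _ => hB x) (mem_univ (c.gr w))
      (mem_univ (c.gr z))
    rw [← dist_eq_norm] at h1
    have h2 := c.dist_gr_le z w
    calc |χ (c.gr z) - χ (c.gr w)| ≤ B * dist (c.gr z) (c.gr w) := by
          rw [← Real.norm_eq_abs]
          simpa [dist_eq_norm] using h1
      _ ≤ B * ((1 + c.lip) * dist z w) := by gcongr
      _ ≤ _ := by
          have : 0 ≤ A * dist z w := by positivity
          nlinarith

lemma stronglyMeasurable_localize (hχ : ContDiff ℝ 1 χ)
    (hg : StronglyMeasurable g) : StronglyMeasurable (c.localize χ g) :=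
  (hχ.continuous.comp c.isClosedEmbedding_gr.continuous).stronglyMeasurable.smul
    (hg.comp_measurable c.measurableEmbedding_gr.measurable)

lemma memLp_localize (hχ : ContDiff ℝ 1 χ)
    (hχs : tsupport χ ⊆ Metric.ball c.x (c.r / 2))
    (hg : StronglyMeasurable g) (hU : IsC2 U) (hg2 : MemLp g 2 (surf U)) :
    MemLp (c.localize χ g) 2 volume := by
  obtain ⟨M, hM0, hM, -⟩ := c.exists_cutoff_bound hχ hχs
  refine ⟨(c.stronglyMeasurable_localize hχ hg).aestronglyMeasurable, ?_⟩
  have h1 : ∫⁻ z, ‖c.localize χ g z‖ₑ ^ 2 ≤ ∫⁻ y, ‖χ y • g y‖ₑ ^ 2 ∂(surf U) :=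
    c.lintegral_gr_le hU.isOpen (F := fun y => ‖χ y • g y‖ₑ ^ 2) fun y hy => by
      simp [c.eq_zero_of_notMem_ball hχs hy]
  have hb := (c.hasCompactSupport_cutoff hχs).exists_bound_of_continuous hχ.continuous
  obtain ⟨A, hA⟩ := hb
  have h2 := memLp_bdd_smul hχ.continuous hA hg2
  rw [← eLpNorm_two_sq, ← eLpNorm_two_sq] at h1
  exact ((ENNReal.pow_le_pow_left_iff two_ne_zero).1 h1).trans_lt h2.2

lemma slob_localize_ne_top (hχ : ContDiff ℝ 1 χ)
    (hχs : tsupport χ ⊆ Metric.ball c.x (c.r / 2))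
    (hg : StronglyMeasurable g) (hU : IsC2 U) (hg2 : MemLp g 2 (surf U)) (hs : surfSlob U g ≠ ⊤) :
    slob (c.localize χ g) ≠ ⊤ := by
  obtain ⟨M, hM0, hM, hL⟩ := c.exists_cutoff_bound hχ hχs
  let B := Metric.ball c.x c.r
  let K : Set E2 := c.gr ⁻¹' B
  have hK : MeasurableSet K := c.measurableEmbedding_gr.measurable Metric.isOpen_ball.measurableSet
  -- The sharp cut at the edge of `K` may give `v` itself an infinite seminorm. This is harmless,
  -- since `slob_smul_le` uses differences of `v` between points of `K` only.
  let v : E2 → C4 := K.indicator fun z => g (c.gr z)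
  have hv : StronglyMeasurable v :=
    (hg.comp_measurable c.measurableEmbedding_gr.measurable).indicator hK
  have hχK : ∀ z ∉ K, χ (c.gr z) = 0 := fun z hz => c.eq_zero_of_notMem_ball hχs hz
  have e : c.localize χ g = fun z => χ (c.gr z) • v z := by
    funext z
    by_cases hz : z ∈ K
    · simp only [localize, v, indicator_of_mem hz]
    · simp [localize, hχK z hz]
  have hv2 : ∫⁻ z, ‖v z‖ₑ ^ 2 ≠ ⊤ := by
    have h1 : ∫⁻ z, ‖v z‖ₑ ^ 2 ≤ ∫⁻ y, ‖B.indicator g y‖ₑ ^ 2 ∂(surf U) :=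
      c.lintegral_gr_le hU.isOpen (F := fun y => ‖B.indicator g y‖ₑ ^ 2) fun y hy => by
        rw [indicator_of_notMem hy]; simp
    refine ne_top_of_le_ne_top ?_ h1
    rw [← eLpNorm_two_sq]
    exact ENNReal.pow_ne_top (hg2.indicator Metric.isOpen_ball.measurableSet).eLpNorm_ne_top
  have hdd : ∫⁻ z, ∫⁻ w, K.indicator (fun z => K.indicator
      (fun w => ‖v z - v w‖ₑ ^ 2 / edist z w ^ 3) w) z ≠ ⊤ := by
    have hΛ : ENNReal.ofReal (1 + c.lip) ^ 3 ≠ ⊤ := by finiteness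
    let F : E3 → E3 → ℝ≥0∞ := fun x y => B.indicator (fun x => B.indicator
      (fun y => ‖g x - g y‖ₑ ^ 2 / edist x y ^ 3) y) x
    have h1 : ∀ z w, K.indicator (fun z => K.indicator
        (fun w => ‖v z - v w‖ₑ ^ 2 / edist z w ^ 3) w) z ≤
        ENNReal.ofReal (1 + c.lip) ^ 3 * F (c.gr z) (c.gr w) := fun z w => by
      by_cases hz : z ∈ K
      · by_cases hw : w ∈ K
        · have hz' : c.gr z ∈ B := hz
          have hw' : c.gr w ∈ B := hw
          simp only [F, v, indicator_of_mem hz, indicator_of_mem hw, indicator_of_mem hz',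
            indicator_of_mem hw']
          exact c.div_edist_cube_le z w fun h => by simp [h]
        · simp [indicator_of_notMem hw]
      · simp [indicator_of_notMem hz]
    have h2 : ∫⁻ z, ∫⁻ w, F (c.gr z) (c.gr w) ≤ surfSlob U g := by
      calc ∫⁻ z, ∫⁻ w, F (c.gr z) (c.gr w) ≤ ∫⁻ z, ∫⁻ y, F (c.gr z) y ∂(surf U) := by
            refine lintegral_mono fun z => ?_
            refine c.lintegral_gr_le hU.isOpen (F := F (c.gr z)) fun y hy => ?_
            have : B.indicator (fun y => ‖g (c.gr z) - g y‖ₑ ^ 2 / edist (c.gr z) y ^ 3) y = 0 :=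
              indicator_of_notMem hy _
            simp only [F, indicator] at this ⊢
            split_ifs <;> simp_all
        _ ≤ ∫⁻ x, ∫⁻ y, F x y ∂(surf U) ∂(surf U) := by
            refine c.lintegral_gr_le hU.isOpen (F := fun x => ∫⁻ y, F x y ∂(surf U)) fun x hx => ?_
            have : ∀ y, F x y = 0 := fun y => indicator_of_notMem hx _
            simp [this]
        _ ≤ _ := by
            refine lintegral_mono fun x => lintegral_mono fun y => ?_
            exact (indicator_le_self _ _ _).trans (indicator_le_self _ _ _)
    refine ne_top_of_le_ne_top (ENNReal.mul_ne_top hΛ (ne_top_of_le_ne_top hs h2)) ?_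
    rw [← lintegral_const_mul' _ _ hΛ]
    refine lintegral_mono fun z => ?_
    rw [← lintegral_const_mul' _ _ hΛ]
    exact lintegral_mono fun w => h1 z w
  rw [e]
  refine ne_top_of_le_ne_top ?_ (slob_smul_le (χ := fun z => χ (c.gr z)) hv (K := K)
    (M := ENNReal.ofReal M ^ 2) (C := ENNReal.ofReal (2 * M) ^ 2)
    (by finiteness) (by finiteness) hχK (fun z => ?_) (fun z w => ?_))
  · have := locConst_ne_top
    finiteness
  · gcongr
    rw [← ofReal_norm]
    exact ENNReal.ofReal_le_ofReal (hM z)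
  · rw [mul_min, mul_one, ← mul_pow]
    refine le_min ?_ ?_
    · gcongr
      rw [← ofReal_norm]
      refine ENNReal.ofReal_le_ofReal ((norm_sub_le _ _).trans ?_)
      have h1 := hM z
      have h2 := hM w
      simp only [Real.norm_eq_abs]
      linarith
    · gcongr
      rw [← ofReal_norm, edist_dist, ← ENNReal.ofReal_mul (by positivity)]
      refine ENNReal.ofReal_le_ofReal ((hL z w).trans ?_)
      have : 0 ≤ M * dist z w := by positivity
      linarith

end

/-- A cut-off function that is one on the ball of half the radius. -/
def cut : E3 → ℝ :=
  (⟨c.r / 2, 3 * c.r / 4, by linarith [c.r_pos], by linarith [c.r_pos]⟩ : ContDiffBump c.x)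

lemma contDiff_cut : ContDiff ℝ 1 c.cut := ContDiffBump.contDiff _

lemma hasCompactSupport_cut : HasCompactSupport c.cut := ContDiffBump.hasCompactSupport _

lemma tsupport_cut : tsupport c.cut ⊆ Metric.ball c.x c.r := by
  rw [cut, ContDiffBump.tsupport_eq]
  exact Metric.closedBall_subset_ball (by linarith [c.r_pos])

lemma cut_eq_one {y : E3} (hy : y ∈ Metric.ball c.x (c.r / 2)) : c.cut y = 1 :=
  ContDiffBump.one_of_mem_closedBall _ (Metric.ball_subset_closedBall hy)

lemma abs_cut_le (y : E3) : |c.cut y| ≤ 1 := by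
  rw [cut, abs_of_nonneg (ContDiffBump.nonneg _)]
  exact ContDiffBump.le_one _

lemma cut_eq_zero {y : E3} (hy : y ∉ Metric.ball c.x c.r) : c.cut y = 0 :=
  image_eq_zero_of_notMem_tsupport fun h => hy (c.tsupport_cut h)

/-- The extension to `ℝ³` of a function in the coordinates of a chart. -/
def extend (k : E2 → C4) (y : E3) : C4 := c.cut y • avg k (c.proj y)

lemma extend_gr (k : E2 → C4) (z : E2) : c.extend k (c.gr z) = c.cut (c.gr z) • k z := by
  rw [extend, proj_gr, avg_zero]

lemma extend_sub {k k' : E2 → C4} (hk : Continuous k) (hk' : Continuous k') :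
    c.extend (k - k') = c.extend k - c.extend k' := by
  funext y
  simp only [extend, avg_sub hk hk', Pi.sub_apply, smul_sub]

lemma contDiff_avg_proj {k : E2 → C4} (hk : ContDiff ℝ 1 k) (hkc : HasCompactSupport k) :
    ContDiff ℝ 1 fun y => avg k (c.proj y) :=
  (contDiff_avg hk hkc).comp (c.contDiff_proj.of_le one_le_two)

lemma contDiff_extend {k : E2 → C4} (hk : ContDiff ℝ 1 k) (hkc : HasCompactSupport k) :
    ContDiff ℝ 1 (c.extend k) :=
  c.contDiff_cut.smul (c.contDiff_avg_proj hk hkc)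

lemma hasCompactSupport_extend (k : E2 → C4) : HasCompactSupport (c.extend k) :=
  c.hasCompactSupport_cut.smul_right

lemma lipschitzWith_proj : LipschitzWith (1 + c.lip) c.proj := by
  refine LipschitzWith.of_dist_le_mul fun y w => ?_
  rw [Prod.dist_eq]
  refine max_le ((c.dist_proj_fst_le y w).trans ?_) ?_
  · have : (0 : ℝ) ≤ c.lip := c.lip.2
    push_cast
    nlinarith [dist_nonneg (x := y) (y := w)]
  · rw [Real.dist_eq, dist_eq_norm]
    rw [add_comm 1]
    exact_mod_cast c.abs_proj_snd_sub_le y w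

/-- Averaging does not increase the `L²` norm on any slice, and the chart ball meets only slices of
height at most `R`, so the thickness `R` is the constant. -/
lemma lintegral_avg_proj_le (hU : IsC2 U) : ∃ C : ℝ≥0∞, C ≠ ⊤ ∧ ∀ k : E2 → C4, ContDiff ℝ 1 k →
    HasCompactSupport k →
    ∫⁻ y in U, (Metric.ball c.x c.r).indicator (fun y => ‖avg k (c.proj y)‖ₑ ^ 2) y ≤
      C * ∫⁻ z, ‖k z‖ₑ ^ 2 := by
  set R : ℝ := |(c.proj c.x).2| + (1 + c.lip) * c.r with hR
  refine ⟨ENNReal.ofReal R, ENNReal.ofReal_ne_top, fun k hk hkc => ?_⟩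
  have hm := (c.contDiff_avg_proj hk hkc).continuous.enorm.measurable.pow_const 2
  rw [c.setLIntegral_eq hU.isOpen (hm.indicator Metric.isOpen_ball.measurableSet)
    fun y hy => indicator_of_notMem hy _]
  have hb : ∀ (x : E2) (t : ℝ), c.lift (x, t) ∈ Metric.ball c.x c.r → t ≤ R := fun x t h => by
    have h1 := c.lipschitzWith_proj.dist_le_mul (c.lift (x, t)) c.x
    have h2 : dist (c.proj (c.lift (x, t))).2 (c.proj c.x).2 ≤ _ := (le_max_right _ _).trans h1
    rw [proj_lift, Real.dist_eq] at h2
    have h3 : dist (c.lift (x, t)) c.x < c.r := h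
    have h4 : ((1 + c.lip : NNReal) : ℝ) * dist (c.lift (x, t)) c.x ≤ (1 + c.lip) * c.r := by
      push_cast
      have : (0 : ℝ) ≤ c.lip := c.lip.2
      gcongr
    have h5 := abs_le.1 h2
    have h6 := le_abs_self (c.proj c.x).2
    linarith [h5.2]
  have hle : ∀ t ∈ Ioi (0 : ℝ), ∫⁻ x : E2, (Metric.ball c.x c.r).indicator
      (fun y => ‖avg k (c.proj y)‖ₑ ^ 2) (c.lift (x, t)) ≤
      (Ioc 0 R).indicator (fun _ => ∫⁻ z, ‖k z‖ₑ ^ 2) t := fun t ht => by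
    by_cases htR : t ≤ R
    · rw [indicator_of_mem (show t ∈ Ioc 0 R from ⟨ht, htR⟩)]
      refine le_trans (lintegral_mono fun x => (indicator_le_self _ _ _).trans ?_)
        (lintegral_avg_le hk.continuous t)
      rw [proj_lift]
    · have : ∀ x : E2, (Metric.ball c.x c.r).indicator
          (fun y => ‖avg k (c.proj y)‖ₑ ^ 2) (c.lift (x, t)) = 0 := fun x =>
        indicator_of_notMem (fun h => htR (hb x t h)) _
      simp [this]
  refine (setLIntegral_mono' measurableSet_Ioi hle).trans ?_
  rw [lintegral_indicator measurableSet_Ioc, lintegral_const, mul_comm]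
  gcongr
  rw [Measure.restrict_apply_univ]
  refine (Measure.restrict_apply_le _ _).trans ?_
  simp

lemma lintegral_fderiv_avg_proj_le (hU : IsC2 U) : ∃ C : ℝ≥0∞, C ≠ ⊤ ∧ ∀ k : E2 → C4,
    ContDiff ℝ 1 k → HasCompactSupport k →
    ∫⁻ y in U, (Metric.ball c.x c.r).indicator (fun y => ‖fderiv ℝ (avg k) (c.proj y)‖ₑ ^ 2) y ≤
      C * slob k := by
  obtain ⟨C, hC, h⟩ := exists_avg_energy_le (G := C4)
  refine ⟨C, hC, fun k hk hkc => le_trans ?_ (h k hk hkc)⟩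
  have hm : Measurable fun y => ‖fderiv ℝ (avg k) (c.proj y)‖ₑ ^ 2 :=
    (((contDiff_avg hk hkc).continuous_fderiv one_ne_zero).comp
      c.contDiff_proj.continuous).enorm.measurable.pow_const 2
  rw [c.setLIntegral_eq hU.isOpen (hm.indicator Metric.isOpen_ball.measurableSet)
    fun y hy => indicator_of_notMem hy _]
  refine lintegral_mono fun t => lintegral_mono fun x => (indicator_le_self _ _ _).trans ?_
  rw [proj_lift]

lemma exists_sobSq_extend_le (hU : IsC2 U) : ∃ C : ℝ≥0∞, C ≠ ⊤ ∧ ∀ k : E2 → C4, ContDiff ℝ 1 k →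
    HasCompactSupport k → sobSq U (c.extend k) ≤ C * ((∫⁻ z, ‖k z‖ₑ ^ 2) + slob k) := by
  obtain ⟨A, hA, h1⟩ := c.lintegral_avg_proj_le hU
  obtain ⟨B, hB, h2⟩ := c.lintegral_fderiv_avg_proj_le hU
  obtain ⟨M, hM⟩ := (c.hasCompactSupport_cut.fderiv ℝ).exists_bound_of_continuous
    (c.contDiff_cut.continuous_fderiv one_ne_zero)
  have hM0 := (norm_nonneg _).trans (hM 0)
  set Λ : ℝ≥0∞ := ENNReal.ofReal (1 + c.lip) ^ 2 with hΛ
  set N : ℝ≥0∞ := ENNReal.ofReal M ^ 2 with hN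
  have hΛt : Λ ≠ ⊤ := by rw [hΛ]; finiteness
  have hNt : N ≠ ⊤ := by rw [hN]; finiteness
  refine ⟨(1 + 2 * N) * A + 2 * Λ * B, by finiteness, fun k hk hkc => ?_⟩
  let S := Metric.ball c.x c.r
  let F₁ : E3 → ℝ≥0∞ := S.indicator fun y => ‖avg k (c.proj y)‖ₑ ^ 2
  let F₂ : E3 → ℝ≥0∞ := S.indicator fun y => ‖fderiv ℝ (avg k) (c.proj y)‖ₑ ^ 2
  have hF₁ : Measurable F₁ := ((c.contDiff_avg_proj hk hkc).continuous.enorm.measurable.pow_const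
    2).indicator Metric.isOpen_ball.measurableSet
  have hcut : ∀ y, ‖c.cut y‖ₑ ≤ 1 := fun y => by
    rw [← ofReal_norm, ← ENNReal.ofReal_one]
    exact ENNReal.ofReal_le_ofReal (c.abs_cut_le y)
  have p1 : ∀ y, ‖c.extend k y‖ₑ ^ 2 ≤ F₁ y := fun y => by
    by_cases hy : y ∈ S
    · simp only [F₁, indicator_of_mem hy, extend, enorm_smul, mul_pow]
      exact mul_le_of_le_one_left zero_le (pow_le_one₀ zero_le (hcut y))
    · simp [extend, c.cut_eq_zero hy]
  have p2 : ∀ y, ‖fderiv ℝ (c.extend k) y‖ₑ ^ 2 ≤ 2 * (Λ * F₂ y + N * F₁ y) := fun y => by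
    by_cases hy : y ∈ S
    · simp only [F₁, F₂, indicator_of_mem hy]
      have e : fderiv ℝ (c.extend k) y = c.cut y • fderiv ℝ (fun y => avg k (c.proj y)) y +
          (fderiv ℝ c.cut y).smulRight (avg k (c.proj y)) :=
        fderiv_fun_smul (c.contDiff_cut.differentiable one_ne_zero y)
          ((c.contDiff_avg_proj hk hkc).differentiable one_ne_zero y)
      have hp : ‖fderiv ℝ c.proj y‖ ≤ 1 + c.lip := by
        simpa using norm_fderiv_le_of_lipschitz ℝ c.lipschitzWith_proj (x₀ := y)
      have hcomp : ‖fderiv ℝ (fun y => avg k (c.proj y)) y‖ ≤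
          (1 + c.lip) * ‖fderiv ℝ (avg k) (c.proj y)‖ := by
        have := fderiv_comp y ((contDiff_avg hk hkc).differentiable one_ne_zero (c.proj y))
          (c.contDiff_proj.differentiable two_ne_zero y)
        change fderiv ℝ (avg k ∘ c.proj) y = _ at this
        change ‖fderiv ℝ (avg k ∘ c.proj) y‖ ≤ _
        rw [this, mul_comm]
        refine (ContinuousLinearMap.opNorm_comp_le _ _).trans ?_
        gcongr
      rw [e]
      refine (enorm_add_sq_le _ _).trans ?_
      gcongr
      · rw [enorm_smul, mul_pow]
        refine (mul_le_of_le_one_left zero_le (pow_le_one₀ zero_le (hcut y))).trans ?_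
        rw [hΛ, ← mul_pow]
        gcongr
        rw [← ofReal_norm, ← ofReal_norm, ← ENNReal.ofReal_mul (by positivity)]
        exact ENNReal.ofReal_le_ofReal hcomp
      · rw [hN, ← mul_pow]
        gcongr
        rw [← ofReal_norm, ContinuousLinearMap.norm_smulRight_apply,
          ENNReal.ofReal_mul (norm_nonneg _), ofReal_norm (avg k _)]
        gcongr
        exact hM y
    · have : fderiv ℝ (c.extend k) y = 0 := fderiv_of_notMem_tsupport (𝕜 := ℝ) fun h =>
        hy (c.tsupport_cut (closure_mono (Function.support_smul_subset_left _ _) h))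
      rw [← ofReal_norm, this, norm_zero, ENNReal.ofReal_zero, zero_pow two_ne_zero]
      exact zero_le
  calc sobSq U (c.extend k)
      ≤ (∫⁻ y in U, F₁ y) + ∫⁻ y in U, 2 * (Λ * F₂ y + N * F₁ y) :=
        add_le_add (lintegral_mono p1) (lintegral_mono p2)
    _ = (1 + 2 * N) * (∫⁻ y in U, F₁ y) + 2 * Λ * ∫⁻ y in U, F₂ y := by
        rw [lintegral_const_mul' _ _ (by simp), lintegral_add_right _ (hF₁.const_mul _),
          lintegral_const_mul' _ _ hΛt, lintegral_const_mul' _ _ hNt]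
        ring
    _ ≤ (1 + 2 * N) * (A * ∫⁻ z, ‖k z‖ₑ ^ 2) + 2 * Λ * (B * slob k) := by
        gcongr
        · exact h1 k hk hkc
        · exact h2 k hk hkc
    _ ≤ ((1 + 2 * N) * A + 2 * Λ * B) * (∫⁻ z, ‖k z‖ₑ ^ 2) +
        ((1 + 2 * N) * A + 2 * Λ * B) * slob k := by
        rw [← mul_assoc, ← mul_assoc]
        gcongr
        · exact le_self_add
        · exact le_add_self
    _ = _ := by ring

lemma eLpNorm_extend_sub_le (hU : IsC2 U) {χ : E3 → ℝ}
    (hχs : tsupport χ ⊆ Metric.ball c.x (c.r / 2)) (g : E3 → C4) (k : E2 → C4) :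
    eLpNorm (c.extend k - fun y => χ y • g y) 2 (surf U) ≤
      (c.jacBound + 1) * eLpNorm (k - c.localize χ g) 2 volume := by
  refine eLpNorm_two_le ?_
  rw [mul_pow, eLpNorm_two_sq]
  refine (c.lintegral_surf_le hU.isOpen fun y hy => ?_).trans ?_
  · simp [extend, c.cut_eq_zero hy, c.eq_zero_of_notMem_ball hχs hy]
  · gcongr with z
    · rw [show (c.jacBound + 1) ^ 2 = c.jacBound + (c.jacBound ^ 2 + c.jacBound + 1) by ring]
      exact le_self_add
    · have : (c.extend k - fun y => χ y • g y) (c.gr z) =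
          c.cut (c.gr z) • (k - c.localize χ g) z := by
        rw [Pi.sub_apply, extend_gr, Pi.sub_apply, smul_sub]
        congr 1
        -- Where `χ` does not vanish the cut-off equals one, so multiplying by it does not change
        -- the localized function.
        by_cases h : χ (c.gr z) = 0
        · simp [localize, h]
        · rw [c.cut_eq_one (hχs (subset_tsupport _ h)), one_smul]
          rfl
      rw [this, enorm_smul]
      refine mul_le_of_le_one_left zero_le ?_
      rw [← ofReal_norm, ← ENNReal.ofReal_one]
      exact ENNReal.ofReal_le_ofReal (c.abs_cut_le _)

end Chart

lemma sobSq_sum_le {U : Set E3} {ι : Type*} (s : Finset ι) {w : ι → E3 → C4}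
    (hw : ∀ i, ContDiff ℝ 1 (w i)) : sobSq U (fun y => ∑ i ∈ s, w i y) ≤
      s.card * ∑ i ∈ s, sobSq U (w i) := by
  have hN : (s.card : ℝ≥0∞) ≠ ⊤ := by simp
  simp only [sobSq, Finset.sum_add_distrib, mul_add]
  rw [← lintegral_finsetSum _ fun i _ => (hw i).continuous.enorm.measurable.pow_const 2,
    ← lintegral_finsetSum _ fun i _ =>
      ((hw i).continuous_fderiv one_ne_zero).enorm.measurable.pow_const 2,
    ← lintegral_const_mul' _ _ hN, ← lintegral_const_mul' _ _ hN]
  refine add_le_add (lintegral_mono fun y => enorm_sum_sq_le _ _) (lintegral_mono fun y => ?_)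
  rw [fderiv_fun_sum fun i _ => (hw i).differentiable one_ne_zero y]
  exact enorm_sum_sq_le _ _

/-- Every function in `H^{1/2}` is a trace. -/
theorem exists_hasTrace_of_surfSlob {U : Set E3} (hU : IsC2 U) {g : E3 → C4}
    (hg : StronglyMeasurable g) (hg2 : MemLp g 2 (surf U)) (hs : surfSlob U g ≠ ⊤) :
    ∃ f : E3 → C4, MemLp f 2 (volume.restrict U) ∧ HasTrace U U f g := by
  obtain ⟨T⟩ := hU.nonempty_atlas
  have hχ : ∀ i, ContDiff ℝ 1 (T.χ (some i)) := fun i => (T.contDiff _).of_le (by simp)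
  have hχs := T.tsupport_some
  let v : T.ι → E2 → C4 := fun i => (T.c i).localize (T.χ (some i)) g
  have hv : ∀ i, StronglyMeasurable (v i) := fun i =>
    (T.c i).stronglyMeasurable_localize (hχ i) hg
  let ε : ℕ → ℝ≥0∞ := fun n => ((n : ℝ≥0∞) + 1)⁻¹
  have hε : ∀ n, ε n ≠ 0 := fun n => by
    simp only [ε, ne_eq, ENNReal.inv_eq_zero]; finiteness
  have hεt : Tendsto ε atTop (𝓝 0) := by
    have := (tendsto_add_atTop_iff_nat (f := fun n : ℕ => ((n : ℝ≥0∞))⁻¹) 1).2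
      ENNReal.tendsto_inv_nat_nhds_zero
    simpa [ε] using this
  -- The localized data are smoothed in the `L²` and Slobodeckij norms. The extension is linear and
  -- bounded for these norms, so the extensions are Cauchy in H¹(U) and their limit has trace `g`.
  choose k hk hkc hk2 hks using fun (i : T.ι) (n : ℕ) => exists_contDiff_slob (hv i)
    ((T.c i).memLp_localize (hχ i) (hχs i) hg hU hg2)
    ((T.c i).hasCompactSupport_localize (hχs i))
    ((T.c i).slob_localize_ne_top (hχ i) (hχs i) hg hU hg2 hs) (hε n)
  choose C hC hCle using fun i => (T.c i).exists_sobSq_extend_le hU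
  let φ : ℕ → E3 → C4 := fun n y => ∑ i, (T.c i).extend (k i n) y
  have hext : ∀ i n, ContDiff ℝ 1 ((T.c i).extend (k i n)) := fun i n =>
    (T.c i).contDiff_extend (hk i n) (hkc i n)
  have hdiff : ∀ i n m, (∫⁻ z, ‖(k i n - k i m) z‖ₑ ^ 2) + slob (k i n - k i m) ≤
      4 * (ε n ^ 2 + ε m ^ 2) := fun i n m => by
    have e : k i n - k i m = (k i n - v i) - (k i m - v i) := by abel
    have hmn : ∀ n, StronglyMeasurable (k i n - v i) := fun n =>
      (hk i n).continuous.stronglyMeasurable.sub (hv i)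
    have h1 : ∫⁻ z, ‖(k i n - k i m) z‖ₑ ^ 2 ≤ 2 * (ε n ^ 2 + ε m ^ 2) := by
      rw [e]
      refine (lintegral_mono fun z => enorm_sub_sq_le _ _).trans ?_
      rw [lintegral_const_mul' _ _ (by simp), lintegral_add_left ((hmn n).enorm.pow_const 2),
        ← eLpNorm_two_sq, ← eLpNorm_two_sq]
      gcongr
      · exact hk2 i n
      · exact hk2 i m
    have h2 : slob (k i n - k i m) ≤ 2 * (ε n ^ 2 + ε m ^ 2) := by
      rw [e]
      refine (slob_sub_le (hmn n) (hmn m)).trans ?_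
      gcongr
      · exact hks i n
      · exact hks i m
    exact (add_le_add h1 h2).trans (le_of_eq (by ring))
  refine exists_hasTrace_of_cauchy hU (φ := φ) (fun n => ContDiff.sum fun i _ => hext i n)
    (fun n => ?_) hg.aestronglyMeasurable ?_ ?_
  · have h := HasCompactSupport.of_support_subset_isCompact (f := φ n)
      (isCompact_iUnion fun i => ((T.c i).hasCompactSupport_extend (k i n)).isCompact)
      (fun y hy => by
        by_contra hn
        refine hy (Finset.sum_eq_zero fun i _ => ?_)
        exact image_eq_zero_of_notMem_tsupport fun h => hn (mem_iUnion.2 ⟨i, h⟩))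
    exact h
  · set N : ℝ≥0∞ := (((Finset.univ : Finset T.ι).card : ℕ) : ℝ≥0∞) with hN
    have hNt : N ≠ ⊤ := by simp [hN]
    have hle : ∀ p : ℕ × ℕ, sobSq U (φ p.1 - φ p.2) ≤
        (N * ∑ i, C i * 4) * (ε p.1 ^ 2 + ε p.2 ^ 2) := fun p => by
      have e : φ p.1 - φ p.2 = fun y => ∑ i, (T.c i).extend (k i p.1 - k i p.2) y := by
        funext y
        simp only [φ, Pi.sub_apply, (T.c _).extend_sub (hk _ p.1).continuous (hk _ p.2).continuous,
          Finset.sum_sub_distrib]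
      rw [e]
      refine (sobSq_sum_le Finset.univ fun i => (T.c i).contDiff_extend
        ((hk i _).sub (hk i _)) ((hkc i _).sub (hkc i _))).trans ?_
      rw [mul_assoc, Finset.sum_mul]
      gcongr with i
      rw [mul_assoc]
      refine (hCle i _ ((hk i _).sub (hk i _)) ((hkc i _).sub (hkc i _))).trans ?_
      gcongr
      exact hdiff i _ _
    have hsq : Tendsto (fun n => ε n ^ 2) atTop (𝓝 0) := by
      simpa [Function.comp_def] using ((ENNReal.continuous_pow 2).tendsto _).comp hεt
    have hlim := ENNReal.Tendsto.const_mul (a := N * ∑ i, C i * 4)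
      ((hsq.comp tendsto_fst).add (hsq.comp tendsto_snd))
      (Or.inr (ENNReal.mul_ne_top hNt (ENNReal.sum_ne_top.2 fun i _ => by
        have := hC i
        finiteness)))
    rw [add_zero, mul_zero, prod_atTop_atTop_eq] at hlim
    exact tendsto_of_tendsto_of_tendsto_of_le_of_le tendsto_const_nhds hlim (fun _ => zero_le) hle
  · have hle : ∀ n, eLpNorm (φ n - g) 2 (surf U) ≤ ∑ i, ((T.c i).jacBound + 1) * ε n := fun n => by
      have e : φ n - g =ᵐ[surf U]
          ∑ i, ((T.c i).extend (k i n) - fun y => T.χ (some i) y • g y) := by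
        filter_upwards [ae_surf_mem] with y hy
        have h1 := T.sum_eq y
        rw [Fintype.sum_option, image_eq_zero_of_notMem_tsupport fun h => T.tsupport_none h hy,
          zero_add] at h1
        simp only [φ, Pi.sub_apply, Finset.sum_apply, Finset.sum_sub_distrib, ← Finset.sum_smul, h1,
          one_smul]
      rw [eLpNorm_congr_ae e]
      refine (eLpNorm_sum_le (fun i _ => ?_) (by norm_num)).trans ?_
      · exact (hext i n).continuous.aestronglyMeasurable.sub
          ((hχ i).continuous.aestronglyMeasurable.smul hg.aestronglyMeasurable)
      · gcongr with i
        refine ((T.c i).eLpNorm_extend_sub_le hU (hχs i) g (k i n)).trans ?_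
        gcongr
        exact hk2 i n
    have hlim : Tendsto (fun n => ∑ i, ((T.c i).jacBound + 1) * ε n) atTop (𝓝 0) := by
      have := tendsto_finsetSum (Finset.univ : Finset T.ι) fun i _ =>
        ENNReal.Tendsto.const_mul (a := (T.c i).jacBound + 1) hεt
          (Or.inr (ENNReal.add_ne_top.2 ⟨(T.c i).jacBound_ne_top, ENNReal.one_ne_top⟩))
      simpa using this
    exact tendsto_of_tendsto_of_tendsto_of_le_of_le tendsto_const_nhds hlim (fun _ => zero_le) hle

end TraceSurjective

/-! ### The Dirac matrices -/

section DiracMatrices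

lemma act_mul (A B : Matrix (Fin 4) (Fin 4) ℂ) (v : C4) : act (A * B) v = act A (act B v) := by
  simp [act, map_mul]

lemma act_add (A B : Matrix (Fin 4) (Fin 4) ℂ) (v : C4) : act (A + B) v = act A v + act B v := by
  simp [act, map_add]

lemma act_smul (z : ℂ) (A : Matrix (Fin 4) (Fin 4) ℂ) (v : C4) : act (z • A) v = z • act A v := by
  simp [act, map_smul]

lemma act_one (v : C4) : act 1 v = v := by
  simp [act, map_one]

lemma inner_act_left {A : Matrix (Fin 4) (Fin 4) ℂ} (hA : A.IsHermitian) (u v : C4) :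
    inner ℂ (act A u) v = inner ℂ u (act A v) := by
  have h : star (act A) = act A := by
    rw [act, ← map_star]
    exact congrArg _ hA
  rw [ContinuousLinearMap.star_eq_adjoint] at h
  conv_lhs => rw [← h]
  rw [ContinuousLinearMap.adjoint_inner_left]

lemma alpha_zero : alpha 0 = !![0, 0, 0, 1; 0, 0, 1, 0; 0, 1, 0, 0; 1, 0, 0, 0] := by
  ext i j
  fin_cases i <;> fin_cases j <;> rfl

lemma alpha_one : alpha 1 = !![0, 0, 0, -Complex.I; 0, 0, Complex.I, 0;
    0, -Complex.I, 0, 0; Complex.I, 0, 0, 0] := by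
  ext i j
  fin_cases i <;> fin_cases j <;> rfl

lemma alpha_two : alpha 2 = !![0, 0, 1, 0; 0, 0, 0, -1; 1, 0, 0, 0; 0, -1, 0, 0] := by
  ext i j
  fin_cases i <;> fin_cases j <;> rfl

lemma beta_eq : beta = !![1, 0, 0, 0; 0, 1, 0, 0; 0, 0, -1, 0; 0, 0, 0, -1] := by
  ext i j
  fin_cases i <;> fin_cases j <;> simp [beta, ofBlocks, finSumFinEquiv, Fin.addCases]

lemma alpha_isHermitian (j : Fin 3) : (alpha j).IsHermitian := by
  ext a b
  fin_cases j <;> simp only [Fin.zero_eta, Fin.mk_one, Fin.reduceFinMk, alpha_zero, alpha_one,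
    alpha_two] <;> fin_cases a <;> fin_cases b <;> simp

lemma beta_isHermitian : beta.IsHermitian := by
  ext a b
  rw [beta_eq]
  fin_cases a <;> fin_cases b <;> simp

lemma beta_mul_beta : beta * beta = 1 := by
  ext a b
  rw [beta_eq]
  fin_cases a <;> fin_cases b <;> simp

lemma alpha_mul_beta (j : Fin 3) : alpha j * beta + beta * alpha j = 0 := by
  ext a b
  rw [beta_eq]
  fin_cases j <;> simp only [Fin.zero_eta, Fin.mk_one, Fin.reduceFinMk, alpha_zero, alpha_one,
    alpha_two] <;> fin_cases a <;> fin_cases b <;> simp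

lemma alpha_mul_self (j : Fin 3) : alpha j * alpha j = 1 := by
  ext a b
  fin_cases j <;> simp only [Fin.zero_eta, Fin.mk_one, Fin.reduceFinMk, alpha_zero, alpha_one,
    alpha_two] <;> fin_cases a <;> fin_cases b <;> simp

lemma alpha_one_mul_zero : alpha 1 * alpha 0 = -(alpha 0 * alpha 1) := by
  ext a b
  rw [alpha_zero, alpha_one]
  fin_cases a <;> fin_cases b <;> simp

lemma alpha_two_mul_zero : alpha 2 * alpha 0 = -(alpha 0 * alpha 2) := by
  ext a b
  rw [alpha_zero, alpha_two]
  fin_cases a <;> fin_cases b <;> simp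

lemma alpha_two_mul_one : alpha 2 * alpha 1 = -(alpha 1 * alpha 2) := by
  ext a b
  rw [alpha_one, alpha_two]
  fin_cases a <;> fin_cases b <;> simp

lemma alphaDot_isHermitian (n : E3) : (alphaDot n).IsHermitian := by
  rw [alphaDot, Matrix.IsHermitian, Matrix.conjTranspose_sum]
  refine Finset.sum_congr rfl fun j _ => ?_
  rw [Matrix.conjTranspose_smul, (alpha_isHermitian j).eq]
  simp

/-- Distinct Dirac matrices anticommute, so the mixed terms cancel, and each has square one. On Σ
the matrix α·ν is therefore an involution. -/
lemma alphaDot_mul_self (n : E3) : alphaDot n * alphaDot n = ((‖n‖ ^ 2 : ℝ) : ℂ) • 1 := by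
  rw [EuclideanSpace.real_norm_sq_eq]
  simp only [alphaDot, Fin.sum_univ_three, add_mul, mul_add, smul_mul_smul_comm, alpha_mul_self,
    alpha_one_mul_zero, alpha_two_mul_zero, alpha_two_mul_one]
  push_cast
  module

lemma act_alphaDot_act (n : E3) (v : C4) :
    act (alphaDot n) (act (alphaDot n) v) = ((‖n‖ ^ 2 : ℝ) : ℂ) • v := by
  rw [← act_mul, alphaDot_mul_self, act_smul, act_one]

lemma norm_act_alphaDot (n : E3) (v : C4) : ‖act (alphaDot n) v‖ = ‖n‖ * ‖v‖ := by
  have h : ‖act (alphaDot n) v‖ ^ 2 = (‖n‖ * ‖v‖) ^ 2 := by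
    have := inner_act_left (alphaDot_isHermitian n) v (act (alphaDot n) v)
    rw [act_alphaDot_act, inner_smul_right, inner_self_eq_norm_sq_to_K,
      inner_self_eq_norm_sq_to_K] at this
    rw [mul_pow]
    exact Complex.ofReal_injective (by push_cast; simpa using this)
  exact (pow_left_inj₀ (norm_nonneg _) (by positivity) two_ne_zero).1 h

lemma act_alphaDot (n : E3) (v : C4) : act (alphaDot n) v = ∑ j, n j • act (alpha j) v := by
  simp only [alphaDot, Fin.sum_univ_three, act_add, act_smul]
  simp only [Complex.coe_smul]

lemma alphaDot_neg (n : E3) : alphaDot (-n) = -alphaDot n := by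
  simp [alphaDot]

lemma act_neg (A : Matrix (Fin 4) (Fin 4) ℂ) (v : C4) : act (-A) v = -act A v := by
  simp [act, map_neg]

end DiracMatrices

/-! ### The Dirac operator on differentiable functions -/

section Classical

/-- The coefficients `-i αⱼ` of the Dirac operator. -/
def diracA (j : Fin 3) : C4 →L[ℝ] C4 := ((-Complex.I) • act (alpha j)).restrictScalars ℝ

/-- The zeroth order coefficient `m β` of the Dirac operator. -/
def diracB (m : ℝ) : C4 →L[ℝ] C4 := ((m : ℂ) • act beta).restrictScalars ℝ

lemma diracA_apply (j : Fin 3) (v : C4) : diracA j v = -(Complex.I • act (alpha j) v) := by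
  simp [diracA]

lemma diracB_apply (m : ℝ) (v : C4) : diracB m v = (m : ℂ) • act beta v := rfl

/-- `-i ∑ⱼ αⱼ dⱼ + m β f`. -/
def diracOf (m : ℝ) (f : E3 → C4) (d : Fin 3 → E3 → C4) (x : E3) : C4 :=
  ∑ j, diracA j (d j x) + diracB m (f x)

/-- The Dirac operator on differentiable functions. -/
def dirac (m : ℝ) (φ : E3 → C4) : E3 → C4 := opApply diracA (diracB m) φ

lemma dirac_eq (m : ℝ) (φ : E3 → C4) : dirac m φ = diracOf m φ fun j => pd j φ := rfl

lemma memLp_diracOf {μ : Measure E3} (m : ℝ) {f : E3 → C4} {d : Fin 3 → E3 → C4}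
    (hf : MemLp f 2 μ) (hd : ∀ j, MemLp (d j) 2 μ) : MemLp (diracOf m f d) 2 μ := by
  have h1 : MemLp (fun x => ∑ j, diracA j (d j x)) 2 μ :=
    memLp_finsetSum _ fun j _ => (diracA j).comp_memLp' (hd j)
  exact h1.add ((diracB m).comp_memLp' hf)

/-- The general density theorem for first order systems becomes available for the Dirac operator;
the signs agree because the coefficients are -i αⱼ. -/
lemma isWeakDirac_iff {m : ℝ} {U : Set E3} {f g : E3 → C4} (hf : MemLp f 2 (volume.restrict U))
    (hg : MemLp g 2 (volume.restrict U)) :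
    IsWeakDirac m U f g ↔ IsWeakOp diracA (diracB m) U f g := by
  refine forall₂_congr fun φ hφ => ?_
  have e : ∀ x, φ x • g x + ∑ j, pd j φ x • diracA j (f x) - φ x • diracB m (f x) =
      φ x • g x - ∑ j, pd j φ x • (Complex.I • act (alpha j) (f x)) -
        φ x • ((m : ℂ) • act beta (f x)) := fun x => by
    simp only [diracA_apply, diracB_apply, smul_neg, Finset.sum_neg_distrib, sub_eq_add_neg]
  have i1 := hφ.integrable hg
  have i2 : ∀ j, IntegrableOn (fun x => pd j φ x • (Complex.I • act (alpha j) (f x))) U :=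
    fun j => hφ.integrable_pd j (memLp_act (alpha j) Complex.I hf)
  have i3 := hφ.integrable (memLp_act beta m hf)
  have i4 : IntegrableOn (fun x => ∑ j, pd j φ x • (Complex.I • act (alpha j) (f x))) U :=
    integrable_finsetSum _ fun j _ => i2 j
  have i5 : IntegrableOn (fun x => φ x • g x -
    ∑ j, pd j φ x • (Complex.I • act (alpha j) (f x))) U := i1.sub i4
  simp only [e]
  rw [integral_sub i5 i3, integral_sub i1 i4, integral_finsetSum _ fun j _ => i2 j, sub_sub,
    sub_eq_zero]

lemma isWeakDirac_diracOf {m : ℝ} {U : Set E3} {f : E3 → C4} {d : Fin 3 → E3 → C4}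
    (hf : MemLp f 2 (volume.restrict U)) (hd : ∀ j, MemLp (d j) 2 (volume.restrict U))
    (hw : ∀ j, IsWeakPD U j f (d j)) : IsWeakDirac m U f (diracOf m f d) := by
  intro φ hφ
  have e : ∀ x, φ x • diracOf m f d x = (∑ j, diracA j (φ x • d j x)) +
      φ x • ((m : ℂ) • act beta (f x)) := fun x => by
    simp only [diracOf, smul_add, Finset.smul_sum, map_smul, diracB_apply]
  have i1 : ∀ j, IntegrableOn (fun x => diracA j (φ x • d j x)) U := fun j =>
    (diracA j).integrable_comp (hφ.integrable (hd j))
  have i2 : IntegrableOn (fun x => ∑ j, diracA j (φ x • d j x)) U :=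
    integrable_finsetSum _ fun j _ => i1 j
  simp only [e]
  rw [integral_add i2 (hφ.integrable (memLp_act beta m hf)), integral_finsetSum _ fun j _ => i1 j]
  congr 1
  refine Finset.sum_congr rfl fun j _ => ?_
  rw [(diracA j).integral_comp_comm (hφ.integrable (hd j)), hw j φ hφ, map_neg,
    ← (diracA j).integral_comp_comm (hφ.integrable_pd j hf), ← integral_neg]
  refine integral_congr_ae (ae_of_all _ fun x => ?_)
  simp only [map_smul, diracA_apply, smul_neg, neg_neg]

lemma memLp_test {φ : E3 → C4} {V : Set E3} (hφ : IsTest V φ) (μ : Measure E3)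
    [IsFiniteMeasureOnCompacts μ] : MemLp φ 2 μ :=
  memLp_of_test hφ.1.continuous hφ.2.1 μ

lemma memLp_pd {φ : E3 → C4} {V : Set E3} (hφ : IsTest V φ) (μ : Measure E3)
    [IsFiniteMeasureOnCompacts μ] (j : Fin 3) : MemLp (pd j φ) 2 μ :=
  memLp_of_test (hφ.continuous_pd j) (hφ.2.1.fderiv_apply ℝ _) μ

lemma memLp_dirac {φ : E3 → C4} {V : Set E3} (hφ : IsTest V φ) (m : ℝ) (μ : Measure E3)
    [IsFiniteMeasureOnCompacts μ] : MemLp (dirac m φ) 2 μ :=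
  memLp_diracOf m (memLp_test hφ μ) (memLp_pd hφ μ)

lemma isWeakDirac_dirac {m : ℝ} {U V : Set E3} {φ : E3 → C4} (hφ : IsTest V φ) :
    IsWeakDirac m U φ (dirac m φ) :=
  isWeakDirac_diracOf (memLp_test hφ _) (memLp_pd hφ _) fun j =>
    isWeakPD_of_contDiff (hφ.1.of_le (by simp)) j

lemma contDiff_inner_act {φ ψ : E3 → C4} (hφ : ContDiff ℝ 1 φ) (hψ : ContDiff ℝ 1 ψ)
    (A : Matrix (Fin 4) (Fin 4) ℂ) : ContDiff ℝ 1 fun x => inner ℂ (φ x) (act A (ψ x)) :=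
  hφ.inner ℂ (((act A).restrictScalars ℝ).contDiff.comp hψ)

lemma pd_inner_act {φ ψ : E3 → C4} (hφ : ContDiff ℝ 1 φ) (hψ : ContDiff ℝ 1 ψ)
    (A : Matrix (Fin 4) (Fin 4) ℂ) (j : Fin 3) (x : E3) :
    pd j (fun x => inner ℂ (φ x) (act A (ψ x))) x =
      inner ℂ (φ x) (act A (pd j ψ x)) + inner ℂ (pd j φ x) (act A (ψ x)) := by
  have h : HasFDerivAt (fun x => act A (ψ x)) (((act A).restrictScalars ℝ).comp (fderiv ℝ ψ x)) x :=
    ((act A).restrictScalars ℝ).hasFDerivAt.comp x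
      (hψ.differentiable one_ne_zero x).hasFDerivAt
  rw [pd, fderiv_inner_apply ℂ (hφ.differentiable one_ne_zero x) h.differentiableAt, h.fderiv]
  rfl

/-- Green's identity for the Dirac operator. -/
theorem dirac_green {U : Set E3} (hU : IsC2 U) (m : ℝ) {φ ψ : E3 → C4} (hφ : ContDiff ℝ 1 φ)
    (hψ : ContDiff ℝ 1 ψ) (hc : HasCompactSupport φ) :
    ∫ x in U, (inner ℂ (dirac m φ x) (ψ x) - inner ℂ (φ x) (dirac m ψ x)) =
      ∫ x, Complex.I * inner ℂ (φ x) (act (alphaDot (normal U x)) (ψ x)) ∂(surf U) := by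
  have := isFiniteMeasure_surf hU
  let F : Fin 3 → E3 → ℂ := fun j x => inner ℂ (φ x) (act (alpha j) (ψ x))
  have hF : ∀ j, ContDiff ℝ 1 (F j) := fun j => contDiff_inner_act hφ hψ (alpha j)
  have hFc : ∀ j, HasCompactSupport (F j) := fun j => hc.mono fun x hx h0 => hx (by simp [F, h0])
  have hg : ∀ j, ∫ x in U, pd j (F j) x = ∫ x, normal U x j • F j x ∂(surf U) := fun j => by
    have := gaussGreen hU (hF j) (hFc j) (EuclideanSpace.single j 1)
    simpa [EuclideanSpace.inner_single_left, pd] using this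
  -- All matrices are Hermitian: the mass terms cancel, and conjugating -i in the first slot makes
  -- the derivative terms combine to i times the divergence of ⟨φ, αⱼ ψ⟩.
  have e1 : ∀ x, inner ℂ (dirac m φ x) (ψ x) - inner ℂ (φ x) (dirac m ψ x) =
      ∑ j, Complex.I * pd j (F j) x := fun x => by
    simp only [F, fun j => pd_inner_act hφ hψ (alpha j) j x, dirac, opApply, diracA_apply,
      diracB_apply, inner_add_left, inner_add_right, sum_inner, inner_sum, inner_neg_left,
      inner_neg_right, inner_smul_left, inner_smul_right, inner_act_left (alpha_isHermitian _),
      inner_act_left beta_isHermitian, Complex.conj_I, Complex.conj_ofReal, Finset.sum_neg_distrib,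
      mul_add, Finset.sum_add_distrib, neg_mul]
    ring
  have e2 : ∀ x, Complex.I * inner ℂ (φ x) (act (alphaDot (normal U x)) (ψ x)) =
      ∑ j, Complex.I * (normal U x j • F j x) := fun x => by
    rw [act_alphaDot, inner_sum, Finset.mul_sum]
    refine Finset.sum_congr rfl fun j _ => ?_
    rw [← Complex.coe_smul, inner_smul_right, ← Complex.coe_smul, smul_eq_mul]
  obtain ⟨N, hN, -, hNn⟩ := hU.exists_normal_extension
  have i2 : ∀ j, Integrable (fun x => Complex.I * (normal U x j • F j x)) (surf U) := fun j => by
    refine Integrable.const_mul ?_ _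
    have : Integrable (fun x => N x j • F j x) (surf U) :=
      (((EuclideanSpace.proj j).continuous.comp hN.continuous).smul
        (hF j).continuous).integrable_of_hasCompactSupport (hFc j).smul_left
    refine this.congr ?_
    filter_upwards [ae_surf_mem] with x hx
    rw [hNn x hx]
  have i1 : ∀ j, IntegrableOn (fun x => Complex.I * pd j (F j) x) U := fun j =>
    (((continuous_pd j (hF j)).integrable_of_hasCompactSupport
      ((hFc j).fderiv_apply ℝ _)).const_mul _).integrableOn
  simp only [e1, e2]
  rw [integral_finsetSum _ fun j _ => i1 j, integral_finsetSum _ fun j _ => i2 j]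
  refine Finset.sum_congr rfl fun j _ => ?_
  rw [integral_const_mul, integral_const_mul, hg]

lemma surf_univ : surf univ = 0 := by
  simp [surf]

/-- Green's identity on ℝ³, where the surface measure is zero. -/
lemma integral_inner_dirac (m : ℝ) {φ ψ : E3 → C4} (hφ : ContDiff ℝ 1 φ)
    (hψ : ContDiff ℝ 1 ψ) (hc : HasCompactSupport φ) (hc' : HasCompactSupport ψ) :
    ∫ x, inner ℂ (dirac m φ x) (ψ x) = ∫ x, inner ℂ (φ x) (dirac m ψ x) := by
  have h := dirac_green isC2_univ m hφ hψ hc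
  rw [surf_univ, integral_zero_measure, Measure.restrict_univ, integral_sub, sub_eq_zero] at h
  · exact h
  · exact ((continuous_opApply hφ).inner hψ.continuous).integrable_of_hasCompactSupport
      (hc'.mono fun x hx h0 => hx (by simp [h0]))
  · exact (hφ.continuous.inner (continuous_opApply hψ)).integrable_of_hasCompactSupport
      (hc.mono fun x hx h0 => hx (by simp [h0]))

end Classical

/-! ### The energy identity and limits of smooth functions -/

section Energy

lemma IsTest.contDiff_one {F : Type*} [NormedAddCommGroup F] [NormedSpace ℝ F] {V : Set E3}
    {φ : E3 → F} (hφ : IsTest V φ) : ContDiff ℝ 1 φ :=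
  hφ.1.of_le (by simp)

lemma IsTest.contDiff_pd {V : Set E3} {φ : E3 → C4} (hφ : IsTest V φ) (j : Fin 3) :
    ContDiff ℝ ∞ (pd j φ) :=
  (hφ.1.fderiv_right (m := ∞) (by simp)).clm_apply contDiff_const

lemma IsTest.contDiff_dirac {V : Set E3} {φ : E3 → C4} (hφ : IsTest V φ) (m : ℝ) :
    ContDiff ℝ ∞ (dirac m φ) :=
  (ContDiff.sum fun j _ => (diracA j).contDiff.comp (hφ.contDiff_pd j)).add
    ((diracB m).contDiff.comp hφ.1)

lemma IsTest.hasCompactSupport_dirac {V : Set E3} {φ : E3 → C4} (hφ : IsTest V φ) (m : ℝ) :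
    HasCompactSupport (dirac m φ) := by
  refine HasCompactSupport.intro hφ.2.1 fun x hx => ?_
  simp [dirac, opApply, pd, fderiv_of_notMem_tsupport (𝕜 := ℝ) hx,
    image_eq_zero_of_notMem_tsupport hx]

lemma pd_pd_comm {V : Set E3} {φ : E3 → C4} (hφ : IsTest V φ) (j k : Fin 3) (x : E3) :
    pd j (pd k φ) x = pd k (pd j φ) x := by
  have hd : DifferentiableAt ℝ (fderiv ℝ φ) x :=
    (hφ.1.fderiv_right (m := ∞) (by simp)).differentiable (by simp) x
  have e : ∀ i l : Fin 3, pd i (pd l φ) x = fderiv ℝ (fderiv ℝ φ) x (EuclideanSpace.single i 1)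
      (EuclideanSpace.single l 1) := fun i l => by
    have : HasFDerivAt (pd l φ) ((fderiv ℝ (fderiv ℝ φ) x).flip (EuclideanSpace.single l 1)) x := by
      have := hd.hasFDerivAt.clm_apply (hasFDerivAt_const (EuclideanSpace.single l (1 : ℝ)) x)
      rw [ContinuousLinearMap.comp_zero, zero_add] at this
      exact this
    rw [pd, this.fderiv]
    rfl
  rw [e, e]
  exact ((contDiff_infty.1 hφ.1 2).contDiffAt.isSymmSndFDerivAt (by simp)).eq _ _

lemma pd_dirac {V : Set E3} {φ : E3 → C4} (hφ : IsTest V φ) (m : ℝ) (k : Fin 3) (x : E3) :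
    pd k (dirac m φ) x = ∑ j, diracA j (pd k (pd j φ) x) + diracB m (pd k φ x) := by
  have h1 : ∀ j, HasFDerivAt (fun x => diracA j (pd j φ x))
      ((diracA j).comp (fderiv ℝ (pd j φ) x)) x := fun j =>
    (diracA j).hasFDerivAt.comp x ((hφ.contDiff_pd j).differentiable (by simp) x).hasFDerivAt
  have h2 : HasFDerivAt (fun x => diracB m (φ x)) ((diracB m).comp (fderiv ℝ φ x)) x :=
    (diracB m).hasFDerivAt.comp x (hφ.differentiable x).hasFDerivAt
  have h3 : HasFDerivAt (dirac m φ) _ x := (HasFDerivAt.fun_sum fun j _ => h1 j).add h2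
  rw [pd, h3.fderiv]
  simp [pd]

lemma diracA_diracA (j k : Fin 3) (v : C4) :
    diracA j (diracA k v) = -act (alpha j * alpha k) v := by
  simp only [diracA_apply, map_neg, map_smul, act_mul, neg_neg, smul_smul,
    Complex.I_mul_I, neg_smul, one_smul]

lemma diracA_diracB (j : Fin 3) (m : ℝ) (v : C4) :
    diracA j (diracB m v) = -diracB m (diracA j v) := by
  have h : act beta (act (alpha j) v) = -act (alpha j) (act beta v) := by
    rw [← act_mul, ← act_mul, ← act_neg, eq_neg_of_add_eq_zero_right (alpha_mul_beta j)]
  simp only [diracA_apply, diracB_apply, map_neg, map_smul, h, smul_neg, neg_neg]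
  rw [smul_comm]

lemma diracB_diracB (m : ℝ) (v : C4) : diracB m (diracB m v) = ((m ^ 2 : ℝ) : ℂ) • v := by
  simp only [diracB_apply, map_smul, ← act_mul, beta_mul_beta, act_one, smul_smul]
  push_cast
  ring_nf

/-- The square of the Dirac operator is `-Δ + m²`. -/
lemma dirac_dirac {V : Set E3} {φ : E3 → C4} (hφ : IsTest V φ) (m : ℝ) (x : E3) :
    dirac m (dirac m φ) x = ((m ^ 2 : ℝ) : ℂ) • φ x - ∑ j, pd j (pd j φ) x := by
  have e : dirac m (dirac m φ) x = ∑ j, diracA j (pd j (dirac m φ) x) + diracB m (dirac m φ x) :=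
    rfl
  have e' : dirac m φ x = ∑ j, diracA j (pd j φ x) + diracB m (φ x) := rfl
  rw [e, e']
  simp only [pd_dirac hφ, map_add, Fin.sum_univ_three, diracA_diracA, diracA_diracB, diracB_diracB,
    alpha_mul_self, act_one, alpha_one_mul_zero, alpha_two_mul_zero, alpha_two_mul_one, act_neg,
    pd_pd_comm hφ 1 0, pd_pd_comm hφ 2 0, pd_pd_comm hφ 2 1]
  module

lemma integral_inner_pd_pd {V : Set E3} {φ : E3 → C4} (hφ : IsTest V φ) (j : Fin 3) :
    ∫ x, inner ℂ (φ x) (pd j (pd j φ) x) = -∫ x, inner ℂ (pd j φ x) (pd j φ x) := by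
  have h1 : ContDiff ℝ 1 (pd j φ) := (hφ.contDiff_pd j).of_le (by simp)
  have hc : HasCompactSupport (pd j φ) := hφ.2.1.fderiv_apply ℝ _
  have h2 : ContDiff ℝ 1 fun x => inner ℂ (φ x) (act 1 (pd j φ x)) :=
    contDiff_inner_act hφ.contDiff_one h1 1
  have h3 : HasCompactSupport fun x => inner ℂ (φ x) (act 1 (pd j φ x)) :=
    hφ.2.1.mono fun x hx h0 => hx (by simp [h0])
  have h := integral_fderiv_eq_zero (μ := volume) h2 h3 (EuclideanSpace.single j 1)
  have e : ∀ x, fderiv ℝ (fun x => inner ℂ (φ x) (act 1 (pd j φ x))) x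
      (EuclideanSpace.single j 1) =
      inner ℂ (φ x) (pd j (pd j φ) x) + inner ℂ (pd j φ x) (pd j φ x) := fun x => by
    have := pd_inner_act hφ.contDiff_one h1 1 j x
    rwa [act_one, act_one] at this
  simp only [e] at h
  rw [integral_add] at h
  · exact eq_neg_of_add_eq_zero_left h
  · exact (hφ.1.continuous.inner (continuous_pd j h1)).integrable_of_hasCompactSupport
      (hφ.2.1.mono fun x hx h0 => hx (by simp [h0]))
  · exact ((hφ.continuous_pd j).inner (hφ.continuous_pd j)).integrable_of_hasCompactSupport
      (hc.mono fun x hx h0 => hx (by simp [h0]))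

/-- By symmetry the left side is ⟨φ, D²φ⟩ for the Dirac operator D, and D² = -Δ + m²; one
integration by parts gives the gradient terms. -/
lemma integral_norm_dirac_sq {V : Set E3} {φ : E3 → C4} (hφ : IsTest V φ) (m : ℝ) :
    ∫ x, ‖dirac m φ x‖ ^ 2 = (m ^ 2 * ∫ x, ‖φ x‖ ^ 2) + ∑ j, ∫ x, ‖pd j φ x‖ ^ 2 := by
  have h := integral_inner_dirac m hφ.contDiff_one ((hφ.contDiff_dirac m).of_le (by simp)) hφ.2.1
    (hφ.hasCompactSupport_dirac m)
  have i1 : ∀ j, Integrable fun x => inner ℂ (φ x) (pd j (pd j φ) x) := fun j =>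
    (hφ.1.continuous.inner (continuous_pd j
      ((hφ.contDiff_pd j).of_le (by simp)))).integrable_of_hasCompactSupport
      (hφ.2.1.mono fun x hx h0 => hx (by simp [h0]))
  have i2 : Integrable fun x => inner ℂ (φ x) (φ x) :=
    (hφ.1.continuous.inner hφ.1.continuous).integrable_of_hasCompactSupport
      (hφ.2.1.mono fun x hx h0 => hx (by simp [h0]))
  simp only [dirac_dirac hφ, inner_sub_right, inner_smul_right, inner_sum] at h
  rw [integral_sub (i2.const_mul _) (integrable_finsetSum _ fun j _ => i1 j), integral_const_mul,
    integral_finsetSum _ fun j _ => i1 j] at h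
  simp only [integral_inner_pd_pd hφ, Finset.sum_neg_distrib, sub_neg_eq_add] at h
  have e : ∀ u : E3 → C4, ∫ x, inner ℂ (u x) (u x) = ((∫ x, ‖u x‖ ^ 2 : ℝ) : ℂ) := fun u => by
    rw [← integral_complex_ofReal]
    refine integral_congr_ae (ae_of_all _ fun x => ?_)
    simp [inner_self_eq_norm_sq_to_K]
  simp only [e] at h
  exact_mod_cast h

lemma eLpNorm_pd_le_eLpNorm_dirac {V : Set E3} {φ : E3 → C4} (hφ : IsTest V φ) (m : ℝ)
    (j : Fin 3) : eLpNorm (pd j φ) 2 volume ≤ eLpNorm (dirac m φ) 2 volume := by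
  have e : ∀ {u : E3 → C4}, MemLp u 2 volume →
      eLpNorm u 2 volume ^ 2 = ENNReal.ofReal (∫ x, ‖u x‖ ^ 2) := fun {u} hu => by
    rw [eLpNorm_two_sq, ofReal_integral_eq_lintegral_ofReal (hu.integrable_norm_pow two_ne_zero)
      (ae_of_all _ fun x => by positivity)]
    refine lintegral_congr fun x => ?_
    rw [ENNReal.ofReal_pow (norm_nonneg _), ofReal_norm]
  have h : eLpNorm (pd j φ) 2 volume ^ 2 ≤ eLpNorm (dirac m φ) 2 volume ^ 2 := by
    rw [e (memLp_pd hφ _ j), e (memLp_dirac hφ m _), integral_norm_dirac_sq hφ]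
    refine ENNReal.ofReal_le_ofReal ?_
    have h1 := Finset.single_le_sum (f := fun j => ∫ x, ‖pd j φ x‖ ^ 2)
      (fun j _ => integral_nonneg fun x => by positivity) (Finset.mem_univ j)
    have h2 : 0 ≤ m ^ 2 * ∫ x, ‖φ x‖ ^ 2 :=
      mul_nonneg (sq_nonneg _) (integral_nonneg fun x => by positivity)
    linarith
  exact (ENNReal.pow_le_pow_left_iff two_ne_zero).1 h

lemma diracOf_sub (m : ℝ) (f f' : E3 → C4) (d d' : Fin 3 → E3 → C4) :
    diracOf m f d - diracOf m f' d' = diracOf m (f - f') (d - d') := by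
  funext x
  simp only [diracOf, Pi.sub_apply, map_sub, Finset.sum_sub_distrib]
  abel

lemma dirac_sub {φ ψ : E3 → C4} (hφ : ContDiff ℝ 1 φ) (hψ : ContDiff ℝ 1 ψ) (m : ℝ) :
    dirac m (φ - ψ) = dirac m φ - dirac m ψ := by
  simp only [dirac_eq, diracOf_sub, pd_sub' hφ hψ]
  rfl

lemma IsTest.sub {V : Set E3} {φ ψ : E3 → C4} (hφ : IsTest V φ) (hψ : IsTest V ψ) :
    IsTest V (φ - ψ) := by
  have := hφ.add (hψ.smul (-1))
  rwa [neg_smul, one_smul, ← sub_eq_add_neg] at this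

lemma tendsto_eLpNorm_prod {α F : Type*} [MeasurableSpace α] [NormedAddCommGroup F] {μ : Measure α}
    {u : ℕ → α → F} {f : α → F} (hu : ∀ n, AEStronglyMeasurable (u n) μ)
    (hf : AEStronglyMeasurable f μ)
    (h : Tendsto (fun n => eLpNorm (u n - f) 2 μ) atTop (𝓝 0)) :
    Tendsto (fun p : ℕ × ℕ => eLpNorm (u p.1 - u p.2) 2 μ) atTop (𝓝 0) := by
  have h1 := (h.comp tendsto_fst).add (h.comp tendsto_snd)
  rw [add_zero, prod_atTop_atTop_eq] at h1
  refine tendsto_of_tendsto_of_tendsto_of_le_of_le tendsto_const_nhds h1 (fun _ => zero_le)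
    fun p => ?_
  have e : u p.1 - u p.2 = (u p.1 - f) - (u p.2 - f) := by abel
  simp only [e]
  exact eLpNorm_sub_le ((hu _).sub hf) ((hu _).sub hf) (by norm_num)

/-- For test functions, convergence in the graph norm of the Dirac operator on `ℝ³` is convergence
in `H¹`. -/
lemma h1Tendsto_of_dirac {m : ℝ} {V : Set E3} {φ : ℕ → E3 → C4} {f g : E3 → C4}
    (hφ : ∀ n, IsTest V (φ n)) (hf : MemLp f 2 volume) (hg : MemLp g 2 volume)
    (h : Tendsto (fun n => eLpNorm (φ n - f) 2 volume) atTop (𝓝 0))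
    (h' : Tendsto (fun n => eLpNorm (dirac m (φ n) - g) 2 volume) atTop (𝓝 0)) :
    H1Tendsto univ φ f := by
  rw [← Measure.restrict_univ (μ := (volume : Measure E3))] at hf hg h h'
  refine ⟨h, fun j => ?_⟩
  obtain ⟨d, hd, hdt⟩ := exists_limit_of_cauchy (μ := volume.restrict univ)
    (f := fun n => pd j (φ n)) (fun n => memLp_pd (hφ n) _ j) (by
      refine tendsto_of_tendsto_of_tendsto_of_le_of_le tendsto_const_nhds
        (tendsto_eLpNorm_prod (fun n => (memLp_dirac (hφ n) m _).1) hg.1 h') (fun _ => zero_le)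
        fun p => ?_
      simp only
      rw [← pd_sub' (hφ _).contDiff_one (hφ _).contDiff_one,
        ← dirac_sub (hφ _).contDiff_one (hφ _).contDiff_one, Measure.restrict_univ]
      exact eLpNorm_pd_le_eLpNorm_dirac ((hφ _).sub (hφ _)) m j)
  exact ⟨d, hd, IsWeakPD.of_tendsto (fun n => isWeakPD_of_contDiff (hφ n).contDiff_one j)
    (fun n => memLp_test (hφ n) _) (fun n => memLp_pd (hφ n) _ j) hf hd h hdt, hdt⟩

lemma eLpNorm_clm_le {μ : Measure E3} (A : C4 →L[ℝ] C4) (u : E3 → C4) :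
    eLpNorm (fun x => A (u x)) 2 μ ≤ ‖A‖ₑ * eLpNorm u 2 μ := by
  have := eLpNorm_le_mul_eLpNorm_of_ae_le_mul (f := fun x => A (u x)) (g := u) (c := ‖A‖) (μ := μ)
    (ae_of_all _ fun x => A.le_opNorm (u x)) 2
  rwa [ofReal_norm] at this

lemma exists_eLpNorm_diracOf_le (m : ℝ) : ∃ K : ℝ≥0∞, K ≠ ⊤ ∧ ∀ (μ : Measure E3) (f : E3 → C4)
    (d : Fin 3 → E3 → C4), AEStronglyMeasurable f μ → (∀ j, AEStronglyMeasurable (d j) μ) →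
      eLpNorm (diracOf m f d) 2 μ ≤ K * (eLpNorm f 2 μ + ∑ j, eLpNorm (d j) 2 μ) := by
  refine ⟨∑ j, ‖diracA j‖ₑ + ‖diracB m‖ₑ, by simp, fun μ f d hf hd => ?_⟩
  have h1 : eLpNorm (fun x => ∑ j, diracA j (d j x)) 2 μ ≤
      ∑ j, ‖diracA j‖ₑ * eLpNorm (d j) 2 μ := by
    have := eLpNorm_sum_le (p := 2) (μ := μ) (f := fun j x => diracA j (d j x)) (s := Finset.univ)
      (fun j _ => (diracA j).continuous.comp_aestronglyMeasurable (hd j)) (by norm_num)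
    rw [Finset.sum_fn] at this
    refine this.trans ?_
    exact Finset.sum_le_sum fun j _ => eLpNorm_clm_le _ _
  have m1 : AEStronglyMeasurable (fun x => ∑ j, diracA j (d j x)) μ :=
    Finset.aestronglyMeasurable_fun_sum _ fun j _ =>
      (diracA j).continuous.comp_aestronglyMeasurable (hd j)
  refine (eLpNorm_add_le m1 ((diracB m).continuous.comp_aestronglyMeasurable hf)
    (by norm_num)).trans ((add_le_add h1 (eLpNorm_clm_le _ _)).trans ?_)
  rw [add_mul, mul_add, mul_add]
  have h2 : ∑ j, ‖diracA j‖ₑ * eLpNorm (d j) 2 μ ≤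
      (∑ j, ‖diracA j‖ₑ) * ∑ j, eLpNorm (d j) 2 μ := by
    rw [Finset.sum_mul]
    gcongr with j
    exact Finset.single_le_sum (f := fun j => eLpNorm (d j) 2 μ) (fun _ _ => zero_le)
      (Finset.mem_univ j)
  exact add_le_add (h2.trans le_add_self) le_self_add

lemma IsWeakDirac.ae_eq {m : ℝ} {U : Set E3} (hU : IsOpen U) {f g g' : E3 → C4}
    (hg : MemLp g 2 (volume.restrict U)) (hg' : MemLp g' 2 (volume.restrict U))
    (h : IsWeakDirac m U f g) (h' : IsWeakDirac m U f g') : g =ᵐ[volume.restrict U] g' :=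
  ae_eq_of_forall_test hU hg hg' fun φ hφ => (h φ hφ).trans (h' φ hφ).symm

lemma H1Tendsto.tendsto_dirac {m : ℝ} {U V : Set E3} (hU : IsOpen U) {φ : ℕ → E3 → C4}
    {f g : E3 → C4} (hφ : ∀ n, IsTest V (φ n)) (hf : MemLp f 2 (volume.restrict U))
    (hg : MemLp g 2 (volume.restrict U)) (h : H1Tendsto U φ f) (hw : IsWeakDirac m U f g) :
    Tendsto (fun n => eLpNorm (dirac m (φ n) - g) 2 (volume.restrict U)) atTop (𝓝 0) := by
  obtain ⟨d, hd, hdw, ht⟩ := h.exists_h1Err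
  obtain ⟨K, hK, hKle⟩ := exists_eLpNorm_diracOf_le m
  refine tendsto_eLpNorm_congr ((isWeakDirac_diracOf hf hd hdw).ae_eq hU
    (memLp_diracOf m hf hd) hg hw) ?_
  have h1 := ENNReal.Tendsto.const_mul ht (Or.inr hK)
  rw [mul_zero] at h1
  refine tendsto_of_tendsto_of_tendsto_of_le_of_le tendsto_const_nhds h1 (fun _ => zero_le)
    fun n => ?_
  simp only [dirac_eq, diracOf_sub]
  exact hKle _ _ _ ((memLp_test (hφ n) _).sub hf).1 fun j => ((memLp_pd (hφ n) _ j).sub (hd j)).1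

lemma IsWeakDirac.of_tendsto {m : ℝ} {U : Set E3} {φ e : ℕ → E3 → C4} {f g : E3 → C4}
    (hφ : ∀ n, IsWeakDirac m U (φ n) (e n)) (hu : ∀ n, MemLp (φ n) 2 (volume.restrict U))
    (hu' : ∀ n, MemLp (e n) 2 (volume.restrict U))
    (hf : MemLp f 2 (volume.restrict U)) (hg : MemLp g 2 (volume.restrict U))
    (h : Tendsto (fun n => eLpNorm (φ n - f) 2 (volume.restrict U)) atTop (𝓝 0))
    (h' : Tendsto (fun n => eLpNorm (e n - g) 2 (volume.restrict U)) atTop (𝓝 0)) :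
    IsWeakDirac m U f g := by
  intro ψ hψ
  have hA : ∀ (A : Matrix (Fin 4) (Fin 4) ℂ) (c : ℂ), Tendsto (fun n =>
      eLpNorm ((fun x => c • act A (φ n x)) - fun x => c • act A (f x)) 2 (volume.restrict U))
      atTop (𝓝 0) := fun A c => by
    have h1 := ENNReal.Tendsto.const_mul h (Or.inr (enorm_ne_top
      (x := ((c • act A).restrictScalars ℝ : C4 →L[ℝ] C4))))
    rw [mul_zero] at h1
    refine tendsto_of_tendsto_of_tendsto_of_le_of_le tendsto_const_nhds h1 (fun _ => zero_le)
      fun n => ?_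
    have e : ((fun x => c • act A (φ n x)) - fun x => c • act A (f x)) =
        fun x => ((c • act A).restrictScalars ℝ) ((φ n - f) x) := by
      funext x
      simp [smul_sub]
    simp only [e]
    exact eLpNorm_clm_le _ _
  have h1 := tendsto_setIntegral_smul hψ.1.continuous hψ.2.1 hu' hg h'
  have h2 := fun j => tendsto_setIntegral_smul (hψ.continuous_pd j) (hψ.2.1.fderiv_apply ℝ _)
    (fun n => memLp_act (alpha j) Complex.I (hu n)) (memLp_act (alpha j) Complex.I hf)
    (hA (alpha j) Complex.I)
  have h3 := tendsto_setIntegral_smul hψ.1.continuous hψ.2.1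
    (fun n => memLp_act beta m (hu n)) (memLp_act beta m hf) (hA beta m)
  refine tendsto_nhds_unique h1 (((tendsto_finsetSum Finset.univ fun j _ => h2 j).add h3).congr
    fun n => (hφ n ψ hψ).symm)

/-- Density in the maximal domain, for the graph norm. No H¹ regularity of `f` is assumed, and the
approximating functions need not vanish on the boundary. -/
lemma exists_dirac_approx {m : ℝ} {U : Set E3} (hU : IsC2 U) {f g : E3 → C4}
    (hf : MemLp f 2 (volume.restrict U)) (hg : MemLp g 2 (volume.restrict U))
    (h : IsWeakDirac m U f g) : ∃ φ : ℕ → E3 → C4, (∀ n, IsTest univ (φ n)) ∧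
      Tendsto (fun n => eLpNorm (φ n - f) 2 (volume.restrict U)) atTop (𝓝 0) ∧
      Tendsto (fun n => eLpNorm (dirac m (φ n) - g) 2 (volume.restrict U)) atTop (𝓝 0) := by
  have hε : ∀ n : ℕ, ((n : ℝ≥0∞) + 1)⁻¹ ≠ 0 := fun n => by
    simp only [ne_eq, ENNReal.inv_eq_zero]; finiteness
  choose ψ hψ h1 h2 using fun n => exists_test_approx hU ((isWeakDirac_iff hf hg).1 h) hf hg (hε n)
  have he : Tendsto (fun n : ℕ => ((n : ℝ≥0∞) + 1)⁻¹) atTop (𝓝 0) := by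
    have := (tendsto_add_atTop_iff_nat (f := fun n : ℕ => ((n : ℝ≥0∞))⁻¹) 1).2
      ENNReal.tendsto_inv_nat_nhds_zero
    simpa using this
  exact ⟨ψ, hψ, tendsto_of_tendsto_of_tendsto_of_le_of_le tendsto_const_nhds he
    (fun _ => zero_le) h1, tendsto_of_tendsto_of_tendsto_of_le_of_le tendsto_const_nhds he
    (fun _ => zero_le) h2⟩

lemma tendsto_integral_inner {α : Type*} [MeasurableSpace α] {μ : Measure α} {u v : ℕ → α → C4}
    {f g : α → C4} (hu : ∀ n, MemLp (u n) 2 μ) (hv : ∀ n, MemLp (v n) 2 μ) (hf : MemLp f 2 μ)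
    (hg : MemLp g 2 μ) (h : Tendsto (fun n => eLpNorm (u n - f) 2 μ) atTop (𝓝 0))
    (h' : Tendsto (fun n => eLpNorm (v n - g) 2 μ) atTop (𝓝 0)) :
    Tendsto (fun n => ∫ x, inner ℂ (u n x) (v n x) ∂μ) atTop (𝓝 (∫ x, inner ℂ (f x) (g x) ∂μ)) := by
  have e : ∀ {a b : α → C4} (ha : MemLp a 2 μ) (hb : MemLp b 2 μ),
      inner ℂ (ha.toLp a) (hb.toLp b) = ∫ x, inner ℂ (a x) (b x) ∂μ := fun {a b} ha hb => by
    rw [L2.inner_def]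
    refine integral_congr_ae ?_
    filter_upwards [ha.coeFn_toLp, hb.coeFn_toLp] with x h1 h2
    rw [h1, h2]
  have h1 := (Lp.tendsto_Lp_iff_tendsto_eLpNorm'' u hu f hf).2 h
  have h2 := (Lp.tendsto_Lp_iff_tendsto_eLpNorm'' v hv g hg).2 h'
  have h3 := h1.inner (𝕜 := ℂ) h2
  simpa only [e] using h3

end Energy

/-! ### Green's identity for functions with traces -/

section GreenTrace

lemma tsupport_pd_subset (j : Fin 3) (φ : E3 → ℝ) : tsupport (pd j φ) ⊆ tsupport φ :=
  tsupport_fderiv_apply_subset ℝ _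

lemma IsTest.mono {F : Type*} [NormedAddCommGroup F] [NormedSpace ℝ F] {U V : Set E3} {φ : E3 → F}
    (h : IsTest U φ) (hUV : U ⊆ V) : IsTest V φ := ⟨h.1, h.2.1, h.2.2.trans hUV⟩

lemma IsWeakPD.mono {U : Set E3} {j : Fin 3} {f d : E3 → C4} (h : IsWeakPD univ j f d) :
    IsWeakPD U j f d := by
  intro φ hφ
  have := h φ (hφ.mono (subset_univ _))
  rwa [setIntegral_test (subset_univ _), setIntegral_test (subset_univ _),
    ← setIntegral_test hφ.2.2, ← setIntegral_test ((tsupport_pd_subset j φ).trans hφ.2.2)] at this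

lemma IsWeakDirac.mono {m : ℝ} {U : Set E3} {f g : E3 → C4} (h : IsWeakDirac m univ f g) :
    IsWeakDirac m U f g := by
  intro φ hφ
  have := h φ (hφ.mono (subset_univ _))
  simp only [setIntegral_univ] at this
  simp only [setIntegral_test hφ.2.2,
    fun j => setIntegral_test (G := C4) ((tsupport_pd_subset j φ).trans hφ.2.2)]
  exact this

lemma H1Tendsto.mono {U : Set E3} {φ : ℕ → E3 → C4} {f : E3 → C4} (h : H1Tendsto univ φ f) :
    H1Tendsto U φ f := by
  have key : ∀ {u : ℕ → E3 → C4} {a : E3 → C4},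
      Tendsto (fun n => eLpNorm (u n - a) 2 (volume.restrict univ)) atTop (𝓝 0) →
      Tendsto (fun n => eLpNorm (u n - a) 2 (volume.restrict U)) atTop (𝓝 0) := fun {u a} h =>
    tendsto_of_tendsto_of_tendsto_of_le_of_le tendsto_const_nhds h (fun _ => zero_le)
      fun n => eLpNorm_mono_measure _ (Measure.restrict_mono_set _ (subset_univ _))
  refine ⟨key h.1, fun j => ?_⟩
  obtain ⟨d, hd, hw, ht⟩ := h.2 j
  exact ⟨d, hd.mono_measure (Measure.restrict_mono_set _ (subset_univ _)), hw.mono, key ht⟩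

lemma IsC2.hasTrace_exterior_iff {U : Set E3} (hU : IsC2 U) {f g : E3 → C4} :
    HasTrace U (DiracShell.exterior U) f g ↔
      HasTrace (DiracShell.exterior U) (DiracShell.exterior U) f g := by
  unfold HasTrace
  rw [hU.surf_exterior]

lemma H1Tendsto.congr_restrict {U : Set E3} {φ : ℕ → E3 → C4} {f f' : E3 → C4}
    (h : H1Tendsto U φ f) (hf : f =ᵐ[volume.restrict U] f') : H1Tendsto U φ f' := by
  refine ⟨tendsto_eLpNorm_congr hf h.1, fun j => ?_⟩
  obtain ⟨d, hd, hw, ht⟩ := h.2 j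
  refine ⟨d, hd, fun ψ hψ => (hw ψ hψ).trans ?_, ht⟩
  congr 1
  refine integral_congr_ae ?_
  filter_upwards [hf] with x hx
  rw [hx]

lemma HasTrace.congr {Ω U : Set E3} {f f' g g' : E3 → C4} (h : HasTrace Ω U f g)
    (hf : f =ᵐ[volume.restrict U] f') (hg : g =ᵐ[surf Ω] g') : HasTrace Ω U f' g' := by
  obtain ⟨φ, hφ, h1, h2⟩ := h
  exact ⟨φ, hφ, h1.congr_restrict hf, tendsto_eLpNorm_congr hg h2⟩

lemma hasTrace_of_isTest {Ω U V : Set E3} {φ : E3 → C4} (hφ : IsTest V φ) : HasTrace Ω U φ φ := by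
  refine ⟨fun _ => φ, fun _ => hφ.mono (subset_univ _), ⟨by simp, fun j => ⟨pd j φ,
    memLp_pd hφ _ j, isWeakPD_of_contDiff hφ.contDiff_one j, by simp⟩⟩, by simp⟩

/-- The surface limit belongs to the sequence and not to a side. For a function in H¹(ℝ³) one
sequence of test functions therefore shows that its two traces coincide. -/
lemma H1Tendsto.exists_tendsto_surf {U V : Set E3} (hU : IsC2 U) {φ : ℕ → E3 → C4} {f : E3 → C4}
    (hφ : ∀ n, IsTest V (φ n)) (hf : MemLp f 2 (volume.restrict U)) (h : H1Tendsto U φ f) :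
    ∃ g, MemLp g 2 (surf U) ∧ Tendsto (fun n => eLpNorm (φ n - g) 2 (surf U)) atTop (𝓝 0) := by
  have := isFiniteMeasure_surf hU
  obtain ⟨K, hK, hKle⟩ := exists_trace_norm_le hU
  obtain ⟨d, hd, -, ht⟩ := h.exists_h1Err
  refine exists_limit_of_cauchy (fun n => memLp_test (hφ n) _) ?_
  have h1 := ENNReal.Tendsto.const_mul ((ht.comp tendsto_fst).add (ht.comp tendsto_snd))
    (Or.inr hK)
  rw [add_zero, mul_zero, prod_atTop_atTop_eq] at h1
  refine tendsto_of_tendsto_of_tendsto_of_le_of_le tendsto_const_nhds h1 (fun _ => zero_le)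
    fun p => ?_
  refine (hKle _ ((hφ p.1).contDiff_one.sub (hφ p.2).contDiff_one)).1.trans ?_
  gcongr
  exact h1Err_sub_le (hφ _).contDiff_one (hφ _).contDiff_one hf hd

lemma eLpNorm_act_alphaDot_le {N : E3 → E3} {M : ℝ} (hM : ∀ x, ‖N x‖ ≤ M) {μ : Measure E3}
    (u : E3 → C4) : eLpNorm (fun x => act (alphaDot (N x)) (u x)) 2 μ ≤
      ENNReal.ofReal M * eLpNorm u 2 μ := by
  refine eLpNorm_le_mul_eLpNorm_of_ae_le_mul (ae_of_all _ fun x => ?_) 2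
  rw [norm_act_alphaDot]
  gcongr
  exact hM x

lemma aestronglyMeasurable_act_alphaDot {N : E3 → E3} (hN : Continuous N) {μ : Measure E3} {u : E3 → C4}
    (hu : AEStronglyMeasurable u μ) :
    AEStronglyMeasurable (fun x => act (alphaDot (N x)) (u x)) μ := by
  simp only [act_alphaDot]
  exact Finset.aestronglyMeasurable_fun_sum _ fun j _ =>
    ((EuclideanSpace.proj j).continuous.comp hN).aestronglyMeasurable.smul
      ((act (alpha j)).continuous.comp_aestronglyMeasurable hu)

lemma exists_normal_extension_bound {U : Set E3} (hU : IsC2 U) : ∃ (N : E3 → E3) (M : ℝ),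
    ContDiff ℝ 1 N ∧ (∀ x, ‖N x‖ ≤ M) ∧ (∀ x, ‖fderiv ℝ N x‖ ≤ M) ∧
      ∀ᵐ x ∂(surf U), N x = normal U x := by
  obtain ⟨N, hN, hNc, hNn⟩ := hU.exists_normal_extension
  obtain ⟨M, hM⟩ := hNc.exists_bound_of_continuous hN.continuous
  obtain ⟨M', hM'⟩ := (hNc.fderiv ℝ).exists_bound_of_continuous (hN.continuous_fderiv one_ne_zero)
  refine ⟨N, max M M', hN, fun x => (hM x).trans (le_max_left _ _),
    fun x => (hM' x).trans (le_max_right _ _), ?_⟩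
  filter_upwards [ae_surf_mem] with x hx using hNn x hx

lemma tendsto_act_normal {U : Set E3} (hU : IsC2 U) {u : ℕ → E3 → C4} {g : E3 → C4}
    (h : Tendsto (fun n => eLpNorm (u n - g) 2 (surf U)) atTop (𝓝 0)) :
    Tendsto (fun n => eLpNorm ((fun x => act (alphaDot (normal U x)) (u n x)) -
      fun x => act (alphaDot (normal U x)) (g x)) 2 (surf U)) atTop (𝓝 0) := by
  obtain ⟨N, M, -, hM, -, hNn⟩ := exists_normal_extension_bound hU
  have h1 := ENNReal.Tendsto.const_mul h (Or.inr (ENNReal.ofReal_ne_top (r := M)))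
  rw [mul_zero] at h1
  refine tendsto_of_tendsto_of_tendsto_of_le_of_le tendsto_const_nhds h1 (fun _ => zero_le)
    fun n => le_trans (le_of_eq (eLpNorm_congr_ae ?_)) (eLpNorm_act_alphaDot_le hM _)
  filter_upwards [hNn] with x hx
  simp [hx]

lemma memLp_act_normal {U : Set E3} (hU : IsC2 U) {g : E3 → C4} (hg : MemLp g 2 (surf U)) :
    MemLp (fun x => act (alphaDot (normal U x)) (g x)) 2 (surf U) := by
  obtain ⟨N, M, hN, hM, -, hNn⟩ := exists_normal_extension_bound hU
  have h : MemLp (fun x => act (alphaDot (N x)) (g x)) 2 (surf U) :=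
    ⟨aestronglyMeasurable_act_alphaDot hN.continuous hg.1, (eLpNorm_act_alphaDot_le hM g).trans_lt
      (ENNReal.mul_lt_top ENNReal.ofReal_lt_top hg.2)⟩
  refine h.ae_eq ?_
  filter_upwards [hNn] with x hx
  rw [hx]

/-- Green's identity for functions in `H¹(U)` in terms of their traces. -/
theorem HasTrace.green {m : ℝ} {U : Set E3} (hU : IsC2 U) {f f' g g' p q : E3 → C4}
    (hf : MemLp f 2 (volume.restrict U)) (hf' : MemLp f' 2 (volume.restrict U))
    (hg : MemLp g 2 (volume.restrict U)) (hg' : MemLp g' 2 (volume.restrict U))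
    (hp : MemLp p 2 (surf U)) (hq : MemLp q 2 (surf U)) (hfp : HasTrace U U f p)
    (hgq : HasTrace U U g q) (hff : IsWeakDirac m U f f') (hgg : IsWeakDirac m U g g') :
    (∫ x in U, inner ℂ (f' x) (g x)) - ∫ x in U, inner ℂ (f x) (g' x) =
      ∫ x, Complex.I * inner ℂ (p x) (act (alphaDot (normal U x)) (q x)) ∂(surf U) := by
  have := isFiniteMeasure_surf hU
  obtain ⟨φ, hφ, h1, h2⟩ := hfp
  obtain ⟨ψ, hψ, k1, k2⟩ := hgq
  have t1 := tendsto_integral_inner (fun n => memLp_dirac (hφ n) m _) (fun n => memLp_test (hψ n) _)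
    hf' hg (h1.tendsto_dirac hU.isOpen hφ hf hf' hff) k1.1
  have t2 := tendsto_integral_inner (fun n => memLp_test (hφ n) _) (fun n => memLp_dirac (hψ n) m _)
    hf hg' h1.1 (k1.tendsto_dirac hU.isOpen hψ hg hg' hgg)
  have t3 := (tendsto_integral_inner (fun n => memLp_test (hφ n) (surf U))
    (fun n => memLp_act_normal hU (memLp_test (hψ n) (surf U))) hp (memLp_act_normal hU hq) h2
    (tendsto_act_normal hU k2)).const_mul Complex.I
  rw [integral_const_mul]
  refine tendsto_nhds_unique (t1.sub t2) (t3.congr fun n => ?_)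
  rw [← integral_const_mul, ← dirac_green hU m (hφ n).contDiff_one (hψ n).contDiff_one (hφ n).2.1,
    integral_sub]
  · exact (((hφ n).contDiff_dirac m).continuous.inner
      (hψ n).1.continuous).integrable_of_hasCompactSupport
      ((hψ n).2.1.mono fun x hx h0 => hx (by simp [h0])) |>.integrableOn
  · exact ((hφ n).1.continuous.inner
      ((hψ n).contDiff_dirac m).continuous).integrable_of_hasCompactSupport
      ((hφ n).2.1.mono fun x hx h0 => hx (by simp [h0])) |>.integrableOn

/-- The Dirac operator is symmetric on pairs of functions of which one is a limit of test functions
that vanish on the boundary. -/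
lemma integral_inner_eq_of_tendsto {m : ℝ} {U V : Set E3} (hU : IsC2 U) {φ : ℕ → E3 → C4}
    {f f' g g' : E3 → C4}
    (hf : MemLp f 2 (volume.restrict U)) (hf' : MemLp f' 2 (volume.restrict U))
    (hg : MemLp g 2 (volume.restrict U)) (hg' : MemLp g' 2 (volume.restrict U))
    (hφ : ∀ n, IsTest V (φ n)) (hφ0 : ∀ n, ∀ x ∈ frontier U, φ n x = 0)
    (h : Tendsto (fun n => eLpNorm (φ n - f) 2 (volume.restrict U)) atTop (𝓝 0))
    (h' : Tendsto (fun n => eLpNorm (dirac m (φ n) - f') 2 (volume.restrict U)) atTop (𝓝 0))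
    (hgg : IsWeakDirac m U g g') :
    ∫ x in U, inner ℂ (f' x) (g x) = ∫ x in U, inner ℂ (f x) (g' x) := by
  -- A function `g` in the maximal domain need not have a trace in `L²`. It is replaced by test
  -- functions, for which the boundary term vanishes because `φ n` is zero on the boundary.
  obtain ⟨ψ, hψ, k, k'⟩ := exists_dirac_approx hU hg hg' hgg
  refine tendsto_nhds_unique (tendsto_integral_inner (fun n => memLp_dirac (hφ n) m _)
    (fun n => memLp_test (hψ n) _) hf' hg h' k) ((tendsto_integral_inner
    (fun n => memLp_test (hφ n) _) (fun n => memLp_dirac (hψ n) m _) hf hg' h k').congr fun n => ?_)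
  have := dirac_green hU m (hφ n).contDiff_one (hψ n).contDiff_one (hφ n).2.1
  rw [integral_sub, integral_eq_zero_of_ae (μ := surf U), sub_eq_zero] at this
  · exact this.symm
  · filter_upwards [ae_surf_mem] with x hx
    simp [hφ0 n x hx]
  · exact (((hφ n).contDiff_dirac m).continuous.inner
      (hψ n).1.continuous).integrable_of_hasCompactSupport
      ((hψ n).2.1.mono fun x hx h0 => hx (by simp [h0])) |>.integrableOn
  · exact ((hφ n).1.continuous.inner
      ((hψ n).contDiff_dirac m).continuous).integrable_of_hasCompactSupport
      ((hφ n).2.1.mono fun x hx h0 => hx (by simp [h0])) |>.integrableOn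

lemma IsTest.smul_const {U : Set E3} {ψ : E3 → ℝ} (hψ : IsTest U ψ) (v : C4) :
    IsTest U fun x => ψ x • v :=
  ⟨hψ.1.smul contDiff_const, hψ.2.1.smul_right,
    (closure_mono (Function.support_smul_subset_left ψ fun _ => v)).trans hψ.2.2⟩

lemma inner_dirac_smul_const {U : Set E3} {ψ : E3 → ℝ} (hψ : IsTest U ψ) (m : ℝ) (v w : C4)
    (x : E3) : inner ℂ (dirac m (fun y => ψ y • v) x) w =
      inner ℂ v ((∑ j, pd j ψ x • (Complex.I • act (alpha j) w)) +
        ψ x • ((m : ℂ) • act beta w)) := by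
  have e : ∀ j, pd j (fun y => ψ y • v) x = pd j ψ x • v := fun j => by
    rw [pd_smul_fun (hψ.differentiable x) (differentiableAt_const v)]
    simp [pd]
  simp only [dirac, opApply, e]
  simp only [map_smul, diracA_apply, diracB_apply, ← Complex.coe_smul, inner_add_left,
    sum_inner, inner_smul_left, inner_neg_left, inner_add_right, inner_sum, inner_smul_right,
    inner_act_left (alpha_isHermitian _), inner_act_left beta_isHermitian, Complex.conj_ofReal,
    Complex.conj_I, neg_mul, neg_neg]
  ring_nf

/-- The Dirac equation may be tested with spinor fields. -/
lemma isWeakDirac_of_forall_test {m : ℝ} {U : Set E3} {f g : E3 → C4} (hf : MemLp f 2 volume)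
    (hg : MemLp g 2 volume) (h : ∀ φ : E3 → C4, IsTest U φ →
      ∫ x, inner ℂ (dirac m φ x) (f x) = ∫ x, inner ℂ (φ x) (g x)) : IsWeakDirac m U f g := by
  intro ψ hψ
  simp only [setIntegral_test hψ.2.2,
    fun j => setIntegral_test (G := C4) ((tsupport_pd_subset j ψ).trans hψ.2.2)]
  rw [← Measure.restrict_univ (μ := (volume : Measure E3))] at hf hg
  have hψu := hψ.mono (subset_univ _)
  have i1 := hψu.integrable hg
  have i2 := fun j => hψu.integrable_pd j (memLp_act (alpha j) Complex.I hf)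
  have i3 := hψu.integrable (memLp_act beta m hf)
  rw [IntegrableOn, Measure.restrict_univ] at i1 i3
  simp only [IntegrableOn, Measure.restrict_univ] at i2
  have i4 : Integrable fun x => ∑ j, pd j ψ x • (Complex.I • act (alpha j) (f x)) :=
    integrable_finsetSum _ fun j _ => i2 j
  have i5 : Integrable fun x => (∑ j, pd j ψ x • (Complex.I • act (alpha j) (f x))) +
    ψ x • ((m : ℂ) • act beta (f x)) := i4.add i3
  -- Pairing with a constant spinor `v` turns the scalar test function `ψ` into the spinor test
  -- field `ψ • v`.
  refine ext_inner_left ℂ fun v => ?_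
  rw [← integral_finsetSum _ fun j _ => i2 j, ← integral_add i4 i3, ← integral_inner i1,
    ← integral_inner i5]
  have := h _ (hψ.smul_const v)
  simp only [inner_dirac_smul_const hψ] at this
  refine Eq.trans (integral_congr_ae (ae_of_all _ fun x => ?_)) this.symm
  simp only [← Complex.coe_smul, inner_smul_left, inner_smul_right, Complex.conj_ofReal]

lemma sobSq_clm_le {U : Set E3} (A : C4 →L[ℝ] C4) {φ : E3 → C4} (hφ : ContDiff ℝ 1 φ) :
    sobSq U (fun x => A (φ x)) ≤ ‖A‖ₑ ^ 2 * sobSq U φ := by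
  rw [sobSq, sobSq, mul_add, ← lintegral_const_mul' _ _ (by simp),
    ← lintegral_const_mul' _ _ (by simp)]
  refine add_le_add (lintegral_mono fun x => ?_) (lintegral_mono fun x => ?_)
  · rw [← mul_pow]
    gcongr
    exact A.le_opENorm _
  · rw [← mul_pow]
    gcongr
    have : fderiv ℝ (fun x => A (φ x)) x = A.comp (fderiv ℝ φ x) :=
      (A.hasFDerivAt.comp x (hφ.differentiable one_ne_zero x).hasFDerivAt).fderiv
    rw [this, ← ofReal_norm, ← ofReal_norm, ← ofReal_norm, ← ENNReal.ofReal_mul (norm_nonneg _)]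
    exact ENNReal.ofReal_le_ofReal (A.opNorm_comp_le _)

/-- Multiplication by `α·ν` preserves the space of traces. -/
theorem HasTrace.act_normal {U : Set E3} (hU : IsC2 U) {f g : E3 → C4}
    (hf : MemLp f 2 (volume.restrict U)) (hg : MemLp g 2 (surf U)) (h : HasTrace U U f g) :
    ∃ f', MemLp f' 2 (volume.restrict U) ∧
      HasTrace U U f' fun x => act (alphaDot (normal U x)) (g x) := by
  obtain ⟨N, M, hN, hM, hM', hNn⟩ := exists_normal_extension_bound hU
  obtain ⟨φ, hφ, h1, h2⟩ := h
  obtain ⟨d, hd, -, ht⟩ := h1.exists_h1Err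
  have hNj : ∀ j, ContDiff ℝ 1 fun x => N x j := fun j =>
    (EuclideanSpace.proj (𝕜 := ℝ) j).contDiff.comp hN
  have hMj : ∀ j x, |N x j| ≤ M := fun j x => (PiLp.norm_apply_le (N x) j).trans (hM x)
  have hMj' : ∀ j x, ‖fderiv ℝ (fun x => N x j) x‖ ≤ M := fun j x => by
    have e : fderiv ℝ (fun x => N x j) x = (EuclideanSpace.proj (𝕜 := ℝ) j).comp (fderiv ℝ N x) :=
      ((EuclideanSpace.proj (𝕜 := ℝ) j).hasFDerivAt.comp x
        (hN.differentiable one_ne_zero x).hasFDerivAt).fderiv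
    rw [e]
    refine le_trans (ContinuousLinearMap.opNorm_le_bound _ (norm_nonneg _) fun v => ?_) (hM' x)
    exact (PiLp.norm_apply_le (fderiv ℝ N x v) j).trans ((fderiv ℝ N x).le_opNorm v)
  let A : Fin 3 → C4 →L[ℝ] C4 := fun j => (act (alpha j)).restrictScalars ℝ
  have hA : ∀ {u : E3 → C4}, ContDiff ℝ 1 u → ∀ j, ContDiff ℝ 1 fun x => A j (u x) :=
    fun hu j => (A j).contDiff.comp hu
  -- Multiplication by α·N for a bounded C¹ extension `N` of the normal with bounded derivative. It
  -- is bounded on H¹(U) and agrees on the surface with α·ν, so it maps a sequence realizing the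
  -- trace `g` to one realizing α·ν g.
  let P : (E3 → C4) → E3 → C4 := fun u x => ∑ j, N x j • A j (u x)
  have hP : ∀ {u : E3 → C4}, ContDiff ℝ 1 u → ContDiff ℝ 1 (P u) := fun hu =>
    ContDiff.sum fun j _ => (hNj j).smul (hA hu j)
  have hPs : ∀ u v, P (u - v) = P u - P v := fun u v => by
    funext x
    simp only [P, Pi.sub_apply, map_sub, smul_sub, Finset.sum_sub_distrib]
  have hPn : ∀ u, (fun x => act (alphaDot (normal U x)) (u x)) =ᵐ[surf U] P u := fun u => by
    filter_upwards [hNn] with x hx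
    rw [← hx, act_alphaDot]
    rfl
  let C : ℝ≥0∞ := 3 * ∑ j, 3 * ENNReal.ofReal (M ^ 2) * ‖A j‖ₑ ^ 2
  have hC : C ≠ ⊤ := by
    refine ENNReal.mul_ne_top (by simp) (ENNReal.sum_ne_top.2 fun j _ => ?_)
    finiteness
  have hle : ∀ {u : E3 → C4}, ContDiff ℝ 1 u → sobSq U (P u) ≤ C * sobSq U u := fun {u} hu => by
    refine (sobSq_sum_le Finset.univ fun j => (hNj j).smul (hA hu j)).trans ?_
    simp only [C, Finset.card_univ, Fintype.card_fin, mul_assoc, Finset.sum_mul]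
    push_cast
    gcongr with j
    refine (sobSq_smul_le (hNj j) (hMj j) (hMj' j) (hA hu j)).trans ?_
    rw [mul_assoc]
    gcongr
    exact sobSq_clm_le (A j) hu
  obtain ⟨f', hf', hft⟩ := exists_hasTrace_of_cauchy (U := U) hU (φ := fun n => P (φ n))
    (g := fun x => act (alphaDot (normal U x)) (g x))
    (fun n => hP (hφ n).contDiff_one)
    (fun n => (hφ n).2.1.mono fun x hx h0 => hx (by simp [P, h0])) (memLp_act_normal hU hg).1
    (by
      have t1 := ENNReal.Tendsto.const_mul (((ENNReal.continuous_pow 2).tendsto _).comp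
        ((ht.comp tendsto_fst).add (ht.comp tendsto_snd)))
        (Or.inr (ENNReal.mul_ne_top hC (b := 3) (by simp)))
      simp only [add_zero, ne_eq, OfNat.ofNat_ne_zero, not_false_eq_true, zero_pow, mul_zero,
        prod_atTop_atTop_eq] at t1
      refine tendsto_of_tendsto_of_tendsto_of_le_of_le tendsto_const_nhds t1 (fun _ => zero_le)
        fun p => ?_
      simp only [← hPs]
      have c1 := (hφ p.1).contDiff_one.sub (hφ p.2).contDiff_one
      refine (hle c1).trans ?_
      rw [mul_assoc C 3]
      refine mul_le_mul_right ((sobSq_le_h1Err c1).trans ?_) C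
      simp only [Function.comp_apply]
      refine mul_le_mul_right (pow_le_pow_left' ?_ 2) 3
      exact h1Err_sub_le (hφ _).contDiff_one (hφ _).contDiff_one hf hd)
    (by
      refine (tendsto_act_normal hU h2).congr fun n => eLpNorm_congr_ae ?_
      filter_upwards [hPn (φ n)] with x hx
      simp only [Pi.sub_apply, hx])
  exact ⟨f', hf', hft⟩

end GreenTrace

/-! ### The Dirac operators -/

section Operators

lemma mem_graph_domRestrict {H G : Type*} [AddCommGroup H] [Module ℂ H] [AddCommGroup G]
    [Module ℂ G] {T : H →ₗ.[ℂ] G} {S : Submodule ℂ H} {x : H} {y : G} :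
    (x, y) ∈ (T.domRestrict S).graph ↔ x ∈ S ∧ (x, y) ∈ T.graph := by
  simp only [LinearPMap.mem_graph_iff]
  constructor
  · rintro ⟨z, rfl, rfl⟩
    exact ⟨z.2.1, ⟨z, z.2.2⟩, rfl, (LinearPMap.domRestrict_apply rfl).symm⟩
  · rintro ⟨hx, z, rfl, rfl⟩
    exact ⟨⟨z, hx, z.2⟩, rfl, LinearPMap.domRestrict_apply rfl⟩

/-! ### Functions given separately on the two sides of the surface. -/

section Sides

variable {Ω : Set E3}

lemma disjoint_exterior : Disjoint Ω (exterior Ω) :=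
  disjoint_left.2 fun _ hx hx' => hx' (subset_closure hx)

lemma IsC2.volume_eq (hΩ : IsC2 Ω) : (volume : Measure E3).restrict Ω +
    volume.restrict (DiracShell.exterior Ω) = volume := by
  rw [← Measure.restrict_union disjoint_exterior hΩ.exterior.isOpen.measurableSet]
  refine Measure.restrict_eq_self_of_ae_mem ?_
  filter_upwards [measure_eq_zero_iff_ae_notMem.1 (volume_frontier hΩ)] with x hx
  rw [hΩ.isOpen.frontier_eq] at hx
  by_cases h : x ∈ Ω
  · exact Or.inl h
  · exact Or.inr fun h' => hx ⟨h', h⟩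

lemma IsC2.ae_of_sides (hΩ : IsC2 Ω) {p : E3 → Prop} (h1 : ∀ᵐ x ∂(volume.restrict Ω), p x)
    (h2 : ∀ᵐ x ∂(volume.restrict (DiracShell.exterior Ω)), p x) : ∀ᵐ x, p x := by
  rw [← hΩ.volume_eq, ae_add_measure_iff]
  exact ⟨h1, h2⟩

lemma IsC2.integral_eq (hΩ : IsC2 Ω) {F : E3 → ℂ} (hF : Integrable F) :
    ∫ x, F x = (∫ x in Ω, F x) + ∫ x in DiracShell.exterior Ω, F x := by
  rw [← integral_add_measure hF.integrableOn hF.integrableOn, hΩ.volume_eq]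

lemma IsC2.eLpNorm_le (hΩ : IsC2 Ω) (w : E3 → C4) : eLpNorm w 2 volume ≤
    eLpNorm w 2 (volume.restrict Ω) + eLpNorm w 2 (volume.restrict (DiracShell.exterior Ω)) := by
  refine (ENNReal.pow_le_pow_left_iff two_ne_zero).1 ?_
  have h : eLpNorm w 2 volume ^ 2 = eLpNorm w 2 (volume.restrict Ω) ^ 2 +
      eLpNorm w 2 (volume.restrict (DiracShell.exterior Ω)) ^ 2 := by
    rw [eLpNorm_two_sq, eLpNorm_two_sq, eLpNorm_two_sq, ← lintegral_add_measure, hΩ.volume_eq]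
  rw [h, add_sq, add_right_comm]
  exact le_self_add

/-- The function that agrees with `u` on `Ω` and with `v` on the exterior. -/
def glue (Ω : Set E3) (u v : E3 → C4) (x : E3) : C4 :=
  Ω.indicator u x + (exterior Ω).indicator v x

lemma glue_ae_left (hΩ : IsC2 Ω) (u v : E3 → C4) : u =ᵐ[volume.restrict Ω] glue Ω u v := by
  filter_upwards [ae_restrict_mem hΩ.isOpen.measurableSet] with x hx
  rw [glue, indicator_of_mem hx, indicator_of_notMem (disjoint_left.1 disjoint_exterior hx),
    add_zero]

lemma glue_ae_right (hΩ : IsC2 Ω) (u v : E3 → C4) :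
    v =ᵐ[volume.restrict (exterior Ω)] glue Ω u v := by
  filter_upwards [ae_restrict_mem hΩ.exterior.isOpen.measurableSet] with x hx
  rw [glue, indicator_of_mem hx, indicator_of_notMem (disjoint_right.1 disjoint_exterior hx),
    zero_add]

lemma memLp_glue (hΩ : IsC2 Ω) {u v : E3 → C4} (hu : MemLp u 2 (volume.restrict Ω))
    (hv : MemLp v 2 (volume.restrict (exterior Ω))) : MemLp (glue Ω u v) 2 volume :=
  ((memLp_indicator_iff_restrict hΩ.isOpen.measurableSet).2 hu).add
    ((memLp_indicator_iff_restrict hΩ.exterior.isOpen.measurableSet).2 hv)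

lemma tendsto_glue (hΩ : IsC2 Ω) {u v : ℕ → E3 → C4} {f : E3 → C4}
    (hu : Tendsto (fun n => eLpNorm (u n - f) 2 (volume.restrict Ω)) atTop (𝓝 0))
    (hv : Tendsto (fun n => eLpNorm (v n - f) 2 (volume.restrict (exterior Ω))) atTop (𝓝 0)) :
    Tendsto (fun n => eLpNorm (glue Ω (u n) (v n) - f) 2 volume) atTop (𝓝 0) := by
  have h := hu.add hv
  rw [add_zero] at h
  refine tendsto_of_tendsto_of_tendsto_of_le_of_le tendsto_const_nhds h (fun _ => zero_le)
    fun n => (hΩ.eLpNorm_le _).trans (add_le_add (le_of_eq (eLpNorm_congr_ae ?_))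
      (le_of_eq (eLpNorm_congr_ae ?_)))
  · filter_upwards [glue_ae_left hΩ (u n) (v n)] with x hx
    simp [hx]
  · filter_upwards [glue_ae_right hΩ (u n) (v n)] with x hx
    simp [hx]

lemma tendsto_restrict {u : ℕ → E3 → C4} {f : E3 → C4} (U : Set E3)
    (h : Tendsto (fun n => eLpNorm (u n - f) 2 volume) atTop (𝓝 0)) :
    Tendsto (fun n => eLpNorm (u n - f) 2 (volume.restrict U)) atTop (𝓝 0) :=
  tendsto_of_tendsto_of_tendsto_of_le_of_le tendsto_const_nhds h (fun _ => zero_le)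
    fun _ => eLpNorm_mono_measure _ Measure.restrict_le_self

end Sides

lemma IsWeakDirac.congr_restrict {m : ℝ} {U : Set E3} {f f' g g' : E3 → C4}
    (h : IsWeakDirac m U f g) (hf : f =ᵐ[volume.restrict U] f') (hg : g =ᵐ[volume.restrict U] g') :
    IsWeakDirac m U f' g' := by
  intro φ hφ
  have h1 : ∫ x in U, φ x • g' x = ∫ x in U, φ x • g x := integral_congr_ae (by
    filter_upwards [hg] with x hx
    rw [hx])
  have h2 : ∀ (ψ : E3 → ℝ) (c : ℂ) (A : Matrix (Fin 4) (Fin 4) ℂ),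
      ∫ x in U, ψ x • (c • act A (f' x)) = ∫ x in U, ψ x • (c • act A (f x)) := fun ψ c A =>
    integral_congr_ae (by
      filter_upwards [hf] with x hx
      rw [hx])
  simp only [h1, h2]
  exact h φ hφ

lemma IsWeakPD.congr_restrict {U : Set E3} {j : Fin 3} {f f' d : E3 → C4}
    (h : IsWeakPD U j f d) (hf : f =ᵐ[volume.restrict U] f') : IsWeakPD U j f' d := by
  intro φ hφ
  rw [h φ hφ]
  congr 1
  refine integral_congr_ae ?_
  filter_upwards [hf] with x hx
  rw [hx]

/-- Approximation in the graph norm is upgraded to approximation in H¹ by the energy identity; in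
particular a weak solution on ℝ³ lies in H¹(ℝ³). -/
lemma exists_h1Tendsto_of_isWeakDirac {m : ℝ} {f g : L2R} (h : IsWeakDirac m univ f g) :
    ∃ φ : ℕ → E3 → C4, (∀ n, IsTest univ (φ n)) ∧ H1Tendsto univ φ f := by
  obtain ⟨φ, hφ, h1, h2⟩ := exists_dirac_approx isC2_univ (f.memLp univ) (g.memLp univ) h
  rw [Measure.restrict_univ] at h1 h2
  exact ⟨φ, hφ, h1Tendsto_of_dirac hφ (Lp.memLp f) (Lp.memLp g) h1 h2⟩

lemma H1Tendsto.mem_H1 {U : Set E3} {φ : ℕ → E3 → C4} {f : L2R} (h : H1Tendsto U φ f) :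
    f ∈ H1 U := fun j => by
  obtain ⟨d, hd, hw, -⟩ := h.2 j
  exact ⟨d, hd, hw⟩

lemma diracRel_univ_graph (m : ℝ) :
    (diracRel m univ).toLinearPMap.graph = diracRel m univ := by
  refine Submodule.toLinearPMap_graph_eq _ ?_
  rintro ⟨f, g⟩ h (rfl : f = 0)
  have h0 := IsWeakDirac.ae_eq isOpen_univ (g.memLp univ) ((0 : L2R).memLp univ) h
    (diracRel m univ).zero_mem
  rw [Measure.restrict_univ] at h0
  exact Lp.ext h0

/-- The H¹ condition in the domain is automatic, so the free operator is the maximal operator on ℝ³.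
Its self-adjointness rests on this. -/
theorem mem_freeDirac_graph {m : ℝ} {f g : L2R} :
    (f, g) ∈ (freeDirac m).graph ↔ IsWeakDirac m univ f g := by
  rw [freeDirac, mem_graph_domRestrict, diracRel_univ_graph]
  refine ⟨fun h => h.2, fun h => ⟨?_, h⟩⟩
  obtain ⟨φ, -, hφ⟩ := exists_h1Tendsto_of_isWeakDirac h
  exact hφ.mem_H1

/-- The graph of the Dirac operator on test functions. -/
def testGraph (m : ℝ) (V : Set E3) : Set (L2R × L2R) :=
  {p | ∃ φ : E3 → C4, IsTest V φ ∧ p.1 =ᵐ[volume] φ ∧ p.2 =ᵐ[volume] dirac m φ}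

lemma mem_closure_testGraph {m : ℝ} {V : Set E3} {p : L2R × L2R} :
    p ∈ _root_.closure (testGraph m V) ↔ ∃ φ : ℕ → E3 → C4, (∀ n, IsTest V (φ n)) ∧
      Tendsto (fun n => eLpNorm (φ n - (p.1 : E3 → C4)) 2 volume) atTop (𝓝 0) ∧
      Tendsto (fun n => eLpNorm (dirac m (φ n) - (p.2 : E3 → C4)) 2 volume) atTop (𝓝 0) := by
  rw [mem_closure_iff_seq_limit]
  constructor
  · rintro ⟨q, hq, hlim⟩
    choose φ hφ h1 h2 using hq
    rw [Prod.tendsto_iff] at hlim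
    refine ⟨φ, hφ, ?_, ?_⟩
    · refine ((Lp.tendsto_Lp_iff_tendsto_eLpNorm' _ _).1 hlim.1).congr fun n =>
        eLpNorm_congr_ae ?_
      filter_upwards [h1 n] with x hx
      simp [hx]
    · refine ((Lp.tendsto_Lp_iff_tendsto_eLpNorm' _ _).1 hlim.2).congr fun n =>
        eLpNorm_congr_ae ?_
      filter_upwards [h2 n] with x hx
      simp [hx]
  · rintro ⟨φ, hφ, h1, h2⟩
    refine ⟨fun n => ((memLp_test (hφ n) volume).toLp _, (memLp_dirac (hφ n) m volume).toLp _),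
      fun n => ⟨φ n, hφ n, (memLp_test (hφ n) volume).coeFn_toLp,
        (memLp_dirac (hφ n) m volume).coeFn_toLp⟩, ?_⟩
    rw [Prod.tendsto_iff]
    constructor
    · rw [Lp.tendsto_Lp_iff_tendsto_eLpNorm']
      refine h1.congr fun n => eLpNorm_congr_ae ?_
      filter_upwards [(memLp_test (hφ n) volume).coeFn_toLp] with x hx
      simp [hx]
    · rw [Lp.tendsto_Lp_iff_tendsto_eLpNorm']
      refine h2.congr fun n => eLpNorm_congr_ae ?_
      filter_upwards [(memLp_dirac (hφ n) m volume).coeFn_toLp] with x hx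
      simp [hx]

/-- For test functions on ℝ³ graph convergence and H¹ convergence are the same by the energy
identity. Closedness is then immediate, and the adjoint can be computed on test functions supported
off Σ. -/
theorem minDirac_graph (m : ℝ) (Ω : Set E3) :
    ((minDirac m Ω).graph : Set (L2R × L2R)) = _root_.closure (testGraph m (frontier Ω)ᶜ) := by
  ext ⟨f, g⟩
  rw [SetLike.mem_coe, minDirac, mem_graph_domRestrict, mem_freeDirac_graph, mem_closure_testGraph]
  constructor
  · rintro ⟨⟨φ, hφ, h1⟩, hw⟩
    have h2 := h1.tendsto_dirac isOpen_univ hφ (f.memLp univ) (g.memLp univ) hw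
    have h1 := h1.1
    rw [Measure.restrict_univ] at h1 h2
    exact ⟨φ, hφ, h1, h2⟩
  · rintro ⟨φ, hφ, h1, h2⟩
    refine ⟨⟨φ, hφ, h1Tendsto_of_dirac hφ (Lp.memLp f) (Lp.memLp g) h1 h2⟩,
      IsWeakDirac.of_tendsto (fun n => isWeakDirac_dirac (hφ n)) (fun n => memLp_test (hφ n) _)
        (fun n => memLp_dirac (hφ n) m _) (f.memLp univ) (g.memLp univ) (tendsto_restrict _ h1)
        (tendsto_restrict _ h2)⟩

lemma toLp_mem_minDirac_graph {m : ℝ} {Ω : Set E3} {φ : E3 → C4} (hφ : IsTest (frontier Ω)ᶜ φ) :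
    ((memLp_test hφ volume).toLp φ, (memLp_dirac hφ m volume).toLp (dirac m φ)) ∈
      (minDirac m Ω).graph := by
  rw [← SetLike.mem_coe, minDirac_graph]
  exact subset_closure ⟨φ, hφ, (memLp_test hφ volume).coeFn_toLp,
    (memLp_dirac hφ m volume).coeFn_toLp⟩

theorem minDirac_isClosed (m : ℝ) (Ω : Set E3) : (minDirac m Ω).IsClosed := by
  rw [LinearPMap.IsClosed, minDirac_graph]
  exact isClosed_closure

lemma inner_toLp_left {φ : E3 → C4} (hφ : MemLp φ 2 volume) (g : L2R) :
    inner ℂ (hφ.toLp φ) g = ∫ x, inner ℂ (φ x) (g x) := by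
  rw [L2.inner_def]
  refine integral_congr_ae ?_
  filter_upwards [hφ.coeFn_toLp] with x hx
  rw [hx]

/-- A function orthogonal to all products of a scalar test function off Σ with a constant spinor
vanishes off Σ, and Σ is a null set. -/
theorem dense_minDirac_domain (m : ℝ) {Ω : Set E3} (hΩ : IsC2 Ω) :
    Dense ((minDirac m Ω).domain : Set L2R) := by
  rw [Submodule.dense_iff_topologicalClosure_eq_top, Submodule.topologicalClosure_eq_top_iff,
    Submodule.eq_bot_iff]
  intro g hg
  have ho : IsOpen (frontier Ω)ᶜ := isClosed_frontier.isOpen_compl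
  have h := ae_eq_of_forall_test ho (g.memLp _) ((0 : L2R).memLp _) fun ψ hψ => by
    have hz : ∫ x in (frontier Ω)ᶜ, ψ x • (0 : L2R) x = 0 := by
      refine integral_eq_zero_of_ae (ae_restrict_of_ae ?_)
      filter_upwards [Lp.coeFn_zero C4 2 (volume : Measure E3)] with x hx
      simp only [hx, Pi.zero_apply, smul_zero]
    have hi := hψ.mono (subset_univ _) |>.integrable (g.memLp univ)
    rw [IntegrableOn, Measure.restrict_univ] at hi
    rw [hz, setIntegral_test hψ.2.2]
    refine ext_inner_left ℂ fun v => ?_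
    have ht := hψ.smul_const v
    have := (Submodule.mem_orthogonal _ _).1 hg _
      (LinearPMap.mem_domain_iff.2 ⟨_, toLp_mem_minDirac_graph (m := m) ht⟩)
    rw [inner_toLp_left] at this
    rw [inner_zero_right, ← integral_inner hi, ← this]
    refine integral_congr_ae (ae_of_all _ fun x => ?_)
    simp only [← Complex.coe_smul, inner_smul_left, inner_smul_right, Complex.conj_ofReal]
  rw [Measure.restrict_eq_self_of_ae_mem (s := (frontier Ω)ᶜ)
    (measure_eq_zero_iff_ae_notMem.1 (volume_frontier hΩ))] at h
  exact Lp.ext h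

theorem mem_maxDirac_graph {m : ℝ} {Ω : Set E3} (hΩ : IsC2 Ω) {f g : L2R} :
    (f, g) ∈ (maxDirac m Ω).graph ↔
      IsWeakDirac m Ω f g ∧ IsWeakDirac m (exterior Ω) f g := by
  rw [maxDirac, Submodule.toLinearPMap_graph_eq]
  · rfl
  · rintro ⟨f, g⟩ h (rfl : f = 0)
    exact Lp.ext (hΩ.ae_of_sides (IsWeakDirac.ae_eq hΩ.isOpen (g.memLp _) ((0 : L2R).memLp _) h.1
      (diracRel m Ω).zero_mem) (IsWeakDirac.ae_eq hΩ.exterior.isOpen (g.memLp _)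
      ((0 : L2R).memLp _) h.2 (diracRel m (exterior Ω)).zero_mem))

/-- If the weak equation holds on both sides, Green's identity against functions vanishing on Σ has
no boundary term and the two sides add up. Conversely, test functions supported in one side lie in
the domain of S, and the adjoint relation for them is the weak equation there. -/
theorem maxDirac_eq_adjoint (m : ℝ) {Ω : Set E3} (hΩ : IsC2 Ω) :
    maxDirac m Ω = (minDirac m Ω)† := by
  refine LinearPMap.eq_of_eq_graph ?_
  rw [LinearPMap.adjoint_graph_eq_graph_adjoint (dense_minDirac_domain m hΩ)]
  ext ⟨f, g⟩
  rw [mem_maxDirac_graph hΩ, Submodule.mem_adjoint_iff]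
  constructor
  · rintro ⟨h1, h2⟩ a b hab
    rw [← SetLike.mem_coe, minDirac_graph, mem_closure_testGraph] at hab
    obtain ⟨φ, hφ, t1, t2⟩ := hab
    have h0 : ∀ n, ∀ x ∈ frontier Ω, φ n x = 0 := fun n x hx =>
      image_eq_zero_of_notMem_tsupport fun h => (hφ n).2.2 h hx
    have e1 := integral_inner_eq_of_tendsto hΩ (a.memLp _) (b.memLp _) (f.memLp _) (g.memLp _)
      hφ h0 (tendsto_restrict _ t1) (tendsto_restrict _ t2) h1
    have e2 := integral_inner_eq_of_tendsto hΩ.exterior (a.memLp _) (b.memLp _) (f.memLp _)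
      (g.memLp _) hφ (hΩ.frontier_exterior ▸ h0) (tendsto_restrict _ t1) (tendsto_restrict _ t2) h2
    rw [sub_eq_zero, L2.inner_def, L2.inner_def, hΩ.integral_eq (L2.integrable_inner _ _),
      hΩ.integral_eq (L2.integrable_inner _ _), e1, e2]
  · intro h
    have key : ∀ U : Set E3, U ⊆ (frontier Ω)ᶜ → IsWeakDirac m U f g := fun U hU => by
      refine isWeakDirac_of_forall_test (Lp.memLp f) (Lp.memLp g) fun φ hφ => ?_
      have := h _ _ (toLp_mem_minDirac_graph (m := m) (hφ.mono hU))
      rwa [sub_eq_zero, inner_toLp_left, inner_toLp_left] at this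
    refine ⟨key _ (fun x hx hx' => (hΩ.isOpen.frontier_eq ▸ hx').2 hx), key _ ?_⟩
    rw [← hΩ.frontier_exterior]
    exact fun x hx hx' => (hΩ.exterior.isOpen.frontier_eq ▸ hx').2 hx

/-- Tested with test functions, the adjoint relation is the weak Dirac equation on ℝ³, which
characterizes the graph of the operator itself. The reverse inclusion is symmetry, by approximation
and Green's identity without boundary. -/
theorem freeDirac_isSelfAdjoint (m : ℝ) : IsSelfAdjoint (freeDirac m) := by
  have hd : Dense ((freeDirac m).domain : Set L2R) :=
    (dense_minDirac_domain m isC2_univ).mono LinearPMap.domRestrict_le.1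
  rw [LinearPMap.isSelfAdjoint_def]
  refine LinearPMap.eq_of_eq_graph ?_
  rw [LinearPMap.adjoint_graph_eq_graph_adjoint hd]
  ext ⟨f, g⟩
  rw [mem_freeDirac_graph, Submodule.mem_adjoint_iff]
  constructor
  · intro h
    refine isWeakDirac_of_forall_test (Lp.memLp f) (Lp.memLp g) fun φ hφ => ?_
    have := h _ _ (mem_freeDirac_graph.2 ((isWeakDirac_dirac (m := m) (U := univ) hφ).congr
      (memLp_test hφ volume).coeFn_toLp.symm (memLp_dirac hφ m volume).coeFn_toLp.symm))
    rwa [sub_eq_zero, inner_toLp_left, inner_toLp_left] at this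
  · intro h a b hab
    obtain ⟨φ, hφ, t1, t2⟩ := exists_dirac_approx isC2_univ (a.memLp univ) (b.memLp univ)
      (mem_freeDirac_graph.1 hab)
    have := integral_inner_eq_of_tendsto isC2_univ (a.memLp _) (b.memLp _) (f.memLp _) (g.memLp _)
      hφ (by simp) t1 t2 h
    rw [Measure.restrict_univ] at this
    rw [sub_eq_zero, L2.inner_def, L2.inner_def, this]

theorem minDirac_symmetric (m : ℝ) (Ω : Set E3) :
    (minDirac m Ω).IsFormalAdjoint (minDirac m Ω) := by
  have hA := LinearPMap.adjoint_isFormalAdjoint (freeDirac_isSelfAdjoint m).dense_domain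
  rw [LinearPMap.isSelfAdjoint_def.1 (freeDirac_isSelfAdjoint m)] at hA
  have hle : minDirac m Ω ≤ freeDirac m := LinearPMap.domRestrict_le
  intro x y
  have h1 := hle.2 (x := x) (y := ⟨x, hle.1 x.2⟩) rfl
  have h2 := hle.2 (x := y) (y := ⟨y, hle.1 y.2⟩) rfl
  have := hA ⟨x, hle.1 x.2⟩ ⟨y, hle.1 y.2⟩
  rw [← h1, ← h2] at this
  exact this

lemma mem_diracT_graph {m : ℝ} {Ω : Set E3} (hΩ : IsC2 Ω) {f g : L2R} :
    (f, g) ∈ (diracT m Ω).graph ↔ f ∈ H1off Ω ∧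
      IsWeakDirac m Ω f g ∧ IsWeakDirac m (exterior Ω) f g := by
  rw [diracT, mem_graph_domRestrict, mem_maxDirac_graph hΩ]

lemma exists_isWeakDirac_of_mem_H1off (m : ℝ) {Ω : Set E3} (hΩ : IsC2 Ω) {f : L2R}
    (hf : f ∈ H1off Ω) : ∃ g : L2R, IsWeakDirac m Ω f g ∧ IsWeakDirac m (exterior Ω) f g := by
  choose d hd hw using hf.1
  choose d' hd' hw' using hf.2
  have h1 := memLp_diracOf m (f.memLp Ω) hd
  have h2 := memLp_diracOf m (f.memLp (exterior Ω)) hd'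
  have hg := memLp_glue hΩ h1 h2
  refine ⟨hg.toLp _, (isWeakDirac_diracOf (f.memLp Ω) hd hw).congr_restrict .rfl ?_,
    (isWeakDirac_diracOf (f.memLp _) hd' hw').congr_restrict .rfl ?_⟩
  · filter_upwards [ae_restrict_of_ae hg.coeFn_toLp, glue_ae_left hΩ (diracOf m f d)
      (diracOf m f d')] with x h1 h2
    rw [h1, h2]
  · filter_upwards [ae_restrict_of_ae hg.coeFn_toLp, glue_ae_right hΩ (diracOf m f d)
      (diracOf m f d')] with x h1 h2
    rw [h1, h2]

theorem diracT_domain (m : ℝ) {Ω : Set E3} (hΩ : IsC2 Ω) : (diracT m Ω).domain = H1off Ω := by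
  rw [diracT, LinearPMap.domRestrict_domain, inf_eq_left]
  intro f hf
  obtain ⟨g, hg⟩ := exists_isWeakDirac_of_mem_H1off m hΩ hf
  exact LinearPMap.mem_domain_iff.2 ⟨g, (mem_maxDirac_graph hΩ).2 hg⟩

lemma maxDirac_isClosed (m : ℝ) {Ω : Set E3} (hΩ : IsC2 Ω) : (maxDirac m Ω).IsClosed := by
  rw [maxDirac_eq_adjoint m hΩ]
  exact LinearPMap.adjoint_isClosed (dense_minDirac_domain m hΩ)

theorem diracT_isClosable (m : ℝ) {Ω : Set E3} (hΩ : IsC2 Ω) : (diracT m Ω).IsClosable :=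
  (maxDirac_isClosed m hΩ).isClosable.leIsClosable LinearPMap.domRestrict_le

lemma mem_diracT_graph_of_isTest {m : ℝ} {Ω V : Set E3} (hΩ : IsC2 Ω) {φ ψ : E3 → C4} {f g : L2R}
    (hφ : IsTest V φ) (hψ : IsTest V ψ) (hf : f =ᵐ[volume] glue Ω φ ψ)
    (hg : g =ᵐ[volume] glue Ω (dirac m φ) (dirac m ψ)) : (f, g) ∈ (diracT m Ω).graph := by
  have f1 := (glue_ae_left hΩ φ ψ).trans (ae_restrict_of_ae hf.symm)
  have f2 := (glue_ae_right hΩ φ ψ).trans (ae_restrict_of_ae hf.symm)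
  have g1 := (glue_ae_left hΩ (dirac m φ) (dirac m ψ)).trans (ae_restrict_of_ae hg.symm)
  have g2 := (glue_ae_right hΩ (dirac m φ) (dirac m ψ)).trans (ae_restrict_of_ae hg.symm)
  exact (mem_diracT_graph hΩ).2 ⟨⟨fun j => ⟨pd j φ, memLp_pd hφ _ j,
      (isWeakPD_of_contDiff hφ.contDiff_one j).congr_restrict f1⟩, fun j => ⟨pd j ψ,
      memLp_pd hψ _ j, (isWeakPD_of_contDiff hψ.contDiff_one j).congr_restrict f2⟩⟩,
    (isWeakDirac_dirac hφ).congr_restrict f1 g1, (isWeakDirac_dirac hψ).congr_restrict f2 g2⟩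

/-- The two sides are approximated independently and glued. The glued functions may jump across Σ,
which is allowed in the domain of T. -/
theorem maxDirac_eq_closure (m : ℝ) {Ω : Set E3} (hΩ : IsC2 Ω) :
    maxDirac m Ω = (diracT m Ω).closure := by
  refine LinearPMap.eq_of_eq_graph ?_
  rw [← (diracT_isClosable m hΩ).graph_closure_eq_closure_graph]
  refine le_antisymm ?_ (Submodule.topologicalClosure_minimal _
    (LinearPMap.le_graph_of_le LinearPMap.domRestrict_le) (maxDirac_isClosed m hΩ))
  rintro ⟨f, g⟩ hfg
  rw [mem_maxDirac_graph hΩ] at hfg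
  obtain ⟨φ, hφ, h1, h2⟩ := exists_dirac_approx hΩ (f.memLp _) (g.memLp _) hfg.1
  obtain ⟨ψ, hψ, k1, k2⟩ := exists_dirac_approx hΩ.exterior (f.memLp _) (g.memLp _) hfg.2
  have m1 : ∀ n, MemLp (glue Ω (φ n) (ψ n)) 2 volume := fun n =>
    memLp_glue hΩ (memLp_test (hφ n) _) (memLp_test (hψ n) _)
  have m2 : ∀ n, MemLp (glue Ω (dirac m (φ n)) (dirac m (ψ n))) 2 volume := fun n =>
    memLp_glue hΩ (memLp_dirac (hφ n) m _) (memLp_dirac (hψ n) m _)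
  rw [← SetLike.mem_coe, Submodule.topologicalClosure_coe, mem_closure_iff_seq_limit]
  refine ⟨fun n => ((m1 n).toLp _, (m2 n).toLp _), fun n => mem_diracT_graph_of_isTest hΩ (hφ n)
    (hψ n) (m1 n).coeFn_toLp (m2 n).coeFn_toLp, ?_⟩
  rw [Prod.tendsto_iff]
  constructor
  · rw [Lp.tendsto_Lp_iff_tendsto_eLpNorm']
    refine (tendsto_glue hΩ h1 k1).congr fun n => eLpNorm_congr_ae ?_
    filter_upwards [(m1 n).coeFn_toLp] with x hx
    simp [hx]
  · rw [Lp.tendsto_Lp_iff_tendsto_eLpNorm']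
    refine (tendsto_glue hΩ h2 k2).congr fun n => eLpNorm_congr_ae ?_
    filter_upwards [(m2 n).coeFn_toLp] with x hx
    simp [hx]

end Operators

/-! ### The boundary mappings -/

section Boundary

variable {Ω : Set E3}

lemma HasTrace.unique_left (hΩ : IsC2 Ω) {f : L2R} {g g' : L2S Ω} (h : HasTrace Ω Ω f g)
    (h' : HasTrace Ω Ω f g') : g = g' :=
  Lp.ext (h.ae_eq hΩ (f.memLp Ω) (Lp.aestronglyMeasurable g) (Lp.aestronglyMeasurable g') h')

lemma HasTrace.unique_right (hΩ : IsC2 Ω) {f : L2R} {g g' : L2S Ω}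
    (h : HasTrace Ω (exterior Ω) f g) (h' : HasTrace Ω (exterior Ω) f g') : g = g' := by
  rw [hΩ.hasTrace_exterior_iff] at h h'
  have := h.ae_eq hΩ.exterior (f.memLp _) (hΩ.surf_exterior.symm ▸ Lp.aestronglyMeasurable g)
    (hΩ.surf_exterior.symm ▸ Lp.aestronglyMeasurable g') h'
  rw [hΩ.surf_exterior] at this
  exact Lp.ext this

lemma exists_trace_left (hΩ : IsC2 Ω) {f : L2R} (hf : f ∈ H1 Ω) :
    ∃ g : L2S Ω, HasTrace Ω Ω f g := by
  choose d hd hw using hf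
  obtain ⟨g, hg, h⟩ := exists_hasTrace hΩ (f.memLp Ω) hd hw
  exact ⟨hg.toLp g, h.congr .rfl hg.coeFn_toLp.symm⟩

lemma exists_trace_right (hΩ : IsC2 Ω) {f : L2R} (hf : f ∈ H1 (exterior Ω)) :
    ∃ g : L2S Ω, HasTrace Ω (exterior Ω) f g := by
  choose d hd hw using hf
  obtain ⟨g, hg, h⟩ := exists_hasTrace hΩ.exterior (f.memLp _) hd hw
  rw [← hΩ.hasTrace_exterior_iff] at h
  rw [hΩ.surf_exterior] at hg
  exact ⟨hg.toLp g, h.congr .rfl hg.coeFn_toLp.symm⟩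

lemma HasTrace.mem_H1 {U : Set E3} {f : L2R} {g : E3 → C4} (h : HasTrace Ω U f g) : f ∈ H1 U := by
  obtain ⟨φ, -, h1, -⟩ := h
  exact h1.mem_H1

theorem existsUnique_trace (hΩ : IsC2 Ω) {f : L2R} (hf : f ∈ H1off Ω) :
    (∃! g : L2S Ω, HasTrace Ω Ω f g) ∧ ∃! g : L2S Ω, HasTrace Ω (exterior Ω) f g := by
  obtain ⟨g, hg⟩ := exists_trace_left hΩ hf.1
  obtain ⟨g', hg'⟩ := exists_trace_right hΩ hf.2
  exact ⟨⟨g, hg, fun k hk => HasTrace.unique_left hΩ hk hg⟩,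
    ⟨g', hg', fun k hk => HasTrace.unique_right hΩ hk hg'⟩⟩

theorem mem_Gamma0_graph (hΩ : IsC2 Ω) {f : L2R} {p : L2S Ω} :
    (f, p) ∈ (Gamma0 Ω).graph ↔ ∃ gp gm : L2S Ω,
      HasTrace Ω Ω f gp ∧ HasTrace Ω (exterior Ω) f gm ∧
        ∀ᵐ x ∂(surf Ω), p x = Complex.I • act (alphaDot (normal Ω x)) (gp x - gm x) := by
  rw [Gamma0, Submodule.toLinearPMap_graph_eq]
  · rfl
  · rintro ⟨f, p⟩ ⟨gp, gm, h1, h2, h3⟩ (rfl : f = 0)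
    have e1 := HasTrace.unique_left hΩ h1 (HasTrace.zero Ω Ω)
    have e2 := HasTrace.unique_right hΩ h2 (HasTrace.zero Ω (exterior Ω))
    subst e1 e2
    refine Lp.ext ?_
    filter_upwards [h3, Lp.coeFn_zero C4 2 (surf Ω)] with x hx h0
    rw [hx, sub_self, map_zero, smul_zero, h0, Pi.zero_apply]

theorem mem_Gamma1_graph (hΩ : IsC2 Ω) {f : L2R} {p : L2S Ω} :
    (f, p) ∈ (Gamma1 Ω).graph ↔ ∃ gp gm : L2S Ω,
      HasTrace Ω Ω f gp ∧ HasTrace Ω (exterior Ω) f gm ∧ p = (1 / 2 : ℂ) • (gp + gm) := by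
  rw [Gamma1, Submodule.toLinearPMap_graph_eq]
  · rfl
  · rintro ⟨f, p⟩ ⟨gp, gm, h1, h2, h3⟩ (rfl : f = 0)
    have e1 := HasTrace.unique_left hΩ h1 (HasTrace.zero Ω Ω)
    have e2 := HasTrace.unique_right hΩ h2 (HasTrace.zero Ω (exterior Ω))
    subst e1 e2
    rw [h3, add_zero, smul_zero]

/-- Multiplication by `α·ν` on `L²(Σ)`. -/
def mulNormal (hΩ : IsC2 Ω) (g : L2S Ω) : L2S Ω :=
  (memLp_act_normal hΩ (Lp.memLp g)).toLp _

lemma coeFn_mulNormal (hΩ : IsC2 Ω) (g : L2S Ω) :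
    mulNormal hΩ g =ᵐ[surf Ω] fun x => act (alphaDot (normal Ω x)) (g x) :=
  MemLp.coeFn_toLp _

lemma ae_norm_normal (hΩ : IsC2 Ω) : ∀ᵐ x ∂(surf Ω), ‖normal Ω x‖ = 1 := by
  filter_upwards [ae_surf_mem] with x hx
  exact (hΩ.isOuterUnitNormal_normal hx).1

lemma act_normal_act_normal (hΩ : IsC2 Ω) : ∀ᵐ x ∂(surf Ω), ∀ v,
    act (alphaDot (normal Ω x)) (act (alphaDot (normal Ω x)) v) = v := by
  filter_upwards [ae_norm_normal hΩ] with x hx v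
  rw [act_alphaDot_act, hx]
  simp

lemma Gamma0_domain (hΩ : IsC2 Ω) : (Gamma0 Ω).domain = H1off Ω := by
  ext f
  rw [LinearPMap.mem_domain_iff]
  constructor
  · rintro ⟨p, hp⟩
    obtain ⟨gp, gm, h1, h2, -⟩ := (mem_Gamma0_graph hΩ).1 hp
    exact ⟨h1.mem_H1, h2.mem_H1⟩
  · rintro ⟨h1, h2⟩
    obtain ⟨gp, hgp⟩ := exists_trace_left hΩ h1
    obtain ⟨gm, hgm⟩ := exists_trace_right hΩ h2
    refine ⟨Complex.I • mulNormal hΩ (gp - gm), (mem_Gamma0_graph hΩ).2 ⟨gp, gm, hgp, hgm, ?_⟩⟩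
    filter_upwards [Lp.coeFn_smul Complex.I (mulNormal hΩ (gp - gm)),
      coeFn_mulNormal hΩ (gp - gm), Lp.coeFn_sub gp gm] with x a b c
    rw [a, Pi.smul_apply, b, c, Pi.sub_apply]

lemma Gamma1_domain (hΩ : IsC2 Ω) : (Gamma1 Ω).domain = H1off Ω := by
  ext f
  rw [LinearPMap.mem_domain_iff]
  constructor
  · rintro ⟨p, hp⟩
    obtain ⟨gp, gm, h1, h2, -⟩ := (mem_Gamma1_graph hΩ).1 hp
    exact ⟨h1.mem_H1, h2.mem_H1⟩
  · rintro ⟨h1, h2⟩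
    obtain ⟨gp, hgp⟩ := exists_trace_left hΩ h1
    obtain ⟨gm, hgm⟩ := exists_trace_right hΩ h2
    exact ⟨_, (mem_Gamma1_graph hΩ).2 ⟨gp, gm, hgp, hgm, rfl⟩⟩

lemma HasTrace.green_left {m : ℝ} (hΩ : IsC2 Ω) {f f' g g' : L2R} {p q : L2S Ω}
    (hfp : HasTrace Ω Ω f p) (hgq : HasTrace Ω Ω g q) (hff : IsWeakDirac m Ω f f')
    (hgg : IsWeakDirac m Ω g g') :
    (∫ x in Ω, inner ℂ (f' x) (g x)) - ∫ x in Ω, inner ℂ (f x) (g' x) =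
      Complex.I * inner ℂ p (mulNormal hΩ q) := by
  rw [HasTrace.green hΩ (f.memLp _) (f'.memLp _) (g.memLp _) (g'.memLp _) (Lp.memLp p) (Lp.memLp q)
    hfp hgq hff hgg, integral_const_mul, L2.inner_def]
  congr 1
  refine integral_congr_ae ?_
  filter_upwards [coeFn_mulNormal hΩ q] with x hx
  rw [hx]

/-- The minus sign comes from the outer normal of the exterior, which is -ν. -/
lemma HasTrace.green_right {m : ℝ} (hΩ : IsC2 Ω) {f f' g g' : L2R} {p q : L2S Ω}
    (hfp : HasTrace Ω (exterior Ω) f p) (hgq : HasTrace Ω (exterior Ω) g q)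
    (hff : IsWeakDirac m (exterior Ω) f f') (hgg : IsWeakDirac m (exterior Ω) g g') :
    (∫ x in exterior Ω, inner ℂ (f' x) (g x)) - ∫ x in exterior Ω, inner ℂ (f x) (g' x) =
      -(Complex.I * inner ℂ p (mulNormal hΩ q)) := by
  rw [hΩ.hasTrace_exterior_iff] at hfp hgq
  rw [HasTrace.green hΩ.exterior (f.memLp _) (f'.memLp _) (g.memLp _) (g'.memLp _)
    (hΩ.surf_exterior.symm ▸ Lp.memLp p) (hΩ.surf_exterior.symm ▸ Lp.memLp q) hfp hgq hff hgg,
    integral_const_mul, L2.inner_def, hΩ.surf_exterior, ← mul_neg, ← integral_neg]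
  congr 1
  refine integral_congr_ae ?_
  filter_upwards [coeFn_mulNormal hΩ q, ae_surf_mem] with x hx hx'
  rw [hx, hΩ.normal_exterior hx', alphaDot_neg, act_neg, inner_neg_right]

lemma mulNormal_sub (hΩ : IsC2 Ω) (g g' : L2S Ω) :
    mulNormal hΩ (g - g') = mulNormal hΩ g - mulNormal hΩ g' := by
  refine Lp.ext ?_
  filter_upwards [coeFn_mulNormal hΩ (g - g'), coeFn_mulNormal hΩ g, coeFn_mulNormal hΩ g',
    Lp.coeFn_sub g g', Lp.coeFn_sub (mulNormal hΩ g) (mulNormal hΩ g')] with x a b c d e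
  rw [a, e, Pi.sub_apply, b, c, d, Pi.sub_apply, map_sub]

lemma inner_mulNormal_left (hΩ : IsC2 Ω) (g g' : L2S Ω) :
    inner ℂ (mulNormal hΩ g) g' = inner ℂ g (mulNormal hΩ g') := by
  rw [L2.inner_def, L2.inner_def]
  refine integral_congr_ae ?_
  filter_upwards [coeFn_mulNormal hΩ g, coeFn_mulNormal hΩ g'] with x a b
  rw [a, b, inner_act_left (alphaDot_isHermitian _)]

lemma mulNormal_mulNormal (hΩ : IsC2 Ω) (g : L2S Ω) : mulNormal hΩ (mulNormal hΩ g) = g := by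
  refine Lp.ext ?_
  filter_upwards [coeFn_mulNormal hΩ (mulNormal hΩ g), coeFn_mulNormal hΩ g,
    act_normal_act_normal hΩ] with x a b c
  rw [a, b, c]

theorem mem_Gamma0_graph_iff (hΩ : IsC2 Ω) {f : L2R} {p : L2S Ω} :
    (f, p) ∈ (Gamma0 Ω).graph ↔ ∃ gp gm : L2S Ω, HasTrace Ω Ω f gp ∧
      HasTrace Ω (exterior Ω) f gm ∧ p = Complex.I • mulNormal hΩ (gp - gm) := by
  rw [mem_Gamma0_graph hΩ]
  refine exists₂_congr fun gp gm => and_congr_right fun _ => and_congr_right fun _ => ?_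
  have h : (Complex.I • mulNormal hΩ (gp - gm) : L2S Ω) =ᵐ[surf Ω] fun x =>
      Complex.I • act (alphaDot (normal Ω x)) (gp x - gm x) := by
    filter_upwards [Lp.coeFn_smul Complex.I (mulNormal hΩ (gp - gm)),
      coeFn_mulNormal hΩ (gp - gm), Lp.coeFn_sub gp gm] with x a b c
    rw [a, Pi.smul_apply, b, c, Pi.sub_apply]
  constructor
  · intro h1
    exact Lp.ext (EventuallyEq.trans h1 h.symm)
  · rintro rfl
    exact h

/-- The abstract Green identity. -/
theorem green_identity {m : ℝ} (hΩ : IsC2 Ω) {f f' g g' : L2R} {f₀ f₁ g₀ g₁ : L2S Ω}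
    (hf : (f, f') ∈ (diracT m Ω).graph) (hg : (g, g') ∈ (diracT m Ω).graph)
    (hf₀ : (f, f₀) ∈ (Gamma0 Ω).graph) (hf₁ : (f, f₁) ∈ (Gamma1 Ω).graph)
    (hg₀ : (g, g₀) ∈ (Gamma0 Ω).graph) (hg₁ : (g, g₁) ∈ (Gamma1 Ω).graph) :
    inner ℂ f' g - inner ℂ f g' = inner ℂ f₁ g₀ - inner ℂ f₀ g₁ := by
  obtain ⟨-, wf, wf'⟩ := (mem_diracT_graph hΩ).1 hf
  obtain ⟨-, wg, wg'⟩ := (mem_diracT_graph hΩ).1 hg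
  obtain ⟨fp, fm, a1, a2, rfl⟩ := (mem_Gamma0_graph_iff hΩ).1 hf₀
  obtain ⟨gp, gm, b1, b2, rfl⟩ := (mem_Gamma0_graph_iff hΩ).1 hg₀
  obtain ⟨fp', fm', c1, c2, rfl⟩ := (mem_Gamma1_graph hΩ).1 hf₁
  obtain ⟨gp', gm', d1, d2, rfl⟩ := (mem_Gamma1_graph hΩ).1 hg₁
  obtain rfl := HasTrace.unique_left hΩ a1 c1
  obtain rfl := HasTrace.unique_right hΩ a2 c2
  obtain rfl := HasTrace.unique_left hΩ b1 d1
  obtain rfl := HasTrace.unique_right hΩ b2 d2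
  have e1 := HasTrace.green_left hΩ a1 b1 wf wg
  have e2 := HasTrace.green_right hΩ a2 b2 wf' wg'
  have e : (inner ℂ f' g - inner ℂ f g' : ℂ) = Complex.I * inner ℂ fp (mulNormal hΩ gp) -
      Complex.I * inner ℂ fm (mulNormal hΩ gm) := by
    rw [L2.inner_def, L2.inner_def, hΩ.integral_eq (L2.integrable_inner _ _),
      hΩ.integral_eq (L2.integrable_inner _ _), ← e1, sub_eq_add_neg (_ - _), ← e2]
    ring
  rw [e]
  -- Written in means and jumps, the mixed terms between the two sides cancel because multiplication
  -- by α·ν is symmetric; the factor 1/2 in the mean accounts for each remaining term appearing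
  -- twice.
  simp only [inner_smul_left, inner_smul_right, inner_add_left, inner_add_right, mulNormal_sub,
    inner_sub_left, inner_sub_right, inner_mulNormal_left, map_div₀, map_one, map_ofNat,
    Complex.conj_I]
  ring

/-- Once H^{1/2}(Σ) is known to be the space of traces, its stability under sums, scalars and α·ν
can be read off from the functions in H¹ instead of the double integral. -/
lemma mem_H12_iff_left (hΩ : IsC2 Ω) {g : L2S Ω} :
    g ∈ H12 Ω ↔ ∃ f : L2R, HasTrace Ω Ω f g := by
  constructor
  · intro h
    obtain ⟨f, hf, ht⟩ := exists_hasTrace_of_surfSlob hΩ (Lp.stronglyMeasurable g) (Lp.memLp g)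
      (ne_of_lt h)
    have hm := memLp_glue hΩ hf (MemLp.zero (ε := C4) (p := 2))
    exact ⟨hm.toLp _, ht.congr ((glue_ae_left hΩ f _).trans (ae_restrict_of_ae hm.coeFn_toLp.symm))
      .rfl⟩
  · rintro ⟨f, h⟩
    exact h.surfSlob_lt_top hΩ (f.memLp Ω) (Lp.aestronglyMeasurable g)

lemma mem_H12_iff_right (hΩ : IsC2 Ω) {g : L2S Ω} :
    g ∈ H12 Ω ↔ ∃ f : L2R, HasTrace Ω (exterior Ω) f g := by
  have hs : surfSlob (exterior Ω) g = surfSlob Ω g := by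
    rw [surfSlob, surfSlob, hΩ.surf_exterior]
  simp only [hΩ.hasTrace_exterior_iff]
  constructor
  · intro h
    obtain ⟨f, hf, ht⟩ := exists_hasTrace_of_surfSlob hΩ.exterior (Lp.stronglyMeasurable g)
      (hΩ.surf_exterior.symm ▸ Lp.memLp g) (hs ▸ ne_of_lt h)
    have hm := memLp_glue hΩ (MemLp.zero (ε := C4) (p := 2)) hf
    exact ⟨hm.toLp _, ht.congr ((glue_ae_right hΩ _ f).trans (ae_restrict_of_ae
      hm.coeFn_toLp.symm)) .rfl⟩
  · rintro ⟨f, h⟩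
    have := h.surfSlob_lt_top hΩ.exterior (f.memLp _)
      (hΩ.surf_exterior.symm ▸ Lp.aestronglyMeasurable g)
    rw [hs] at this
    exact this

lemma add_mem_H12 (hΩ : IsC2 Ω) {g g' : L2S Ω} (h : g ∈ H12 Ω) (h' : g' ∈ H12 Ω) :
    g + g' ∈ H12 Ω := by
  rw [mem_H12_iff_left hΩ] at *
  obtain ⟨f, hf⟩ := h
  obtain ⟨f', hf'⟩ := h'
  exact ⟨f + f', hf.add hf'⟩

lemma smul_mem_H12 (hΩ : IsC2 Ω) (c : ℂ) {g : L2S Ω} (h : g ∈ H12 Ω) : c • g ∈ H12 Ω := by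
  rw [mem_H12_iff_left hΩ] at *
  obtain ⟨f, hf⟩ := h
  exact ⟨c • f, hf.smul c⟩

lemma sub_mem_H12 (hΩ : IsC2 Ω) {g g' : L2S Ω} (h : g ∈ H12 Ω) (h' : g' ∈ H12 Ω) :
    g - g' ∈ H12 Ω := by
  have := add_mem_H12 hΩ h (smul_mem_H12 hΩ (-1) h')
  rwa [neg_smul, one_smul, ← sub_eq_add_neg] at this

lemma mulNormal_mem_H12 (hΩ : IsC2 Ω) {g : L2S Ω} (h : g ∈ H12 Ω) : mulNormal hΩ g ∈ H12 Ω := by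
  rw [mem_H12_iff_left hΩ] at *
  obtain ⟨f, hf⟩ := h
  obtain ⟨f', hf', ht⟩ := hf.act_normal hΩ (f.memLp Ω) (Lp.memLp g)
  have hm := memLp_glue hΩ hf' (MemLp.zero (ε := C4) (p := 2))
  exact ⟨hm.toLp _, ht.congr ((glue_ae_left hΩ f' _).trans (ae_restrict_of_ae hm.coeFn_toLp.symm))
    (coeFn_mulNormal hΩ g).symm⟩

theorem range_Gamma (hΩ : IsC2 Ω) :
    {p : L2S Ω × L2S Ω | ∃ f : L2R, (f, p.1) ∈ (Gamma0 Ω).graph ∧ (f, p.2) ∈ (Gamma1 Ω).graph} =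
      H12 Ω ×ˢ H12 Ω := by
  ext ⟨p, q⟩
  simp only [mem_ofPred_eq, mem_prod]
  constructor
  · rintro ⟨f, h0, h1⟩
    obtain ⟨gp, gm, a1, a2, rfl⟩ := (mem_Gamma0_graph_iff hΩ).1 h0
    obtain ⟨gp', gm', b1, b2, rfl⟩ := (mem_Gamma1_graph hΩ).1 h1
    have m1 := (mem_H12_iff_left hΩ).2 ⟨f, a1⟩
    have m2 := (mem_H12_iff_right hΩ).2 ⟨f, a2⟩
    have m3 := (mem_H12_iff_left hΩ).2 ⟨f, b1⟩
    have m4 := (mem_H12_iff_right hΩ).2 ⟨f, b2⟩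
    exact ⟨smul_mem_H12 hΩ _ (mulNormal_mem_H12 hΩ (sub_mem_H12 hΩ m1 m2)),
      smul_mem_H12 hΩ _ (add_mem_H12 hΩ m3 m4)⟩
  · rintro ⟨hp, hq⟩
    -- The one-sided values q ∓ (i/2) α·ν p have mean `q` and jump -i α·ν p; applying i α·ν to the
    -- jump returns `p` because (α·ν)² = 1.
    have hh := smul_mem_H12 hΩ (-(1 / 2 : ℂ) * Complex.I) (mulNormal_mem_H12 hΩ hp)
    obtain ⟨f, hf⟩ := (mem_H12_iff_left hΩ).1 (add_mem_H12 hΩ hq hh)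
    obtain ⟨f', hf'⟩ := (mem_H12_iff_right hΩ).1 (sub_mem_H12 hΩ hq hh)
    have hm := memLp_glue hΩ (f.memLp Ω) (f'.memLp (exterior Ω))
    have t1 : HasTrace Ω Ω (hm.toLp _) _ := hf.congr ((glue_ae_left hΩ f f').trans
      (ae_restrict_of_ae hm.coeFn_toLp.symm)) .rfl
    have t2 : HasTrace Ω (exterior Ω) (hm.toLp _) _ := hf'.congr ((glue_ae_right hΩ f f').trans
      (ae_restrict_of_ae hm.coeFn_toLp.symm)) .rfl
    refine ⟨hm.toLp _, (mem_Gamma0_graph_iff hΩ).2 ⟨_, _, t1, t2, ?_⟩,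
      (mem_Gamma1_graph hΩ).2 ⟨_, _, t1, t2, by module⟩⟩
    set r := mulNormal hΩ p with hr
    have e : q + (-(1 / 2 : ℂ) * Complex.I) • r - (q - (-(1 / 2 : ℂ) * Complex.I) • r) =
        (-Complex.I) • r := by module
    have hs : mulNormal hΩ ((-Complex.I) • r) = (-Complex.I) • mulNormal hΩ r := by
      refine Lp.ext ?_
      filter_upwards [coeFn_mulNormal hΩ ((-Complex.I) • r), coeFn_mulNormal hΩ r,
        Lp.coeFn_smul (-Complex.I) r, Lp.coeFn_smul (-Complex.I) (mulNormal hΩ r)] with x a b c d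
      rw [a, d, Pi.smul_apply, b, c, Pi.smul_apply, map_smul]
    rw [e, hs, hr, mulNormal_mulNormal, smul_smul, mul_neg, Complex.I_mul_I, neg_neg, one_smul]

/-- Restrictions of test functions to Σ are traces and are dense in `L²` of the finite surface
measure. -/
theorem dense_H12 (hΩ : IsC2 Ω) : Dense (H12 Ω) := by
  have := isFiniteMeasure_surf hΩ
  refine (Lp.dense_hasCompactSupport_contDiff (F := C4) (μ := surf Ω) (p := 2) (by simp)).mono ?_
  rintro g ⟨φ, hg, hc, hφ⟩
  have ht : IsTest univ φ := ⟨hφ, hc, subset_univ _⟩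
  exact (mem_H12_iff_left hΩ).2 ⟨(memLp_test ht volume).toLp φ, (hasTrace_of_isTest ht).congr
    (ae_restrict_of_ae (memLp_test ht volume).coeFn_toLp.symm) hg.symm⟩

lemma mem_pker_iff {H G : Type*} [NormedAddCommGroup H] [InnerProductSpace ℂ H] [CompleteSpace H]
    [NormedAddCommGroup G] [InnerProductSpace ℂ G] [CompleteSpace G] {Γ : H →ₗ.[ℂ] G} {f : H} :
    f ∈ pker Γ ↔ (f, 0) ∈ Γ.graph := by
  rw [LinearPMap.mem_graph_iff, pker, Submodule.mem_map]
  exact ⟨fun ⟨y, h, e⟩ => ⟨y, e, h⟩, fun ⟨y, e, h⟩ => ⟨y, h, e⟩⟩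

theorem diracT_domRestrict_pker (m : ℝ) (hΩ : IsC2 Ω) :
    (diracT m Ω).domRestrict (pker (Gamma0 Ω)) = freeDirac m := by
  refine LinearPMap.eq_of_eq_graph ?_
  ext ⟨f, g⟩
  rw [mem_graph_domRestrict, mem_diracT_graph hΩ, mem_freeDirac_graph, mem_pker_iff,
    mem_Gamma0_graph_iff hΩ]
  constructor
  · rintro ⟨⟨gp, gm, t1, t2, h0⟩, -, w1, w2⟩
    -- Multiplication by α·ν is an involution, so the kernel condition forces the two traces to
    -- agree.
    have hgm : gp = gm := by
      rw [eq_comm, smul_eq_zero_iff_right Complex.I_ne_zero] at h0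
      have h1 := mulNormal_mulNormal hΩ (gp - gm)
      have h2 := mulNormal_sub hΩ 0 0
      rw [sub_self, sub_self] at h2
      rw [h0, h2] at h1
      exact sub_eq_zero.1 h1.symm
    subst hgm
    -- A test function has the same trace from both sides, and by now so does `f`. The two boundary
    -- terms of Green's identity then cancel, leaving the weak equation across Σ.
    refine isWeakDirac_of_forall_test (Lp.memLp f) (Lp.memLp g) fun φ hφ => ?_
    have := isFiniteMeasure_surf hΩ
    have hφs := memLp_test hφ (surf Ω)
    have c1 := (memLp_test hφ volume).coeFn_toLp
    have c2 := (memLp_dirac hφ m volume).coeFn_toLp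
    have e1 := HasTrace.green_left (m := m) hΩ (p := hφs.toLp φ)
      (f := (memLp_test hφ volume).toLp φ) (f' := (memLp_dirac hφ m volume).toLp _)
      ((hasTrace_of_isTest hφ).congr (ae_restrict_of_ae c1.symm) hφs.coeFn_toLp.symm) t1
      ((isWeakDirac_dirac hφ).congr c1.symm c2.symm) w1
    have e2 := HasTrace.green_right (m := m) hΩ (p := hφs.toLp φ)
      (f := (memLp_test hφ volume).toLp φ) (f' := (memLp_dirac hφ m volume).toLp _)
      ((hasTrace_of_isTest hφ).congr (ae_restrict_of_ae c1.symm) hφs.coeFn_toLp.symm) t2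
      ((isWeakDirac_dirac hφ).congr c1.symm c2.symm) w2
    rw [← inner_toLp_left (memLp_dirac hφ m volume), ← inner_toLp_left (memLp_test hφ volume),
      L2.inner_def, L2.inner_def, hΩ.integral_eq (L2.integrable_inner _ _),
      hΩ.integral_eq (L2.integrable_inner _ _)]
    linear_combination e1 + e2
  · intro h
    -- A weak solution on ℝ³ is an H¹ limit of test functions, and their common restrictions to Σ
    -- give the same trace from both sides, hence zero jump.
    obtain ⟨φ, hφ, hφf⟩ := exists_h1Tendsto_of_isWeakDirac h
    obtain ⟨t, ht, htl⟩ := (hφf.mono (U := Ω)).exists_tendsto_surf hΩ hφ (f.memLp Ω)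
    have hl := tendsto_eLpNorm_congr ht.coeFn_toLp.symm htl
    exact ⟨⟨ht.toLp t, ht.toLp t, ⟨φ, hφ, hφf.mono, hl⟩, ⟨φ, hφ, hφf.mono, hl⟩, by
      rw [mulNormal_sub, sub_self, smul_zero]⟩, ⟨hφf.mono.mem_H1, hφf.mono.mem_H1⟩, h.mono, h.mono⟩

theorem isQuasiBoundaryTriple (m : ℝ) (hΩ : IsC2 Ω) :
    IsQuasiBoundaryTriple (minDirac m Ω) (diracT m Ω) (Gamma0 Ω) (Gamma1 Ω) where
  dense_domain := dense_minDirac_domain m hΩ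
  isClosed := minDirac_isClosed m Ω
  symmetric := minDirac_symmetric m Ω
  closable := diracT_isClosable m hΩ
  closure_eq := (maxDirac_eq_closure m hΩ).symm.trans (maxDirac_eq_adjoint m hΩ)
  domain_zero := (Gamma0_domain hΩ).trans (diracT_domain m hΩ).symm
  domain_one := (Gamma1_domain hΩ).trans (diracT_domain m hΩ).symm
  green f g f₀ g₀ f₁ g₁ hf₀ hf₁ hg₀ hg₁ := by
    refine green_identity (m := m) hΩ (LinearPMap.mem_graph _ f) (LinearPMap.mem_graph _ g)
      ?_ ?_ ?_ ?_
    · exact hf₀ ▸ LinearPMap.mem_graph _ f₀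
    · exact hf₁ ▸ LinearPMap.mem_graph _ f₁
    · exact hg₀ ▸ LinearPMap.mem_graph _ g₀
    · exact hg₁ ▸ LinearPMap.mem_graph _ g₁
  dense_range := by
    rw [range_Gamma hΩ]
    exact (dense_H12 hΩ).prod (dense_H12 hΩ)
  selfAdjoint := by
    rw [diracT_domRestrict_pker m hΩ]
    exact freeDirac_isSelfAdjoint m

end Boundary

end DiracShell

end

theorem theorem4p1 (m : ℝ) (hm : 0 < m) (Ω : Set E3) (hΩ : IsBoundedC2 Ω) :
    -- the traces `f₊|_Σ`, `f₋|_Σ` of `f ∈ H¹(ℝ³ ∖ Σ; ℂ⁴)` are well defined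
    (∀ f ∈ H1off Ω, (∃! g : L2S Ω, HasTrace Ω Ω f g) ∧ ∃! g : L2S Ω, HasTrace Ω (exterior Ω) f g) ∧
    -- `dom T = H¹(ℝ³ ∖ Σ; ℂ⁴)`
    (diracT m Ω).domain = H1off Ω ∧
    -- the triple is a quasi boundary triple for `T_max = S* = closure T`
    IsQuasiBoundaryTriple (minDirac m Ω) (diracT m Ω) (Gamma0 Ω) (Gamma1 Ω) ∧
    maxDirac m Ω = (minDirac m Ω)† ∧
    maxDirac m Ω = (diracT m Ω).closure ∧
    -- the range of `(Γ₀, Γ₁)`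
    {p : L2S Ω × L2S Ω | ∃ f : L2R, (f, p.1) ∈ (Gamma0 Ω).graph ∧ (f, p.2) ∈ (Gamma1 Ω).graph} =
      H12 Ω ×ˢ H12 Ω ∧
    -- `T ↾ ker Γ₀` is the free Dirac operator
    (diracT m Ω).domRestrict (pker (Gamma0 Ω)) = freeDirac m := by
  have h := hΩ.isC2
  exact ⟨fun f hf => existsUnique_trace h hf, diracT_domain m h, isQuasiBoundaryTriple m h,
    maxDirac_eq_adjoint m h, maxDirac_eq_closure m h, range_Gamma h, diracT_domRestrict_pker m h⟩
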